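/- **Setting.** Let $F$ be a compact connected oriented surface (possibly with boundary) and $A$ a commutative ring. A *diagram* in $F$ is a finite graph embedded in $F$ with vertices of valence 1 (exactly the points of the diagram on $\partial F$) and of valence 4, each 4-valent vertex being a classical (over/under), flat, virtual or singular crossing; closed components without crossings are allowed, and diagrams are considered up to isotopy fixed on $\partial F$. An *$n$-tangle* is a diagram in the disk $\mathbb D^2$ with $2n$ fixed boundary points. Fix whether the target diagrams and tangles below are oriented or unoriented. In the oriented case the 2-tangles used below have, like a crossing, two adjacent incoming ends followed counterclockwise by two outgoing ends; in either case they are inserted at an oriented crossing with ends matched in this order. A *knot theory* $\mathcal M'$ is a set of local moves $T_1\to T_2$, where $T_1$ is an $n$-tangle and $T_2$ is an $n$-tangle, or more generally an $A$-linear combination of $n$-tangles, with the same boundary. For a set $\mathscr D'$ of diagrams closed under isotopy and the moves of $\mathcal M'$, the *skein module* $\mathscr S(\mathscr D'|\mathcal M')$ is $A[\mathscr D']$ modulo all differences $D-R_M(D,T)$, where $R_M(D,T)$ is the result of a move $M\in\mathcal M'$ applied to a subtangle $T$ of $D\in\mathscr D'$; $\mathscr S(\mathbb D^2|\mathcal M')$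 denotes the analogous module of tangles with a given boundary. Let $\mathcal M$ be the oriented classical knot theory, generated by the oriented Reidemeister moves (the two $\Omega_1$ moves removing a positive loop, all oriented $\Omega_2$ moves, and the $\Omega_3$ move with three positive crossings, i.e. $\sigma_1\sigma_2\sigma_1=\sigma_2\sigma_1\sigma_2$ with all strands directed upwards, generate all of them), or the oriented virtual knot theory, generated by these moves together with the virtual moves $V\Omega_1,V\Omega_2,V\Omega_3$ and the semivirtual move $SV\Omega_3$. Let $\mathscr D$ be a set of oriented diagrams in $F$ with only classical crossings (resp. only classical and virtual crossings), and let $\sim_{\mathcal M}$ be the equivalence on $\mathscr D$ generated by isotopies and moves of $\mathcal M$ between diagrams of $\mathscr D$. Write $\mathcal C(D)$ for the set of classical crossings of $D$. A *local transformation rule* $\tau$ assigns to every $D\in\mathscr D$ and $c\in\mathcal C(D)$ an element $\tau_D(c)\in A[\mathcal T_2]$, the free module on (isotopy classes of) 2-tangles, such that $\tau_D(c)=\tau_{D'}(c')$ whenever $c$ and $c'$ correspond to each other under an isotopy or a move $D\to D'$ of $\mathcal M$ in $\mathscr D$. Let $R_\tau(D,c)$ be the linear combination of diagrams obtained by replacing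 $c$ with $\tau_D(c)$, and let $$d_\tau(D)=\sum_{c\in\mathcal C(D)}R_\tau(D,c)$$ be the $\tau$-derivation. Let $\mathcal M'$ be a knot theory that includes $\mathcal M$ (every move of $\mathcal M$, with orientations forgotten in the unoriented case, holds in $\mathscr S(\mathbb D^2|\mathcal M')$), and let $\mathscr D'$ be a set of diagrams in $F$, closed under isotopy and $\mathcal M'$, such that $d_\tau(D)\in A[\mathscr D']$ for all $D\in\mathscr D$. For $x\in A[\mathcal T_2]$ we use the following notions. * $x$ is *$\Omega_3^+$-compatible* if, for each of the three crossings of the move $\sigma_1\sigma_2\sigma_1=\sigma_2\sigma_1\sigma_2$, replacing this crossing by $x$ on both sides gives equal elements of $\mathscr S(\mathbb D^2|\mathcal M')$. * $i_+(x)=-\,\sigma^{-1}x\,\sigma^{-1}$ and $i_-(x)=-\,\sigma\, x\,\sigma$, where $\sigma^{\pm1}$ is the crossing of sign $\pm1$ and the tangles are stacked in the direction of the strands. * $Cl^l(x)$, $Cl^r(x)$ are the left and right closures of $x$ (the two ends on the left, resp. on the right, are joined by an arc), and $Ann^{l}(\mathcal M')$, $Ann^{r}(\mathcal M')$ are the sets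 of $x$ with $Cl^{l}(x)=0$, resp. $Cl^{r}(x)=0$, in $\mathscr S(\mathbb D^2|\mathcal M')$. **Theorem.** Suppose that 1. $\tau_D(c)$ is $\Omega_3^+$-compatible for every $D\in\mathscr D$ and every positive crossing $c\in\mathcal C(D)$; if $\mathcal M$ is the virtual theory, then moreover $\tau_D(c)$ is compatible with the semivirtual move: in $\mathscr S(\mathbb D^2|\mathcal M')$ the move $SV\Omega_3$ stays valid when its (positive) classical crossing is replaced by $\tau_D(c)$ on both sides; 2. for any $D\in\mathscr D$ and any two crossings $c_1,c_2\in\mathcal C(D)$ to which a decreasing second Reidemeister move can be applied, $i_{\mathrm{sgn}(c_1)}(\tau_D(c_1))=\tau_D(c_2)$ in $\mathscr S(\mathbb D^2|\mathcal M')$; 3. $\tau_D(c)\in Ann^{r}(\mathcal M')$ for every positive crossing $c$ of $D\in\mathscr D$ that bounds a loop on its right removable by a first Reidemeister move, and $\tau_D(c)\in Ann^{l}(\mathcal M')$ for every such crossing with the loop on its left. Then $d_\tau$ is invariant: if $D_1,D_2\in\mathscr D$ and $D_1\sim_{\mathcal M}D_2$, then $d_\tau(D_1)=d_\tau(D_2)$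 in $\mathscr S(\mathscr D'|\mathcal M')$. -/

import Mathlib

open scoped unitInterval

noncomputable section

namespace Skein

/-! ### The standard disk, surfaces, orientations -/

/-- The standard closed disk. -/
abbrev Disk : Type := Metric.closedBall (0 : ℂ) 1

/-- The `i`-th of `m` marked points on the boundary circle, in counterclockwise order. -/
def port (m i : ℕ) : Disk :=
  ⟨Complex.exp ((2 * Real.pi * (i / m : ℝ) : ℝ) * Complex.I), by
    rw [mem_closedBall_zero_iff, Complex.norm_exp_ofReal_mul_I]⟩

theorem norm_port (m i : ℕ) : ‖(port m i : ℂ)‖ = 1 := by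
  unfold port
  exact Complex.norm_exp_ofReal_mul_I _

/-- Reflection of the disk. -/
def Disk.conj : C(Disk, Disk) where
  toFun z := ⟨(starRingEnd ℂ) z, by
    have h := z.2
    rw [mem_closedBall_zero_iff] at h ⊢
    rwa [RCLike.norm_conj]⟩
  continuous_toFun := by
    exact Continuous.subtype_mk (Complex.continuous_conj.comp continuous_subtype_val) _

/-- Counterclockwise rotation of the disk by a quarter turn. -/
def Disk.quarter : C(Disk, Disk) where
  toFun z := ⟨Complex.I * z, by
    have h := z.2
    rw [mem_closedBall_zero_iff] at h ⊢
    simpa using h⟩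
  continuous_toFun := by
    exact Continuous.subtype_mk (continuous_const.mul continuous_subtype_val) _

/-- Isotopy of embeddings of a compact space: a homotopy through injective maps. -/
def EmbIsotopic {X F : Type*} [TopologicalSpace X] [TopologicalSpace F] (f g : C(X, F)) : Prop :=
  ContinuousMap.HomotopicWith f g (fun k => Function.Injective k)

/-- The data of an oriented surface used to speak of diagrams: its boundary, and the class of
orientation preserving embeddings of the standard disk. -/
structure Surf (F : Type) [TopologicalSpace F] where
  bdry : Set F
  pos : C(Disk, F) → Prop
  pos_isotopic : ∀ f g, EmbIsotopic f g → pos f → pos g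

/-- An orientation of a connected topological surface, as an isotopy invariant choice, for every
embedded disk, of exactly one of the embedding and its composition with a reflection. -/
structure SurfaceOrientation (F : Type) [TopologicalSpace F] where
  pos : C(Disk, F) → Prop
  pos_isotopic : ∀ f g, EmbIsotopic f g → pos f → pos g
  pos_conj : ∀ f : C(Disk, F), Function.Injective f → (pos (f.comp Disk.conj) ↔ ¬ pos f)

/-- An oriented topological surface with boundary. -/
def SurfaceOrientation.surf {F : Type} [TopologicalSpace F]
    [ChartedSpace (EuclideanHalfSpace 2) F] (ω : SurfaceOrientation F) : Surf F where
  bdry := (modelWithCornersEuclideanHalfSpace 2).boundary F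
  pos := ω.pos
  pos_isotopic := ω.pos_isotopic

/-- The standard disk with its standard orientation: the orientation preserving embeddings of the
disk into itself are those that are isotopic to the identity. -/
def diskSurf : Surf Disk where
  bdry := {z | ‖(z : ℂ)‖ = 1}
  pos f := EmbIsotopic (ContinuousMap.id Disk) f
  pos_isotopic _ _ h h' := ContinuousMap.HomotopicWith.trans h' h

/-! ### Diagrams -/

/-- Types of vertices: positive, negative, flat, virtual and singular crossings, and boxes.
Boxes are only used to mark a disk in which a tangle is to be inserted; the list of signs of a box
gives its boundary points counterclockwise (`true`: a strand enters the box there,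
`false`: a strand leaves it). -/
inductive Label : Type
  | pos
  | neg
  | flat
  | virt
  | sing
  | box (bd : List Bool)

/-- A crossing in standard position: the strands `0 → 2` and `1 → 3` enter at the points `0, 1`
and leave at the points `2, 3`, numbered counterclockwise. -/
def crossSigns : List Bool := [true, true, false, false]

/-- The boundary pattern of a vertex. In a positive crossing the strand `0 → 2` is the
overcrossing one, in a negative crossing it is the strand `1 → 3`. -/
def Label.signs : Label → List Bool
  | .box bd => bd
  | _ => crossSigns

/-- Crossing change. -/
def Label.switch : Label → Label
  | .pos => .neg
  | .neg => .pos
  | l => l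

def Label.IsClassical (l : Label) : Prop := l = .pos ∨ l = .neg

def Label.IsBox (l : Label) : Prop := ∃ bd, l = .box bd

theorem Label.IsClassical.signs_eq {l : Label} (h : l.IsClassical) : l.signs = crossSigns := by
  rcases h with rfl | rfl <;> rfl

/-- The endpoint of the edge `p.1`: its head if `p.2 = true`, its tail otherwise. -/
def endpt {F E : Type} [TopologicalSpace F] (path : E → C(I, F)) (p : E × Bool) : F :=
  path p.1 (if p.2 then 1 else 0)

/-- A tangle diagram in a surface: an embedded finite graph. Every vertex `v` of valence four
(or box) is given together with a standard neighbourhood `chart v`, an orientation preserving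
embedding of the disk that carries the structure of the vertex; the edges are parametrized
paths outside of these neighbourhoods. Vertices of valence one lie on the boundary of the surface,
all the remaining endpoints are shared by exactly two ends of edges (auxiliary vertices of valence
two; they are immaterial by the definition of isotopy below, as are the parametrizations).
The directions of edges are meaningful for oriented diagrams only. -/
structure Diagram {F : Type} [TopologicalSpace F] (S : Surf F) where
  V : Type
  E : Type
  finV : Finite V
  finE : Finite E
  label : V → Label
  chart : V → C(Disk, F)
  path : E → C(I, F)
  chart_inj : ∀ v, Function.Injective (chart v)
  chart_pos : ∀ v, S.pos (chart v)
  chart_inner : ∀ v z, chart v z ∉ S.bdry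
  chart_disjoint : ∀ v w z z', chart v z = chart w z' → v = w
  path_inner : ∀ e t, t ≠ 0 → t ≠ 1 → path e t ∉ S.bdry
  path_chart : ∀ e t, t ≠ 0 → t ≠ 1 → ∀ v z, path e t ≠ chart v z
  path_inj : ∀ e t, t ≠ 0 → t ≠ 1 → ∀ f s, path e t = path f s → e = f ∧ t = s
  end_bdry : ∀ p q, endpt path p ∈ S.bdry → endpt path p = endpt path q → p = q
  end_chart : ∀ p v z, endpt path p = chart v z →
    ∃ i < (label v).signs.length, z = port (label v).signs.length i
  end_port : ∀ v, ∀ i < (label v).signs.length,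
    ∃! p, endpt path p = chart v (port (label v).signs.length i)
  end_joint : ∀ p, endpt path p ∉ S.bdry → (∀ v z, endpt path p ≠ chart v z) →
    ∃! q, q ≠ p ∧ endpt path q = endpt path p

attribute [instance] Diagram.finV Diagram.finE

section
variable {F : Type} [TopologicalSpace F] {S : Surf F}

/-- The endpoint of an edge of a diagram. -/
def Diagram.pt (D : Diagram S) (p : D.E × Bool) : F := endpt D.path p

/-- The union of the edges. -/
def Diagram.curve (D : Diagram S) : Set F := ⋃ e, Set.range (D.path e)

/-- The set of classical crossings of a diagram. -/
abbrev Diagram.Crossings (D : Diagram S) : Type := {c : D.V // (D.label c).IsClassical}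

/-- The directions of the edges agree at all vertices. -/
def Diagram.IsOriented (D : Diagram S) : Prop :=
  (∀ p v, ∀ i < (D.label v).signs.length,
    D.pt p = D.chart v (port (D.label v).signs.length i) →
      p.2 = (D.label v).signs.getD i false) ∧
  ∀ p q, p ≠ q → D.pt p = D.pt q → p.2 ≠ q.2

end

/-- A diagram in the standard disk has the boundary points prescribed by `bd`. -/
def IsTangle (bd : List Bool) (T : Diagram diskSurf) : Prop :=
  ∀ z : Disk, ‖(z : ℂ)‖ = 1 → ((∃ p, T.pt p = z) ↔ ∃ i < bd.length, z = port bd.length i)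

/-! ### Insertion of tangles -/

section
variable {F : Type} [TopologicalSpace F] {S : Surf F}

/-- Vertices of the diagram obtained by insertion of tangles at the vertices from `P`. -/
abbrev Diagram.FillV (D : Diagram S) (P : Set D.V) (T : D.V → Diagram diskSurf) : Type :=
  {v : D.V // v ∉ P} ⊕ (Σ v : P, (T v).V)

/-- Edges of the diagram obtained by insertion of tangles at the vertices from `P`. -/
abbrev Diagram.FillE (D : Diagram S) (P : Set D.V) (T : D.V → Diagram diskSurf) : Type :=
  D.E ⊕ (Σ v : P, (T v).E)

def Diagram.fillLabel (D : Diagram S) (P : Set D.V) (T : D.V → Diagram diskSurf) :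
    D.FillV P T → Label
  | .inl v => D.label v
  | .inr x => (T x.1).label x.2

def Diagram.fillChart (D : Diagram S) (P : Set D.V) (T : D.V → Diagram diskSurf) :
    D.FillV P T → C(Disk, F)
  | .inl v => D.chart v
  | .inr x => (D.chart x.1).comp ((T x.1).chart x.2)

def Diagram.fillPath (D : Diagram S) (P : Set D.V) (T : D.V → Diagram diskSurf) :
    D.FillE P T → C(I, F)
  | .inl e => D.path e
  | .inr x => (D.chart x.1).comp ((T x.1).path x.2)

theorem Diagram.end_cases (D : Diagram S) (e : D.E) (s : I) :
    (s ≠ 0 ∧ s ≠ 1) ∨ ∃ b, D.path e s = endpt D.path (e, b) := by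
  by_cases h0 : s = 0
  · exact Or.inr ⟨false, by simp [endpt, h0]⟩
  by_cases h1 : s = 1
  · exact Or.inr ⟨true, by simp [endpt, h1]⟩
  exact Or.inl ⟨h0, h1⟩

/-- Whenever an edge meets the neighbourhood of a vertex, it does so at a marked point. -/
theorem Diagram.path_eq_chart (D : Diagram S) {e : D.E} {s : I} {v : D.V} {z : Disk}
    (h : D.path e s = D.chart v z) : ‖(z : ℂ)‖ = 1 := by
  rcases D.end_cases e s with hs | ⟨b, hb⟩
  · exact absurd h (D.path_chart e s hs.1 hs.2 v z)
  · obtain ⟨i, -, rfl⟩ := D.end_chart (e, b) v z (hb ▸ h)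
    exact norm_port _ _

theorem Diagram.end_chart_norm (D : Diagram S) {p : D.E × Bool} {v : D.V} {z : Disk}
    (h : endpt D.path p = D.chart v z) : ‖(z : ℂ)‖ = 1 := by
  obtain ⟨i, -, rfl⟩ := D.end_chart p v z h
  exact norm_port _ _

theorem Diagram.end_chart_unique (D : Diagram S) {p q : D.E × Bool} {v : D.V} {z : Disk}
    (hp : endpt D.path p = D.chart v z) (hq : endpt D.path q = D.chart v z) : p = q := by
  obtain ⟨i, hi, rfl⟩ := D.end_chart p v z hp
  exact (D.end_port v i hi).unique hp hq

/-- The composition of an orientation preserving embedding of the disk in a surface and an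
orientation preserving embedding of the disk in itself preserves orientation. -/
theorem Surf.pos_comp (S : Surf F) {f : C(Disk, F)} {g : C(Disk, Disk)}
    (hf : Function.Injective f) (hp : S.pos f) (hg : diskSurf.pos g) : S.pos (f.comp g) := by
  obtain ⟨H⟩ := hg
  refine S.pos_isotopic f (f.comp g) ⟨⟨⟨f.comp H.toContinuousMap, ?_, ?_⟩, ?_⟩⟩ hp
  · intro z
    simp
  · intro z
    simp
  · intro t
    exact hf.comp (H.prop' t)

theorem Diagram.fill_pt_inl (D : Diagram S) (P : Set D.V) (T : D.V → Diagram diskSurf)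
    (e : D.E) (b : Bool) :
    endpt (D.fillPath P T) (Sum.inl e, b) = endpt D.path (e, b) := rfl

theorem Diagram.fill_pt_inr (D : Diagram S) (P : Set D.V) (T : D.V → Diagram diskSurf)
    (v : P) (e : (T v).E) (b : Bool) :
    endpt (D.fillPath P T) (Sum.inr ⟨v, e⟩, b) = D.chart v (endpt (T v).path (e, b)) := rfl

/-- Insertion of the tangles `T v` in the standard neighbourhoods of the vertices `v ∈ P`
of a diagram. -/
def Diagram.fill (D : Diagram S) (P : Set D.V) (T : D.V → Diagram diskSurf)
    (hT : ∀ v ∈ P, IsTangle (D.label v).signs (T v)) : Diagram S where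
  V := D.FillV P T
  E := D.FillE P T
  finV := inferInstance
  finE := inferInstance
  label := D.fillLabel P T
  chart := D.fillChart P T
  path := D.fillPath P T
  chart_inj := by
    rintro (v | x)
    · exact D.chart_inj v
    · exact (D.chart_inj x.1).comp ((T x.1).chart_inj x.2)
  chart_pos := by
    rintro (v | x)
    · exact D.chart_pos v
    · exact S.pos_comp (D.chart_inj _) (D.chart_pos _) ((T x.1).chart_pos x.2)
  chart_inner := by
    rintro (v | x) z
    · exact D.chart_inner v z
    · exact D.chart_inner x.1 _
  chart_disjoint := by
    rintro (⟨v, hv⟩ | ⟨⟨v, hv⟩, x⟩) (⟨w, hw⟩ | ⟨⟨w, hw⟩, y⟩) z z' h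
    · obtain rfl := D.chart_disjoint v w z z' h
      rfl
    · obtain rfl := D.chart_disjoint v w z _ h
      exact absurd hw hv
    · obtain rfl := D.chart_disjoint v w _ z' h
      exact absurd hv hw
    · obtain rfl := D.chart_disjoint v w _ _ h
      obtain rfl := (T v).chart_disjoint x y z z' (D.chart_inj v h)
      rfl
  path_inner := by
    rintro (e | x) t h0 h1
    · exact D.path_inner e t h0 h1
    · exact D.chart_inner x.1 _
  path_chart := by
    rintro (e | ⟨⟨v, hv⟩, e⟩) t h0 h1 (⟨w, hw⟩ | ⟨⟨w, hw⟩, y⟩) z h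
    · exact D.path_chart e t h0 h1 w z h
    · exact D.path_chart e t h0 h1 w _ h
    · obtain rfl := D.chart_disjoint v w _ z h
      exact hw hv
    · obtain rfl := D.chart_disjoint v w _ _ h
      exact (T v).path_chart e t h0 h1 y z (D.chart_inj v h)
  path_inj := by
    rintro (e | ⟨⟨v, hv⟩, e⟩) t h0 h1 (f | ⟨⟨w, hw⟩, f⟩) s h
    · obtain ⟨rfl, rfl⟩ := D.path_inj e t h0 h1 f s h
      exact ⟨rfl, rfl⟩
    · exact absurd h (D.path_chart e t h0 h1 w _)
    · exact absurd (D.path_eq_chart (Eq.symm h)) ((T v).path_inner e t h0 h1)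
    · obtain rfl := D.chart_disjoint v w _ _ h
      obtain ⟨rfl, rfl⟩ := (T v).path_inj e t h0 h1 f s (D.chart_inj v h)
      exact ⟨rfl, rfl⟩
  end_bdry := by
    rintro ⟨e | ⟨v, e⟩, b⟩ ⟨f | ⟨w, f⟩, c⟩ hb h
    · have := D.end_bdry (e, b) (f, c) hb h
      simp only [Prod.mk.injEq] at this
      obtain ⟨rfl, rfl⟩ := this
      rfl
    · rw [h] at hb
      exact absurd hb (D.chart_inner w _)
    · exact absurd hb (D.chart_inner v _)
    · exact absurd hb (D.chart_inner v _)
  end_chart := by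
    rintro ⟨e | ⟨⟨v, hv⟩, e⟩, b⟩ (⟨w, hw⟩ | ⟨⟨w, hw⟩, y⟩) z h
    · exact D.end_chart (e, b) w z h
    · exact absurd (D.end_chart_norm (p := (e, b)) h) ((T w).chart_inner y z)
    · obtain rfl := D.chart_disjoint v w _ z h
      exact absurd hv hw
    · obtain rfl := D.chart_disjoint v w _ _ h
      exact (T v).end_chart (e, b) y z (D.chart_inj v h)
  end_port := by
    rintro (⟨w, hw⟩ | ⟨⟨w, hw⟩, y⟩) i hi
    · obtain ⟨⟨e, b⟩, hp, hu⟩ := D.end_port w i hi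
      refine ⟨(Sum.inl e, b), hp, ?_⟩
      rintro ⟨f | ⟨⟨v, hv⟩, f⟩, c⟩ h
      · have := hu (f, c) h
        simp only [Prod.mk.injEq] at this
        obtain ⟨rfl, rfl⟩ := this
        rfl
      · obtain rfl := D.chart_disjoint v w _ _ h
        exact absurd hv hw
    · obtain ⟨⟨e, b⟩, hp, hu⟩ := (T w).end_port y i hi
      refine ⟨(Sum.inr ⟨⟨w, hw⟩, e⟩, b), congrArg (D.chart w) hp, ?_⟩
      rintro ⟨f | ⟨⟨v, hv⟩, f⟩, c⟩ h
      · exact absurd (D.end_chart_norm (p := (f, c)) h) ((T w).chart_inner y _)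
      · obtain rfl := D.chart_disjoint v w _ _ h
        have := hu (f, c) (D.chart_inj v h)
        simp only [Prod.mk.injEq] at this
        obtain ⟨rfl, rfl⟩ := this
        rfl
  end_joint := by
    rintro ⟨e | ⟨⟨v, hv⟩, e⟩, b⟩ hb hc
    · rw [D.fill_pt_inl P T] at hb hc
      by_cases hv : ∃ v z, endpt D.path (e, b) = D.chart v z
      · obtain ⟨v, z, hz⟩ := hv
        have hP : v ∈ P := by
          by_contra hP
          exact hc (Sum.inl ⟨v, hP⟩) z hz
        obtain ⟨⟨f, c⟩, hf⟩ := (hT v hP z (D.end_chart_norm hz)).2 (D.end_chart _ v z hz)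
        refine ⟨(Sum.inr ⟨⟨v, hP⟩, f⟩, c), ⟨by simp, ?_⟩, ?_⟩
        · rw [D.fill_pt_inl, D.fill_pt_inr, hz]
          exact congrArg (D.chart v) hf
        · rintro ⟨g | ⟨⟨w, hw⟩, g⟩, d⟩ ⟨hne, h⟩
          · have := D.end_chart_unique (p := (g, d)) (q := (e, b)) (h.trans hz) hz
            simp only [Prod.mk.injEq] at this
            obtain ⟨rfl, rfl⟩ := this
            exact absurd rfl hne
          · rw [D.fill_pt_inl, D.fill_pt_inr, hz] at h
            obtain rfl := D.chart_disjoint w v _ _ h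
            have h' := D.chart_inj w h
            have := (T w).end_bdry (g, d) (f, c)
              (by rw [h']; exact D.end_chart_norm hz) (h'.trans hf.symm)
            simp only [Prod.mk.injEq] at this
            obtain ⟨rfl, rfl⟩ := this
            rfl
      · push Not at hv
        obtain ⟨⟨f, c⟩, ⟨hne, hf⟩, hu⟩ := D.end_joint (e, b) hb hv
        refine ⟨(Sum.inl f, c), ⟨?_, hf⟩, ?_⟩
        · intro h
          simp only [Prod.mk.injEq, Sum.inl.injEq] at h
          obtain ⟨rfl, rfl⟩ := h
          exact hne rfl
        · rintro ⟨g | ⟨⟨w, hw⟩, g⟩, d⟩ ⟨hne', h⟩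
          · have := hu (g, d) ⟨?_, h⟩
            · simp only [Prod.mk.injEq] at this
              obtain ⟨rfl, rfl⟩ := this
              rfl
            · intro h'
              simp only [Prod.mk.injEq] at h'
              obtain ⟨rfl, rfl⟩ := h'
              exact hne' rfl
          · exact absurd h.symm (hv w _)
    · by_cases hn : ‖((endpt (T v).path (e, b) : Disk) : ℂ)‖ = 1
      · obtain ⟨i, hi, hz⟩ := (hT v hv _ hn).1 ⟨(e, b), rfl⟩
        obtain ⟨⟨f, c⟩, hf, hu⟩ := D.end_port v i hi
        refine ⟨(Sum.inl f, c), ⟨by simp, ?_⟩, ?_⟩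
        · rw [D.fill_pt_inl, D.fill_pt_inr, hz]
          exact hf
        · rintro ⟨g | ⟨⟨w, hw⟩, g⟩, d⟩ ⟨hne', h⟩
          · rw [D.fill_pt_inl, D.fill_pt_inr, hz] at h
            have := hu (g, d) h
            simp only [Prod.mk.injEq] at this
            obtain ⟨rfl, rfl⟩ := this
            rfl
          · rw [D.fill_pt_inr, D.fill_pt_inr] at h
            obtain rfl := D.chart_disjoint w v _ _ h
            have h' := D.chart_inj w h
            have := (T w).end_bdry (e, b) (g, d) hn h'.symm
            simp only [Prod.mk.injEq] at this
            obtain ⟨rfl, rfl⟩ := this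
            exact absurd rfl hne'
      · have hin : ∀ w z, endpt (T v).path (e, b) ≠ (T v).chart w z := by
          intro w z h
          exact hc (Sum.inr ⟨⟨v, hv⟩, w⟩) z (congrArg (D.chart v) h)
        obtain ⟨⟨f, c⟩, ⟨hne, hf⟩, hu⟩ := (T v).end_joint (e, b) hn hin
        refine ⟨(Sum.inr ⟨⟨v, hv⟩, f⟩, c), ⟨?_, congrArg (D.chart v) hf⟩, ?_⟩
        · intro h
          apply hne
          simp only [Prod.mk.injEq, Sum.inr.injEq, Sigma.mk.injEq, heq_eq_eq, true_and] at h
          obtain ⟨rfl, rfl⟩ := h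
          rfl
        · rintro ⟨g | ⟨⟨w, hw⟩, g⟩, d⟩ ⟨hne', h⟩
          · exact absurd (D.end_chart_norm (p := (g, d)) h) hn
          · rw [D.fill_pt_inr, D.fill_pt_inr] at h
            obtain rfl := D.chart_disjoint w v _ _ h
            have h' := D.chart_inj w h
            have := hu (g, d) ⟨?_, h'⟩
            · simp only [Prod.mk.injEq] at this
              obtain ⟨rfl, rfl⟩ := this
              rfl
            · intro h''
              simp only [Prod.mk.injEq] at h''
              obtain ⟨rfl, rfl⟩ := h''
              exact hne' rfl

/-- Insertion of a tangle at a single vertex. -/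
def Diagram.plug (D : Diagram S) (v : D.V) (T : Diagram diskSurf)
    (hT : IsTangle (D.label v).signs T) : Diagram S :=
  D.fill {v} (fun _ => T) (by rintro _ rfl; exact hT)

/-- A vertex of the inserted tangle, as a vertex of the result. -/
def Diagram.plugIn (D : Diagram S) (v : D.V) (T : Diagram diskSurf)
    (hT : IsTangle (D.label v).signs T) (x : T.V) : (D.plug v T hT).V :=
  Sum.inr ⟨⟨v, rfl⟩, x⟩

/-- Correspondence between the vertices of two diagrams obtained by insertions at the same vertex:
the vertices outside correspond to themselves, those inside correspond by means of `r`. -/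
def Diagram.plugCorr (D : Diagram S) (v : D.V) (T T' : Diagram diskSurf)
    (hT : IsTangle (D.label v).signs T) (hT' : IsTangle (D.label v).signs T')
    (r : T.V → T'.V → Prop) : (D.plug v T hT).V → (D.plug v T' hT').V → Prop :=
  Sum.LiftRel (fun a b => a = b) (fun x y => r x.2 y.2)

end

/-! ### Isotopy -/

/-- Oriented or unoriented diagrams. -/
inductive Mode : Type
  | oriented
  | unoriented

section
variable {F : Type} [TopologicalSpace F] {S : Surf F}

/-- The self-homeomorphisms of a compact surface that are isotopic to the identity relative to the
boundary. -/
def IsAmbient (S : Surf F) (g : C(F, F)) : Prop :=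
  ContinuousMap.HomotopicWith (ContinuousMap.id F) g
    (fun k => Function.Bijective k ∧ ∀ x ∈ S.bdry, k x = x)

/-- Coincidence of vertex structures. Without orientations the standard neighbourhood of a crossing
may be turned; a quarter turn interchanges the two pictures of a classical crossing. -/
def SameVertex (o : Mode) (l : Label) (χ : C(Disk, F)) (l' : Label) (χ' : C(Disk, F)) : Prop :=
  (l' = l ∧ χ' = χ) ∨
    (o = .unoriented ∧ ¬ l.IsBox ∧ l' = l.switch ∧ χ' = χ.comp Disk.quarter)

/-- The homeomorphism `g` maps the diagram `D` to the diagram `D'`: it respects the vertices, the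
union of the edges and, for oriented diagrams, the directions of edges (these are compared on
common subarcs). -/
structure MapsTo (o : Mode) (D D' : Diagram S) (g : C(F, F)) (eV : D.V ≃ D'.V) : Prop where
  vertex : ∀ v, SameVertex o (D.label v) (g.comp (D.chart v)) (D'.label (eV v)) (D'.chart (eV v))
  curve : g '' D.curve = D'.curve
  direction : o = .oriented → ∀ (e : D.E) (e' : D'.E) (s t s' t' : I), s < t → s' < t' →
    D.path e s ≠ D.path e t → g '' (D.path e '' Set.Icc s t) = D'.path e' '' Set.Icc s' t' →
      g (D.path e s) = D'.path e' s'

/-- Two diagrams in the disk have the same incidence of vertices, edges and boundary points.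
(All neighbourhoods of vertices being orientation preserving, the cyclic orders of edges at vertices
are the same as well.) -/
structure SameShape (T T' : Diagram diskSurf) (eV : T.V ≃ T'.V) (eE : T.E ≃ T'.E) : Prop where
  label : ∀ v, T'.label (eV v) = T.label v
  bdry : ∀ p (z : Disk), ‖(z : ℂ)‖ = 1 → (T.pt p = z ↔ T'.pt (eE p.1, p.2) = z)
  vertex : ∀ p v, ∀ i < (T.label v).signs.length,
    (T.pt p = T.chart v (port (T.label v).signs.length i) ↔
      T'.pt (eE p.1, p.2) = T'.chart (eV v) (port (T.label v).signs.length i))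
  joint : ∀ p q, (T.pt p = T.pt q ↔ T'.pt (eE p.1, p.2) = T'.pt (eE q.1, q.2))

/-- Every component of a diagram in the disk, considered as a graph, meets the boundary. -/
def ConnectedToBoundary (T : Diagram diskSurf) : Prop :=
  ∀ (A : Set T.E) (B : Set T.V),
    (∀ p, ‖(T.pt p : ℂ)‖ = 1 → p.1 ∈ A) →
    (∀ p q, T.pt p = T.pt q → p.1 ∈ A → q.1 ∈ A) →
    (∀ p v z, T.pt p = T.chart v z → (p.1 ∈ A ↔ v ∈ B)) →
    A = Set.univ ∧ B = Set.univ

theorem SameShape.isTangle_symm {T T' : Diagram diskSurf} {eV : T.V ≃ T'.V} {eE : T.E ≃ T'.E}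
    (h : SameShape T T' eV eE) {P : Set T.V} {R : T.V → Diagram diskSurf}
    (hR : ∀ v ∈ P, IsTangle (T.label v).signs (R v)) :
    ∀ v' ∈ eV.symm ⁻¹' P, IsTangle (T'.label v').signs (R (eV.symm v')) := by
  intro v' hv'
  have := h.label (eV.symm v')
  rw [Equiv.apply_symm_apply] at this
  rw [this]
  exact hR _ hv'

/-- The elementary isotopies, together with the correspondence of vertices they induce.
* `ambient`: an ambient isotopy of the surface fixed on the boundary (including a change of
  parametrizations and of auxiliary vertices).
* `planar`: inside an embedded disk, a plane graph `T` all of whose components meet the boundary is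
  replaced by a plane graph `T'` of the same shape (the same arbitrary tangles `R` being inserted
  in both). By the uniqueness of a plane embedding with given cyclic orders at vertices, `T` and
  `T'` are isotopic relative to the boundary of the disk, so such a replacement is an isotopy. -/
inductive Isotopy (o : Mode) : (D D' : Diagram S) → (D.V → D'.V → Prop) → Prop
  | ambient (D D' : Diagram S) (g : C(F, F)) (eV : D.V ≃ D'.V) (hg : IsAmbient S g)
      (h : MapsTo o D D' g eV) : Isotopy o D D' (fun v v' => eV v = v')
  | planar (W : Diagram S) (v : W.V) (T T' : Diagram diskSurf) (eV : T.V ≃ T'.V) (eE : T.E ≃ T'.E)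
      (h : SameShape T T' eV eE) (hc : ConnectedToBoundary T) (P : Set T.V)
      (R : T.V → Diagram diskSurf) (hR : ∀ x ∈ P, IsTangle (T.label x).signs (R x))
      (hT : IsTangle (W.label v).signs (T.fill P R hR))
      (hT' : IsTangle (W.label v).signs
        (T'.fill (eV.symm ⁻¹' P) (fun x' => R (eV.symm x')) (h.isTangle_symm hR))) :
      Isotopy o (W.plug v (T.fill P R hR) hT)
        (W.plug v (T'.fill (eV.symm ⁻¹' P) (fun x' => R (eV.symm x')) (h.isTangle_symm hR)) hT')
        (W.plugCorr v _ _ hT hT'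
          (Sum.LiftRel (fun x x' => eV x.1 = x'.1)
            (fun x x' => (⟨x.1.1, x.2⟩ : Σ y : T.V, (R y).V) = ⟨eV.symm x'.1.1, x'.2⟩)))

/-- Genuine diagrams (without boxes), oriented if required. -/
def diagrams (S : Surf F) (o : Mode) : Set (Diagram S) :=
  {D | (∀ v, ¬ (D.label v).IsBox) ∧ (o = .oriented → D.IsOriented)}

end

/-! ### Tangles, skein modules, knot theories -/

/-- Tangle diagrams with the boundary pattern `bd`; with the length of `bd` equal to `2n` these are
the `n`-tangles. In the unoriented case the signs in `bd` are irrelevant. -/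
def tangles (o : Mode) (bd : List Bool) : Set (Diagram diskSurf) :=
  {T | T ∈ diagrams diskSurf o ∧ IsTangle bd T ∧
    (o = .oriented → ∀ p, ∀ i < bd.length, T.pt p = port bd.length i →
      p.2 = !(bd.getD i false))}

/-- The type of tangle diagrams with the boundary pattern `bd`. -/
abbrev Tangle (o : Mode) (bd : List Bool) : Type 1 := {T // T ∈ tangles o bd}

/-- A local move: a tangle and a linear combination of tangles with the same boundary. -/
structure LocalMove (o : Mode) (A : Type*) [CommRing A] where
  bd : List Bool
  lhs : Tangle o bd
  rhs : Tangle o bd →₀ A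

/-- A knot theory is given by a set of local moves. -/
abbrev KnotTheory (o : Mode) (A : Type*) [CommRing A] := Set (LocalMove o A)

section
variable {F : Type} [TopologicalSpace F] {S : Surf F} {o : Mode} {A : Type*} [CommRing A]

/-- Insertion of a tangle at a vertex with the same boundary pattern. -/
def Diagram.put (D : Diagram S) (v : D.V) {bd : List Bool} (hv : (D.label v).signs = bd)
    (T : Tangle o bd) : Diagram S :=
  D.plug v T.1 (hv ▸ T.2.2.1)

/-- Linear extension of the insertion of a tangle at a vertex. -/
def Diagram.putLin (D : Diagram S) (v : D.V) {bd : List Bool} (hv : (D.label v).signs = bd) :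
    (Tangle o bd →₀ A) →ₗ[A] (Diagram S →₀ A) :=
  Finsupp.lmapDomain A A (D.put v hv)

/-- A linear combination of tangles, as a linear combination of diagrams in the disk. -/
def toDiagrams {bd : List Bool} : (Tangle o bd →₀ A) →ₗ[A] (Diagram diskSurf →₀ A) :=
  Finsupp.lmapDomain A A Subtype.val

/-- The relations of the skein module of the set `𝒟` of diagrams: isotopies and the local moves from
`M` applied to the diagrams from `𝒟`. -/
def skeinRel (M : KnotTheory o A) (𝒟 : Set (Diagram S)) : Submodule A (Diagram S →₀ A) :=
  Submodule.span A
    ({x | ∃ D ∈ 𝒟, ∃ D' ∈ 𝒟, ∃ r, Isotopy o D D' r ∧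
        x = Finsupp.single D 1 - Finsupp.single D' 1} ∪
     {x | ∃ m ∈ M, ∃ (W : Diagram S) (v : W.V) (hv : (W.label v).signs = m.bd),
        W.put v hv m.lhs ∈ 𝒟 ∧ (∀ T ∈ m.rhs.support, W.put v hv T ∈ 𝒟) ∧
        x = Finsupp.single (W.put v hv m.lhs) 1 - W.putLin v hv m.rhs})

/-- Equality in the skein module of `𝒟` (for combinations of diagrams from `𝒟`). -/
def SkeinEq (M : KnotTheory o A) (𝒟 : Set (Diagram S)) (x y : Diagram S →₀ A) : Prop :=
  x - y ∈ skeinRel M 𝒟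

/-- The quotient of a submodule `P` by (its part of) a submodule `R`. -/
abbrev SubQuotient {B N : Type*} [CommRing B] [AddCommGroup N] [Module B N] (P R : Submodule B N) :=
  P ⧸ R.submoduleOf P

def SubQuotient.mk {B N : Type*} [CommRing B] [AddCommGroup N] [Module B N] (P R : Submodule B N)
    (x : N) (hx : x ∈ P) : SubQuotient P R :=
  Submodule.Quotient.mk ⟨x, hx⟩

/-- The skein module: combinations of diagrams from `𝒟` modulo isotopies and local moves. -/
abbrev SkeinModule (M : KnotTheory o A) (𝒟 : Set (Diagram S)) :=
  SubQuotient (Finsupp.supported A A 𝒟) (skeinRel M 𝒟)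

/-- The class in the skein module of a combination of diagrams from `𝒟`. -/
def skeinClass (M : KnotTheory o A) (𝒟 : Set (Diagram S)) (x : Diagram S →₀ A)
    (hx : x ∈ Finsupp.supported A A 𝒟) : SkeinModule M 𝒟 :=
  SubQuotient.mk _ _ x hx

/-- The set of diagrams `𝒟` is closed under isotopies and the local moves of `M`. -/
def ClosedUnder (M : KnotTheory o A) (𝒟 : Set (Diagram S)) : Prop :=
  (∀ D D' r, Isotopy o D D' r → (D ∈ 𝒟 ↔ D' ∈ 𝒟)) ∧
  ∀ m ∈ M, ∀ (W : Diagram S) (v : W.V) (hv : (W.label v).signs = m.bd),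
    ∀ T ∈ m.rhs.support, (W.put v hv m.lhs ∈ 𝒟 ↔ W.put v hv T ∈ 𝒟)

end

/-! ### Pictures of tangles -/

/-- Places where an edge of a picture may begin or end: a boundary point of the disk, or a marked
point of a vertex. -/
inductive Place (n : ℕ) : Type
  | bd (i : ℕ)
  | vx (v : Fin n) (i : ℕ)

/-- The combinatorial description of a picture in the disk: the signs of the boundary points in
counterclockwise order (`true`: a strand enters the disk), the vertices, and the list of edges
(from, to). -/
structure Wiring where
  bd : List Bool
  n : ℕ
  vertex : Fin n → Label
  edges : List (Place n × Place n)

/-- The point of the disk described by a place. -/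
def Place.point {n : ℕ} (m : ℕ) (T : Diagram diskSurf) (v : Fin n ≃ T.V) : Place n → Disk
  | .bd i => port m i
  | .vx k i => T.chart (v k) (port (T.label (v k)).signs.length i)

/-- A drawing in the disk of the picture with the description `w`. All the pictures considered
below are connected to the boundary, so that the drawing is unique up to isotopy. -/
structure Picture (w : Wiring) where
  T : Diagram diskSurf
  isTangle : IsTangle w.bd T
  v : Fin w.n ≃ T.V
  e : Fin w.edges.length ≃ T.E
  label_eq : ∀ k, T.label (v k) = w.vertex k
  tail : ∀ j, T.path (e j) 0 = Place.point w.bd.length T v (w.edges.get j).1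
  head : ∀ j, T.path (e j) 1 = Place.point w.bd.length T v (w.edges.get j).2

/-- Insertion of a combination of 2-tangles at a crossing of a picture. -/
def Picture.put {w : Wiring} (Q : Picture w) (k : Fin w.n) (hk : (w.vertex k).signs = crossSigns)
    {o : Mode} {A : Type*} [CommRing A] :
    (Tangle o crossSigns →₀ A) →ₗ[A] (Diagram diskSurf →₀ A) :=
  Q.T.putLin (Q.v k) (by rw [Q.label_eq, hk])

/-- A trivial strand. -/
abbrev strand : Wiring where
  bd := [true, false]
  n := 0
  vertex := Fin.elim0
  edges := [(.bd 0, .bd 1)]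

/-- The loop on the right of a crossing `l`; in other words, the right closure of a 2-tangle
in place of `l`. -/
abbrev loopRight (l : Label) : Wiring where
  bd := [true, false]
  n := 1
  vertex := ![l]
  edges := [(.bd 0, .vx 0 0), (.vx 0 2, .vx 0 1), (.vx 0 3, .bd 1)]

/-- The loop on the left of a crossing `l`; in other words, the left closure of a 2-tangle
in place of `l`. -/
abbrev loopLeft (l : Label) : Wiring where
  bd := [true, false]
  n := 1
  vertex := ![l]
  edges := [(.bd 0, .vx 0 1), (.vx 0 3, .vx 0 0), (.vx 0 2, .bd 1)]

/-- Two parallel strands. -/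
abbrev parallelStrands : Wiring where
  bd := crossSigns
  n := 0
  vertex := Fin.elim0
  edges := [(.bd 0, .bd 3), (.bd 1, .bd 2)]

/-- Two parallel strands that cross at `l` and then at `l'`. -/
abbrev parallelBigon (l l' : Label) : Wiring where
  bd := crossSigns
  n := 2
  vertex := ![l, l']
  edges := [(.bd 0, .vx 0 0), (.bd 1, .vx 0 1), (.vx 0 3, .vx 1 0), (.vx 0 2, .vx 1 1),
    (.vx 1 3, .bd 3), (.vx 1 2, .bd 2)]

/-- Two antiparallel strands. -/
abbrev antiStrands : Wiring where
  bd := [true, false, true, false]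
  n := 0
  vertex := Fin.elim0
  edges := [(.bd 0, .bd 3), (.bd 2, .bd 1)]

/-- Two antiparallel strands with two crossings that form a counterclockwise bigon. -/
abbrev ccwBigon (l l' : Label) : Wiring where
  bd := [true, false, true, false]
  n := 2
  vertex := ![l, l']
  edges := [(.bd 0, .vx 1 1), (.vx 1 2, .bd 1), (.bd 2, .vx 0 1), (.vx 0 2, .bd 3),
    (.vx 1 3, .vx 0 0), (.vx 0 3, .vx 1 0)]

/-- Two antiparallel strands, with the other position of the boundary points. -/
abbrev antiStrands' : Wiring where
  bd := [false, true, false, true]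
  n := 0
  vertex := Fin.elim0
  edges := [(.bd 3, .bd 0), (.bd 1, .bd 2)]

/-- Two antiparallel strands with two crossings that form a clockwise bigon. -/
abbrev cwBigon (l l' : Label) : Wiring where
  bd := [false, true, false, true]
  n := 2
  vertex := ![l, l']
  edges := [(.vx 1 3, .bd 0), (.bd 1, .vx 1 0), (.vx 0 3, .bd 2), (.bd 3, .vx 0 0),
    (.vx 0 2, .vx 1 1), (.vx 1 2, .vx 0 1)]

/-- Three strands `1, 2, 3` directed upwards: first `1, 2` cross (at the vertex `0`), then `1, 3`
(at the vertex `1`), then `2, 3` (at the vertex `2`). -/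
abbrev triangleLeft (l₀ l₁ l₂ : Label) : Wiring where
  bd := [true, true, true, false, false, false]
  n := 3
  vertex := ![l₀, l₁, l₂]
  edges := [(.bd 0, .vx 0 0), (.bd 1, .vx 0 1), (.vx 0 3, .vx 2 0), (.vx 0 2, .vx 1 0),
    (.bd 2, .vx 1 1), (.vx 1 3, .vx 2 1), (.vx 1 2, .bd 3), (.vx 2 2, .bd 4), (.vx 2 3, .bd 5)]

/-- The same strands crossing in the opposite order: first `2, 3` (at the vertex `2`), then `1, 3`
(at the vertex `1`), then `1, 2` (at the vertex `0`). -/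
abbrev triangleRight (l₀ l₁ l₂ : Label) : Wiring where
  bd := [true, true, true, false, false, false]
  n := 3
  vertex := ![l₀, l₁, l₂]
  edges := [(.bd 1, .vx 2 0), (.bd 2, .vx 2 1), (.bd 0, .vx 1 0), (.vx 2 3, .vx 1 1),
    (.vx 2 2, .vx 0 1), (.vx 1 3, .bd 5), (.vx 1 2, .vx 0 0), (.vx 0 3, .bd 4), (.vx 0 2, .bd 3)]

/-- A 2-tangle (in place of the vertex `1`) between two crossings `l`, stacked along the
strands. -/
abbrev sandwich (l : Label) : Wiring where
  bd := crossSigns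
  n := 3
  vertex := ![l, .box crossSigns, l]
  edges := [(.bd 0, .vx 0 0), (.bd 1, .vx 0 1), (.vx 0 3, .vx 1 0), (.vx 0 2, .vx 1 1),
    (.vx 1 3, .vx 2 0), (.vx 1 2, .vx 2 1), (.vx 2 3, .bd 3), (.vx 2 2, .bd 2)]

/-! ### Oriented classical and virtual knot theories -/

/-- The classical and the virtual theory. -/
inductive Theory : Type
  | classical
  | virtual

/-- The oriented second Reidemeister moves: each of them replaces the picture on the left by the one
on the right. -/
inductive IsOmega2 : Wiring → Wiring → Prop
  | a : IsOmega2 (parallelBigon .pos .neg) parallelStrands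
  | b : IsOmega2 (parallelBigon .neg .pos) parallelStrands
  | c : IsOmega2 (ccwBigon .pos .neg) antiStrands
  | d : IsOmega2 (cwBigon .pos .neg) antiStrands'

/-- Moves generating the oriented theories. Classical: two first Reidemeister moves (the loops of
positive crossings), the second Reidemeister moves, and the third Reidemeister move with three
positive crossings; they generate all the oriented Reidemeister moves. Virtual: in addition the
virtual and the semivirtual moves. -/
inductive IsMove : Theory → Wiring → Wiring → Prop
  | omega1r (𝔱) : IsMove 𝔱 (loopRight .pos) strand
  | omega1l (𝔱) : IsMove 𝔱 (loopLeft .pos) strand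
  | omega2 (𝔱 w w') (h : IsOmega2 w w') : IsMove 𝔱 w w'
  | omega3 (𝔱) : IsMove 𝔱 (triangleLeft .pos .pos .pos) (triangleRight .pos .pos .pos)
  | virtual1r : IsMove .virtual (loopRight .virt) strand
  | virtual1l : IsMove .virtual (loopLeft .virt) strand
  | virtual2par : IsMove .virtual (parallelBigon .virt .virt) parallelStrands
  | virtual2ccw : IsMove .virtual (ccwBigon .virt .virt) antiStrands
  | virtual2cw : IsMove .virtual (cwBigon .virt .virt) antiStrands'
  | virtual3 : IsMove .virtual (triangleLeft .virt .virt .virt) (triangleRight .virt .virt .virt)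
  | semivirtual3 : IsMove .virtual (triangleLeft .pos .virt .virt) (triangleRight .pos .virt .virt)

section
variable {F : Type} [TopologicalSpace F] {S : Surf F} {A : Type*} [CommRing A] {o : Mode}

/-- The oriented diagrams of the classical and the virtual theory in a surface. -/
def sourceDiagrams (S : Surf F) (𝔱 : Theory) : Set (Diagram S) :=
  {D | D ∈ diagrams S .oriented ∧
    ∀ v, (D.label v).IsClassical ∨ (𝔱 = .virtual ∧ D.label v = .virt)}

/-- Elementary morphisms of the diagram category of the theory `𝔱`, with the induced correspondence
of vertices. In a move the vertices of the two pictures with the same number correspond to each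
other (in the moves of the first and second types there are none on the right). -/
inductive Step (𝔱 : Theory) : (D D' : Diagram S) → (D.V → D'.V → Prop) → Prop
  | isotopy (D D' : Diagram S) (r : D.V → D'.V → Prop) (h : Isotopy .oriented D D' r) :
      Step 𝔱 D D' r
  | move (w w' : Wiring) (hw : IsMove 𝔱 w w') (Q : Picture w) (Q' : Picture w')
      (W : Diagram S) (v : W.V) (hv : IsTangle (W.label v).signs Q.T)
      (hv' : IsTangle (W.label v).signs Q'.T) :
      Step 𝔱 (W.plug v Q.T hv) (W.plug v Q'.T hv')
        (W.plugCorr v Q.T Q'.T hv hv'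
          (fun x x' => ∃ (k : Fin w.n) (k' : Fin w'.n), (k : ℕ) = (k' : ℕ) ∧ Q.v k = x ∧ Q'.v k' = x'))

/-- Equivalence of diagrams in the set `𝒟` modulo the moves of the theory. -/
def Equivalent (𝔱 : Theory) (𝒟 : Set (Diagram S)) : Diagram S → Diagram S → Prop :=
  Relation.EqvGen (fun D D' => D ∈ 𝒟 ∧ D' ∈ 𝒟 ∧ ∃ r, Step 𝔱 D D' r)

/-- The moves of the theory `𝔱` are expressed by the moves of `M'` (the theory `M'` includes `𝔱`). -/
def Includes (𝔱 : Theory) (M' : KnotTheory o A) : Prop :=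
  ∀ w w', IsMove 𝔱 w w' → ∀ (Q : Picture w) (Q' : Picture w'),
    SkeinEq M' (tangles o w.bd) (Finsupp.single Q.T 1) (Finsupp.single Q'.T 1)

/-! ### Transformation rules and derivations -/

/-- An assignment of a combination of 2-tangles to every vertex of every diagram (only the values at
the classical crossings of the diagrams from a given set matter). -/
abbrev Rule (S : Surf F) (o : Mode) (A : Type*) [CommRing A] :=
  (D : Diagram S) → D.V → (Tangle o crossSigns →₀ A)

/-- A local transformation rule is a trait: the values at corresponding crossings are equal
as combinations of isotopy classes of 2-tangles. -/
def IsTrait (𝔱 : Theory) (𝒟 : Set (Diagram S)) (τ : Rule S o A) : Prop :=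
  ∀ D ∈ 𝒟, ∀ D' ∈ 𝒟, ∀ r, Step 𝔱 D D' r → ∀ c c',
    (D.label c).IsClassical → (D'.label c').IsClassical → r c c' →
    SkeinEq (∅ : KnotTheory o A) (tangles o crossSigns) (toDiagrams (τ D c)) (toDiagrams (τ D' c'))

/-- The application of the rule `τ` at the crossing `c`. -/
def applyAt (τ : Rule S o A) (D : Diagram S) (c : D.Crossings) : Diagram S →₀ A :=
  D.putLin c.1 c.2.signs_eq (τ D c.1)

/-- The derivation of a diagram: the sum over its classical crossings. -/
def derivation (τ : Rule S o A) (D : Diagram S) : Diagram S →₀ A :=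
  ∑ᶠ c : D.Crossings, applyAt τ D c

/-- Compatibility with the third Reidemeister move: the picture of the move with three positive
crossings remains an equality when any of the crossings is replaced, on both sides, by the
combination of 2-tangles `x`. -/
def Omega3Compatible (M' : KnotTheory o A) (x : Tangle o crossSigns →₀ A) : Prop :=
  ∀ (Q : Picture (triangleLeft .pos .pos .pos)) (Q' : Picture (triangleRight .pos .pos .pos)),
    SkeinEq M' (tangles o [true, true, true, false, false, false])
      (Q.put 0 rfl x) (Q'.put 0 rfl x) ∧
    SkeinEq M' (tangles o [true, true, true, false, false, false])
      (Q.put 1 rfl x) (Q'.put 1 rfl x) ∧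
    SkeinEq M' (tangles o [true, true, true, false, false, false])
      (Q.put 2 rfl x) (Q'.put 2 rfl x)

/-- Compatibility with the semivirtual move: a strand that intersects the tangle's ends in virtual
crossings can be moved across the tangle. -/
def SemivirtualCompatible (M' : KnotTheory o A) (x : Tangle o crossSigns →₀ A) : Prop :=
  ∀ (Q : Picture (triangleLeft .pos .virt .virt)) (Q' : Picture (triangleRight .pos .virt .virt)),
    SkeinEq M' (tangles o [true, true, true, false, false, false])
      (Q.put 0 rfl x) (Q'.put 0 rfl x)

/-- The duality for a crossing of type `l` (positive or negative): the value `y` is minus the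
tangle `x` placed between two crossings of the sign opposite to `l`. -/
def IsDual (M' : KnotTheory o A) (l : Label) (x y : Tangle o crossSigns →₀ A) : Prop :=
  ∀ Q : Picture (sandwich l.switch),
    SkeinEq M' (tangles o crossSigns) (-(Q.put 1 rfl x)) (toDiagrams y)

/-- The annihilator of the right closure. -/
def AnnRight (M' : KnotTheory o A) (x : Tangle o crossSigns →₀ A) : Prop :=
  ∀ Q : Picture (loopRight .pos), SkeinEq M' (tangles o [true, false]) (Q.put 0 rfl x) 0

/-- The annihilator of the left closure. -/
def AnnLeft (M' : KnotTheory o A) (x : Tangle o crossSigns →₀ A) : Prop :=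
  ∀ Q : Picture (loopLeft .pos), SkeinEq M' (tangles o [true, false]) (Q.put 0 rfl x) 0

end

end Skein

end

/-!
The derivation of a diagram is a sum over its crossings, so that invariance is checked for one
isotopy or one move at a time (`finsum_derivationTerm_step`). The crossings outside of the support
of a move contribute equally before and after it, since the rule takes the same value on them and
the move holds in the target theory. What remains is a sum over the crossings of the move, and it is
computed in a skein module of tangles.

*Local skein modules.* `Sk S M' m` consists of combinations of tangles with `m` boundary points,
modulo those that vanish after insertion in every diagram of the surface. An equality in the skein
module of tangles implies an equality here (`SkeinEq.clsLin_eq`), because an isotopy of the disk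
relative to the boundary extends to the surface by the identity. The extension is continuous since
an embedding of the disk maps the open disk onto an open set; this is the invariance of domain in
the plane (`isOpen_image_disk_interior`), which follows from a winding number argument. Conversely,
relations between all the diagrams of the surface imply relations in the skein module of any closed
set of diagrams (`skeinEq_of_mem_relAll`).

*Planar identities.* A picture of a connected wiring is unique up to isotopy (`Picture.skSame`), and
pictures can be composed, where auxiliary vertices of valence two are removed by uniting edges
(`exists_contraction`, `exists_comp`). Hence an identity between composed tangles amounts to a
finite check of their wirings (`cls_draw_comp`). The existence of the few basic pictures is shown by
drawings with integer coordinates (`Sketch.exists_picture`). All other planar identities are of this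
form; in particular, tangles with two or three parallel strands can be multiplied, `mul₄` and
`mul₆`, and the multiplication is associative. The trivial tangle is used as a unit for products
only: for a single tangle this would require the removal of a collar of the boundary.

*Moves.* For the moves `Ω₁` the contribution of the crossing vanishes by assumption, for `Ω₃` and
for the semivirtual move the contributions of corresponding crossings agree by compatibility, and
the virtual moves contain no classical crossings. The move `Ω₂` is the main case (`omega2_cancel`).
Let `p` and `n` be the classes of the two crossings, and let `x` be the value of the rule at the
positive one, so that `- n x n` is its value at the negative one. If the strands are parallel, then
`x n + p (- n x n) = 0` because `p n` is trivial. For antiparallel strands, denote by an index the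
strands on which a 2-tangle is placed. Compatibility with `Ω₃` gives `n₁₂ p₂₃ x₁₂ = x₂₃ p₁₂ n₂₃` and
`(n x n)₁₂ p₂₃ p₁₂ = p₂₃ p₁₂ (n x n)₂₃` (`Omega3Compatible.slide`). The left closure of a product
`a₂₃ p₁₂ b₂₃` is `a b`, by a move `Ω₁` (`closureLeft_mul`), and the counterclockwise bigon of `b`
and `a` is expressed through the left closure of `a₁₂ p₂₃ b₁₂`, by insertion of a cancelling
clockwise bigon (`ccw_eq`). Together with the identities above, this reduces an antiparallel bigon
to parallel ones (`ccw_neg`). The other orientation is the mirror image, with right closures.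
-/

noncomputable section

namespace Skein

/-! ### Invariance of domain in the plane -/

open Complex in
theorem eq_of_exp_eq_const {X : Type*} [TopologicalSpace X] [PreconnectedSpace X] {u : X → ℂ}
    (hu : Continuous u) {c : ℂ} (h : ∀ x, exp (u x) = c) (x y : X) : u x = u y := by
  have hn : ∀ x', ∃ n : ℤ, u x' = u y + n * (2 * Real.pi * Complex.I) := fun x' =>
    exp_eq_exp_iff_exists_int.1 ((h x').trans (h y).symm)
  choose n hn using hn
  have hc : Continuous fun x' => (n x' : ℂ) := by
    have : (fun x' => (n x' : ℂ)) = fun x' => (u x' - u y) / (2 * Real.pi * Complex.I) := by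
      funext x'
      rw [hn x', eq_div_iff Complex.two_pi_I_ne_zero]
      ring
    rw [this]
    fun_prop
  have hc' : Continuous n := Complex.isClosedEmbedding_intCast.isEmbedding.continuous_iff.2 hc
  have := PreconnectedSpace.constant inferInstance hc' (x := x) (y := y)
  have h0 : n y = 0 := by
    have := hn y
    simpa [Complex.two_pi_I_ne_zero] using this
  rw [hn x, this, h0]
  simp

/-- A loop in the punctured plane, written as a periodic function, has a periodic logarithm;
equivalently, its winding number around the origin is zero. -/
def HasPeriodicLog (g : ℝ → ℂ) : Prop :=
  ∃ L : ℝ → ℂ, Continuous L ∧ (∀ θ, Complex.exp (L θ) = g θ) ∧ ∀ θ, L (θ + 2 * Real.pi) = L θ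

theorem exists_log_of_ne_zero {h : I × ℝ → ℂ} (hc : Continuous h) (h0 : ∀ x, h x ≠ 0) :
    ∃ L : I × ℝ → ℂ, Continuous L ∧ ∀ x, Complex.exp (L x) = h x := by
  -- the strip is replaced by the whole plane, which is known to be simply connected
  let p : ℝ × ℝ → I × ℝ := fun x => (Set.projIcc 0 1 zero_le_one x.1, x.2)
  have hp : Continuous p := (continuous_projIcc.comp continuous_fst).prodMk continuous_snd
  obtain ⟨L, ⟨-, hL⟩, -⟩ := Complex.isCoveringMapOn_exp.existsUnique_continuousMap_lifts
    (⟨h ∘ p, hc.comp hp⟩ : C(ℝ × ℝ, ℂ)) (a₀ := (0, 0))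
    (Complex.exp_log (h0 (p (0, 0)))) (fun x => h0 (p x))
  refine ⟨fun x => L (x.1, x.2), by fun_prop, fun x => ?_⟩
  refine (congrFun hL ((x.1 : ℝ), x.2)).trans ?_
  simp [p]

theorem HasPeriodicLog.homotopy {h : I × ℝ → ℂ} (hc : Continuous h) (h0 : ∀ x, h x ≠ 0)
    (hp : ∀ t θ, h (t, θ + 2 * Real.pi) = h (t, θ))
    (h1 : HasPeriodicLog fun θ => h (0, θ)) : HasPeriodicLog fun θ => h (1, θ) := by
  obtain ⟨L, hLc, hL⟩ := exists_log_of_ne_zero hc h0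
  obtain ⟨L₀, hL₀c, hL₀, hL₀p⟩ := h1
  refine ⟨fun θ => L (1, θ), by fun_prop, fun θ => hL _, fun θ => ?_⟩
  have hd : ∀ x : I × ℝ, Complex.exp (L (x.1, x.2 + 2 * Real.pi) - L x) = 1 := by
    intro x
    rw [Complex.exp_sub, hL, hL, hp, div_self (h0 _)]
  have h2 := eq_of_exp_eq_const (u := fun x : I × ℝ => L (x.1, x.2 + 2 * Real.pi) - L x)
    (by fun_prop) hd (1, θ) (0, θ)
  have hd' : ∀ θ : ℝ, Complex.exp (L (0, θ) - L₀ θ) = 1 := by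
    intro θ
    rw [Complex.exp_sub, hL, hL₀, div_self (h0 _)]
  have h3 := eq_of_exp_eq_const (u := fun θ : ℝ => L (0, θ) - L₀ θ)
    (by fun_prop) hd' (θ + 2 * Real.pi) θ
  rw [hL₀p] at h3
  linear_combination h2 + h3

/-- For a periodic logarithm `L` of an odd loop, the difference `L (θ + π) - L θ` does not depend on
`θ`, and vanishes since its double does; but its exponential is `-1`. -/
theorem not_hasPeriodicLog_of_odd {g : ℝ → ℂ} (hg : ∀ θ, g (θ + Real.pi) = -g θ) :
    ¬ HasPeriodicLog g := by
  rintro ⟨L, hc, hL, hp⟩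
  have hne : ∀ θ, g θ ≠ 0 := fun θ => hL θ ▸ Complex.exp_ne_zero _
  have hd : ∀ θ : ℝ, Complex.exp (L (θ + Real.pi) - L θ) = -1 := by
    intro θ
    rw [Complex.exp_sub, hL, hL, hg, neg_div, div_self (hne _)]
  have h1 : L (0 + Real.pi + Real.pi) - L (0 + Real.pi) = L (0 + Real.pi) - L 0 :=
    eq_of_exp_eq_const (u := fun θ : ℝ => L (θ + Real.pi) - L θ) (by fun_prop) hd (0 + Real.pi) 0
  have h2 := hp 0
  rw [show (0 : ℝ) + 2 * Real.pi = 0 + Real.pi + Real.pi by ring] at h2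
  have h3 : L (0 + Real.pi) - L 0 = 0 := by linear_combination h2 / 2 - h1 / 2
  have h4 := hd 0
  rw [h3, Complex.exp_zero] at h4
  norm_num at h4

/-- Invariance of domain in the plane, at the centre of the disk. The loop `f (e ^ (i θ)) - f 0` is
homotopic in the punctured plane to the odd loop `f (e ^ (i θ) / 2) - f (- e ^ (i θ) / 2)`, so that
it winds around the origin. If `f 0` were not an interior point of the image, there would be a point
`q` close to it outside of the image, and `f (r e ^ (i θ)) - q` would contract the loop. -/
theorem mem_interior_image_closedBall {f : ℂ → ℂ} (hf : Continuous f)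
    (hi : Set.InjOn f (Metric.closedBall 0 1)) :
    f 0 ∈ interior (f '' Metric.closedBall 0 1) := by
  set e : ℝ → ℂ := fun θ => Complex.exp (θ * Complex.I) with he
  have hec : Continuous e := by fun_prop
  have hen : ∀ θ, ‖e θ‖ = 1 := fun θ => Complex.norm_exp_ofReal_mul_I θ
  have hep : ∀ θ, e (θ + 2 * Real.pi) = e θ := by
    intro θ
    simp only [he]
    push_cast
    rw [add_mul, Complex.exp_add, Complex.exp_two_pi_mul_I, mul_one]
  have hem : ∀ θ, e (θ + Real.pi) = -e θ := by
    intro θ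
    simp only [he]
    push_cast
    rw [add_mul, Complex.exp_add, Complex.exp_pi_mul_I]
    ring
  by_contra hint
  -- a disk around `f 0` that avoids the image of the unit circle
  have hK : IsCompact (f '' Metric.sphere 0 1) := (isCompact_sphere 0 1).image hf
  have h0K : f 0 ∉ f '' Metric.sphere 0 1 := by
    rintro ⟨z, hz, hzz⟩
    have := hi (Metric.sphere_subset_closedBall hz) (by simp) hzz
    subst this
    simp at hz
  obtain ⟨ε, hε, hball⟩ := Metric.isOpen_iff.1 hK.isClosed.isOpen_compl (f 0) h0K
  obtain ⟨q, hqball, hq⟩ : ∃ q ∈ Metric.ball (f 0) ε, q ∉ f '' Metric.closedBall 0 1 := by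
    by_contra hcon
    push Not at hcon
    exact hint (mem_interior.2 ⟨_, hcon, Metric.isOpen_ball, Metric.mem_ball_self hε⟩)
  -- the point `q` is not in the image, so the loop contracts to the image of the centre
  have s1 : HasPeriodicLog fun θ => f (e θ) - q := by
    have := HasPeriodicLog.homotopy (h := fun x : I × ℝ => f ((x.1 : ℝ) * e x.2) - q)
      (by fun_prop) ?_ ?_ ?_
    · simpa using this
    · rintro ⟨t, θ⟩ h
      refine hq ⟨(t : ℝ) * e θ, ?_, sub_eq_zero.1 h⟩
      rw [mem_closedBall_zero_iff, norm_mul, hen, mul_one, Complex.norm_real, Real.norm_eq_abs,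
        abs_of_nonneg t.2.1]
      exact t.2.2
    · intro t θ
      simp only [hep]
    · refine ⟨fun _ => Complex.log (f 0 - q), continuous_const, fun θ => ?_, fun θ => rfl⟩
      rw [Complex.exp_log]
      · simp
      · intro h
        exact hq ⟨0, by simp, sub_eq_zero.1 h⟩
  -- the base point moves from `q` to `f 0` inside the disk that avoids the image of the circle
  have s2 : HasPeriodicLog fun θ => f (e θ) - f 0 := by
    have := HasPeriodicLog.homotopy
      (h := fun x : I × ℝ => f (e x.2) - ((1 - (x.1 : ℝ)) * q + (x.1 : ℝ) * f 0)) (by fun_prop)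
      ?_ ?_ ?_
    · simpa using this
    · rintro ⟨t, θ⟩ h
      have hmem : (1 - (t : ℝ)) * q + (t : ℝ) * f 0 ∈ Metric.ball (f 0) ε := by
        have := (convex_ball (f 0) ε) hqball (Metric.mem_ball_self hε) (a := 1 - (t : ℝ))
          (b := (t : ℝ)) (by linarith [t.2.2]) t.2.1 (by ring)
        simpa using this
      refine hball hmem ⟨e θ, by simp [hen], sub_eq_zero.1 h⟩
    · intro t θ
      simp only [hep]
    · simpa using s1
  -- the homotopy `f (z / (1 + t)) - f (- t z / (1 + t))`, without zeros since `f` is injective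
  have s3 : HasPeriodicLog fun θ => f (e θ / 2) - f (-(e θ / 2)) := by
    have := HasPeriodicLog.homotopy
      (h := fun x : I × ℝ => f (((1 / (1 + (x.1 : ℝ)) : ℝ) : ℂ) * e x.2) -
        f (-(((x.1 : ℝ) / (1 + (x.1 : ℝ)) : ℝ) : ℂ) * e x.2)) ?_ ?_ ?_ ?_
    · convert this using 3 with θ
      · norm_num
        ring_nf
      · norm_num
        ring_nf
    · have h1 : Continuous fun x : I × ℝ => 1 / (1 + (x.1 : ℝ)) := by
        refine continuous_const.div (by fun_prop) fun x => ?_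
        have := x.1.2.1
        positivity
      have h2 : Continuous fun x : I × ℝ => (x.1 : ℝ) / (1 + (x.1 : ℝ)) := by
        refine Continuous.div (by fun_prop) (by fun_prop) fun x => ?_
        have := x.1.2.1
        positivity
      fun_prop
    · rintro ⟨t, θ⟩ h
      have ht := t.2.1
      have ht1 := t.2.2
      have hpos : 0 < 1 + (t : ℝ) := by positivity
      have := hi ?_ ?_ (sub_eq_zero.1 h)
      · have hne : e θ ≠ 0 := fun h0 => by simpa [h0] using hen θ
        have h3 := mul_right_cancel₀ hne this
        rw [← Complex.ofReal_neg, Complex.ofReal_inj] at h3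
        field_simp at h3
        linarith
      · rw [mem_closedBall_zero_iff, norm_mul, hen, mul_one, Complex.norm_real, Real.norm_eq_abs,
          abs_of_nonneg (by positivity), div_le_one hpos]
        linarith
      · rw [mem_closedBall_zero_iff, norm_mul, hen, mul_one, norm_neg, Complex.norm_real,
          Real.norm_eq_abs, abs_of_nonneg (by positivity), div_le_one hpos]
        linarith
    · intro t θ
      simp only [hep]
    · simpa using s2
  refine not_hasPeriodicLog_of_odd (fun θ => ?_) s3
  simp only [hem]
  ring_nf

/-- The radial retraction of the plane onto the closed unit disk. -/
def toDisk : C(ℂ, Disk) where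
  toFun z := ⟨(((max 1 ‖z‖)⁻¹ : ℝ) : ℂ) * z, by
    have h : 0 < max 1 ‖z‖ := lt_max_of_lt_left one_pos
    rw [mem_closedBall_zero_iff, norm_mul, Complex.norm_real, Real.norm_eq_abs,
      abs_of_pos (inv_pos.2 h), inv_mul_le_one₀ h]
    exact le_max_right _ _⟩
  continuous_toFun := by
    refine Continuous.subtype_mk ?_ _
    have : Continuous fun z : ℂ => (max 1 ‖z‖)⁻¹ :=
      Continuous.inv₀ (by fun_prop) fun z => (lt_max_of_lt_left one_pos).ne'
    fun_prop

theorem toDisk_coe (z : Disk) : toDisk (z : ℂ) = z := by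
  apply Subtype.ext
  have h := mem_closedBall_zero_iff.1 z.2
  simp [toDisk, max_eq_left h]

theorem coe_toDisk {z : ℂ} (h : ‖z‖ ≤ 1) : (toDisk z : ℂ) = z := by
  simp [toDisk, max_eq_left h]

/-- An embedding of the closed disk in a surface maps the open disk onto an open set. -/
theorem isOpen_image_disk_interior {F : Type} [TopologicalSpace F]
    [ChartedSpace (EuclideanHalfSpace 2) F] {χ : C(Disk, F)} (hχ : Function.Injective χ) :
    IsOpen (χ '' {z | ‖(z : ℂ)‖ < 1}) := by
  rw [isOpen_iff_mem_nhds]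
  rintro _ ⟨z, hz, rfl⟩
  set 𝓘 := modelWithCornersEuclideanHalfSpace 2
  set φ := extChartAt 𝓘 (χ z)
  let L : EuclideanSpace ℝ (Fin 2) ≃L[ℝ] ℂ :=
    Complex.orthonormalBasisOneI.repr.symm.toContinuousLinearEquiv
  have hs0 : φ.source ∈ nhds (χ z) := extChartAt_source_mem_nhds (χ z)
  have hsrc : χ ⁻¹' φ.source ∈ nhds z :=
    χ.continuous.continuousAt.preimage_mem_nhds (hs0)
  obtain ⟨r₀, hr₀, hr₀s⟩ := Metric.mem_nhds_iff.1 hsrc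
  set r := min (r₀ / 2) ((1 - ‖(z : ℂ)‖) / 2) with hr
  have hz' : ‖(z : ℂ)‖ < 1 := hz
  have hrpos : 0 < r := lt_min (by positivity) (by linarith)
  have hr1 : r < r₀ := (min_le_left _ _).trans_lt (by linarith)
  have hr2 : r < 1 - ‖(z : ℂ)‖ := (min_le_right _ _).trans_lt (by linarith)
  -- a small disk around `z`, parametrized by the unit disk, lies in one chart of the surface
  let a : C(ℂ, Disk) := ⟨fun w => toDisk (z + r * (toDisk w : ℂ)), toDisk.continuous.comp
    (continuous_const.add (continuous_const.mul (continuous_subtype_val.comp toDisk.continuous)))⟩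
  have ha : ∀ w, (a w : ℂ) = z + r * (toDisk w : ℂ) ∧ ‖(a w : ℂ)‖ < 1 ∧ χ (a w) ∈ φ.source := by
    intro w
    have hw : ‖((toDisk w : Disk) : ℂ)‖ ≤ 1 := mem_closedBall_zero_iff.1 (toDisk w).2
    have h1 : ‖(r : ℂ) * (toDisk w : ℂ)‖ ≤ r := by
      rw [norm_mul, Complex.norm_real, Real.norm_eq_abs, abs_of_pos hrpos]
      exact mul_le_of_le_one_right hrpos.le hw
    have h2 : ‖(z : ℂ) + r * (toDisk w : ℂ)‖ < 1 := (norm_add_le _ _).trans_lt (by linarith)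
    have h3 : (a w : ℂ) = z + r * (toDisk w : ℂ) := coe_toDisk h2.le
    refine ⟨h3, h3 ▸ h2, hr₀s ?_⟩
    rw [Metric.mem_ball, Subtype.dist_eq, dist_eq_norm, h3, add_sub_cancel_left]
    exact h1.trans_lt hr1
  have hcont : Continuous fun w => φ (χ (a w)) :=
    (show ContinuousOn φ φ.source from continuousOn_extChartAt (χ z)).comp_continuous
      (by fun_prop) fun w => (ha w).2.2
  have key := mem_interior_image_closedBall (f := fun w => L (φ (χ (a w))))
    (L.continuous.comp hcont) ?_
  swap
  · intro w hw w' hw' h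
    have h1 := hχ (φ.injOn (ha w).2.2 (ha w').2.2 (L.injective h))
    have h2 := congrArg (Subtype.val) h1
    rw [(ha w).1, (ha w').1] at h2
    have h3 := mul_left_cancel₀ (Complex.ofReal_ne_zero.2 hrpos.ne') (add_left_cancel h2)
    rwa [coe_toDisk (mem_closedBall_zero_iff.1 hw), coe_toDisk (mem_closedBall_zero_iff.1 hw')]
      at h3
  have ha0 : a 0 = z := by
    apply Subtype.ext
    rw [(ha 0).1, coe_toDisk (by simp)]
    simp
  have hcA : ContinuousAt (fun y => L (φ y)) (χ z) :=
    L.continuous.continuousAt.comp (show ContinuousAt φ (χ z) from continuousAt_extChartAt (χ z))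
  simp only [ha0] at key
  filter_upwards [hcA.preimage_mem_nhds (mem_interior_iff_mem_nhds.1 key),
    hs0] with y hy hys
  obtain ⟨w, -, hw⟩ := hy
  exact ⟨a w, (ha w).2.1, φ.injOn (ha w).2.2 hys (L.injective hw)⟩

/-! ### Extension of isotopies of an embedded disk -/

theorem IsAmbient.bijective {F : Type} [TopologicalSpace F] {S : Surf F} {g : C(F, F)}
    (hg : IsAmbient S g) : Function.Bijective g := by
  obtain ⟨H⟩ := hg
  have h := (H.prop' 1).1
  convert h using 1
  funext x
  exact (H.apply_one x).symm

theorem IsAmbient.apply_bdry {F : Type} [TopologicalSpace F] {S : Surf F} {g : C(F, F)}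
    (hg : IsAmbient S g) {x : F} (hx : x ∈ S.bdry) : g x = x := by
  obtain ⟨H⟩ := hg
  have h := (H.prop' 1).2 x hx
  exact (H.apply_one x).symm.trans h

theorem IsAmbient.refl {F : Type} [TopologicalSpace F] (S : Surf F) :
    IsAmbient S (ContinuousMap.id F) :=
  ContinuousMap.HomotopicWith.refl _ ⟨Function.bijective_id, fun _ _ => rfl⟩

open Classical in
/-- The extension by the identity of a self-map of the disk to a surface in which the disk is
embedded. -/
def extendById {F : Type} [TopologicalSpace F] (χ : C(Disk, F)) (φ : Disk → Disk)
    (x : F) : F :=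
  if h : ∃ z, χ z = x then χ (φ h.choose) else x

section
variable {F : Type} [TopologicalSpace F] {χ : C(Disk, F)}

theorem extendById_apply (hχ : Function.Injective χ) (φ : Disk → Disk) (z : Disk) :
    extendById χ φ (χ z) = χ (φ z) := by
  have h : ∃ z', χ z' = χ z := ⟨z, rfl⟩
  rw [extendById, dif_pos h, hχ h.choose_spec]

theorem extendById_of_notMem (φ : Disk → Disk) {x : F} (h : ∀ z, χ z ≠ x) :
    extendById χ φ x = x := by
  rw [extendById, dif_neg (by push Not; exact h)]

theorem extendById_bijective (hχ : Function.Injective χ) {φ : Disk → Disk}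
    (hφ : Function.Bijective φ) : Function.Bijective (extendById χ φ) := by
  constructor
  · intro x y h
    by_cases hx : ∃ z, χ z = x <;> by_cases hy : ∃ z, χ z = y
    · obtain ⟨z, rfl⟩ := hx
      obtain ⟨w, rfl⟩ := hy
      rw [extendById_apply hχ, extendById_apply hχ] at h
      rw [hφ.1 (hχ h)]
    · obtain ⟨z, rfl⟩ := hx
      push Not at hy
      rw [extendById_apply hχ, extendById_of_notMem _ hy] at h
      exact absurd h (hy _)
    · obtain ⟨w, rfl⟩ := hy
      push Not at hx
      rw [extendById_apply hχ, extendById_of_notMem _ hx] at h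
      exact absurd h.symm (hx _)
    · push Not at hx hy
      rwa [extendById_of_notMem _ hx, extendById_of_notMem _ hy] at h
  · intro y
    by_cases hy : ∃ z, χ z = y
    · obtain ⟨w, rfl⟩ := hy
      obtain ⟨z, rfl⟩ := hφ.2 w
      exact ⟨χ z, extendById_apply hχ _ _⟩
    · push Not at hy
      exact ⟨y, extendById_of_notMem _ hy⟩

theorem continuous_extendById [T2Space F] (hχ : Function.Injective χ)
    (hopen : IsOpen (χ '' {z | ‖(z : ℂ)‖ < 1})) {φ : I × Disk → Disk} (hφ : Continuous φ)
    (hb : ∀ t (z : Disk), ‖(z : ℂ)‖ = 1 → φ (t, z) = z) :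
    Continuous fun x : I × F => extendById χ (fun z => φ (x.1, z)) x.2 := by
  -- the surface is covered by two closed sets: the disk and the complement of the open disk
  have hemb : Topology.IsClosedEmbedding χ := χ.continuous.isClosedEmbedding hχ
  set Φ : I × F → F := fun x => extendById χ (fun z => φ (x.1, z)) x.2 with hΦ
  have h1 : ContinuousOn Φ (Set.univ ×ˢ Set.range χ) := by
    have hce : Topology.IsClosedEmbedding (Prod.map (id : I → I) χ) :=
      Topology.IsClosedEmbedding.prodMap Topology.IsClosedEmbedding.id hemb
    have : ContinuousOn Φ (Set.range (Prod.map (id : I → I) χ)) := by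
      rw [← Set.image_univ, hce.isInducing.continuousOn_image_iff]
      refine Continuous.continuousOn ?_
      have : Φ ∘ Prod.map (id : I → I) χ = fun x => χ (φ x) := by
        funext x
        exact extendById_apply hχ (fun z => φ (x.1, z)) x.2
      rw [this]
      fun_prop
    rwa [Set.range_prodMap, Set.range_id] at this
  have h2 : ContinuousOn Φ (Set.univ ×ˢ (χ '' {z | ‖(z : ℂ)‖ < 1})ᶜ) := by
    refine continuous_snd.continuousOn.congr ?_
    rintro ⟨t, x⟩ ⟨-, hx⟩
    by_cases h : ∃ z, χ z = x
    · obtain ⟨z, rfl⟩ := h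
      simp only [hΦ]
      rw [extendById_apply hχ, hb]
      refine le_antisymm (mem_closedBall_zero_iff.1 z.2) (not_lt.1 fun hlt => hx ⟨z, hlt, rfl⟩)
    · push Not at h
      exact extendById_of_notMem _ h
  have h3 := h1.union_of_isClosed h2 (isClosed_univ.prod hemb.isClosed_range)
    (isClosed_univ.prod hopen.isClosed_compl)
  rw [← Set.prod_union, Set.eq_univ_of_forall (s := Set.range χ ∪ _), Set.univ_prod_univ] at h3
  · exact continuousOn_univ.1 h3
  · intro x
    by_cases h : ∃ z, χ z = x
    · exact Or.inl h
    · refine Or.inr ?_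
      rintro ⟨z, -, hz⟩
      exact h ⟨z, hz⟩

/-- An isotopy of the disk relative to its boundary extends to a surface in which the disk is
embedded. -/
theorem IsAmbient.extend [T2Space F] {S : Surf F} (hχ : Function.Injective χ)
    (hopen : IsOpen (χ '' {z | ‖(z : ℂ)‖ < 1})) (hin : ∀ z, χ z ∉ S.bdry) {g : C(Disk, Disk)}
    (hg : IsAmbient diskSurf g) :
    ∃ g' : C(F, F), IsAmbient S g' ∧ (∀ z, g' (χ z) = χ (g z)) ∧
      ∀ x, (∀ z, χ z ≠ x) → g' x = x := by
  obtain ⟨H⟩ := hg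
  have hc := continuous_extendById hχ hopen (φ := fun x => H x) H.continuous
    (fun t z hz => (H.prop' t).2 z hz)
  refine ⟨⟨fun x => extendById χ g x, ?_⟩, ⟨⟨⟨⟨_, hc⟩, ?_, ?_⟩, ?_⟩⟩, ?_, ?_⟩
  · convert hc.comp (Continuous.prodMk_right (1 : I)) using 2 with x
    simp
  · intro x
    by_cases h : ∃ z, χ z = x
    · obtain ⟨z, rfl⟩ := h
      simp [extendById_apply hχ]
    · push Not at h
      simp [extendById_of_notMem _ h]
  · intro x
    simp
  · intro t
    refine ⟨extendById_bijective hχ (H.prop' t).1,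
      fun x hx => extendById_of_notMem (fun z => H (t, z)) ?_⟩
    rintro z rfl
    exact hin z hx
  · exact fun z => extendById_apply hχ _ _
  · exact fun x hx => extendById_of_notMem _ hx

end

/-! ### Insertion of tangles and maps of diagrams -/

section
variable {F : Type} [TopologicalSpace F] {S : Surf F}

theorem Diagram.subset_of_image_subarc (D : Diagram S) {e e' : D.E} {s t s' t' : I} (hst : s < t)
    (h : D.path e '' Set.Icc s t ⊆ D.path e' '' Set.Icc s' t') :
    e = e' ∧ s' ≤ s ∧ t ≤ t' := by
  have key : ∀ m ∈ Set.Ioo s t, e = e' ∧ m ∈ Set.Icc s' t' := by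
    intro m hm
    obtain ⟨m', hm', hmm⟩ := h ⟨m, Set.Ioo_subset_Icc_self hm, rfl⟩
    have h0 : m ≠ 0 := ((bot_le (a := s)).trans_lt hm.1).ne'
    have h1 : m ≠ 1 := (hm.2.trans_le (le_top (a := t))).ne
    obtain ⟨h2, rfl⟩ := D.path_inj e m h0 h1 e' m' hmm.symm
    exact ⟨h2, hm'⟩
  obtain ⟨m, hm⟩ := exists_between hst
  have hcl : Set.Icc s t ⊆ Set.Icc s' t' := by
    rw [← closure_Ioo hst.ne]
    exact closure_minimal (fun m hm => (key m hm).2) isClosed_Icc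
  exact ⟨(key m hm).1, (hcl (Set.left_mem_Icc.2 hst.le)).1, (hcl (Set.right_mem_Icc.2 hst.le)).2⟩

/-- An edge of a diagram, and a subarc of it, are determined by the set of points. -/
theorem Diagram.eq_of_image_subarc (D : Diagram S) {e e' : D.E} {s t s' t' : I} (hst : s < t)
    (hst' : s' < t') (h : D.path e '' Set.Icc s t = D.path e' '' Set.Icc s' t') :
    e = e' ∧ s = s' ∧ t = t' := by
  obtain ⟨h1, h2, h3⟩ := D.subset_of_image_subarc hst h.subset
  obtain ⟨-, h4, h5⟩ := D.subset_of_image_subarc hst' h.symm.subset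
  exact ⟨h1, le_antisymm h4 h2, le_antisymm h3 h5⟩

/-- A nondegenerate subarc of an edge contains a point outside of the standard neighbourhoods. -/
theorem Diagram.exists_subarc_notMem_chart (D : Diagram S) (e : D.E) {s t : I} (hst : s < t) :
    ∃ x ∈ D.path e '' Set.Icc s t, ∀ v z, x ≠ D.chart v z := by
  obtain ⟨m, hm⟩ := exists_between hst
  exact ⟨_, ⟨m, Set.Ioo_subset_Icc_self hm, rfl⟩, D.path_chart e m
    ((bot_le (a := s)).trans_lt hm.1).ne' (hm.2.trans_le (le_top (a := t))).ne⟩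

theorem Diagram.fill_curve (D : Diagram S) (P : Set D.V) (T : D.V → Diagram diskSurf)
    (hT : ∀ v ∈ P, IsTangle (D.label v).signs (T v)) :
    (D.fill P T hT).curve = D.curve ∪ ⋃ v : P, D.chart v '' (T v).curve := by
  ext x
  simp only [Diagram.curve, Set.mem_iUnion, Set.mem_union, Set.mem_range, Set.mem_image]
  constructor
  · rintro ⟨e | ⟨v, e⟩, t, rfl⟩
    · exact Or.inl ⟨e, t, rfl⟩
    · exact Or.inr ⟨v, _, ⟨e, t, rfl⟩, rfl⟩
  · rintro (⟨e, t, rfl⟩ | ⟨v, _, ⟨e, t, rfl⟩, rfl⟩)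
    · exact ⟨Sum.inl e, t, rfl⟩
    · exact ⟨Sum.inr ⟨v, e⟩, t, rfl⟩

theorem SameVertex.comp_chart {F' : Type} [TopologicalSpace F'] {o : Mode} {l l' : Label}
    {χ χ' : C(Disk, Disk)} (h : SameVertex o l χ l' χ') (a : C(Disk, F')) :
    SameVertex o l (a.comp χ) l' (a.comp χ') := by
  rcases h with ⟨h1, rfl⟩ | ⟨h1, h2, h3, rfl⟩
  · exact Or.inl ⟨h1, rfl⟩
  · exact Or.inr ⟨h1, h2, h3, rfl⟩

/-- The correspondence of the vertices of two diagrams obtained by insertion of tangles. -/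
def Diagram.fillEquiv {D D' : Diagram S} (eV : D.V ≃ D'.V) {P : Set D.V} {P' : Set D'.V}
    (hP : ∀ v, v ∈ P ↔ eV v ∈ P') {T : D.V → Diagram diskSurf} {T' : D'.V → Diagram diskSurf}
    (ε : ∀ v : P, (T v).V ≃ (T' (eV v)).V) : D.FillV P T ≃ D'.FillV P' T' :=
  Equiv.sumCongr (eV.subtypeEquiv fun v => not_congr (hP v))
    (Equiv.sigmaCongr (β₂ := fun w : P' => (T' w).V) (eV.subtypeEquiv hP) ε)

/-- A homeomorphism that maps a diagram to a diagram, and respects the inserted tangles, maps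
the diagrams obtained by insertion to each other. -/
theorem MapsTo.fill {o : Mode} {D D' : Diagram S} {g : C(F, F)} (hg : Function.Injective g)
    (eV : D.V ≃ D'.V) {P : Set D.V} {P' : Set D'.V} (hP : ∀ v, v ∈ P ↔ eV v ∈ P')
    (hV : ∀ v ∉ P, SameVertex o (D.label v) (g.comp (D.chart v)) (D'.label (eV v))
      (D'.chart (eV v)))
    (hC : g '' D.curve = D'.curve)
    (hD : o = .oriented → ∀ (e : D.E) (e' : D'.E) (s t s' t' : I), s < t → s' < t' →
      D.path e s ≠ D.path e t → g '' (D.path e '' Set.Icc s t) = D'.path e' '' Set.Icc s' t' →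
        g (D.path e s) = D'.path e' s')
    {T : D.V → Diagram diskSurf} {T' : D'.V → Diagram diskSurf}
    (γ : D.V → C(Disk, Disk)) (ε : ∀ v : P, (T v).V ≃ (T' (eV v)).V)
    (hTT : ∀ v : P, MapsTo o (T v) (T' (eV v)) (γ v) (ε v))
    (hγ : ∀ v : P, (D'.chart (eV v)).comp (γ v) = g.comp (D.chart v))
    (hT : ∀ v ∈ P, IsTangle (D.label v).signs (T v))
    (hT' : ∀ v ∈ P', IsTangle (D'.label v).signs (T' v)) :
    MapsTo o (D.fill P T hT) (D'.fill P' T' hT') g (Diagram.fillEquiv eV hP ε) := by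
  have hγ' : ∀ (v : P) z, g (D.chart v z) = D'.chart (eV v) (γ v z) := fun v z =>
    (DFunLike.congr_fun (hγ v) z).symm
  have hout : ∀ e (v : P) z t, t ≠ 0 → t ≠ 1 → D.path e t ≠ D.chart v z :=
    fun e v z t h0 h1 => D.path_chart e t h0 h1 v z
  refine ⟨?_, ?_, ?_⟩
  · rintro (⟨v, hv⟩ | ⟨v, x⟩)
    · exact hV v hv
    · have := ((hTT v).vertex x).comp_chart (D'.chart (eV v))
      rw [← ContinuousMap.comp_assoc, hγ v] at this
      exact this
  · rw [Diagram.fill_curve, Diagram.fill_curve, Set.image_union, hC, Set.image_iUnion]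
    congr 1
    refine Function.Surjective.iSup_congr (eV.subtypeEquiv hP) (Equiv.surjective _) fun v => ?_
    rw [Equiv.subtypeEquiv_apply]
    dsimp only
    rw [← (hTT v).curve]
    ext y
    simp only [Set.mem_image, exists_exists_and_eq_and]
    exact exists_congr fun z => and_congr_right fun _ => by rw [hγ']
  -- an arc of an edge of `D` cannot be mapped to an arc inside an inserted tangle, nor conversely,
  -- because it contains a point outside of the neighbourhoods of the vertices
  · rintro ho (e | ⟨v, e⟩) (e' | ⟨⟨w', hw⟩, e'⟩) s t s' t' hs hs' hne him
    · exact hD ho e e' s t s' t' hs hs' hne him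
    · exfalso
      obtain ⟨x, hx, hxx⟩ := D.exists_subarc_notMem_chart e hs
      obtain ⟨v, rfl⟩ := eV.surjective w'
      have h1 : g x ∈ (D'.fill P' T' hT').path (Sum.inr ⟨⟨eV v, hw⟩, e'⟩) '' Set.Icc s' t' :=
        him ▸ Set.mem_image_of_mem g hx
      obtain ⟨u, -, hu⟩ := h1
      have hv : v ∈ P := (hP v).2 hw
      obtain ⟨z, hz⟩ : ∃ z, γ v z = (T' (eV v)).path e' u := by
        have h2 : (T' (eV v)).path e' u ∈ (T' (eV v)).curve := Set.mem_iUnion.2 ⟨e', u, rfl⟩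
        rw [← (hTT ⟨v, hv⟩).curve] at h2
        obtain ⟨z, -, hz⟩ := h2
        exact ⟨z, hz⟩
      have h3 : g x = g (D.chart v z) := by
        rw [hγ' ⟨v, hv⟩, hz]
        exact hu.symm
      exact hxx v z (hg h3)
    · exfalso
      obtain ⟨x, hx, hxx⟩ := D'.exists_subarc_notMem_chart e' hs'
      have h1 : x ∈ g '' ((D.fill P T hT).path (Sum.inr ⟨v, e⟩) '' Set.Icc s t) := him ▸ hx
      obtain ⟨_, ⟨u, -, rfl⟩, rfl⟩ := h1
      exact hxx (eV v) _ (hγ' v _)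
    · obtain ⟨w, rfl⟩ := eV.surjective w'
      have him' : g '' (D.chart v '' ((T v).path e '' Set.Icc s t)) =
          D'.chart (eV w) '' ((T' (eV w)).path e' '' Set.Icc s' t') := by
        rw [Set.image_image (D.chart v), Set.image_image (D'.chart (eV w))]
        exact him
      have h0 : g (D.chart v ((T v).path e s)) ∈
          g '' (D.chart v '' ((T v).path e '' Set.Icc s t)) :=
        ⟨_, ⟨_, ⟨s, Set.left_mem_Icc.2 hs.le, rfl⟩, rfl⟩, rfl⟩
      rw [him', hγ'] at h0
      obtain ⟨z, -, hz⟩ := h0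
      have h1 := eV.injective (D'.chart_disjoint _ _ _ _ hz)
      subst h1
      have him2 : γ v '' ((T v).path e '' Set.Icc s t) =
          (T' (eV v)).path e' '' Set.Icc s' t' := by
        apply Set.image_injective.2 (D'.chart_inj (eV v))
        rw [← him']
        ext y
        simp only [Set.mem_image, exists_exists_and_eq_and]
        exact exists_congr fun z => and_congr_right fun _ => by rw [hγ' v]
      have h2 := (hTT v).direction ho e e' s t s' t' hs hs' (fun h => hne (congrArg (D.chart v) h))
        him2
      exact (hγ' v _).trans (congrArg (D'.chart (eV v)) h2)

/-- A renaming of vertices and edges. Surjectivity is sufficient: neighbourhoods of distinct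
vertices are disjoint, and distinct edges have no common interior points. -/
structure Relabel (D D' : Diagram S) where
  eV : D.V → D'.V
  eE : D.E → D'.E
  surjV : Function.Surjective eV
  surjE : Function.Surjective eE
  label : ∀ v, D'.label (eV v) = D.label v
  chart : ∀ v, D'.chart (eV v) = D.chart v
  path : ∀ e, D'.path (eE e) = D.path e

/-- The neighbourhoods of distinct vertices being disjoint, a renaming is injective on vertices. -/
theorem Relabel.injV {D D' : Diagram S} (ρ : Relabel D D') : Function.Injective ρ.eV := by
  intro v w h
  have h1 : D.chart v = D.chart w := by rw [← ρ.chart, ← ρ.chart, h]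
  exact D.chart_disjoint v w 0 0 (by rw [h1])

/-- The identical renaming. -/
def Relabel.refl (D : Diagram S) : Relabel D D where
  eV := id
  eE := id
  surjV := Function.surjective_id
  surjE := Function.surjective_id
  label _ := rfl
  chart _ := rfl
  path _ := rfl

/-- Equal diagrams differ by a renaming. -/
def Relabel.ofEq {D D' : Diagram S} (h : D = D') : Relabel D D' := h ▸ Relabel.refl D

/-- The vertices of a renamed diagram correspond to those of the original one. -/
def Relabel.equiv {D D' : Diagram S} (ρ : Relabel D D') : D.V ≃ D'.V :=
  Equiv.ofBijective ρ.eV ⟨ρ.injV, ρ.surjV⟩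

theorem Relabel.mapsTo (o : Mode) {D D' : Diagram S} (ρ : Relabel D D') :
    MapsTo o D D' (ContinuousMap.id F) ρ.equiv := by
  refine ⟨fun v => Or.inl ⟨ρ.label v, ?_⟩, ?_, ?_⟩
  · rw [ContinuousMap.id_comp]
    exact ρ.chart v
  · rw [ContinuousMap.coe_id, Set.image_id]
    exact Function.Surjective.iSup_congr ρ.eE ρ.surjE fun e => by rw [ρ.path]
  · intro _ e e' s t s' t' hs hs' _ him
    rw [ContinuousMap.coe_id, Set.image_id, ← ρ.path e] at him
    obtain ⟨rfl, rfl, rfl⟩ := D'.eq_of_image_subarc hs hs' him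
    rw [ρ.path]
    rfl

/-- Insertion of tangles in two rounds amounts to the insertion of tangles in one round: the tangles
`T''` are the tangles `T` with the tangles `T'` inserted, or those `T'` that are inserted at
vertices of `D`. -/
def Diagram.fillFill (D : Diagram S) (P : Set D.V) (T : D.V → Diagram diskSurf)
    (hT : ∀ v ∈ P, IsTangle (D.label v).signs (T v)) (P' : Set (D.FillV P T))
    (T' : D.FillV P T → Diagram diskSurf)
    (hT' : ∀ v ∈ P', IsTangle ((D.fill P T hT).label v).signs (T' v)) (P'' : Set D.V)
    (T'' : D.V → Diagram diskSurf) (hT'' : ∀ v ∈ P'', IsTangle (D.label v).signs (T'' v))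
    (hP : ∀ v, v ∈ P'' ↔ v ∈ P ∨ ∃ h : v ∉ P, Sum.inl ⟨v, h⟩ ∈ P')
    (ρ : ∀ v (hv : v ∈ P), Relabel ((T v).fill {x | (Sum.inr ⟨⟨v, hv⟩, x⟩ : D.FillV P T) ∈ P'}
      (fun x => T' (Sum.inr ⟨⟨v, hv⟩, x⟩)) (fun x hx => hT' (Sum.inr ⟨⟨v, hv⟩, x⟩) hx)) (T'' v))
    (ρ' : ∀ v (hv : v ∉ P), Sum.inl ⟨v, hv⟩ ∈ P' → Relabel (T' (Sum.inl ⟨v, hv⟩)) (T'' v)) :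
    Relabel ((D.fill P T hT).fill P' T' hT') (D.fill P'' T'' hT'') where
  eV
    | .inl ⟨.inl v, h⟩ => .inl ⟨v, fun h' => by
        exact ((hP v).1 h').elim v.2 fun h2 => h h2.2⟩
    | .inl ⟨.inr ⟨v, x⟩, h⟩ => .inr ⟨⟨v, (hP v).2 (.inl v.2)⟩, (ρ v v.2).eV (.inl ⟨x, h⟩)⟩
    | .inr ⟨⟨.inl v, h⟩, y⟩ => .inr ⟨⟨v, (hP v).2 (.inr ⟨v.2, h⟩)⟩, (ρ' v v.2 h).eV y⟩
    | .inr ⟨⟨.inr ⟨v, x⟩, h⟩, y⟩ =>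
        .inr ⟨⟨v, (hP v).2 (.inl v.2)⟩, (ρ v v.2).eV (.inr ⟨⟨x, h⟩, y⟩)⟩
  eE
    | .inl (.inl e) => .inl e
    | .inl (.inr ⟨v, e⟩) => .inr ⟨⟨v, (hP v).2 (.inl v.2)⟩, (ρ v v.2).eE (.inl e)⟩
    | .inr ⟨⟨.inl v, h⟩, e⟩ => .inr ⟨⟨v, (hP v).2 (.inr ⟨v.2, h⟩)⟩, (ρ' v v.2 h).eE e⟩
    | .inr ⟨⟨.inr ⟨v, x⟩, h⟩, e⟩ =>
        .inr ⟨⟨v, (hP v).2 (.inl v.2)⟩, (ρ v v.2).eE (.inr ⟨⟨x, h⟩, e⟩)⟩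
  surjV := by
    rintro (⟨v, h⟩ | ⟨⟨v, h⟩, y⟩)
    · have h1 : v ∉ P := fun h1 => h ((hP v).2 (.inl h1))
      exact ⟨.inl ⟨.inl ⟨v, h1⟩, fun h2 => h ((hP v).2 (.inr ⟨h1, h2⟩))⟩, rfl⟩
    · by_cases hv : v ∈ P
      · obtain ⟨z, rfl⟩ := (ρ v hv).surjV y
        rcases z with ⟨x, hx⟩ | ⟨⟨x, hx⟩, y⟩
        · exact ⟨.inl ⟨.inr ⟨⟨v, hv⟩, x⟩, hx⟩, rfl⟩
        · exact ⟨.inr ⟨⟨.inr ⟨⟨v, hv⟩, x⟩, hx⟩, y⟩, rfl⟩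
      · rcases (hP v).1 h with h1 | ⟨h1, h2⟩
        · exact absurd h1 hv
        · obtain ⟨y, rfl⟩ := (ρ' v h1 h2).surjV y
          exact ⟨.inr ⟨⟨.inl ⟨v, h1⟩, h2⟩, y⟩, rfl⟩
  surjE := by
    rintro (e | ⟨⟨v, h⟩, y⟩)
    · exact ⟨.inl (.inl e), rfl⟩
    · by_cases hv : v ∈ P
      · obtain ⟨z, rfl⟩ := (ρ v hv).surjE y
        rcases z with e | ⟨⟨x, hx⟩, y⟩
        · exact ⟨.inl (.inr ⟨⟨v, hv⟩, e⟩), rfl⟩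
        · exact ⟨.inr ⟨⟨.inr ⟨⟨v, hv⟩, x⟩, hx⟩, y⟩, rfl⟩
      · rcases (hP v).1 h with h1 | ⟨h1, h2⟩
        · exact absurd h1 hv
        · obtain ⟨y, rfl⟩ := (ρ' v h1 h2).surjE y
          exact ⟨.inr ⟨⟨.inl ⟨v, h1⟩, h2⟩, y⟩, rfl⟩
  label := by
    rintro (⟨v | ⟨v, x⟩, h⟩ | ⟨⟨v | ⟨v, x⟩, h⟩, y⟩)
    · rfl
    · exact (ρ v v.2).label (.inl ⟨x, h⟩)
    · exact (ρ' v v.2 h).label y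
    · exact (ρ v v.2).label (.inr ⟨⟨x, h⟩, y⟩)
  chart := by
    rintro (⟨v | ⟨v, x⟩, h⟩ | ⟨⟨v | ⟨v, x⟩, h⟩, y⟩)
    · rfl
    · exact congrArg (D.chart v).comp ((ρ v v.2).chart (.inl ⟨x, h⟩))
    · exact congrArg (D.chart v).comp ((ρ' v v.2 h).chart y)
    · exact congrArg (D.chart v).comp ((ρ v v.2).chart (.inr ⟨⟨x, h⟩, y⟩))
  path := by
    rintro ((e | ⟨v, e⟩) | ⟨⟨v | ⟨v, x⟩, h⟩, e⟩)
    · rfl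
    · exact congrArg (D.chart v).comp ((ρ v v.2).path (.inl e))
    · exact congrArg (D.chart v).comp ((ρ' v v.2 h).path e)
    · exact congrArg (D.chart v).comp ((ρ v v.2).path (.inr ⟨⟨x, h⟩, e⟩))

end

/-! ### Renaming of vertices and repeated insertion -/

section
variable {F : Type} [TopologicalSpace F] {S : Surf F}

/-- The inverse renaming. -/
def Relabel.symm {D D' : Diagram S} (ρ : Relabel D D') : Relabel D' D where
  eV := Function.surjInv ρ.surjV
  eE := Function.surjInv ρ.surjE
  surjV v := ⟨ρ.eV v, ρ.injV (Function.surjInv_eq ρ.surjV _)⟩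
  surjE e := ⟨ρ.eE e, by
    have h := Function.surjInv_eq ρ.surjE (ρ.eE e)
    have h1 : D.path (Function.surjInv ρ.surjE (ρ.eE e)) = D.path e := by
      rw [← ρ.path, h, ρ.path]
    obtain ⟨t, ht⟩ := exists_between (zero_lt_one (α := I))
    exact (D.path_inj _ t ht.1.ne' ht.2.ne _ t (by rw [h1])).1⟩
  label v := by
    conv_rhs => rw [← Function.surjInv_eq ρ.surjV v]
    rw [ρ.label]
  chart v := by
    conv_rhs => rw [← Function.surjInv_eq ρ.surjV v]
    rw [ρ.chart]
  path e := by
    conv_rhs => rw [← Function.surjInv_eq ρ.surjE e]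
    rw [ρ.path]

/-- The composition of renamings. -/
def Relabel.trans {D D' D'' : Diagram S} (ρ : Relabel D D') (ρ' : Relabel D' D'') :
    Relabel D D'' where
  eV := ρ'.eV ∘ ρ.eV
  eE := ρ'.eE ∘ ρ.eE
  surjV := ρ'.surjV.comp ρ.surjV
  surjE := ρ'.surjE.comp ρ.surjE
  label v := (ρ'.label _).trans (ρ.label v)
  chart v := (ρ'.chart _).trans (ρ.chart v)
  path v := (ρ'.path _).trans (ρ.path v)

/-- Insertion at the vertices from equal sets. -/
def Diagram.fillSetCongr (D : Diagram S) {P P' : Set D.V} (h : P = P')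
    {T : D.V → Diagram diskSurf} (hT : ∀ v ∈ P, IsTangle (D.label v).signs (T v))
    (hT' : ∀ v ∈ P', IsTangle (D.label v).signs (T v)) :
    Relabel (D.fill P T hT) (D.fill P' T hT') := by
  subst h
  exact Relabel.refl _

/-- Insertion at no vertices. -/
def Diagram.fillEmpty (D : Diagram S) {P : Set D.V} (h : ∀ v, v ∉ P)
    {T : D.V → Diagram diskSurf} (hT : ∀ v ∈ P, IsTangle (D.label v).signs (T v)) :
    Relabel (D.fill P T hT) D where
  eV
    | .inl v => v
    | .inr x => absurd x.1.2 (h _)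
  eE
    | .inl e => e
    | .inr x => absurd x.1.2 (h _)
  surjV v := ⟨.inl ⟨v, h v⟩, rfl⟩
  surjE e := ⟨.inl e, rfl⟩
  label := by
    rintro (v | x)
    · rfl
    · exact absurd x.1.2 (h _)
  chart := by
    rintro (v | x)
    · rfl
    · exact absurd x.1.2 (h _)
  path := by
    rintro (e | x)
    · rfl
    · exact absurd x.1.2 (h _)

/-- One more insertion, at a vertex that is still vacant. -/
def Diagram.fillInsert (D : Diagram S) (P : Set D.V) (T : D.V → Diagram diskSurf)
    (hT : ∀ v ∈ P, IsTangle (D.label v).signs (T v)) (k : D.V) (hk : k ∉ P)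
    (U : Diagram diskSurf) (hU : IsTangle (D.label k).signs U) (P' : Set D.V)
    (hP' : P' = insert k P) (T' : D.V → Diagram diskSurf)
    (hT' : ∀ v ∈ P', IsTangle (D.label v).signs (T' v))
    (h : ∀ v ∈ P, T' v = T v) (hk' : T' k = U) :
    Relabel ((D.fill P T hT).plug (Sum.inl ⟨k, hk⟩) U hU) (D.fill P' T' hT') := by
  refine D.fillFill P T hT _ _ _ P' T' hT' ?_ ?_ ?_
  · intro v
    subst hP'
    constructor
    · rintro (rfl | hv)
      exacts [Or.inr ⟨hk, rfl⟩, Or.inl hv]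
    · rintro (hv | ⟨_, hv⟩)
      · exact Or.inr hv
      · cases hv
        exact Or.inl rfl
  · intro v hv
    refine Relabel.trans ((T v).fillEmpty ?_ _) (Relabel.ofEq (h v hv).symm)
    intro x hx
    cases hx
  · intro v hv hvk
    have hvk' : v = k := by
      cases hvk
      rfl
    subst hvk'
    exact Relabel.ofEq hk'.symm

open Classical in
/-- One more insertion, at a vertex of one of the inserted tangles. -/
def Diagram.fillInner (D : Diagram S) (P : Set D.V) (T : D.V → Diagram diskSurf)
    (hT : ∀ v ∈ P, IsTangle (D.label v).signs (T v)) (y : P) (z : (T y).V)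
    (U : Diagram diskSurf) (hU : IsTangle ((T y).label z).signs U) (T' : D.V → Diagram diskSurf)
    (hT' : ∀ v ∈ P, IsTangle (D.label v).signs (T' v))
    (h : ∀ v ∈ P, v ≠ y → T' v = T v) (hy : T' y = (T y).plug z U hU) :
    Relabel ((D.fill P T hT).plug (Sum.inr ⟨y, z⟩) U hU) (D.fill P T' hT') := by
  refine D.fillFill P T hT _ _ _ P T' hT' ?_ ?_ ?_
  · intro v
    refine ⟨Or.inl, ?_⟩
    rintro (hv | ⟨_, hv⟩)
    · exact hv
    · cases hv
  · intro v hv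
    by_cases hvy : v = y
    · obtain ⟨y, hy'⟩ := y
      dsimp only at hvy hU hy
      subst hvy
      refine Relabel.trans ((T v).fillSetCongr (P' := {z}) ?_ _ ?_) (Relabel.ofEq hy.symm)
      · ext x
        constructor
        · intro hx
          cases hx
          rfl
        · rintro rfl
          rfl
      · rintro _ rfl
        exact hU
    · refine Relabel.trans ((T v).fillEmpty ?_ _) (Relabel.ofEq (h v hv hvy).symm)
      intro x hx
      cases hx
      exact hvy rfl
  · intro v hv hvk
    exact absurd hvk (fun h => nomatch h)

/-- Insertion in an inserted tangle. -/
def Diagram.plugPlug (W : Diagram S) (v : W.V) (H : Diagram diskSurf)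
    (hH : IsTangle (W.label v).signs H) (k : H.V) (T : Diagram diskSurf)
    (hT : IsTangle (H.label k).signs T) (hHT : IsTangle (W.label v).signs (H.plug k T hT)) :
    Relabel ((W.plug v H hH).plug (W.plugIn v H hH k) T hT) (W.plug v (H.plug k T hT) hHT) := by
  refine W.fillFill {v} (fun _ => H) _ _ _ _ {v} (fun _ => H.plug k T hT) _ ?_ ?_ ?_
  · intro w
    refine ⟨Or.inl, ?_⟩
    rintro (hw | ⟨_, hw⟩)
    · exact hw
    · cases hw
  · intro w hw
    cases hw
    refine H.fillSetCongr (P' := {k}) ?_ _ ?_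
    ext x
    constructor
    · intro hx
      cases hx
      rfl
    · rintro rfl
      rfl
  · intro w hw hvk
    exact absurd hvk (fun h => nomatch h)

open Classical in
/-- Insertions at different vertices commute. -/
def Diagram.plugComm (W : Diagram S) {v c : W.V} (hvc : c ≠ v)
    (T U : Diagram diskSurf)
    (hT : IsTangle (W.label v).signs T) (hU : IsTangle (W.label c).signs U) :
    Relabel ((W.plug v T hT).plug (Sum.inl ⟨c, hvc⟩) U hU)
      ((W.plug c U hU).plug (Sum.inl ⟨v, hvc.symm⟩) T hT) := by
  have h : ∀ w ∈ ({c, v} : Set W.V), IsTangle (W.label w).signs (if w = v then T else U) := by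
    rintro w (rfl | rfl)
    · rw [if_neg hvc]
      exact hU
    · rw [if_pos rfl]
      exact hT
  refine (W.fillInsert {v} (fun _ => T) _ c hvc U hU {c, v} rfl (fun w => if w = v then T else U)
    h ?_ (if_neg hvc)).trans
    (W.fillInsert {c} (fun _ => U) _ v hvc.symm T hT {c, v} (Set.pair_comm c v)
    (fun w => if w = v then T else U) h ?_ (if_pos rfl)).symm
  · rintro w rfl
    exact if_pos rfl
  · rintro w rfl
    exact if_neg hvc

end

/-! ### Boundary points -/

theorem port_injOn {m i j : ℕ} (hi : i < m) (hj : j < m) (h : port m i = port m j) : i = j := by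
  have h1 := congrArg Subtype.val h
  simp only [port] at h1
  obtain ⟨n, hn⟩ := Complex.exp_eq_exp_iff_exists_int.1 h1
  have hm : (0 : ℝ) < m := by exact_mod_cast (Nat.zero_le i).trans_lt hi
  have h2 : (2 * Real.pi * (i / m : ℝ) : ℝ) = 2 * Real.pi * (j / m : ℝ) + n * (2 * Real.pi) := by
    have h3 : ((2 * Real.pi * (i / m : ℝ) : ℝ) : ℂ) =
        ((2 * Real.pi * (j / m : ℝ) + n * (2 * Real.pi) : ℝ) : ℂ) := by
      apply mul_right_cancel₀ Complex.I_ne_zero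
      rw [hn]
      push_cast
      ring
    exact_mod_cast h3
  have h3 : (i : ℝ) = j + n * m := by
    have h4 := Real.pi_pos
    field_simp at h2
    linarith
  have h4 : (i : ℤ) = j + n * m := by exact_mod_cast h3
  have h5 : n = 0 := by
    by_contra hn0
    rcases lt_or_gt_of_ne hn0 with h6 | h6
    · have : n * (m : ℤ) ≤ -1 * m := by
        apply mul_le_mul_of_nonneg_right <;> omega
      omega
    · have : 1 * (m : ℤ) ≤ n * m := by
        apply mul_le_mul_of_nonneg_right <;> omega
      omega
  subst h5
  omega

/-- A diagram in the disk with `m` boundary points in the standard position. -/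
def HasPorts (m : ℕ) (T : Diagram diskSurf) : Prop :=
  ∀ z : Disk, ‖(z : ℂ)‖ = 1 → ((∃ p, T.pt p = z) ↔ ∃ i < m, z = port m i)

theorem HasPorts.card {m : ℕ} {T : Diagram diskSurf} (h : HasPorts m T) :
    {z : Disk | ‖(z : ℂ)‖ = 1 ∧ ∃ p, T.pt p = z}.ncard = m := by
  have : {z : Disk | ‖(z : ℂ)‖ = 1 ∧ ∃ p, T.pt p = z} = Set.range fun i : Fin m => port m i := by
    ext z
    constructor
    · rintro ⟨hz, hp⟩
      obtain ⟨i, hi, rfl⟩ := (h z hz).1 hp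
      exact ⟨⟨i, hi⟩, rfl⟩
    · rintro ⟨i, rfl⟩
      exact ⟨norm_port _ _, (h _ (norm_port _ _)).2 ⟨i, i.2, rfl⟩⟩
  rw [this, ← Set.image_univ, Set.ncard_image_of_injective]
  · simp
  · intro i j hij
    exact Fin.ext (port_injOn i.2 j.2 hij)

theorem HasPorts.unique {m m' : ℕ} {T : Diagram diskSurf} (h : HasPorts m T)
    (h' : HasPorts m' T) : m = m' := h.card.symm.trans h'.card

theorem HasPorts.of_pt {m : ℕ} {T T' : Diagram diskSurf} (h : HasPorts m T)
    (h' : ∀ z : Disk, ‖(z : ℂ)‖ = 1 → ((∃ p, T'.pt p = z) ↔ ∃ p, T.pt p = z)) :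
    HasPorts m T' := fun z hz => (h' z hz).trans (h z hz)

theorem fill_pt_iff (D : Diagram diskSurf) (P : Set D.V) (T : D.V → Diagram diskSurf)
    (hT : ∀ v ∈ P, IsTangle (D.label v).signs (T v)) {z : Disk} (hz : ‖(z : ℂ)‖ = 1) :
    (∃ p, (D.fill P T hT).pt p = z) ↔ ∃ p, D.pt p = z := by
  constructor
  · rintro ⟨⟨e | ⟨v, e⟩, b⟩, h⟩
    · exact ⟨(e, b), h⟩
    · exact absurd (h ▸ hz) (D.chart_inner v _)
  · rintro ⟨⟨e, b⟩, h⟩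
    exact ⟨(Sum.inl e, b), h⟩

theorem hasPorts_fill {m : ℕ} {D : Diagram diskSurf} {P : Set D.V} {T : D.V → Diagram diskSurf}
    {hT : ∀ v ∈ P, IsTangle (D.label v).signs (T v)} :
    HasPorts m (D.fill P T hT) ↔ HasPorts m D :=
  ⟨fun h => h.of_pt fun _ hz => (fill_pt_iff D P T hT hz).symm,
    fun h => h.of_pt fun _ hz => fill_pt_iff D P T hT hz⟩

theorem hasPorts_plug {m : ℕ} {D : Diagram diskSurf} {v : D.V} {T : Diagram diskSurf}
    {hT : IsTangle (D.label v).signs T} : HasPorts m (D.plug v T hT) ↔ HasPorts m D :=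
  hasPorts_fill

/-- The tangle diagrams with `m` boundary points. Neither the directions of the boundary points nor
the absence of boxes is required. -/
abbrev Tg (m : ℕ) : Type 1 := {T : Diagram diskSurf // HasPorts m T}

/-! ### Local skein modules -/

section
variable {F : Type} [TopologicalSpace F] (S : Surf F) {o : Mode} {A : Type*} [CommRing A]
  (M' : KnotTheory o A)

/-- The relations of the skein module of all the diagrams in a surface. -/
abbrev relAll : Submodule A (Diagram S →₀ A) := skeinRel M' (Set.univ : Set (Diagram S))

variable {S}

theorem isotopy_mem {D D' : Diagram S} {r : D.V → D'.V → Prop} (h : Isotopy o D D' r) :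
    (Finsupp.single D 1 - Finsupp.single D' 1 : Diagram S →₀ A) ∈ relAll S M' :=
  Submodule.subset_span (Or.inl ⟨D, trivial, D', trivial, r, h, rfl⟩)

theorem mapsTo_id_mem {D D' : Diagram S} {eV : D.V ≃ D'.V}
    (h : MapsTo o D D' (ContinuousMap.id F) eV) :
    (Finsupp.single D 1 - Finsupp.single D' 1 : Diagram S →₀ A) ∈ relAll S M' :=
  isotopy_mem M' (Isotopy.ambient D D' _ eV (IsAmbient.refl S) h)

theorem relabel_mem {D D' : Diagram S} (ρ : Relabel D D') :
    (Finsupp.single D 1 - Finsupp.single D' 1 : Diagram S →₀ A) ∈ relAll S M' :=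
  mapsTo_id_mem M' (ρ.mapsTo o)

/-- Insertion of combinations of tangles at a vertex. -/
def plugLin (A : Type*) [CommRing A] {m : ℕ} (W : Diagram S) (v : W.V)
    (hv : (W.label v).signs.length = m) : (Tg m →₀ A) →ₗ[A] (Diagram S →₀ A) :=
  Finsupp.lmapDomain A A fun T => W.plug v T.1 (by subst hv; exact T.2)

theorem plugLin_single {m : ℕ} (W : Diagram S) (v : W.V)
    (hv : (W.label v).signs.length = m) (T : Tg m) (hT : IsTangle (W.label v).signs T.1) (a : A) :
    plugLin A W v hv (Finsupp.single T a) = Finsupp.single (W.plug v T.1 hT) a := by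
  rw [plugLin, Finsupp.lmapDomain_apply, Finsupp.mapDomain_single]

variable (S) in
/-- The combinations of tangles that vanish after insertion in any diagram in the surface. -/
def Null (m : ℕ) : Submodule A (Tg m →₀ A) :=
  ⨅ (W : Diagram S) (v : W.V) (hv : (W.label v).signs.length = m),
    (relAll S M').comap (plugLin A W v hv)

theorem mem_Null {m : ℕ} {x : Tg m →₀ A} : x ∈ Null S M' m ↔
    ∀ (W : Diagram S) (v : W.V) (hv : (W.label v).signs.length = m),
      plugLin A W v hv x ∈ relAll S M' := by
  simp only [Null, Submodule.mem_iInf, Submodule.mem_comap]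

variable (S) in
/-- The skein module of tangles with `m` boundary points, where combinations of tangles are
considered up to equality after insertion in any diagram in the surface. -/
abbrev Sk (m : ℕ) : Type _ := (Tg m →₀ A) ⧸ Null S M' m

variable (S) in
/-- The class of a tangle in the local skein module. -/
def cls {m : ℕ} (T : Tg m) : Sk S M' m := (Null S M' m).mkQ (Finsupp.single T 1)

variable {M'}

/-- Tangles that become equivalent after any insertion have the same class. -/
theorem cls_eq {m : ℕ} {T T' : Tg m}
    (h : ∀ (W : Diagram S) (v : W.V) (_ : (W.label v).signs.length = m)
      (hT : IsTangle (W.label v).signs T.1) (hT' : IsTangle (W.label v).signs T'.1),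
      (Finsupp.single (W.plug v T.1 hT) 1 - Finsupp.single (W.plug v T'.1 hT') 1 :
        Diagram S →₀ A) ∈ relAll S M') :
    cls S M' T = cls S M' T' := by
  rw [cls, cls, ← sub_eq_zero, ← map_sub, Submodule.mkQ_apply, Submodule.Quotient.mk_eq_zero,
    mem_Null]
  intro W v hv
  have hT : IsTangle (W.label v).signs T.1 := by subst hv; exact T.2
  have hT' : IsTangle (W.label v).signs T'.1 := by subst hv; exact T'.2
  rw [map_sub, plugLin_single W v hv T hT, plugLin_single W v hv T' hT']
  exact h W v hv hT hT'

theorem Sk.hom_ext {m : ℕ} {N : Type*} [AddCommGroup N] [Module A N] {f g : Sk S M' m →ₗ[A] N}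
    (h : ∀ T, f (cls S M' T) = g (cls S M' T)) : f = g := by
  refine Submodule.linearMap_qext _ (Finsupp.lhom_ext' fun T => LinearMap.ext_ring ?_)
  exact h T

theorem mapsTo_plug {o : Mode} {T T' : Diagram diskSurf} {ε : T.V ≃ T'.V}
    (h : MapsTo o T T' (ContinuousMap.id Disk) ε) (W : Diagram S) (v : W.V)
    (hT : IsTangle (W.label v).signs T) (hT' : IsTangle (W.label v).signs T') :
    ∃ eV, MapsTo o (W.plug v T hT) (W.plug v T' hT') (ContinuousMap.id F) eV := by
  refine ⟨_, MapsTo.fill (D := W) (D' := W) (g := ContinuousMap.id F) Function.injective_id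
    (Equiv.refl _) (P := {v}) (P' := {v}) (fun _ => Iff.rfl) (fun w _ => Or.inl ⟨rfl, rfl⟩)
    (by simp) ?_ (T := fun _ => T) (T' := fun _ => T') (fun _ => ContinuousMap.id Disk)
    (fun _ => ε) (fun _ => h) (fun _ => rfl) _ _⟩
  intro ho e e' s t s' t' hs hs' hne him
  rw [ContinuousMap.coe_id, Set.image_id] at him
  obtain ⟨rfl, rfl, rfl⟩ := W.eq_of_image_subarc hs hs' him
  rfl

theorem cls_eq_of_mapsTo {m : ℕ} {T T' : Tg m} {ε : T.1.V ≃ T'.1.V}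
    (h : MapsTo o T.1 T'.1 (ContinuousMap.id Disk) ε) : cls S M' T = cls S M' T' :=
  cls_eq fun W v _ hT hT' => mapsTo_id_mem M' (mapsTo_plug h W v hT hT').choose_spec

theorem cls_eq_of_relabel {m : ℕ} {T T' : Tg m} (ρ : Relabel T.1 T'.1) :
    cls S M' T = cls S M' T' :=
  cls_eq_of_mapsTo (ρ.mapsTo o)

/-- A plane graph with inserted tangles is determined up to isotopy by its shape. -/
theorem cls_eq_of_sameShape {m : ℕ} {T T' : Diagram diskSurf} {eV : T.V ≃ T'.V}
    {eE : T.E ≃ T'.E} (h : SameShape T T' eV eE) (hc : ConnectedToBoundary T) (P : Set T.V)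
    (R : T.V → Diagram diskSurf) (hR : ∀ x ∈ P, IsTangle (T.label x).signs (R x))
    (hm : HasPorts m (T.fill P R hR))
    (hm' : HasPorts m (T'.fill (eV.symm ⁻¹' P) (fun x' => R (eV.symm x')) (h.isTangle_symm hR))) :
    cls S M' ⟨_, hm⟩ = cls S M' ⟨_, hm'⟩ :=
  cls_eq fun W v _ hT hT' => isotopy_mem M' (Isotopy.planar W v T T' eV eE h hc P R hR hT hT')

/-- Insertion at a vertex of a tangle, as an operation on local skein modules. It is well defined
because insertion in `H`, followed by insertion of `H` in a diagram `W`, is insertion in the diagram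
obtained from `W` by insertion of `H`. -/
def plugOp {m n : ℕ} (M' : KnotTheory o A) (H : Diagram diskSurf) (hH : HasPorts n H) (k : H.V)
    (hk : (H.label k).signs.length = m) : Sk S M' m →ₗ[A] Sk S M' n :=
  Submodule.mapQ _ _ (Finsupp.lmapDomain A A fun T : Tg m =>
    (⟨H.plug k T.1 (by subst hk; exact T.2), hasPorts_plug.2 hH⟩ : Tg n)) (by
    intro x hx
    rw [Submodule.mem_comap, mem_Null]
    intro W v hv
    have hHv : IsTangle (W.label v).signs H := by subst hv; exact hH
    have h1 := (mem_Null M').1 hx (W.plug v H hHv) (W.plugIn v H hHv k) hk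
    rw [← Submodule.Quotient.mk_eq_zero, ← Submodule.mkQ_apply] at h1 ⊢
    rw [← h1, ← LinearMap.comp_apply, ← LinearMap.comp_apply, ← LinearMap.comp_apply]
    congr 1
    refine Finsupp.lhom_ext' fun T => LinearMap.ext_ring ?_
    have hT : IsTangle (H.label k).signs T.1 := by subst hk; exact T.2
    simp only [LinearMap.comp_apply, Finsupp.lsingle_apply, Finsupp.lmapDomain_apply,
      Finsupp.mapDomain_single]
    have hHT : IsTangle (W.label v).signs (H.plug k T.1 hT) := by
      subst hv
      exact hasPorts_plug.2 hH
    rw [plugLin_single W v hv _ hHT,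
      plugLin_single (W.plug v H hHv) (W.plugIn v H hHv k) hk T hT, ← sub_eq_zero, ← map_sub,
      Submodule.mkQ_apply, Submodule.Quotient.mk_eq_zero, ← neg_sub]
    exact Submodule.neg_mem _ (relabel_mem M' (W.plugPlug v H hHv k T.1 hT hHT)))

theorem plugOp_cls {m n : ℕ} (H : Diagram diskSurf) (hH : HasPorts n H) (k : H.V)
    (hk : (H.label k).signs.length = m) (T : Tg m) (hT : IsTangle (H.label k).signs T.1) :
    plugOp M' H hH k hk (cls S M' T) = cls S M' ⟨H.plug k T.1 hT, hasPorts_plug.2 hH⟩ := by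
  simp only [plugOp, cls, Submodule.mapQ_apply, Submodule.mkQ_apply, Finsupp.lmapDomain_apply,
    Finsupp.mapDomain_single]

open Classical in
variable (S M') in
/-- The class of a combination of diagrams in the disk (those with a wrong number of boundary
points are disregarded). -/
def clsLin (m : ℕ) : (Diagram diskSurf →₀ A) →ₗ[A] Sk S M' m :=
  Finsupp.linearCombination A fun T => if h : HasPorts m T then cls S M' ⟨T, h⟩ else 0

theorem clsLin_single {m : ℕ} {T : Diagram diskSurf} (h : HasPorts m T) (a : A) :
    clsLin S M' m (Finsupp.single T a) = a • cls S M' ⟨T, h⟩ := by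
  simp [clsLin, h]

theorem clsLin_toDiagrams {bd : List Bool} (x : Tangle o bd →₀ A) :
    clsLin S M' bd.length (toDiagrams x) = (Null S M' bd.length).mkQ
      (Finsupp.lmapDomain A A (fun T : Tangle o bd => (⟨T.1, T.2.2.1⟩ : Tg bd.length)) x) := by
  induction x using Finsupp.induction_linear with
  | zero => simp
  | add f g hf hg => rw [map_add, map_add, hf, hg, map_add, map_add]
  | single T a =>
    rw [toDiagrams, Finsupp.lmapDomain_apply, Finsupp.mapDomain_single,
      clsLin_single (show HasPorts bd.length T.1 from T.2.2.1), Finsupp.lmapDomain_apply,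
      Finsupp.mapDomain_single, cls, ← map_smul, Finsupp.smul_single, smul_eq_mul, mul_one]

theorem clsLin_putLin {n : ℕ} (H : Diagram diskSurf) (hH : HasPorts n H) (k : H.V) {bd : List Bool}
    (hk : (H.label k).signs = bd) (x : Tangle o bd →₀ A) :
    clsLin S M' n (H.putLin k hk x) =
      plugOp M' H hH k (congrArg _ hk) (clsLin S M' bd.length (toDiagrams x)) := by
  induction x using Finsupp.induction_linear with
  | zero => simp
  | add f g hf hg => simp only [map_add, hf, hg]
  | single T a =>
    have hT : IsTangle (H.label k).signs T.1 := by subst hk; exact T.2.2.1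
    rw [toDiagrams, Finsupp.lmapDomain_apply, Finsupp.mapDomain_single,
      clsLin_single (show HasPorts bd.length T.1 from T.2.2.1), map_smul, plugOp_cls (hT := hT),
      Diagram.putLin, Finsupp.lmapDomain_apply, Finsupp.mapDomain_single]
    exact clsLin_single _ _

end

/-! ### Locality of skein relations -/

section
variable {F : Type} [TopologicalSpace F] {S : Surf F} {o : Mode} {A : Type*} [CommRing A]
  {M' : KnotTheory o A}

variable (M') in
/-- Insertion at a vertex, as a map from the local skein module to the skein module of all the
diagrams in the surface. -/
def plugSk {m : ℕ} (W : Diagram S) (v : W.V) (hv : (W.label v).signs.length = m) :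
    Sk S M' m →ₗ[A] (Diagram S →₀ A) ⧸ relAll S M' :=
  Submodule.mapQ _ _ (plugLin A W v hv) fun _ hx => (mem_Null M').1 hx W v hv

theorem plugSk_cls {m : ℕ} (W : Diagram S) (v : W.V) (hv : (W.label v).signs.length = m)
    (T : Tg m) (hT : IsTangle (W.label v).signs T.1) :
    plugSk M' W v hv (cls S M' T) = (relAll S M').mkQ (Finsupp.single (W.plug v T.1 hT) 1) := by
  rw [plugSk, cls, Submodule.mkQ_apply, Submodule.mapQ_apply, plugLin_single W v hv T hT]
  rfl

theorem mkQ_single_eq {D D' : Diagram S}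
    (h : (Finsupp.single D 1 - Finsupp.single D' 1 : Diagram S →₀ A) ∈ relAll S M') :
    (relAll S M').mkQ (Finsupp.single D 1) = (relAll S M').mkQ (Finsupp.single D' 1) := by
  rwa [← sub_eq_zero, ← map_sub, Submodule.mkQ_apply, Submodule.Quotient.mk_eq_zero]

theorem mkQ_putLin (W : Diagram S) (v : W.V) {bd : List Bool} (hv : (W.label v).signs = bd)
    (x : Tangle o bd →₀ A) :
    (relAll S M').mkQ (W.putLin v hv x) =
      plugSk M' W v (congrArg _ hv) (clsLin S M' bd.length (toDiagrams x)) := by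
  induction x using Finsupp.induction_linear with
  | zero => simp
  | add f g hf hg => simp only [map_add, hf, hg]
  | single T a =>
    have hT : IsTangle (W.label v).signs T.1 := by subst hv; exact T.2.2.1
    rw [toDiagrams, Finsupp.lmapDomain_apply, Finsupp.mapDomain_single,
      clsLin_single (show HasPorts bd.length T.1 from T.2.2.1), map_smul, plugSk_cls (hT := hT),
      Diagram.putLin, Finsupp.lmapDomain_apply, Finsupp.mapDomain_single, ← map_smul,
      Finsupp.smul_single, smul_eq_mul, mul_one]
    rfl

theorem plugSk_plugIn {m n : ℕ} (W : Diagram S) (v : W.V) (hv : (W.label v).signs.length = n)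
    (H : Diagram diskSurf) (hH : HasPorts n H) (hHv : IsTangle (W.label v).signs H) (k : H.V)
    (hk : (H.label k).signs.length = m) (x : Sk S M' m) :
    plugSk M' (W.plug v H hHv) (W.plugIn v H hHv k) hk x =
      plugSk M' W v hv (plugOp M' H hH k hk x) := by
  rw [← LinearMap.comp_apply]
  congr 1
  refine Sk.hom_ext fun T => ?_
  have hT : IsTangle (H.label k).signs T.1 := by subst hk; exact T.2
  have hHT : IsTangle (W.label v).signs (H.plug k T.1 hT) := by
    subst hv
    exact hasPorts_plug.2 hH
  rw [LinearMap.comp_apply, plugOp_cls (hT := hT), plugSk_cls (hT := hHT)]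
  refine (plugSk_cls (W.plug v H hHv) (W.plugIn v H hHv k) hk T hT).trans ?_
  exact mkQ_single_eq (relabel_mem M' (W.plugPlug v H hHv k T.1 hT hHT))

open Classical in
/-- A diagram with a vertex turned to a box. -/
def Diagram.setBox (W : Diagram S) (v : W.V) (bd : List Bool)
    (h : (W.label v).signs.length = bd.length) : Diagram S :=
  have hl : ∀ w, (if w = v then Label.box bd else W.label w).signs.length =
      (W.label w).signs.length := by
    intro w
    split_ifs with hw
    · rw [hw, h]
      rfl
    · rfl
  { W with
    label := fun w => if w = v then .box bd else W.label w
    end_chart := by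
      intro p w z hz
      rw [hl]
      exact W.end_chart p w z hz
    end_port := by
      intro w i hi
      rw [hl] at hi ⊢
      exact W.end_port w i hi }

open Classical in
/-- Insertion at a vertex forgets the label of this vertex. -/
def Diagram.setBoxPlug (W : Diagram S) (v : W.V) (bd : List Bool)
    (h : (W.label v).signs.length = bd.length) (T : Diagram diskSurf)
    (hT : IsTangle (W.label v).signs T) (hT' : IsTangle ((W.setBox v bd h).label v).signs T) :
    Relabel (W.plug v T hT) ((W.setBox v bd h).plug v T hT') where
  eV x := x
  eE x := x
  surjV x := ⟨x, rfl⟩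
  surjE x := ⟨x, rfl⟩
  label := by
    rintro (⟨w, hw⟩ | x)
    · exact if_neg hw
    · rfl
  chart := by
    rintro (⟨w, hw⟩ | x) <;> rfl
  path := by
    rintro (e | x) <;> rfl

theorem setBox_signs (W : Diagram S) (v : W.V) (bd : List Bool)
    (h : (W.label v).signs.length = bd.length) : ((W.setBox v bd h).label v).signs = bd := by
  classical
  exact congrArg Label.signs (if_pos rfl)

/-- The directions of boundary points are immaterial for the vanishing of a combination of tangles:
any vertex with the right number of marked points can be turned to a box with given directions. -/
theorem cls_eq_zero_of_putLin {bd : List Bool} (x : Tangle o bd →₀ A)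
    (h : ∀ (W : Diagram S) (v : W.V) (hv : (W.label v).signs = bd),
      W.putLin v hv x ∈ relAll S M') : clsLin S M' bd.length (toDiagrams x) = 0 := by
  rw [clsLin_toDiagrams, Submodule.mkQ_apply, Submodule.Quotient.mk_eq_zero, mem_Null]
  intro W v hv
  have h1 := h (W.setBox v bd hv) v (setBox_signs W v bd hv)
  rw [← Submodule.Quotient.mk_eq_zero, ← Submodule.mkQ_apply] at h1 ⊢
  rw [← h1, ← LinearMap.comp_apply, ← LinearMap.comp_apply, ← LinearMap.comp_apply]
  congr 1
  refine Finsupp.lhom_ext' fun T => LinearMap.ext_ring ?_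
  have hT : IsTangle (W.label v).signs T.1 := by
    have := T.2.2.1
    unfold IsTangle at this ⊢
    rwa [hv]
  simp only [LinearMap.comp_apply, Finsupp.lsingle_apply, Finsupp.lmapDomain_apply,
    Finsupp.mapDomain_single, Diagram.putLin]
  rw [plugLin_single W v hv _ hT]
  exact mkQ_single_eq (relabel_mem M' (W.setBoxPlug v bd hv T.1 hT _))

/-- A local move is an equality in the local skein module. -/
theorem clsLin_move {μ : LocalMove o A} (hμ : μ ∈ M') :
    clsLin S M' μ.bd.length (toDiagrams (Finsupp.single μ.lhs 1)) =
      clsLin S M' μ.bd.length (toDiagrams μ.rhs) := by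
  rw [← sub_eq_zero, ← map_sub, ← map_sub]
  apply cls_eq_zero_of_putLin
  intro W v hv
  refine Submodule.subset_span (Or.inr ⟨μ, hμ, W, v, hv, trivial, fun _ _ => trivial, ?_⟩)
  rw [map_sub, Diagram.putLin, Finsupp.lmapDomain_apply, Finsupp.mapDomain_single]

end

section
variable {F : Type} [TopologicalSpace F] [T2Space F] [ChartedSpace (EuclideanHalfSpace 2) F]
  {ω : SurfaceOrientation F} {o : Mode} {A : Type*} [CommRing A] {M' : KnotTheory o A}

/-- Isotopic tangles become isotopic after insertion: the isotopy of the disk extends to the surface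
by the identity, since the image of the open disk is open in the surface. -/
theorem cls_eq_of_isotopy {m : ℕ} {T T' : Tg m} {r : T.1.V → T'.1.V → Prop}
    (h : Isotopy o T.1 T'.1 r) : cls ω.surf M' T = cls ω.surf M' T' := by
  obtain ⟨T, hT⟩ := T
  obtain ⟨T', hT'⟩ := T'
  dsimp only at h
  cases h with
  | ambient _ _ g eV hg h =>
    -- the edges of `W` are fixed by the extension, since they meet the disk in its boundary only
    refine cls_eq fun W v hv hTv hTv' => ?_
    obtain ⟨g', hg', hgχ, hgo⟩ := IsAmbient.extend (S := ω.surf) (W.chart_inj v)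
      (isOpen_image_disk_interior (W.chart_inj v)) (W.chart_inner v) hg
    have hfix : ∀ e s, g' (W.path e s) = W.path e s := by
      intro e s
      by_cases hz : ∃ z, W.path e s = W.chart v z
      · obtain ⟨z, hz⟩ := hz
        rw [hz, hgχ, hg.apply_bdry (W.path_eq_chart hz)]
      · exact hgo _ fun z hz' => hz ⟨z, hz'.symm⟩
    have him : ∀ e (B : Set I), g' '' (W.path e '' B) = W.path e '' B := by
      intro e B
      rw [Set.image_image]
      exact Set.image_congr fun s _ => hfix e s
    refine isotopy_mem M' (Isotopy.ambient _ _ g' _ hg' (MapsTo.fill (D := W) (D' := W)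
      hg'.bijective.1 (Equiv.refl _) (P := {v}) (P' := {v}) (fun _ => Iff.rfl) ?_ ?_ ?_
      (T := fun _ => T) (T' := fun _ => T') (fun _ => g) (fun _ => eV) (fun _ => h) ?_ _ _))
    · intro w hw
      refine Or.inl ⟨rfl, ?_⟩
      ext z
      exact (hgo _ fun z' hz' => hw (W.chart_disjoint _ _ _ _ hz').symm).symm
    · rw [Diagram.curve, Set.image_iUnion]
      exact Set.iUnion_congr fun e => by rw [← Set.image_univ, him]
    · intro _ e e' s t s' t' hs hs' _ hst
      rw [him] at hst
      obtain ⟨rfl, rfl, rfl⟩ := W.eq_of_image_subarc hs hs' hst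
      exact hfix _ _
    · rintro ⟨w, hw⟩
      cases hw
      ext z
      exact (hgχ z).symm
  | planar W₀ v₀ T₁ T₁' eV eE h hc P R hR hP hP' =>
    have h1 : HasPorts (W₀.label v₀).signs.length (T₁.fill P R hR) := hP
    have h2 : HasPorts (W₀.label v₀).signs.length (T₁'.fill (eV.symm ⁻¹' P)
      (fun x' => R (eV.symm x')) (h.isTangle_symm hR)) := hP'
    have h3 : HasPorts m W₀ := hasPorts_plug.1 hT
    rw [← plugOp_cls W₀ h3 v₀ rfl ⟨_, h1⟩, ← plugOp_cls W₀ h3 v₀ rfl ⟨_, h2⟩]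
    exact congrArg _ (cls_eq_of_sameShape h hc P R hR h1 h2)

/-- Equality in the skein module of tangles implies equality after insertion in any diagram. -/
theorem SkeinEq.clsLin_eq {bd : List Bool} {x y : Diagram diskSurf →₀ A}
    (h : SkeinEq M' (tangles o bd) x y) :
    clsLin ω.surf M' bd.length x = clsLin ω.surf M' bd.length y := by
  rw [← sub_eq_zero, ← map_sub, ← LinearMap.mem_ker]
  refine (Submodule.span_le (p := LinearMap.ker (clsLin ω.surf M' bd.length))).2 ?_ h
  rintro _ (⟨D, hD, D', hD', r, hr, rfl⟩ | ⟨μ, hμ, W, v, hv, hl, -, rfl⟩)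
  · rw [SetLike.mem_coe, LinearMap.mem_ker, map_sub, sub_eq_zero,
      clsLin_single (show HasPorts bd.length D from hD.2.1),
      clsLin_single (show HasPorts bd.length D' from hD'.2.1)]
    exact congrArg _ (cls_eq_of_isotopy (T := ⟨D, hD.2.1⟩) (T' := ⟨D', hD'.2.1⟩) hr)
  · have h1 : HasPorts bd.length W := hasPorts_plug.1 hl.2.1
    have h2 : Finsupp.single (W.put v hv μ.lhs) 1 =
        W.putLin v hv (Finsupp.single μ.lhs (1 : A)) := by
      rw [Diagram.putLin, Finsupp.lmapDomain_apply, Finsupp.mapDomain_single]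
    rw [SetLike.mem_coe, LinearMap.mem_ker, h2, ← map_sub, clsLin_putLin W h1, map_sub, map_sub,
      clsLin_move hμ, sub_self, map_zero]

theorem SkeinEq.clsLin_eq_of_empty {bd : List Bool} {x y : Diagram diskSurf →₀ A}
    (h : SkeinEq (∅ : KnotTheory o A) (tangles o bd) x y) :
    clsLin ω.surf M' bd.length x = clsLin ω.surf M' bd.length y := by
  refine SkeinEq.clsLin_eq (Submodule.span_mono ?_ h)
  exact Set.union_subset_union_right _ fun x ⟨μ, hμ, _⟩ => absurd hμ (Set.notMem_empty _)

end

section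
variable {F : Type} [TopologicalSpace F] {S : Surf F} {o : Mode} {A : Type*} [CommRing A]
  {M' : KnotTheory o A}

/-- A set closed under the moves being a union of classes of diagrams that are related by
isotopies and moves, relations between diagrams from this set follow from those that involve only
diagrams from this set. -/
theorem skeinEq_of_mem_relAll {𝒟 : Set (Diagram S)} (h : ClosedUnder M' 𝒟)
    {x y : Diagram S →₀ A} (hx : x ∈ Finsupp.supported A A 𝒟) (hy : y ∈ Finsupp.supported A A 𝒟)
    (hxy : x - y ∈ relAll S M') : SkeinEq M' 𝒟 x y := by
  classical
  -- the projection to the combinations of diagrams from `𝒟` keeps or kills each relation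
  let f : (Diagram S →₀ A) →ₗ[A] (Diagram S →₀ A) :=
    (Submodule.subtype _).comp (Finsupp.restrictDom A A 𝒟)
  have hf : ∀ z, f z = z.filter (· ∈ 𝒟) := fun z => rfl
  have h1 : f (x - y) = x - y := by
    rw [hf, Finsupp.filter_eq_self_iff]
    intro D hD
    have := (Submodule.sub_mem _ hx hy)
    rw [Finsupp.mem_supported] at this
    exact this (Finsupp.mem_support_iff.2 hD)
  rw [SkeinEq, ← h1]
  have h2 : relAll S M' ≤ (skeinRel M' 𝒟).comap f := by
    refine Submodule.span_le.2 ?_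
    rintro _ (⟨D, -, D', -, r, hr, rfl⟩ | ⟨μ, hμ, W, v, hv, -, -, rfl⟩)
    · rw [SetLike.mem_coe, Submodule.mem_comap, map_sub, hf, hf]
      by_cases hD : D ∈ 𝒟
      · have hD' := (h.1 D D' r hr).1 hD
        rw [Finsupp.filter_single_of_pos _ hD, Finsupp.filter_single_of_pos _ hD']
        exact Submodule.subset_span (Or.inl ⟨D, hD, D', hD', r, hr, rfl⟩)
      · have hD' : D' ∉ 𝒟 := fun h' => hD ((h.1 D D' r hr).2 h')
        rw [Finsupp.filter_single_of_neg _ hD, Finsupp.filter_single_of_neg _ hD', sub_self]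
        exact Submodule.zero_mem _
    · rw [SetLike.mem_coe, Submodule.mem_comap, map_sub, hf, hf]
      have h3 := h.2 μ hμ W v hv
      have h4 : ∀ D, W.putLin v hv μ.rhs D ≠ 0 → ∃ T ∈ μ.rhs.support, W.put v hv T = D := by
        intro D hD
        have := Finsupp.mapDomain_support (Finsupp.mem_support_iff.2 hD)
        rwa [Finset.mem_image] at this
      by_cases hD : W.put v hv μ.lhs ∈ 𝒟
      · rw [Finsupp.filter_single_of_pos _ hD, (Finsupp.filter_eq_self_iff _ _).2]
        · exact Submodule.subset_span
            (Or.inr ⟨μ, hμ, W, v, hv, hD, fun T hT => (h3 T hT).1 hD, rfl⟩)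
        · intro D hD'
          obtain ⟨T, hT, rfl⟩ := h4 D hD'
          exact (h3 T hT).1 hD
      · rw [Finsupp.filter_single_of_neg _ hD, (Finsupp.filter_eq_zero_iff _ _).2, sub_self]
        · exact Submodule.zero_mem _
        · intro D hD'
          by_contra h0
          obtain ⟨T, hT, rfl⟩ := h4 D h0
          exact hD ((h3 T hT).2 hD')
  exact h2 hxy

end

/-! ### Removal of auxiliary vertices -/

section
variable {F : Type} [TopologicalSpace F] {S : Surf F}

/-- Concatenation of parametrized paths. -/
def concat (p q : C(I, F)) (h : p 1 = q 0) : C(I, F) :=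
  ((⟨p, rfl, rfl⟩ : Path (p 0) (p 1)).trans (⟨q, h.symm, rfl⟩ : Path (p 1) (q 1))).toContinuousMap

theorem concat_cases (p q : C(I, F)) (h : p 1 = q 0) (t : I) :
    (∃ s : I, concat p q h t = p s ∧ (t : ℝ) = s / 2) ∨
      ∃ s : I, s ≠ 0 ∧ concat p q h t = q s ∧ (t : ℝ) = (1 + s) / 2 := by
  have h1 := Path.trans_apply (⟨p, rfl, rfl⟩ : Path (p 0) (p 1))
    (⟨q, h.symm, rfl⟩ : Path (p 1) (q 1)) t
  by_cases ht : (t : ℝ) ≤ 1 / 2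
  · rw [dif_pos ht] at h1
    exact Or.inl ⟨_, h1, by simp⟩
  · rw [dif_neg ht] at h1
    refine Or.inr ⟨_, ?_, h1, by simp⟩
    intro h0
    have := congrArg Subtype.val h0
    simp only [Set.Icc.coe_zero] at this
    linarith

theorem concat_zero (p q : C(I, F)) (h : p 1 = q 0) : concat p q h 0 = p 0 :=
  Path.source _

theorem concat_one (p q : C(I, F)) (h : p 1 = q 0) : concat p q h 1 = q 1 :=
  Path.target _

theorem concat_left (p q : C(I, F)) (h : p 1 = q 0) {t s : I} (hts : (t : ℝ) = s / 2) :
    concat p q h t = p s := by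
  have h1 := Path.trans_apply (⟨p, rfl, rfl⟩ : Path (p 0) (p 1))
    (⟨q, h.symm, rfl⟩ : Path (p 1) (q 1)) t
  have ht : (t : ℝ) ≤ 1 / 2 := by
    rw [hts]
    linarith [s.2.2]
  rw [dif_pos ht] at h1
  refine h1.trans (congrArg p (Subtype.ext ?_))
  simp only
  linarith

theorem concat_right (p q : C(I, F)) (h : p 1 = q 0) {t s : I} (hts : (t : ℝ) = (1 + s) / 2) :
    concat p q h t = q s := by
  rcases concat_cases p q h t with ⟨s', h1, h2⟩ | ⟨s', -, h1, h2⟩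
  · have h3 : s' = 1 := Subtype.ext (show (s' : ℝ) = 1 by linarith [s.2.1, s'.2.2])
    have h4 : s = 0 := Subtype.ext (show (s : ℝ) = 0 by linarith [s.2.1, s'.2.2])
    rw [h1, h3, h4, h]
  · have h3 : s' = s := Subtype.ext (by linarith)
    rw [h1, h3]

/-- A common endpoint of two edges is an endpoint of no other edge. -/
theorem Diagram.eq_of_pt_eq_joint (D : Diagram S) {e f : D.E} (h : D.path e 1 = D.path f 0)
    {q : D.E × Bool} (hq : D.pt q = D.path e 1) : q = (e, true) ∨ q = (f, false) := by
  have h0 : endpt D.path (e, true) = endpt D.path (f, false) := by simpa [endpt] using h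
  have he : endpt D.path (e, true) = D.path e 1 := by simp [endpt]
  have hb : endpt D.path (e, true) ∉ S.bdry := fun hb =>
    absurd (D.end_bdry _ _ hb h0) (by simp)
  have hc : ∀ v z, endpt D.path (e, true) ≠ D.chart v z := fun v z hz =>
    absurd (D.end_chart_unique hz (h0.symm.trans hz)) (by simp)
  obtain ⟨r, -, hr⟩ := D.end_joint _ hb hc
  by_cases hqe : q = (e, true)
  · exact Or.inl hqe
  · exact Or.inr ((hr q ⟨hqe, hq.trans he.symm⟩).trans (hr (f, false) ⟨by simp, h0.symm⟩).symm)

theorem Diagram.joint_notMem_bdry (D : Diagram S) {e f : D.E} (h : D.path e 1 = D.path f 0) :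
    D.path e 1 ∉ S.bdry := fun hb =>
  absurd (D.end_bdry (e, true) (f, false) (by simpa [endpt] using hb) (by simpa [endpt] using h))
    (by simp)

theorem Diagram.joint_ne_chart (D : Diagram S) {e f : D.E} (h : D.path e 1 = D.path f 0)
    (v : D.V) (z : Disk) : D.path e 1 ≠ D.chart v z := fun hz =>
  absurd (D.end_chart_unique (p := (e, true)) (q := (f, false)) (v := v) (z := z)
    (by simpa [endpt] using hz) (by simpa [endpt] using h.symm.trans hz)) (by simp)

theorem Diagram.eq_of_path_eq_joint (D : Diagram S) {e f : D.E} (h : D.path e 1 = D.path f 0)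
    {g : D.E} {a : I} (hg : D.path e 1 = D.path g a) : g = e ∧ a = 1 ∨ g = f ∧ a = 0 := by
  rcases D.end_cases g a with ha | ⟨b, hb⟩
  · have := (D.path_inj g a ha.1 ha.2 e 1 hg.symm).2
    exact absurd this ha.2
  · by_cases ha : a ≠ 0 ∧ a ≠ 1
    · exact absurd (D.path_inj g a ha.1 ha.2 e 1 hg.symm).2 ha.2
    · have ha' : a = 0 ∨ a = 1 := by
        by_contra h'
        push Not at h'
        exact ha h'
      rcases ha' with rfl | rfl
      · rcases D.eq_of_pt_eq_joint h (q := (g, false)) (by simpa [Diagram.pt, endpt] using hg.symm)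
          with h1 | h1 <;> simp at h1
        exact Or.inr ⟨h1, rfl⟩
      · rcases D.eq_of_pt_eq_joint h (q := (g, true)) (by simpa [Diagram.pt, endpt] using hg.symm)
          with h1 | h1 <;> simp at h1
        exact Or.inl ⟨h1, rfl⟩

open Classical in
/-- The edges after the union of the edges `e` and `f` with a common endpoint. -/
def Diagram.mergePath (D : Diagram S) (e f : D.E) (h : D.path e 1 = D.path f 0) (x : D.E) :
    C(I, F) :=
  if x = e then concat (D.path e) (D.path f) h else D.path x

/-- The point with the parameter `t` of an edge `x` of the new diagram is the point with the
parameter `s` of the edge `g` of the old one. -/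
def Diagram.MergePos (D : Diagram S) (e f x : D.E) (t : I) (g : D.E) (s : I) : Prop :=
  x ≠ e ∧ g = x ∧ s = t ∨ x = e ∧ g = e ∧ (t : ℝ) = s / 2 ∨
    x = e ∧ g = f ∧ s ≠ 0 ∧ (t : ℝ) = (1 + s) / 2

theorem Diagram.exists_mergePos (D : Diagram S) {e f : D.E} (h : D.path e 1 = D.path f 0)
    (x : D.E) (t : I) : ∃ g s, D.mergePath e f h x t = D.path g s ∧ D.MergePos e f x t g s := by
  by_cases hx : x = e
  · subst hx
    rw [mergePath, if_pos rfl]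
    rcases concat_cases _ _ h t with ⟨s, h1, h2⟩ | ⟨s, h0, h1, h2⟩
    · exact ⟨x, s, h1, Or.inr (Or.inl ⟨rfl, rfl, h2⟩)⟩
    · exact ⟨f, s, h1, Or.inr (Or.inr ⟨rfl, rfl, h0, h2⟩)⟩
  · rw [mergePath, if_neg hx]
    exact ⟨x, t, rfl, Or.inl ⟨hx, rfl, rfl⟩⟩

theorem Diagram.MergePos.unique {D : Diagram S} {e f x y : D.E} {t t' : I} {g : D.E} {s : I}
    (hx : x ≠ f) (hy : y ≠ f) (hef : e ≠ f) (h : D.MergePos e f x t g s)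
    (h' : D.MergePos e f y t' g s) : x = y ∧ t = t' := by
  rcases h with ⟨h1, rfl, rfl⟩ | ⟨rfl, rfl, h2⟩ | ⟨rfl, rfl, -, h2⟩ <;>
    rcases h' with ⟨h3, h4, h5⟩ | ⟨h3, h4, h5⟩ | ⟨h3, h4, -, h5⟩
  · exact ⟨h4, h5⟩
  · exact absurd h4 h1
  · exact absurd h4 hx
  · exact absurd h4.symm h3
  · exact ⟨h3.symm, Subtype.ext (by rw [h2, h5])⟩
  · exact absurd h4 hef
  · exact absurd h4.symm hy
  · exact absurd h4.symm hef
  · exact ⟨h3.symm, Subtype.ext (by rw [h2, h5])⟩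

theorem Diagram.MergePos.interior {D : Diagram S} {e f x : D.E} {t : I} {g : D.E} {s : I}
    (h : D.MergePos e f x t g s) (h0 : t ≠ 0) (h1 : t ≠ 1) :
    (s ≠ 0 ∧ s ≠ 1) ∨ (x = e ∧ g = e ∧ s = 1 ∧ (t : ℝ) = 1 / 2) := by
  rcases h with ⟨-, -, rfl⟩ | ⟨hx, rfl, h2⟩ | ⟨hx, rfl, h3, h2⟩
  · exact Or.inl ⟨h0, h1⟩
  · by_cases hs : s = 1
    · refine Or.inr ⟨hx, rfl, hs, ?_⟩
      rw [h2, hs]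
      simp
    · refine Or.inl ⟨fun hs0 => h0 (Subtype.ext ?_), hs⟩
      rw [h2, hs0]
      simp
  · refine Or.inl ⟨h3, fun hs1 => h1 (Subtype.ext ?_)⟩
    rw [h2, hs1]
    norm_num

open Classical in
/-- The end of an old edge that becomes the given end of a new edge. -/
def Diagram.mergeEnd (D : Diagram S) (e f : D.E) (p : D.E × Bool) : D.E × Bool :=
  if p = (e, true) then (f, true) else p

theorem Diagram.endpt_mergePath (D : Diagram S) {e f : D.E} (h : D.path e 1 = D.path f 0)
    (p : D.E × Bool) :
    endpt (D.mergePath e f h) p = endpt D.path (D.mergeEnd e f p) := by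
  obtain ⟨x, b⟩ := p
  by_cases hx : x = e
  · subst hx
    cases b
    · simp [endpt, mergePath, mergeEnd, concat_zero]
    · simp [endpt, mergePath, mergeEnd, concat_one]
  · simp [endpt, mergePath, mergeEnd, hx]

theorem Diagram.mergeEnd_injective (D : Diagram S) {e f : D.E} {p q : D.E × Bool} (hp : p.1 ≠ f)
    (hq : q.1 ≠ f) (h : D.mergeEnd e f p = D.mergeEnd e f q) : p = q := by
  unfold mergeEnd at h
  split_ifs at h with h1 h2 h2
  · rw [h1, h2]
  · exact absurd (by rw [← h]) hq
  · exact absurd (by rw [h]) hp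
  · exact h

theorem Diagram.exists_mergeEnd (D : Diagram S) {e f : D.E} (hef : e ≠ f)
    (h : D.path e 1 = D.path f 0) (p : D.E × Bool) (hp : endpt D.path p ≠ D.path e 1) :
    ∃ q, q.1 ≠ f ∧ D.mergeEnd e f q = p := by
  obtain ⟨x, b⟩ := p
  by_cases hx : x = f
  · subst hx
    cases b
    · exact absurd (by simp [endpt, h]) hp
    · exact ⟨(e, true), hef, by simp [mergeEnd]⟩
  · refine ⟨(x, b), hx, ?_⟩
    rw [mergeEnd, if_neg]
    rintro h1
    simp only [Prod.mk.injEq] at h1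
    obtain ⟨rfl, rfl⟩ := h1
    exact hp (by simp [endpt])

theorem Diagram.endpt_mergePath_ne (D : Diagram S) {e f : D.E} (hef : e ≠ f)
    (h : D.path e 1 = D.path f 0) {p : D.E × Bool} (hp : p.1 ≠ f) :
    endpt (D.mergePath e f h) p ≠ D.path e 1 := by
  rw [D.endpt_mergePath h]
  intro h1
  rcases D.eq_of_pt_eq_joint h h1 with h2 | h2
  · unfold mergeEnd at h2
    split_ifs at h2 with h3
    · exact hef (congrArg Prod.fst h2).symm
    · exact h3 h2
  · unfold mergeEnd at h2
    split_ifs at h2 with h3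
    · simp at h2
    · exact hp (congrArg Prod.fst h2)

/-- The union of two edges with a common endpoint; this endpoint is an auxiliary vertex. -/
def Diagram.merge (D : Diagram S) (e f : D.E) (hef : e ≠ f) (h : D.path e 1 = D.path f 0) :
    Diagram S where
  V := D.V
  E := {x : D.E // x ≠ f}
  finV := D.finV
  finE := inferInstance
  label := D.label
  chart := D.chart
  path x := D.mergePath e f h x
  chart_inj := D.chart_inj
  chart_pos := D.chart_pos
  chart_inner := D.chart_inner
  chart_disjoint := D.chart_disjoint
  path_inner := by
    rintro ⟨x, hx⟩ t h0 h1
    obtain ⟨g, s, hg, hp⟩ := D.exists_mergePos h x t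
    rw [hg]
    rcases hp.interior h0 h1 with hs | ⟨-, rfl, rfl, -⟩
    · exact D.path_inner g s hs.1 hs.2
    · exact D.joint_notMem_bdry h
  path_chart := by
    rintro ⟨x, hx⟩ t h0 h1 v z
    obtain ⟨g, s, hg, hp⟩ := D.exists_mergePos h x t
    rw [hg]
    rcases hp.interior h0 h1 with hs | ⟨-, rfl, rfl, -⟩
    · exact D.path_chart g s hs.1 hs.2 v z
    · exact D.joint_ne_chart h v z
  path_inj := by
    rintro ⟨x, hx⟩ t h0 h1 ⟨y, hy⟩ s' hxy
    obtain ⟨g, s, hg, hp⟩ := D.exists_mergePos h x t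
    obtain ⟨g', a, hg', hp'⟩ := D.exists_mergePos h y s'
    have hgg : D.path g s = D.path g' a := hg.symm.trans (hxy.trans hg')
    have key : x = y ∧ t = s' := by
      rcases hp.interior h0 h1 with hs | ⟨rfl, rfl, rfl, ht⟩
      · obtain ⟨rfl, rfl⟩ := D.path_inj g s hs.1 hs.2 g' a hgg
        exact hp.unique hx hy hef hp'
      · rcases D.eq_of_path_eq_joint h hgg with ⟨rfl, rfl⟩ | ⟨rfl, rfl⟩
        · exact hp.unique hx hy hef hp'
        · rcases hp' with ⟨-, h3, -⟩ | ⟨-, h3, -⟩ | ⟨-, -, h3, -⟩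
          · exact absurd h3.symm hy
          · exact absurd h3.symm hef
          · exact absurd rfl h3
    exact ⟨Subtype.ext key.1, key.2⟩
  end_bdry := by
    rintro ⟨⟨x, hx⟩, b⟩ ⟨⟨y, hy⟩, c⟩ hb hxy
    have h1 := D.endpt_mergePath h (x, b)
    have h2 := D.endpt_mergePath h (y, c)
    have h3 := D.end_bdry _ _ (h1 ▸ hb) (h1.symm.trans (Eq.trans hxy h2))
    have h4 := D.mergeEnd_injective hx hy h3
    simp only [Prod.mk.injEq] at h4
    obtain ⟨rfl, rfl⟩ := h4
    rfl
  end_chart := by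
    rintro ⟨⟨x, hx⟩, b⟩ v z hv
    exact D.end_chart _ v z ((D.endpt_mergePath h (x, b)).symm.trans hv)
  end_port := by
    intro v i hi
    obtain ⟨p, hp, hu⟩ := D.end_port v i hi
    obtain ⟨⟨x, b⟩, hx, rfl⟩ := D.exists_mergeEnd hef h p (fun h' =>
      D.joint_ne_chart h v _ (h'.symm.trans hp))
    refine ⟨(⟨x, hx⟩, b), (D.endpt_mergePath h (x, b)).trans hp, ?_⟩
    rintro ⟨⟨y, hy⟩, c⟩ hc
    have h4 := D.mergeEnd_injective hy hx (hu _ ((D.endpt_mergePath h (y, c)).symm.trans hc))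
    simp only [Prod.mk.injEq] at h4
    obtain ⟨rfl, rfl⟩ := h4
    rfl
  end_joint := by
    rintro ⟨⟨x, hx⟩, b⟩ hb hv
    have h1 := D.endpt_mergePath h (x, b)
    have hb' : endpt D.path (D.mergeEnd e f (x, b)) ∉ S.bdry := by
      rw [← h1]
      exact hb
    obtain ⟨q, ⟨hq, hqp⟩, hu⟩ := D.end_joint _ hb' (fun v z => by
      rw [← h1]
      exact hv v z)
    obtain ⟨⟨y, c⟩, hy, rfl⟩ := D.exists_mergeEnd hef h q (by
      rw [hqp, ← h1]
      exact D.endpt_mergePath_ne hef h hx)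
    refine ⟨(⟨y, hy⟩, c), ⟨?_, (D.endpt_mergePath h (y, c)).trans (hqp.trans h1.symm)⟩, ?_⟩
    · intro h5
      simp only [Prod.mk.injEq, Subtype.mk.injEq] at h5
      obtain ⟨rfl, rfl⟩ := h5
      exact hq rfl
    · rintro ⟨⟨y', hy'⟩, c'⟩ ⟨hne, hpt⟩
      have h6 := hu (D.mergeEnd e f (y', c')) ⟨?_, ?_⟩
      · have h4 := D.mergeEnd_injective hy' hy h6
        simp only [Prod.mk.injEq] at h4
        obtain ⟨rfl, rfl⟩ := h4
        rfl
      · intro h7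
        have h4 := D.mergeEnd_injective hy' hx h7
        simp only [Prod.mk.injEq] at h4
        obtain ⟨rfl, rfl⟩ := h4
        exact hne rfl
      · exact (D.endpt_mergePath h (y', c')).symm.trans (Eq.trans hpt h1)

theorem Diagram.mergePath_zero (D : Diagram S) {e f : D.E} (h : D.path e 1 = D.path f 0) (x : D.E) :
    D.mergePath e f h x 0 = D.path x 0 := by
  unfold mergePath
  split_ifs with hx
  · rw [concat_zero, hx]
  · rfl

theorem Diagram.mergePath_of_ne (D : Diagram S) {e f : D.E} (h : D.path e 1 = D.path f 0)
    {x : D.E} (hx : x ≠ e) : D.mergePath e f h x = D.path x :=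
  if_neg hx

theorem Diagram.mergePath_self (D : Diagram S) {e f : D.E} (h : D.path e 1 = D.path f 0) :
    D.mergePath e f h e = concat (D.path e) (D.path f) h :=
  if_pos rfl

theorem Diagram.merge_curve (D : Diagram S) {e f : D.E} (hef : e ≠ f)
    (h : D.path e 1 = D.path f 0) : (D.merge e f hef h).curve = D.curve := by
  refine Set.Subset.antisymm (Set.iUnion_subset ?_) (Set.iUnion_subset fun g => ?_)
  · rintro ⟨x, hx⟩ _ ⟨t, rfl⟩
    obtain ⟨g, s, hg, -⟩ := D.exists_mergePos h x t
    exact Set.mem_iUnion.2 ⟨g, s, hg.symm⟩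
  · rintro _ ⟨s, rfl⟩
    rw [Diagram.curve, Set.mem_iUnion]
    by_cases hg : g = f
    · subst hg
      refine ⟨⟨e, hef⟩, ⟨(1 + s) / 2, by linarith [s.2.1], by linarith [s.2.2]⟩, ?_⟩
      change D.mergePath e g h e _ = _
      rw [mergePath_self]
      exact concat_right _ _ _ rfl
    · by_cases hge : g = e
      · subst hge
        refine ⟨⟨g, hg⟩, ⟨s / 2, by linarith [s.2.1], by linarith [s.2.2]⟩, ?_⟩
        change D.mergePath g f h g _ = _
        rw [mergePath_self]
        exact concat_left _ _ _ rfl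
      · refine ⟨⟨g, hg⟩, s, ?_⟩
        change D.mergePath e f h g s = _
        rw [mergePath_of_ne _ h hge]

/-- An arc of an edge of a diagram that coincides with an arc of a united edge has the same
direction. The arc lies in the first or in the second of the united edges, and cannot contain their
common point. -/
theorem Diagram.merge_direction (D : Diagram S) {e f : D.E} (hef : e ≠ f)
    (h : D.path e 1 = D.path f 0) {g x : D.E} (hx : x ≠ f) {s t s' t' : I} (hs : s < t)
    (hs' : s' < t')
    (him : D.path g '' Set.Icc s t = D.mergePath e f h x '' Set.Icc s' t') :
    D.path g s = D.mergePath e f h x s' := by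
  by_cases hxe : x = e
  swap
  · rw [mergePath_of_ne _ h hxe] at him ⊢
    obtain ⟨rfl, rfl, rfl⟩ := D.eq_of_image_subarc hs hs' him
    rfl
  subst hxe
  rw [mergePath_self] at him ⊢
  have hlt : (s' : ℝ) < t' := hs'
  rcases le_or_gt (t' : ℝ) (1 / 2) with ht | ht
  · have him' : D.path g '' Set.Icc s t = D.path x '' Set.Icc
        ⟨2 * s', by linarith [s'.2.1], by linarith⟩
        ⟨2 * t', by linarith [t'.2.1], by linarith⟩ := by
      rw [him]
      ext y
      constructor
      · rintro ⟨a, ⟨ha, ha'⟩, rfl⟩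
        have ha1 : (s' : ℝ) ≤ a := ha
        have ha2 : (a : ℝ) ≤ t' := ha'
        refine ⟨⟨2 * a, by linarith [a.2.1], by linarith⟩, ⟨?_, ?_⟩, ?_⟩
        · exact Subtype.mk_le_mk.2 (by linarith)
        · exact Subtype.mk_le_mk.2 (by linarith)
        · exact (concat_left _ _ _ (by simp)).symm
      · rintro ⟨a, ⟨ha, ha'⟩, rfl⟩
        have ha1 : 2 * (s' : ℝ) ≤ a := ha
        have ha2 : (a : ℝ) ≤ 2 * t' := ha'
        refine ⟨⟨a / 2, by linarith [a.2.1], by linarith [a.2.2]⟩, ⟨?_, ?_⟩, ?_⟩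
        · exact Subtype.mk_le_mk.2 (by linarith)
        · exact Subtype.mk_le_mk.2 (by linarith)
        · exact concat_left _ _ _ rfl
    obtain ⟨rfl, rfl, -⟩ := D.eq_of_image_subarc hs (Subtype.mk_lt_mk.2 (by linarith)) him'
    exact (concat_left _ _ _ (by simp)).symm
  · rcases le_or_gt (1 / 2 : ℝ) s' with hs1 | hs1
    · have him' : D.path g '' Set.Icc s t = D.path f '' Set.Icc
          ⟨2 * s' - 1, by linarith, by linarith [s'.2.2]⟩
          ⟨2 * t' - 1, by linarith, by linarith [t'.2.2]⟩ := by
        rw [him]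
        ext y
        constructor
        · rintro ⟨a, ⟨ha, ha'⟩, rfl⟩
          have ha1 : (s' : ℝ) ≤ a := ha
          have ha2 : (a : ℝ) ≤ t' := ha'
          refine ⟨⟨2 * a - 1, by linarith, by linarith [a.2.2]⟩, ⟨?_, ?_⟩, ?_⟩
          · exact Subtype.mk_le_mk.2 (by linarith)
          · exact Subtype.mk_le_mk.2 (by linarith)
          · exact (concat_right _ _ _ (by simp)).symm
        · rintro ⟨a, ⟨ha, ha'⟩, rfl⟩
          have ha1 : 2 * (s' : ℝ) - 1 ≤ a := ha
          have ha2 : (a : ℝ) ≤ 2 * t' - 1 := ha'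
          refine ⟨⟨(1 + a) / 2, by linarith [a.2.1], by linarith [a.2.2]⟩, ⟨?_, ?_⟩, ?_⟩
          · exact Subtype.mk_le_mk.2 (by linarith)
          · exact Subtype.mk_le_mk.2 (by linarith)
          · exact concat_right _ _ _ rfl
      obtain ⟨rfl, rfl, -⟩ := D.eq_of_image_subarc hs (Subtype.mk_lt_mk.2 (by linarith)) him'
      exact (concat_right _ _ _ (by simp)).symm
    · -- A subarc that passes through the removed vertex contains subarcs of both edges.
      have h1 : D.path x '' Set.Icc ⟨2 * s', by linarith [s'.2.1], by linarith⟩ 1 ⊆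
          D.path g '' Set.Icc s t := by
        rw [him]
        rintro _ ⟨a, ⟨ha, ha'⟩, rfl⟩
        have ha1 : 2 * (s' : ℝ) ≤ a := ha
        refine ⟨⟨a / 2, by linarith [a.2.1], by linarith [a.2.2]⟩, ⟨?_, ?_⟩, concat_left _ _ _ rfl⟩
        · exact Subtype.mk_le_mk.2 (by linarith)
        · exact Subtype.mk_le_mk.2 (by linarith [a.2.2])
      have h2 : D.path f '' Set.Icc 0 ⟨2 * t' - 1, by linarith, by linarith [t'.2.2]⟩ ⊆
          D.path g '' Set.Icc s t := by
        rw [him]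
        rintro _ ⟨a, ⟨ha, ha'⟩, rfl⟩
        have ha1 : (a : ℝ) ≤ 2 * t' - 1 := ha'
        refine ⟨⟨(1 + a) / 2, by linarith [a.2.1], by linarith [a.2.2]⟩, ⟨?_, ?_⟩,
          concat_right _ _ _ rfl⟩
        · exact Subtype.mk_le_mk.2 (by linarith [a.2.1])
        · exact Subtype.mk_le_mk.2 (by linarith)
      have h3 := (D.subset_of_image_subarc
        (Subtype.mk_lt_mk.2 (show 2 * (s' : ℝ) < 1 by linarith)) h1).1
      have h4 := (D.subset_of_image_subarc
        (Subtype.mk_lt_mk.2 (show (0 : ℝ) < 2 * t' - 1 by linarith)) h2).1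
      exact absurd (h3.trans h4.symm) hef

end

section
variable {F : Type} [TopologicalSpace F] (S : Surf F) {o : Mode} {A : Type*} [CommRing A]
  (M' : KnotTheory o A)

/-- Two diagrams in the disk with the same vertices give equal classes after any insertions of
tangles in vertices. -/
def SkSame {T T' : Diagram diskSurf} (eV : T.V ≃ T'.V) : Prop :=
  ∀ (P : Set T.V) (R : T.V → Diagram diskSurf) (hR : ∀ v ∈ P, IsTangle (T.label v).signs (R v))
    (P' : Set T'.V) (R' : T'.V → Diagram diskSurf)
    (hR' : ∀ v ∈ P', IsTangle (T'.label v).signs (R' v)), (∀ v, v ∈ P ↔ eV v ∈ P') →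
    (∀ v ∈ P, R' (eV v) = R v) → ∀ (m : ℕ) (hm : HasPorts m (T.fill P R hR))
      (hm' : HasPorts m (T'.fill P' R' hR')), cls S M' ⟨_, hm⟩ = cls S M' ⟨_, hm'⟩

variable {S M'}

/-- The union of two edges does not change the set of points of a diagram and the directions of
arcs. -/
theorem skSame_merge (T : Diagram diskSurf) {e f : T.E} (hef : e ≠ f)
    (h : T.path e 1 = T.path f 0) :
    SkSame S M' (T := T) (T' := T.merge e f hef h) (Equiv.refl T.V) := by
  intro P R hR P' R' hR' hP hRR m hm hm'
  obtain rfl : P = P' := Set.ext hP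
  refine cls_eq_of_mapsTo (MapsTo.fill (D := T) (D' := T.merge e f hef h)
    (g := ContinuousMap.id Disk) Function.injective_id (Equiv.refl T.V) (P := P) (P' := P) hP
    (fun v _ => Or.inl ⟨rfl, rfl⟩) ?_ ?_ (fun _ => ContinuousMap.id Disk)
    (fun v => (Relabel.ofEq (hRR v.1 v.2).symm).equiv)
    (fun v => (Relabel.ofEq (hRR v.1 v.2).symm).mapsTo o) (fun _ => rfl) hR hR')
  · rw [ContinuousMap.coe_id, Set.image_id, T.merge_curve]
  · rintro - g ⟨x, hx⟩ s t s' t' hs hs' - him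
    rw [ContinuousMap.coe_id, Set.image_id] at him
    exact T.merge_direction hef h hx hs hs' him

theorem SkSame.trans {T T' T'' : Diagram diskSurf} {eV : T.V ≃ T'.V} {eV' : T'.V ≃ T''.V}
    (h : SkSame S M' eV) (h' : SkSame S M' eV') (hl : ∀ v, T'.label (eV v) = T.label v)
    (hp : ∀ m, HasPorts m T → HasPorts m T') :
    SkSame S M' (eV.trans eV') := by
  intro P R hR P'' R'' hR'' hP hRR m hm hm''
  have hR' : ∀ v ∈ eV.symm ⁻¹' P, IsTangle (T'.label v).signs (R (eV.symm v)) := by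
    intro v hv
    have := hl (eV.symm v)
    rw [Equiv.apply_symm_apply] at this
    rw [this]
    exact hR _ hv
  have hm' : HasPorts m (T'.fill (eV.symm ⁻¹' P) (fun v => R (eV.symm v)) hR') :=
    hasPorts_fill.2 (hp m (hasPorts_fill.1 hm))
  refine (h P R hR _ _ hR' ?_ ?_ m hm hm').trans (h' _ _ hR' P'' R'' hR'' ?_ ?_ m hm' hm'')
  · intro v
    rw [Set.mem_preimage, Equiv.symm_apply_apply]
  · intro v _
    rw [Equiv.symm_apply_apply]
  · intro v
    rw [Set.mem_preimage, hP, Equiv.trans_apply, Equiv.apply_symm_apply]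
  · intro v hv
    rw [← hRR _ hv, Equiv.trans_apply, Equiv.apply_symm_apply]

/-- Insertion of the same tangles. -/
def Diagram.fillCongr {F : Type} [TopologicalSpace F] {S : Surf F} (T : Diagram S) {P : Set T.V}
    {R R' : T.V → Diagram diskSurf}
    (hR : ∀ v ∈ P, IsTangle (T.label v).signs (R v))
    (hR' : ∀ v ∈ P, IsTangle (T.label v).signs (R' v)) (h : ∀ v ∈ P, R' v = R v) :
    Relabel (T.fill P R hR) (T.fill P R' hR') where
  eV
    | .inl v => .inl v
    | .inr x => .inr ⟨x.1, (Relabel.ofEq (h x.1 x.1.2).symm).eV x.2⟩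
  eE
    | .inl e => .inl e
    | .inr x => .inr ⟨x.1, (Relabel.ofEq (h x.1 x.1.2).symm).eE x.2⟩
  surjV := by
    rintro (v | ⟨v, x⟩)
    · exact ⟨.inl v, rfl⟩
    · obtain ⟨y, rfl⟩ := (Relabel.ofEq (h v v.2).symm).surjV x
      exact ⟨.inr ⟨v, y⟩, rfl⟩
  surjE := by
    rintro (v | ⟨v, x⟩)
    · exact ⟨.inl v, rfl⟩
    · obtain ⟨y, rfl⟩ := (Relabel.ofEq (h v v.2).symm).surjE x
      exact ⟨.inr ⟨v, y⟩, rfl⟩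
  label := by
    rintro (v | ⟨v, x⟩)
    · rfl
    · exact (Relabel.ofEq (h v v.2).symm).label x
  chart := by
    rintro (v | ⟨v, x⟩)
    · rfl
    · exact congrArg (T.chart v).comp ((Relabel.ofEq (h v v.2).symm).chart x)
  path := by
    rintro (v | ⟨v, x⟩)
    · rfl
    · exact congrArg (T.chart v).comp ((Relabel.ofEq (h v v.2).symm).path x)

/-- At most one end of an edge lies at a marked point. -/
theorem Diagram.end_eq_of_place (T : Diagram diskSurf) {n m : ℕ} (v : Fin n ≃ T.V) (x : Place n)
    {p q : T.E × Bool} (hp : T.pt p = x.point m T v) (hq : T.pt q = x.point m T v) : p = q := by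
  cases x with
  | bd i =>
    refine T.end_bdry p q ?_ (hp.trans hq.symm)
    change ‖((T.pt p : Disk) : ℂ)‖ = 1
    rw [hp]
    exact norm_port m i
  | vx k i => exact T.end_chart_unique hp hq

/-- If the edges of a diagram form chains that correspond to the edges of a wiring, then the
removal of the auxiliary vertices gives a picture of this wiring. The function `wd` assigns to an
edge its chain, and `pos` is increasing along chains (so that no chain is closed). -/
theorem exists_contraction {w : Wiring} (T : Diagram diskSurf) (hT : IsTangle w.bd T)
    (v : Fin w.n ≃ T.V) (hl : ∀ k, T.label (v k) = w.vertex k) (wd : T.E → Fin w.edges.length)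
    (pos : T.E → ℕ)
    (hA : ∀ e, T.path e 1 = (w.edges.get (wd e)).2.point w.bd.length T v ∨
      ∃ f, wd f = wd e ∧ pos e < pos f ∧ T.path e 1 = T.path f 0)
    (hB : ∀ e, T.path e 0 = (w.edges.get (wd e)).1.point w.bd.length T v ∨
      ∃ f, wd f = wd e ∧ T.path f 1 = T.path e 0)
    (hC : ∀ j, ∃ e, wd e = j ∧ T.path e 0 = (w.edges.get j).1.point w.bd.length T v) :
    ∃ Q : Picture w, SkSame S M' (v.symm.trans Q.v) := by
  have pt0 : ∀ (T : Diagram diskSurf) (e : T.E), T.pt (e, false) = T.path e 0 := fun T e => by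
    simp [Diagram.pt, endpt]
  have pt1 : ∀ (T : Diagram diskSurf) (e : T.E), T.pt (e, true) = T.path e 1 := fun T e => by
    simp [Diagram.pt, endpt]
  -- two consecutive edges of a chain are united, until every chain consists of a single edge
  induction hn : Nat.card T.E using Nat.strong_induction_on generalizing T with
  | _ n ih =>
  by_cases hex : ∃ e f, wd f = wd e ∧ pos e < pos f ∧ T.path e 1 = T.path f 0
  · obtain ⟨e, f, hwd, hpos, h⟩ := hex
    have hef : e ≠ f := by
      rintro rfl
      exact lt_irrefl _ hpos
    have hj : ∀ x b, T.pt (x, b) = T.path e 1 → x ≠ e ∨ b = false → x = f ∧ b = false := by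
      intro x b hx hxe
      rcases T.eq_of_pt_eq_joint h hx with h1 | h1 <;> simp only [Prod.mk.injEq] at h1
      · rcases hxe with hxe | hxe
        · exact absurd h1.1 hxe
        · simp [hxe] at h1
      · exact h1
    have hpl : ∀ x : Place w.n, T.path e 1 ≠ x.point w.bd.length T v := by
      intro x hx
      exact absurd (T.end_eq_of_place v x ((pt1 T e).trans hx) ((pt0 T f).trans (h.symm.trans hx)))
        (by simp)
    have h1 : ∀ x : T.E, x ≠ e → T.mergePath e f h x 1 = T.path x 1 := fun x hx => by
      rw [T.mergePath_of_ne h hx]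
    have h1e : T.mergePath e f h e 1 = T.path f 1 := by
      rw [T.mergePath_self, concat_one]
    have hm : ∀ m, HasPorts m T → HasPorts m (T.merge e f hef h) := by
      intro m hm
      refine hm.of_pt fun z hz => ?_
      constructor
      · rintro ⟨⟨⟨x, hx⟩, b⟩, hxz⟩
        exact ⟨_, (T.endpt_mergePath h (x, b)).symm.trans hxz⟩
      · rintro ⟨p, rfl⟩
        obtain ⟨⟨x, b⟩, hx, rfl⟩ := T.exists_mergeEnd hef h p (fun h' => by
          have := T.joint_notMem_bdry h
          rw [← h'] at this
          exact this hz)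
        exact ⟨(⟨x, hx⟩, b), T.endpt_mergePath h (x, b)⟩
    have hcard : Nat.card (T.merge e f hef h).E < n := by
      rw [← hn]
      exact Finite.card_subtype_lt (p := fun x => x ≠ f) (x := f) (by simp)
    obtain ⟨Q, hQ⟩ : ∃ Q : Picture w,
        SkSame S M' (T := T.merge e f hef h) (T' := Q.T) (v.symm.trans Q.v) := by
      refine ih _ hcard (T.merge e f hef h) (hm _ hT) v hl (fun x => wd x.1)
        (fun x => pos x.1) ?_ ?_ ?_ rfl
      · rintro ⟨x, hx⟩
        change T.mergePath e f h x 1 = _ ∨ ∃ g : {g // g ≠ f}, wd g = wd x ∧ pos x < pos g ∧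
          T.mergePath e f h x 1 = T.mergePath e f h g 0
        by_cases hxe : x = e
        · subst hxe
          rw [h1e]
          rcases hA f with hf | ⟨g, hg1, hg2, hg3⟩
          · rw [hwd] at hf
            exact Or.inl hf
          · refine Or.inr ⟨⟨g, ?_⟩, hg1.trans hwd, hpos.trans hg2, ?_⟩
            · rintro rfl
              exact lt_irrefl _ hg2
            · exact hg3.trans (T.mergePath_zero h g).symm
        · rw [h1 x hxe]
          rcases hA x with hf | ⟨g, hg1, hg2, hg3⟩
          · exact Or.inl hf
          · refine Or.inr ⟨⟨g, ?_⟩, hg1, hg2, ?_⟩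
            · rintro rfl
              exact absurd (hj x true ((pt1 T x).trans (hg3.trans h.symm)) (Or.inl hxe)).2 (by simp)
            · exact hg3.trans (T.mergePath_zero h g).symm
      · rintro ⟨x, hx⟩
        change T.mergePath e f h x 0 = _ ∨ ∃ g : {g // g ≠ f}, wd g = wd x ∧
          T.mergePath e f h g 1 = T.mergePath e f h x 0
        rw [T.mergePath_zero]
        rcases hB x with hf | ⟨g, hg1, hg2⟩
        · exact Or.inl hf
        · refine Or.inr ?_
          by_cases hge : g = e
          · subst hge
            exact absurd (hj x false ((pt0 T x).trans hg2.symm) (Or.inr rfl)).1 hx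
          · by_cases hgf : g = f
            · subst hgf
              exact ⟨⟨e, hef⟩, hwd.symm.trans hg1, h1e.trans hg2⟩
            · exact ⟨⟨g, hgf⟩, hg1, (h1 g hge).trans hg2⟩
      · intro j
        obtain ⟨x, hx1, hx2⟩ := hC j
        refine ⟨⟨x, ?_⟩, hx1, (T.mergePath_zero h x).trans hx2⟩
        rintro rfl
        exact hpl _ (h.trans hx2)
    exact ⟨Q, (skSame_merge T hef h).trans hQ (fun _ => rfl) hm⟩
  · have hA' : ∀ e, T.path e 1 = (w.edges.get (wd e)).2.point w.bd.length T v := fun e =>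
      (hA e).resolve_right fun ⟨f, hf⟩ => hex ⟨e, f, hf⟩
    have hB' : ∀ e, T.path e 0 = (w.edges.get (wd e)).1.point w.bd.length T v := by
      refine fun e => (hB e).resolve_right ?_
      rintro ⟨f, -, hf⟩
      exact absurd (T.end_eq_of_place v _ ((pt1 T f).trans (hA' f))
        ((pt0 T e).trans (hf.symm.trans (hA' f)))) (by simp)
    have hbij : Function.Bijective wd := by
      refine ⟨fun e f hef => ?_, fun j => ⟨(hC j).choose, (hC j).choose_spec.1⟩⟩
      have h2 := hB' f
      rw [← hef] at h2
      exact congrArg Prod.fst (T.end_eq_of_place v _ ((pt0 T e).trans (hB' e)) ((pt0 T f).trans h2))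
    refine ⟨⟨T, hT, v, (Equiv.ofBijective wd hbij).symm, hl, fun j => ?_, fun j => ?_⟩, ?_⟩
    · rw [hB']
      congr 3
      exact (Equiv.ofBijective wd hbij).apply_symm_apply j
    · rw [hA']
      congr 3
      exact (Equiv.ofBijective wd hbij).apply_symm_apply j
    · intro P R hR P' R' hR' hP hRR m hm hm'
      obtain rfl : P = P' := Set.ext fun x => by
        have := hP x
        rwa [Equiv.trans_apply, Equiv.apply_symm_apply] at this
      refine cls_eq_of_relabel (T.fillCongr hR hR' fun y hy => ?_)
      have := hRR y hy
      rwa [Equiv.trans_apply, Equiv.apply_symm_apply] at this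

end

/-! ### Pictures up to isotopy -/

deriving instance DecidableEq for Label

section
variable {w : Wiring}

theorem Picture.isTangle_fill (Q : Picture w) {X : Set (Fin w.n)} {R : Fin w.n → Diagram diskSurf}
    (hR : ∀ k ∈ X, HasPorts (w.vertex k).signs.length (R k)) :
    ∀ x ∈ Q.v.symm ⁻¹' X, IsTangle (Q.T.label x).signs (R (Q.v.symm x)) := by
  intro x hx
  have h := hR _ hx
  rwa [← Q.label_eq, Equiv.apply_symm_apply] at h

/-- The diagram obtained from a picture by insertion of tangles in the vertices from `X`. -/
def Picture.fillTg (Q : Picture w) (X : Set (Fin w.n)) (R : Fin w.n → Diagram diskSurf)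
    (hR : ∀ k ∈ X, HasPorts (w.vertex k).signs.length (R k)) : Tg w.bd.length :=
  ⟨Q.T.fill (Q.v.symm ⁻¹' X) (fun x => R (Q.v.symm x)) (Q.isTangle_fill hR),
    hasPorts_fill.2 Q.isTangle⟩

/-- The place where the edge `j` begins (`false`) or ends (`true`). -/
def Wiring.place (w : Wiring) (j : Fin w.edges.length) (b : Bool) : Place w.n :=
  if b then (w.edges.get j).2 else (w.edges.get j).1

theorem Picture.pt_eq (Q : Picture w) (j : Fin w.edges.length) (b : Bool) :
    Q.T.pt (Q.e j, b) = (w.place j b).point w.bd.length Q.T Q.v := by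
  cases b
  · simpa [Diagram.pt, endpt, Wiring.place] using Q.tail j
  · simpa [Diagram.pt, endpt, Wiring.place] using Q.head j

theorem Picture.point_eq_iff (Q Q' : Picture w) (x y : Place w.n) :
    x.point w.bd.length Q.T Q.v = y.point w.bd.length Q.T Q.v ↔
      x.point w.bd.length Q'.T Q'.v = y.point w.bd.length Q'.T Q'.v := by
  have h : ∀ (Q Q' : Picture w) (x y : Place w.n),
      x.point w.bd.length Q.T Q.v = y.point w.bd.length Q.T Q.v →
        x.point w.bd.length Q'.T Q'.v = y.point w.bd.length Q'.T Q'.v := by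
    intro Q Q' x y h
    have hbd : ∀ (Q : Picture w) i v z, port w.bd.length i ≠ Q.T.chart v z := fun Q i v z h =>
      Q.T.chart_inner v z (h ▸ norm_port _ i)
    cases x with
    | bd i =>
      cases y with
      | bd j => exact h
      | vx k j => exact absurd h (hbd Q _ _ _)
    | vx k i =>
      cases y with
      | bd j => exact absurd h.symm (hbd Q _ _ _)
      | vx l j =>
        simp only [Place.point] at h ⊢
        obtain rfl := Q.v.injective (Q.T.chart_disjoint _ _ _ _ h)
        have h' := Q.T.chart_inj _ h
        rw [Q.label_eq] at h'
        rw [Q'.label_eq, h']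
  exact ⟨h Q Q' x y, h Q' Q x y⟩

/-- The shape of a picture is determined by its wiring. -/
theorem Picture.sameShape (Q Q' : Picture w) :
    SameShape Q.T Q'.T (Q.v.symm.trans Q'.v) (Q.e.symm.trans Q'.e) := by
  refine ⟨?_, ?_, ?_, ?_⟩
  · intro v
    obtain ⟨k, rfl⟩ := Q.v.surjective v
    rw [Equiv.trans_apply, Equiv.symm_apply_apply, Q'.label_eq, Q.label_eq]
  · rintro ⟨e, b⟩ z hz
    obtain ⟨j, rfl⟩ := Q.e.surjective e
    dsimp only
    rw [Equiv.trans_apply, Equiv.symm_apply_apply, Q.pt_eq, Q'.pt_eq]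
    have h : ∀ (Q : Picture w) v y, Q.T.chart v y ≠ z := fun Q v y h =>
      Q.T.chart_inner v y (h ▸ hz)
    cases w.place j b with
    | bd i => rfl
    | vx k i => exact iff_of_false (h Q _ _) (h Q' _ _)
  · rintro ⟨e, b⟩ v i -
    obtain ⟨j, rfl⟩ := Q.e.surjective e
    obtain ⟨k, rfl⟩ := Q.v.surjective v
    dsimp only
    rw [Equiv.trans_apply, Equiv.symm_apply_apply, Equiv.trans_apply, Equiv.symm_apply_apply,
      Q.pt_eq, Q'.pt_eq]
    have h := Q.point_eq_iff Q' (w.place j b) (.vx k i)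
    simp only [Place.point] at h
    rwa [Q'.label_eq, ← Q.label_eq] at h
  · rintro ⟨e, b⟩ ⟨f, c⟩
    obtain ⟨j, rfl⟩ := Q.e.surjective e
    obtain ⟨k, rfl⟩ := Q.e.surjective f
    dsimp only
    rw [Equiv.trans_apply, Equiv.symm_apply_apply, Equiv.trans_apply, Equiv.symm_apply_apply,
      Q.pt_eq, Q'.pt_eq, Q.pt_eq, Q'.pt_eq]
    exact Q.point_eq_iff Q' _ _

/-- A vertex can be reached from the boundary along at most `d` edges. -/
def Wiring.reach (w : Wiring) : ℕ → Fin w.n → Bool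
  | 0, _ => false
  | d + 1, k => w.edges.any fun e =>
      let near : Place w.n → Bool
        | .bd _ => true
        | .vx l _ => w.reach d l
      let here : Place w.n → Bool
        | .bd _ => false
        | .vx l _ => l = k
      (here e.1 && near e.2) || (here e.2 && near e.1)

/-- All vertices can be reached from the boundary. -/
def Wiring.Connected (w : Wiring) : Prop := ∀ k, w.reach w.n k = true

instance : Decidable w.Connected := inferInstanceAs (Decidable (∀ _, _))

theorem Picture.connectedToBoundary (Q : Picture w) (hw : w.Connected) :
    ConnectedToBoundary Q.T := by
  intro A B h1 _ h3
  have hbd : ∀ j b i, w.place j b = .bd i → Q.e j ∈ A := by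
    intro j b i h
    refine h1 (Q.e j, b) ?_
    rw [Q.pt_eq, h]
    exact norm_port _ _
  have hvx : ∀ j b k i, w.place j b = .vx k i → (Q.e j ∈ A ↔ Q.v k ∈ B) := by
    intro j b k i h
    refine h3 (Q.e j, b) _ (port (Q.T.label (Q.v k)).signs.length i) ?_
    rw [Q.pt_eq, h]
    rfl
  have hr : ∀ d k, w.reach d k = true → Q.v k ∈ B := by
    intro d
    induction d with
    | zero => intro k h; cases h
    | succ d ih =>
      have hnear : ∀ j b b' k i, w.place j b = .vx k i →
          (match w.place j b' with
            | .bd _ => true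
            | .vx l _ => w.reach d l) = true → Q.v k ∈ B := by
        intro j b b' k i hk hn
        rw [← hvx j b k i hk]
        cases hp : w.place j b' with
        | bd i' => exact hbd j b' i' hp
        | vx l i' =>
          rw [hp] at hn
          exact (hvx j b' l i' hp).2 (ih l hn)
      have hhere : ∀ j b k, (match w.place j b with
            | .bd _ => false
            | .vx l _ => decide (l = k)) = true → ∃ i, w.place j b = .vx k i := by
        intro j b k hk
        cases hp : w.place j b with
        | bd i' =>
          rw [hp] at hk
          cases hk
        | vx l i' =>
          rw [hp] at hk
          exact ⟨i', by rw [of_decide_eq_true hk]⟩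
      intro k h
      rw [Wiring.reach, List.any_eq_true] at h
      obtain ⟨e, he, h⟩ := h
      obtain ⟨j, rfl⟩ := List.get_of_mem he
      rw [Bool.or_eq_true, Bool.and_eq_true, Bool.and_eq_true] at h
      rcases h with ⟨h4, h5⟩ | ⟨h4, h5⟩
      · obtain ⟨i, hi⟩ := hhere j false k h4
        exact hnear j false true k i hi h5
      · obtain ⟨i, hi⟩ := hhere j true k h4
        exact hnear j true false k i hi h5
  have hB : B = Set.univ := by
    refine Set.eq_univ_of_forall fun v => ?_
    obtain ⟨k, rfl⟩ := Q.v.surjective v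
    exact hr _ k (hw k)
  refine ⟨Set.eq_univ_of_forall fun e => ?_, hB⟩
  obtain ⟨j, rfl⟩ := Q.e.surjective e
  cases hp : w.place j true with
  | bd i => exact hbd j true i hp
  | vx k i =>
    rw [hvx j true k i hp, hB]
    trivial

end

section
variable {F : Type} [TopologicalSpace F] {S : Surf F} {o : Mode} {A : Type*} [CommRing A]
  {M' : KnotTheory o A} {w : Wiring}

/-- A picture is determined by its wiring up to isotopy. -/
theorem Picture.skSame (hw : w.Connected) (Q Q' : Picture w) :
    SkSame S M' (Q.v.symm.trans Q'.v) := by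
  intro P R hR P' R' hR' hP hRR m hm hm'
  have h := Q.sameShape Q'
  obtain rfl : P' = (Q.v.symm.trans Q'.v).symm ⁻¹' P := by
    ext v
    rw [Set.mem_preimage, hP, Equiv.apply_symm_apply]
  rw [cls_eq_of_sameShape h (Q.connectedToBoundary hw) P R hR hm
    (hasPorts_fill.2 (hasPorts_fill.1 hm'))]
  refine cls_eq_of_relabel (Q'.T.fillCongr (h.isTangle_symm hR) hR' fun v hv => ?_)
  rw [← hRR _ hv, Equiv.apply_symm_apply]

end

section
variable {α : Type*} [DecidableEq α]

/-- Starting at the point `x`, follow the edges from `L` (at most `d` of them); the result is the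
number of edges and the final point. -/
def follow (L : List (α × α)) : ℕ → α → ℕ × α
  | 0, x => (0, x)
  | d + 1, x =>
    match L.find? (fun e => e.1 = x) with
    | none => (0, x)
    | some e => ((follow L d e.2).1 + 1, (follow L d e.2).2)

/-- The number of the edge from `M` that ends where the chain of edges from `L` through `e` ends. -/
def chainIdx (L M : List (α × α)) (e : α × α) : ℕ :=
  M.findIdx fun m => m.2 = (follow L L.length e.2).2

/-- The position of an edge in its chain; it increases along the chain. -/
def chainPos (L : List (α × α)) (e : α × α) : ℕ := L.length - (follow L L.length e.2).1

/-- The edges from the list `L` form chains that correspond to the edges from the list `M`. -/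
def chainCheck (L M : List (α × α)) : Bool :=
  (L.all fun e =>
    (M[chainIdx L M e]?).any fun m =>
      (m.2 = e.2 || L.any fun f =>
        f.1 = e.2 && chainIdx L M f = chainIdx L M e && chainPos L e < chainPos L f) &&
      (m.1 = e.1 || L.any fun f => f.2 = e.1 && chainIdx L M f = chainIdx L M e)) &&
  (List.finRange M.length).all fun j =>
    L.any fun e => (M.get j).1 = e.1 && chainIdx L M e = j

end

section
variable {F : Type} [TopologicalSpace F] {S : Surf F} {o : Mode} {A : Type*} [CommRing A]
  {M' : KnotTheory o A}

/-- A diagram in which the points with the names from `α` are connected by the edges from the list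
`L` gives a picture after the removal of auxiliary vertices, if the edges form chains as prescribed.
-/
theorem exists_picture_of_chainCheck {α : Type*} [DecidableEq α] {w : Wiring}
    (T : Diagram diskSurf) (hT : IsTangle w.bd T) (v : Fin w.n ≃ T.V)
    (hl : ∀ k, T.label (v k) = w.vertex k) (ends : T.E → α × α) (point : α → Disk)
    (h0 : ∀ e, T.path e 0 = point (ends e).1) (h1 : ∀ e, T.path e 1 = point (ends e).2)
    (L : List (α × α)) (hL : ∀ e, ends e ∈ L) (hL' : ∀ l ∈ L, ∃ e, ends e = l)
    (node : Place w.n → α)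
    (hnode : ∀ j b, point (node (w.place j b)) = (w.place j b).point w.bd.length T v)
    (h : chainCheck L (w.edges.map fun e => (node e.1, node e.2)) = true) :
    ∃ Q : Picture w, SkSame S M' (v.symm.trans Q.v) := by
  set M := w.edges.map fun e => (node e.1, node e.2) with hM
  have hlen : M.length = w.edges.length := by rw [hM, List.length_map]
  rw [chainCheck, Bool.and_eq_true, List.all_eq_true, List.all_eq_true] at h
  obtain ⟨hAB, hC⟩ := h
  have hi : ∀ e, chainIdx L M (ends e) < w.edges.length := by
    intro e
    have := hAB _ (hL e)
    by_contra hlt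
    rw [List.getElem?_eq_none (by omega)] at this
    simp at this
  have hget : ∀ e, M[chainIdx L M (ends e)]? =
      some (node (w.edges.get ⟨_, hi e⟩).1, node (w.edges.get ⟨_, hi e⟩).2) := by
    intro e
    rw [List.getElem?_eq_getElem (by rw [hlen]; exact hi e)]
    simp [hM]
  refine exists_contraction T hT v hl (fun e => ⟨_, hi e⟩) (fun e => chainPos L (ends e)) ?_ ?_ ?_
  · intro e
    have := hAB _ (hL e)
    rw [hget e] at this
    simp only [Option.any_some, Bool.and_eq_true, Bool.or_eq_true, decide_eq_true_eq,
      List.any_eq_true] at this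
    rcases this.1 with h2 | ⟨f, hf, ⟨h2, h3⟩, h4⟩
    · left
      rw [h1, ← h2]
      exact hnode ⟨_, hi e⟩ true
    · obtain ⟨f, rfl⟩ := hL' f hf
      right
      exact ⟨f, Fin.ext h3, h4, by rw [h1, h0, h2]⟩
  · intro e
    have := hAB _ (hL e)
    rw [hget e] at this
    simp only [Option.any_some, Bool.and_eq_true, Bool.or_eq_true, decide_eq_true_eq,
      List.any_eq_true] at this
    rcases this.2 with h2 | ⟨f, hf, h2, h3⟩
    · left
      rw [h0, ← h2]
      exact hnode ⟨_, hi e⟩ false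
    · obtain ⟨f, rfl⟩ := hL' f hf
      right
      exact ⟨f, Fin.ext h3, by rw [h1, h0, h2]⟩
  · intro j
    have := hC ⟨j, by rw [hlen]; exact j.2⟩ (List.mem_finRange _)
    simp only [List.any_eq_true, Bool.and_eq_true, decide_eq_true_eq] at this
    obtain ⟨e, he, h2, h3⟩ := this
    obtain ⟨e, rfl⟩ := hL' e he
    refine ⟨e, Fin.ext h3, ?_⟩
    rw [h0, ← h2]
    refine Eq.trans ?_ (hnode j false)
    simp [hM, Wiring.place]

/-! ### Composition of pictures -/

/-- Codes of places: `[i]` for a point of the boundary, and `[k, i]` for a point of the vertex `k`.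
-/
def Place.code {n : ℕ} : Place n → List ℕ
  | .bd i => [i]
  | .vx k i => [k, i]

/-- Places of a picture inserted at the vertex `i` of another picture. -/
def Place.codeIn {n : ℕ} (i : ℕ) : Place n → List ℕ
  | .bd k => [i, k]
  | .vx a k => [i, a, k]

/-- Places of a picture where the vertices are described by the codes `s`. -/
def Place.codeSub {n : ℕ} (s : Fin n → List ℕ) : Place n → List ℕ
  | .bd k => [k]
  | .vx b k => s b ++ [k]

/-- Codes of the vertices after insertion of pictures: `[i]` for an old vertex `i`, and `[i, a]` for
the vertex `a` of the picture inserted at `i`. -/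
def compVertices (h : Wiring) (u : Fin h.n → Wiring) (P : Fin h.n → Bool) : List (List ℕ) :=
  (List.finRange h.n).flatMap fun i =>
    if P i then (List.finRange (u i).n).map fun a => [i.1, a.1] else [[i.1]]

/-- The ends of the edges after insertion of pictures at the vertices `i` with `P i`. -/
def compEdges (h : Wiring) (u : Fin h.n → Wiring) (P : Fin h.n → Bool) :
    List (List ℕ × List ℕ) :=
  (h.edges.map fun e => (e.1.code, e.2.code)) ++
  (List.finRange h.n).flatMap fun i =>
    if P i then (u i).edges.map fun e => (e.1.codeIn i, e.2.codeIn i) else []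

/-- Insertion of pictures with the wirings `u i` in a picture with the wiring `h`, at its vertices
`i` with `P i`, gives a picture with the wiring `w`; the vertices of `w` have the codes `s`. -/
def compCheck (h : Wiring) (u : Fin h.n → Wiring) (P : Fin h.n → Bool) (w : Wiring)
    (s : Fin w.n → List ℕ) : Bool :=
  w.bd.length = h.bd.length &&
  ((List.finRange h.n).all fun i => !P i || (u i).bd.length = (h.vertex i).signs.length) &&
  ((List.finRange w.n).all fun k => s k ∈ compVertices h u P) &&
  ((List.finRange w.n).all fun k => (List.finRange w.n).all fun l => s k ≠ s l || k = l) &&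
  ((compVertices h u P).all fun x => (List.finRange w.n).any fun k => s k = x) &&
  ((List.finRange w.n).all fun k => (List.finRange h.n).all fun i =>
    (s k ≠ [i.1] || w.vertex k = h.vertex i) &&
    (List.finRange (u i).n).all fun a => s k ≠ [i.1, a.1] || w.vertex k = (u i).vertex a) &&
  chainCheck (compEdges h u P) (w.edges.map fun e => (e.1.codeSub s, e.2.codeSub s))

theorem mem_compVertices {h : Wiring} {u : Fin h.n → Wiring} {P : Fin h.n → Bool} {x : List ℕ} :
    x ∈ compVertices h u P ↔ ∃ i, (P i = true ∧ ∃ a : Fin (u i).n, x = [i.1, a.1]) ∨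
      (P i = false ∧ x = [i.1]) := by
  simp only [compVertices, List.mem_flatMap, List.mem_finRange, true_and]
  refine exists_congr fun i => ?_
  cases P i <;> simp [eq_comm]

open Classical in
/-- The point of the composed picture that has the given code. -/
def compPoint {h : Wiring} {u : Fin h.n → Wiring} (H : Picture h) (U : ∀ i, Picture (u i)) :
    List ℕ → Disk
  | [i] => port h.bd.length i
  | [i, k] => if hi : i < h.n then Place.point h.bd.length H.T H.v (.vx ⟨i, hi⟩ k) else 0
  | [i, a, k] => if hi : i < h.n then if ha : a < (u ⟨i, hi⟩).n then
      H.T.chart (H.v ⟨i, hi⟩) (Place.point (u ⟨i, hi⟩).bd.length (U ⟨i, hi⟩).T (U ⟨i, hi⟩).v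
        (.vx ⟨a, ha⟩ k)) else 0 else 0
  | _ => 0

theorem compPoint_code {h : Wiring} {u : Fin h.n → Wiring} (H : Picture h)
    (U : ∀ i, Picture (u i)) (x : Place h.n) :
    compPoint H U x.code = x.point h.bd.length H.T H.v := by
  cases x with
  | bd i => rfl
  | vx k i => exact dif_pos k.2

theorem compPoint_codeIn {h : Wiring} {u : Fin h.n → Wiring} (H : Picture h)
    (U : ∀ i, Picture (u i)) (i : Fin h.n) (hi : (u i).bd.length = (h.vertex i).signs.length)
    (x : Place (u i).n) :
    compPoint H U (x.codeIn i) =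
      H.T.chart (H.v i) (x.point (u i).bd.length (U i).T (U i).v) := by
  cases x with
  | bd k =>
    refine (dif_pos i.2).trans ?_
    simp only [Place.point]
    rw [H.label_eq, hi]
  | vx a k => exact (dif_pos i.2).trans (dif_pos a.2)

/-- Composition of pictures: a picture `H` with pictures `U i` inserted at some of its vertices,
and with arbitrary tangles inserted at the vertices of the result, equals the picture with the
composed wiring and with the same tangles inserted. -/
theorem exists_comp {h : Wiring} {u : Fin h.n → Wiring} {P : Fin h.n → Bool} {w : Wiring}
    {s : Fin w.n → List ℕ} (hs : compCheck h u P w s = true) (H : Picture h)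
    (U : ∀ i, Picture (u i)) :
    ∃ Q : Picture w, ∀ X R hR XH RH hRH (XU : ∀ i, Set (Fin (u i).n))
      (RU : ∀ i, Fin (u i).n → Diagram diskSurf)
      (hRU : ∀ i, ∀ k ∈ XU i, HasPorts ((u i).vertex k).signs.length (RU i k)),
      (∀ i, P i = true → i ∈ XH ∧ RH i = ((U i).fillTg (XU i) (RU i) (hRU i)).1) →
      (∀ k i, s k = [i.1] → (k ∈ X ↔ i ∈ XH) ∧ (k ∈ X → R k = RH i)) →
      (∀ k i (a : Fin (u i).n), s k = [i.1, a.1] → (k ∈ X ↔ a ∈ XU i) ∧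
        (k ∈ X → R k = RU i a)) →
      ∀ m hm hm', cls S M' (⟨(H.fillTg XH RH hRH).1, hm⟩ : Tg m) =
        cls S M' ⟨(Q.fillTg X R hR).1, hm'⟩ := by
  classical
  simp only [compCheck, Bool.and_eq_true, List.all_eq_true, List.mem_finRange, true_imp_iff,
    Bool.or_eq_true, decide_eq_true_eq, List.any_eq_true, true_and, Bool.not_eq_true',
    decide_not, decide_eq_false_iff_not, ← imp_iff_not_or, ne_eq] at hs
  obtain ⟨⟨⟨⟨⟨⟨hbd, hlen⟩, hmem⟩, hinj⟩, hsurj⟩, hlab⟩, hch⟩ := hs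
  have hlen' : ∀ i, P i = true → (u i).bd.length = (h.vertex i).signs.length := by
    intro i hi
    rcases hlen i with h1 | h1
    · rw [hi] at h1
      cases h1
    · exact h1
  -- the diagram `D` is the picture `H` with the pictures `U i` inserted; `code` gives the codes of
  -- its vertices
  let PP : Set H.T.V := H.v.symm ⁻¹' {i | P i = true}
  have hT : ∀ x ∈ PP, IsTangle (H.T.label x).signs (U (H.v.symm x)).T := by
    intro x hx
    obtain ⟨i, rfl⟩ := H.v.surjective x
    have hi : P i = true := by simpa [PP] using hx
    rw [Equiv.symm_apply_apply, H.label_eq]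
    have h1 : HasPorts (u i).bd.length (U i).T := (U i).isTangle
    rw [hlen' i hi] at h1
    exact h1
  let D : Diagram diskSurf := H.T.fill PP (fun x => (U (H.v.symm x)).T) hT
  let code : D.V → List ℕ
    | .inl x => [(H.v.symm x).1]
    | .inr x => [(H.v.symm x.1).1, ((U (H.v.symm x.1)).v.symm x.2).1]
  have hcode_inj : Function.Injective code := by
    rintro (⟨x, hx⟩ | ⟨⟨x, hx⟩, a⟩) (⟨y, hy⟩ | ⟨⟨y, hy⟩, b⟩) hxy
    · simp only [code, List.cons.injEq, and_true] at hxy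
      obtain rfl := H.v.symm.injective (Fin.ext hxy)
      rfl
    · simp [code] at hxy
    · simp [code] at hxy
    · simp only [code, List.cons.injEq, and_true] at hxy
      obtain rfl := H.v.symm.injective (Fin.ext hxy.1)
      obtain rfl := (U _).v.symm.injective (Fin.ext hxy.2)
      rfl
  have hcode_mem : ∀ x, code x ∈ compVertices h u P := by
    rintro (⟨x, hx⟩ | ⟨⟨x, hx⟩, a⟩) <;> rw [mem_compVertices]
    · exact ⟨H.v.symm x, Or.inr ⟨by simpa [PP] using hx, rfl⟩⟩
    · exact ⟨H.v.symm x, Or.inl ⟨hx, _, rfl⟩⟩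
  have hex : ∀ k, ∃ x, code x = s k := by
    intro k
    obtain ⟨i, ⟨hi, a, h1⟩ | ⟨hi, h1⟩⟩ := mem_compVertices.1 (hmem k)
    · have hi' : H.v i ∈ PP := by simpa [PP] using hi
      have h2 : H.v.symm (H.v i) = i := Equiv.symm_apply_apply _ _
      refine ⟨.inr ⟨⟨H.v i, hi'⟩, (U (H.v.symm (H.v i))).v
        ⟨a.1, by rw [h2]; exact a.2⟩⟩, ?_⟩
      simp [code, h1]
    · have hi' : H.v i ∉ PP := by simpa [PP] using hi
      exact ⟨.inl ⟨H.v i, hi'⟩, by simp [code, h1]⟩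
  choose f hf using hex
  have hfb : Function.Bijective f := by
    constructor
    · intro k l hkl
      refine (hinj k l) ?_
      rw [← hf, ← hf, hkl]
    · intro x
      obtain ⟨k, hk⟩ := hsurj _ (hcode_mem x)
      exact ⟨k, hcode_inj ((hf k).trans hk)⟩
  let v : Fin w.n ≃ D.V := Equiv.ofBijective f hfb
  have hv : ∀ k, code (v k) = s k := hf
  have hv' : ∀ x, s (v.symm x) = code x := fun x => by rw [← hv, Equiv.apply_symm_apply]
  have hlabel : ∀ k, D.label (v k) = w.vertex k := by
    intro k
    have hk := hv k
    generalize v k = x at hk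
    rcases x with ⟨x, hx⟩ | ⟨⟨x, hx⟩, a⟩
    · rw [(hlab k (H.v.symm x)).1 hk.symm, ← H.label_eq, Equiv.apply_symm_apply]
      rfl
    · rw [(hlab k (H.v.symm x)).2 _ hk.symm, ← (U _).label_eq, Equiv.apply_symm_apply]
      rfl
  -- the codes of the ends of edges
  let ends : D.E → List ℕ × List ℕ
    | .inl e => ((h.place (H.e.symm e) false).code, (h.place (H.e.symm e) true).code)
    | .inr x => (((u _).place ((U (H.v.symm x.1)).e.symm x.2) false).codeIn (H.v.symm x.1),
        ((u _).place ((U (H.v.symm x.1)).e.symm x.2) true).codeIn (H.v.symm x.1))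
  have hpath : ∀ (e : D.E) b, D.pt (e, b) =
      compPoint H U (if b then (ends e).2 else (ends e).1) := by
    rintro (e | ⟨⟨x, hx⟩, e⟩) b
    · have h1 := H.pt_eq (H.e.symm e) b
      rw [Equiv.apply_symm_apply, ← compPoint_code H U] at h1
      cases b <;> exact h1
    · have h1 := (U (H.v.symm x)).pt_eq ((U (H.v.symm x)).e.symm e) b
      rw [Equiv.apply_symm_apply] at h1
      have h2 := (compPoint_codeIn H U (H.v.symm x) (hlen' _ hx)
        ((u (H.v.symm x)).place ((U (H.v.symm x)).e.symm e) b))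
      rw [← h1, Equiv.apply_symm_apply] at h2
      cases b <;> exact h2.symm
  have hDT : IsTangle w.bd D := by
    change HasPorts w.bd.length D
    rw [hbd]
    exact hasPorts_fill.2 H.isTangle
  obtain ⟨Q, hQ⟩ := exists_picture_of_chainCheck (S := S) (M' := M') D hDT v hlabel ends
    (compPoint H U) (fun e => by simpa [Diagram.pt, endpt] using hpath e false)
    (fun e => by simpa [Diagram.pt, endpt] using hpath e true) (compEdges h u P)
    (by
      rintro (e | ⟨⟨x, hx⟩, e⟩)
      · exact List.mem_append_left _ (List.mem_map.2 ⟨_, List.get_mem _ (H.e.symm e), rfl⟩)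
      · refine List.mem_append_right _ (List.mem_flatMap.2 ⟨H.v.symm x, List.mem_finRange _, ?_⟩)
        rw [if_pos (show P (H.v.symm x) = true from hx)]
        exact List.mem_map.2 ⟨_, List.get_mem _ ((U (H.v.symm x)).e.symm e), rfl⟩)
    (by
      intro l hl
      rcases List.mem_append.1 hl with hl | hl
      · obtain ⟨e, he, rfl⟩ := List.mem_map.1 hl
        obtain ⟨j, rfl⟩ := List.get_of_mem he
        refine ⟨.inl (H.e j), ?_⟩
        simp [ends, Wiring.place]
      · obtain ⟨i, -, hl⟩ := List.mem_flatMap.1 hl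
        by_cases hi : P i = true
        · rw [if_pos hi] at hl
          obtain ⟨e, he, rfl⟩ := List.mem_map.1 hl
          obtain ⟨j, rfl⟩ := List.get_of_mem he
          obtain ⟨x, rfl⟩ := H.v.symm.surjective i
          refine ⟨.inr ⟨⟨x, hi⟩, (U (H.v.symm x)).e j⟩, ?_⟩
          simp [ends, Wiring.place]
        · rw [if_neg hi] at hl
          cases hl)
    (Place.codeSub s)
    (by
      intro j b
      generalize w.place j b = x
      cases x with
      | bd k =>
        simp only [Place.codeSub, compPoint, Place.point, hbd]
      | vx k i =>
        have hk := hv k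
        simp only [Place.codeSub, Place.point]
        rw [← hk]
        generalize v k = x
        rcases x with ⟨x, hx⟩ | ⟨⟨x, hx⟩, a⟩
        · have h1 := compPoint_code H U (.vx (H.v.symm x) i)
          simp only [Place.point, Equiv.apply_symm_apply] at h1
          exact h1
        · have h1 := compPoint_codeIn H U (H.v.symm x) (hlen' _ hx)
            (.vx ((U (H.v.symm x)).v.symm a) i)
          simp only [Place.point, Equiv.apply_symm_apply] at h1
          exact h1)
    hch
  -- insertion in two rounds is compared to a single insertion in `D`
  refine ⟨Q, ?_⟩
  intro X R hR XH RH hRH XU RU hRU h1 h2 h3 m hm hm'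
  have hRD : ∀ x ∈ v.symm ⁻¹' X, IsTangle (D.label x).signs (R (v.symm x)) := by
    intro x hx
    have h4 := hR _ hx
    rwa [← hlabel, Equiv.apply_symm_apply] at h4
  have hmD : HasPorts m (D.fill (v.symm ⁻¹' X) (fun x => R (v.symm x)) hRD) := by
    have h4 := (hasPorts_fill (hT := Q.isTangle_fill hR).1 hm').unique Q.isTangle
    subst h4
    exact hasPorts_fill.2 hDT
  refine Eq.trans ?_ (hQ _ _ hRD _ _ (Q.isTangle_fill hR) (fun x => by simp) (fun x _ => by simp)
    m hmD hm')
  refine (cls_eq_of_relabel (H.T.fillFill PP _ hT _ _ hRD _ _ (H.isTangle_fill hRH) ?_ ?_ ?_)).symm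
  · intro x
    constructor
    · intro hx
      by_cases hxP : x ∈ PP
      · exact Or.inl hxP
      · refine Or.inr ⟨hxP, ?_⟩
        exact (h2 _ _ (hv' (.inl ⟨x, hxP⟩))).1.2 hx
    · rintro (hx | ⟨hx, hx'⟩)
      · exact (h1 _ hx).1
      · exact (h2 _ _ (hv' (.inl ⟨x, hx⟩))).1.1 hx'
  · intro x hx
    have hin : ∀ a, _ := fun a => h3 _ _ _ (hv' (.inr ⟨⟨x, hx⟩, a⟩))
    have hset : {a : (U (H.v.symm x)).T.V | v.symm (Sum.inr ⟨⟨x, hx⟩, a⟩) ∈ X} =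
        (U (H.v.symm x)).v.symm ⁻¹' XU (H.v.symm x) := by
      ext a
      exact (hin a).1
    refine Relabel.trans (Diagram.fillSetCongr _ hset _ ?_) (Relabel.trans
      (Diagram.fillCongr _ ?_ ((U (H.v.symm x)).isTangle_fill (hRU _)) ?_)
      (Relabel.ofEq (h1 _ hx).2.symm))
    · rw [← hset]
      exact fun a ha => hRD _ ha
    · rw [← hset]
      exact fun a ha => hRD _ ha
    · intro a ha
      exact ((hin a).2 ((hin a).1.2 ha)).symm
  · intro x hx hx'
    exact Relabel.ofEq ((h2 _ _ (hv' (.inl ⟨x, hx⟩))).2 hx')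

end

/-! ### Drawings of pictures -/

/-- The coefficient of the quadratic form `x² + κ x y + y²` used for drawings with `m` boundary
points; in the coordinates with this form the boundary points are integer vectors. -/
def latK (m : ℕ) : ℤ := if m = 6 then 1 else 0

/-- The quadratic form, on integer vectors. -/
def latQ (m : ℕ) (p : ℤ × ℤ) : ℤ := p.1 * p.1 + latK m * p.1 * p.2 + p.2 * p.2

/-- Twice the scalar product. -/
def latB (m : ℕ) (p u : ℤ × ℤ) : ℤ :=
  2 * p.1 * u.1 + latK m * (p.1 * u.2 + p.2 * u.1) + 2 * p.2 * u.2

/-- The integer vectors of length one. -/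
def latUnits (m : ℕ) : List (ℤ × ℤ) :=
  if m = 6 then [(1, 0), (0, 1), (-1, 1), (-1, 0), (0, -1), (1, -1)]
  else [(1, 0), (0, 1), (-1, 0), (0, -1)]

/-- The boundary points in the coordinates of a drawing. -/
def latPort (m i : ℕ) : ℤ × ℤ := ((latUnits m)[if m = 2 then 2 * i else i]?).getD 0

/-- The quadratic form, on real vectors. -/
def qR (m : ℕ) (x y : ℝ) : ℝ := x * x + latK m * x * y + y * y

theorem qR_int (m : ℕ) (p : ℤ × ℤ) : qR m p.1 p.2 = latQ m p := by
  simp [qR, latQ]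

theorem latK_cases (m : ℕ) : latK m = 0 ∨ latK m = 1 := by
  unfold latK
  split_ifs <;> simp

theorem qR_nonneg (m : ℕ) (x y : ℝ) : 0 ≤ qR m x y := by
  unfold qR
  rcases latK_cases m with h | h <;> rw [h] <;> push_cast <;>
    nlinarith [sq_nonneg (x + y), sq_nonneg x, sq_nonneg y]

theorem qR_pos (m : ℕ) {x y : ℝ} (h : x ≠ 0 ∨ y ≠ 0) : 0 < qR m x y := by
  have : 0 < x ^ 2 + y ^ 2 := by
    rcases h with h | h
    · have := pow_pos (abs_pos.2 h) 2
      rw [sq_abs] at this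
      positivity
    · have := pow_pos (abs_pos.2 h) 2
      rw [sq_abs] at this
      positivity
  unfold qR
  rcases latK_cases m with h | h <;> rw [h] <;> push_cast <;>
    nlinarith [sq_nonneg (x + y)]

/-- The height of the second vector of the basis. -/
def latH (m : ℕ) : ℝ := √(1 - (latK m / 2 : ℝ) ^ 2)

theorem latH_pos (m : ℕ) : 0 < latH m := by
  refine Real.sqrt_pos.2 ?_
  rcases latK_cases m with h | h <;> rw [h] <;> norm_num

theorem latH_sq (m : ℕ) : latH m * latH m = 1 - (latK m / 2 : ℝ) ^ 2 := by
  refine Real.mul_self_sqrt ?_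
  rcases latK_cases m with h | h <;> rw [h] <;> norm_num

/-- The point of the plane with given coordinates. -/
def plane (m : ℕ) (x y : ℝ) : ℂ := ⟨x + latK m / 2 * y, latH m * y⟩

theorem norm_plane_sq (m : ℕ) (x y : ℝ) : ‖plane m x y‖ ^ 2 = qR m x y := by
  rw [← Complex.normSq_eq_norm_sq, Complex.normSq_apply]
  simp only [plane, qR]
  linear_combination y * y * latH_sq m

theorem norm_plane_le (m : ℕ) {x y : ℝ} : ‖plane m x y‖ ≤ 1 ↔ qR m x y ≤ 1 := by
  rw [← norm_plane_sq, sq_le_one_iff₀ (norm_nonneg _)]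

theorem norm_plane_eq (m : ℕ) {x y : ℝ} : ‖plane m x y‖ = 1 ↔ qR m x y = 1 := by
  rw [← norm_plane_sq, pow_eq_one_iff_of_nonneg (norm_nonneg _) two_ne_zero]

theorem plane_injective (m : ℕ) {x y x' y' : ℝ} (h : plane m x y = plane m x' y') :
    x = x' ∧ y = y' := by
  have h1 := congrArg Complex.re h
  have h2 := congrArg Complex.im h
  simp only [plane] at h1 h2
  have h3 := mul_left_cancel₀ (latH_pos m).ne' h2
  subst h3
  exact ⟨by linarith, rfl⟩

/-- The first coordinate of a point of the plane. -/
def latX (m : ℕ) (z : ℂ) : ℝ := z.re - latK m / 2 * (z.im / latH m)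

/-- The second coordinate of a point of the plane. -/
def latY (m : ℕ) (z : ℂ) : ℝ := z.im / latH m

theorem plane_lat (m : ℕ) (z : ℂ) : plane m (latX m z) (latY m z) = z := by
  have := (latH_pos m).ne'
  apply Complex.ext
  · simp only [plane, latX, latY]
    ring
  · simp only [plane, latY]
    field_simp

theorem qR_lat (m : ℕ) (z : ℂ) : qR m (latX m z) (latY m z) = ‖z‖ ^ 2 := by
  rw [← norm_plane_sq, plane_lat]

theorem port_pow (m i : ℕ) : (port m i : ℂ) = (port m 1 : ℂ) ^ i := by
  simp only [port]
  rw [← Complex.exp_nat_mul]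
  congr 1
  push_cast
  ring

/-- The boundary points are integer vectors: for two or four points in the usual coordinates, and
for six points in the coordinates of the hexagonal lattice. -/
theorem port_eq_plane {m : ℕ} (hm : m = 2 ∨ m = 4 ∨ m = 6) {i : ℕ} (hi : i < m) :
    (port m i : ℂ) = plane m (latPort m i).1 (latPort m i).2 := by
  have h2 : (port 2 1 : ℂ) = -1 := by
    rw [← Complex.exp_pi_mul_I]
    simp only [port]
    congr 1
    push_cast
    ring
  have h4 : (port 4 1 : ℂ) = Complex.I := by
    rw [← Complex.exp_pi_div_two_mul_I]
    simp only [port]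
    congr 1
    push_cast
    ring
  have h6 : (port 6 1 : ℂ) = ⟨1 / 2, √3 / 2⟩ := by
    have : (port 6 1 : ℂ) = Complex.exp ((Real.pi / 3 : ℝ) * Complex.I) := by
      simp only [port]
      congr 1
      push_cast
      ring
    rw [this, Complex.exp_mul_I, ← Complex.ofReal_cos, ← Complex.ofReal_sin, Real.cos_pi_div_three,
      Real.sin_pi_div_three]
    apply Complex.ext <;> simp
  have e0 : latH 2 = 1 := by simp [latH, latK]
  have e1 : latH 4 = 1 := by simp [latH, latK]
  have e2 : latH 6 = √3 / 2 := by
    rw [latH]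
    have : (1 - (latK 6 / 2 : ℝ) ^ 2) = (√3 / 2) ^ 2 := by
      have h : (√3 : ℝ) ^ 2 = 3 := Real.sq_sqrt (by norm_num)
      rw [div_pow (√3), h]
      simp [latK]
      norm_num
    rw [this, Real.sqrt_sq (by positivity)]
  have s2 : (√3 : ℝ) ^ 2 = 3 := Real.sq_sqrt (by norm_num)
  have s3 : (√3 : ℝ) ^ 3 = 3 * √3 := by rw [pow_succ, s2]
  have s4 : (√3 : ℝ) ^ 4 = 9 := by rw [pow_succ, s3, mul_assoc, ← sq, s2]; norm_num
  have s5 : (√3 : ℝ) ^ 5 = 9 * √3 := by rw [pow_succ, s4]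
  rw [port_pow]
  rcases hm with rfl | rfl | rfl
  · rw [h2]
    interval_cases i <;> apply Complex.ext <;> simp [plane, latPort, latUnits, latK]
  · rw [h4]
    interval_cases i <;> apply Complex.ext <;>
      simp [plane, latPort, latUnits, latK, e1, pow_succ]
  · rw [h6]
    interval_cases i <;> apply Complex.ext <;>
      simp [plane, latPort, latUnits, latK, e2, pow_succ] <;>
      ring_nf <;> simp only [s2, s3, s4, s5] <;> ring

/-- A drawing of a picture in the plane: vertices are replaced by ellipses with given centers and
radii, and edges by polygonal paths, which are given by the list of their segments. All the
coordinates are integers, and `size` is the radius of the outer circle. -/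
structure Sketch (w : Wiring) where
  size : ℤ
  center : Fin w.n → ℤ × ℤ
  radius : Fin w.n → ℤ
  segs : List ((ℤ × ℤ) × (ℤ × ℤ))

namespace Sketch
variable {w : Wiring} (s : Sketch w)

/-- The beginning (`false`) or the end (`true`) of a segment. -/
def tip (j : Fin s.segs.length) (b : Bool) : ℤ × ℤ :=
  if b then (s.segs.get j).2 else (s.segs.get j).1

/-- The number of marked points of a vertex. -/
abbrev deg (w : Wiring) (k : Fin w.n) : ℕ := (w.vertex k).signs.length

/-- The marked points of an ellipse. -/
def boxPort (k : Fin w.n) (i : ℕ) : ℤ × ℤ :=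
  s.center k + s.radius k • latPort (deg w k) i

/-- The coordinates of the marked points of a wiring. -/
def node : Place w.n → ℤ × ℤ
  | .bd i => s.size • latPort w.bd.length i
  | .vx k i => s.boxPort k i

/-- The linear functionals that are tried for the separation of two segments. These few directions
are sufficient for the drawings below; a segment that touches another one in an endpoint is
permitted. -/
def functionals : List (ℤ × ℤ) :=
  [(1, 0), (-1, 0), (0, 1), (0, -1), (1, 1), (-1, -1), (1, -1), (-1, 1), (1, 2), (-1, -2), (2, 1),
    (-2, -1), (1, -2), (-1, 2), (2, -1), (-2, 1)]

/-- The value of a linear functional. -/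
def eval (f p : ℤ × ℤ) : ℤ := f.1 * p.1 + f.2 * p.2

/-- The ellipses are disjoint and lie inside the disk. -/
def ValidBoxes : Prop :=
  0 < s.size ∧ (w.bd.length = 2 ∨ w.bd.length = 4 ∨ w.bd.length = 6) ∧
  (∀ k, (deg w k = 2 ∨ deg w k = 4 ∨ deg w k = 6) ∧ 0 < s.radius k ∧
    |(s.center k).1| + |(s.center k).2| + 4 * s.radius k < s.size) ∧
  ∀ k l, k ≠ l → 2 * (s.radius k + s.radius l) < |(s.center k).1 - (s.center l).1| ∨
    2 * (s.radius k + s.radius l) < |(s.center k).2 - (s.center l).2|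

/-- The segments lie in the disk, do not meet the ellipses (a tangent line separates them), and
do not meet each other, except at their endpoints. -/
def ValidSegs : Prop :=
  (∀ j, s.tip j false ≠ s.tip j true ∧ ∀ b, latQ w.bd.length (s.tip j b) ≤ s.size * s.size) ∧
  (∀ j k, ∃ u ∈ latUnits (deg w k),
    (∀ b, 2 * s.radius k ≤ latB (deg w k) (s.tip j b - s.center k) u) ∧
    ∃ b, 2 * s.radius k < latB (deg w k) (s.tip j b - s.center k) u) ∧
  ∀ i j, i ≠ j → ∃ f ∈ functionals, (∀ b c, eval f (s.tip j b) ≤ eval f (s.tip i c)) ∧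
    ∃ c, ∀ b, eval f (s.tip j b) < eval f (s.tip i c)

/-- The place is one of the marked points. -/
def InRange (w : Wiring) : Place w.n → Prop
  | .bd i => i < w.bd.length
  | .vx k i => i < deg w k

instance (x : Place w.n) : Decidable (InRange w x) := by
  cases x <;> unfold InRange <;> infer_instance

/-- The endpoints of the segments. -/
def ValidEnds : Prop :=
  (∀ j b, (∀ i c, s.tip i c = s.tip j b → (i, c) = (j, b)) ∨
    latQ w.bd.length (s.tip j b) < s.size * s.size) ∧
  (∀ j b, latQ w.bd.length (s.tip j b) < s.size * s.size ∨
    ∃ i : Fin w.bd.length, s.tip j b = s.node (.bd i)) ∧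
  (∀ i : Fin w.bd.length, ∃ j b, s.tip j b = s.node (.bd i)) ∧
  (∀ j b k, s.radius k * s.radius k < latQ (deg w k) (s.tip j b - s.center k) ∨
    ∃ i : Fin (deg w k), s.tip j b = s.boxPort k i) ∧
  (∀ k, ∀ i : Fin (deg w k), ∃ j b, s.tip j b = s.boxPort k i ∧
    ∀ j' b', s.tip j' b' = s.boxPort k i → (j', b') = (j, b)) ∧
  ∀ j b, (∃ i : Fin w.bd.length, s.tip j b = s.node (.bd i)) ∨
    (∃ k, ∃ i : Fin (deg w k), s.tip j b = s.boxPort k i) ∨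
    ∃ i c, (i, c) ≠ (j, b) ∧ s.tip i c = s.tip j b ∧
      ∀ i' c', s.tip i' c' = s.tip j b → (i', c') = (j, b) ∨ (i', c') = (i, c)

/-- The conditions for a sketch to be a drawing of the wiring; they are decidable, since they
concern integers only. -/
def Valid : Prop := s.ValidBoxes ∧ s.ValidSegs ∧ s.ValidEnds ∧
  (∀ j b, InRange w (w.place j b)) ∧
  chainCheck s.segs (w.edges.map fun e => (s.node e.1, s.node e.2)) = true

instance : Decidable s.ValidBoxes := by unfold ValidBoxes; infer_instance
instance : Decidable s.ValidSegs := by unfold ValidSegs; infer_instance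
instance : Decidable s.ValidEnds := by unfold ValidEnds; infer_instance
instance : Decidable s.Valid := by unfold Valid; infer_instance

variable {s}

/-- The point of the disk with given coordinates. -/
def pnt (s : Sketch w) (x y : ℝ) : Disk := toDisk (plane w.bd.length (x / s.size) (y / s.size))

section
variable (h0 : 0 < s.size)
include h0

theorem size_pos : (0 : ℝ) < s.size := by exact_mod_cast h0

theorem qR_div (x y : ℝ) : qR w.bd.length (x / s.size) (y / s.size) =
    qR w.bd.length x y / (s.size * s.size) := by
  have := (size_pos h0).ne'
  unfold qR
  field_simp

theorem qR_div_le {x y : ℝ} : qR w.bd.length (x / s.size) (y / s.size) ≤ 1 ↔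
    qR w.bd.length x y ≤ s.size * s.size := by
  have := size_pos h0
  rw [qR_div h0, div_le_one (by positivity)]

theorem coe_pnt {x y : ℝ} (h : qR w.bd.length x y ≤ s.size * s.size) :
    (s.pnt x y : ℂ) = plane w.bd.length (x / s.size) (y / s.size) :=
  coe_toDisk ((norm_plane_le _).2 ((qR_div_le h0).2 h))

theorem norm_pnt {x y : ℝ} (h : qR w.bd.length x y ≤ s.size * s.size) :
    ‖(s.pnt x y : ℂ)‖ = 1 ↔ qR w.bd.length x y = s.size * s.size := by
  have := size_pos h0
  rw [coe_pnt h0 h, norm_plane_eq, qR_div h0, div_eq_one_iff_eq (by positivity)]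

theorem pnt_injective {x y x' y' : ℝ} (h : qR w.bd.length x y ≤ s.size * s.size)
    (h' : qR w.bd.length x' y' ≤ s.size * s.size) (hp : s.pnt x y = s.pnt x' y') :
    x = x' ∧ y = y' := by
  have := (size_pos h0).ne'
  have h1 := congrArg Subtype.val hp
  rw [coe_pnt h0 h, coe_pnt h0 h'] at h1
  obtain ⟨h2, h3⟩ := plane_injective _ h1
  exact ⟨by field_simp at h2; exact h2, by field_simp at h3; exact h3⟩

end

theorem continuous_pnt : Continuous fun p : ℝ × ℝ => s.pnt p.1 p.2 := by
  refine toDisk.continuous.comp ?_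
  have : Continuous fun p : ℝ × ℝ =>
      Complex.equivRealProdCLM.symm (p.1 / s.size + latK w.bd.length / 2 * (p.2 / s.size),
        latH w.bd.length * (p.2 / s.size)) := by fun_prop
  exact this

/-- The neighbourhood of a vertex: an ellipse. -/
def chart (s : Sketch w) (k : Fin w.n) : C(Disk, Disk) where
  toFun z := s.pnt ((s.center k).1 + s.radius k * latX (deg w k) z)
    ((s.center k).2 + s.radius k * latY (deg w k) z)
  continuous_toFun := by
    refine continuous_pnt.comp (f := fun z : Disk => (((s.center k).1 : ℝ) +
      s.radius k * latX (deg w k) z, ((s.center k).2 : ℝ) + s.radius k * latY (deg w k) z)) ?_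
    have h1 : Continuous fun z : Disk => (z : ℂ).re :=
      Complex.continuous_re.comp continuous_subtype_val
    have h2 : Continuous fun z : Disk => (z : ℂ).im :=
      Complex.continuous_im.comp continuous_subtype_val
    unfold latX latY
    fun_prop

/-- A segment. -/
def path (s : Sketch w) (j : Fin s.segs.length) : C(I, Disk) where
  toFun t := s.pnt ((1 - t) * (s.tip j false).1 + t * (s.tip j true).1)
    ((1 - t) * (s.tip j false).2 + t * (s.tip j true).2)
  continuous_toFun := by
    refine continuous_pnt.comp (f := fun t : I => ((1 - (t : ℝ)) * (s.tip j false).1 +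
      t * (s.tip j true).1, (1 - (t : ℝ)) * (s.tip j false).2 + t * (s.tip j true).2)) ?_
    fun_prop

theorem endpt_path (s : Sketch w) (j : Fin s.segs.length) (b : Bool) :
    endpt s.path (j, b) = s.pnt (s.tip j b).1 (s.tip j b).2 := by
  cases b <;> simp [endpt, path]

theorem abs_lat_lt (m : ℕ) {z : ℂ} (hz : ‖z‖ ≤ 1) : |latX m z| < 2 ∧ |latY m z| < 2 := by
  have h : qR m (latX m z) (latY m z) ≤ 1 := by
    rw [qR_lat]
    exact pow_le_one₀ (norm_nonneg _) hz
  unfold qR at h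
  generalize latX m z = x at h ⊢
  generalize latY m z = y at h ⊢
  rw [abs_lt, abs_lt]
  rcases latK_cases m with h' | h' <;> rw [h'] at h <;> push_cast at h <;>
    refine ⟨⟨?_, ?_⟩, ?_, ?_⟩ <;>
    nlinarith [sq_nonneg (x + y), sq_nonneg (x + 2 * y), sq_nonneg (2 * x + y)]

theorem qR_lt_of_abs (m : ℕ) {x y r : ℝ} (h : |x| + |y| < r) : qR m x y < r * r := by
  have h1 : qR m x y ≤ (|x| + |y|) * (|x| + |y|) := by
    unfold qR
    rw [add_mul, mul_add, mul_add, abs_mul_abs_self, abs_mul_abs_self]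
    have h2 : x * y ≤ |x| * |y| := by
      rw [← abs_mul]
      exact le_abs_self _
    have h3 : 0 ≤ |x| * |y| := by positivity
    rcases latK_cases m with h' | h' <;> rw [h'] <;> push_cast <;> linarith
  have h2 : 0 ≤ |x| + |y| := by positivity
  nlinarith

/-- Points of an ellipse lie on one side of a tangent line. -/
theorem tangent_le {m : ℕ} {x y : ℝ} (h : qR m x y ≤ 1) {u : ℤ × ℤ} (hu : u ∈ latUnits m) :
    2 * x * u.1 + latK m * (x * u.2 + y * u.1) + 2 * y * u.2 ≤ 2 := by
  have h1 : latQ m u = 1 := by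
    unfold latUnits at hu
    split_ifs at hu with hm
    · subst hm
      fin_cases hu <;> simp [latQ, latK]
    · fin_cases hu <;> simp [latQ, latK, hm]
  have h2 : qR m u.1 u.2 = 1 := by
    rw [qR_int, h1]
    norm_num
  have h3 := qR_nonneg m (x - u.1) (y - u.2)
  unfold qR at h h2 h3
  linarith

theorem ValidSegs.tip_le (h : s.ValidSegs) (j : Fin s.segs.length) (b : Bool) :
    qR w.bd.length (s.tip j b).1 (s.tip j b).2 ≤ s.size * s.size := by
  rw [qR_int]
  exact_mod_cast (h.1 j).2 b

/-- By strict convexity of the disk, only the ends of a segment can lie on the boundary circle. -/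
theorem ValidSegs.path_lt (h : s.ValidSegs) (j : Fin s.segs.length) {t : I} (h0 : t ≠ 0)
    (h1 : t ≠ 1) : qR w.bd.length ((1 - t) * (s.tip j false).1 + t * (s.tip j true).1)
      ((1 - t) * (s.tip j false).2 + t * (s.tip j true).2) < s.size * s.size := by
  have ht0 : (0 : ℝ) < t := lt_of_le_of_ne t.2.1 fun h => h0 (Subtype.ext h.symm)
  have ht1 : (t : ℝ) < 1 := lt_of_le_of_ne t.2.2 fun h => h1 (Subtype.ext h)
  have hd : 0 < qR w.bd.length ((s.tip j false).1 - (s.tip j true).1)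
      ((s.tip j false).2 - (s.tip j true).2) := by
    refine qR_pos _ ?_
    by_contra hc
    push Not at hc
    refine (h.1 j).1 (Prod.ext ?_ ?_)
    · exact_mod_cast sub_eq_zero.1 hc.1
    · exact_mod_cast sub_eq_zero.1 hc.2
  have e0 := h.tip_le j false
  have e1 := h.tip_le j true
  have key : qR w.bd.length ((1 - t) * (s.tip j false).1 + t * (s.tip j true).1)
      ((1 - t) * (s.tip j false).2 + t * (s.tip j true).2) =
      (1 - t) * qR w.bd.length (s.tip j false).1 (s.tip j false).2 +
      t * qR w.bd.length (s.tip j true).1 (s.tip j true).2 -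
      t * (1 - t) * qR w.bd.length ((s.tip j false).1 - (s.tip j true).1)
        ((s.tip j false).2 - (s.tip j true).2) := by
    unfold qR
    ring
  rw [key]
  have h2 : 0 < t * (1 - t) * qR w.bd.length ((s.tip j false).1 - (s.tip j true).1)
        ((s.tip j false).2 - (s.tip j true).2) := mul_pos (mul_pos ht0 (by linarith)) hd
  have h3 := mul_le_mul_of_nonneg_left e0 (show (0 : ℝ) ≤ 1 - t by linarith)
  have h4 := mul_le_mul_of_nonneg_left e1 ht0.le
  linarith

theorem ValidBoxes.chart_lt (h : s.ValidBoxes) (k : Fin w.n) (z : Disk) :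
    qR w.bd.length ((s.center k).1 + s.radius k * latX (deg w k) z)
      ((s.center k).2 + s.radius k * latY (deg w k) z) < s.size * s.size := by
  obtain ⟨hx, hy⟩ := abs_lat_lt (deg w k) (mem_closedBall_zero_iff.1 z.2)
  obtain ⟨-, hr, hc⟩ := h.2.2.1 k
  have hr' : (0 : ℝ) < s.radius k := by exact_mod_cast hr
  have hc' : |((s.center k).1 : ℝ)| + |((s.center k).2 : ℝ)| + 4 * s.radius k < s.size := by
    exact_mod_cast hc
  refine qR_lt_of_abs _ ?_
  have h1 := abs_add_le ((s.center k).1 : ℝ) (s.radius k * latX (deg w k) z)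
  have h2 := abs_add_le ((s.center k).2 : ℝ) (s.radius k * latY (deg w k) z)
  rw [abs_mul, abs_of_pos hr'] at h1 h2
  nlinarith

/-- Coordinates of a point of an ellipse. -/
theorem ValidBoxes.of_chart_eq (h : s.ValidBoxes) {k : Fin w.n} {z : Disk} {x y : ℝ}
    (hxy : qR w.bd.length x y ≤ s.size * s.size) (he : s.pnt x y = s.chart k z) :
    x = (s.center k).1 + s.radius k * latX (deg w k) z ∧
      y = (s.center k).2 + s.radius k * latY (deg w k) z :=
  pnt_injective h.1 hxy (h.chart_lt k z).le he

theorem qR_lat_le (m : ℕ) (z : Disk) : qR m (latX m z) (latY m z) ≤ 1 := by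
  rw [qR_lat]
  exact pow_le_one₀ (norm_nonneg _) (mem_closedBall_zero_iff.1 z.2)

theorem ValidBoxes.chart_injective (h : s.ValidBoxes) (k : Fin w.n) :
    Function.Injective (s.chart k) := by
  intro z z' hz
  obtain ⟨h1, h2⟩ := h.of_chart_eq (h.chart_lt k z).le hz
  have hr : (0 : ℝ) < s.radius k := by exact_mod_cast (h.2.2.1 k).2.1
  have h3 := mul_left_cancel₀ hr.ne' (add_left_cancel h1)
  have h4 := mul_left_cancel₀ hr.ne' (add_left_cancel h2)
  apply Subtype.ext
  rw [← plane_lat (deg w k) z, h3, h4, plane_lat]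

/-- The neighbourhood of a vertex preserves the orientation: the straight line homotopy to the
identity consists of injective maps, since both coordinates are scaled by positive factors. -/
theorem ValidBoxes.chart_pos (h : s.ValidBoxes) (k : Fin w.n) : diskSurf.pos (s.chart k) := by
  have hr : (0 : ℝ) < s.radius k := by exact_mod_cast (h.2.2.1 k).2.1
  have hN := size_pos h.1
  have hH := latH_pos w.bd.length
  have hH' := latH_pos (deg w k)
  let f : C(I × Disk, ℂ) := ⟨fun p =>
      ((1 - p.1 : ℝ) : ℂ) * p.2 + ((p.1 : ℝ) : ℂ) * s.chart k p.2, by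
    have hc : Continuous fun p : I × Disk => ((s.chart k p.2 : Disk) : ℂ) :=
      continuous_subtype_val.comp ((s.chart k).continuous.comp continuous_snd)
    generalize s.chart k = g at hc
    fun_prop⟩
  have hf : ∀ p, ‖f p‖ ≤ 1 := by
    intro p
    have h1 : ‖(p.2 : ℂ)‖ ≤ 1 := mem_closedBall_zero_iff.1 p.2.2
    have h2 : ‖(s.chart k p.2 : ℂ)‖ ≤ 1 := mem_closedBall_zero_iff.1 (s.chart k p.2).2
    have h3 : (0 : ℝ) ≤ p.1 := p.1.2.1
    have h4 : (0 : ℝ) ≤ 1 - p.1 := sub_nonneg.2 p.1.2.2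
    refine (norm_add_le _ _).trans ?_
    rw [norm_mul, norm_mul, Complex.norm_real, Complex.norm_real, Real.norm_of_nonneg h3,
      Real.norm_of_nonneg h4]
    nlinarith
  refine ⟨⟨⟨toDisk.comp f, ?_, ?_⟩, ?_⟩⟩
  · intro z
    simp [f, toDisk_coe]
  · intro z
    simp [f, toDisk_coe]
  · intro t z z' hz
    have h1 : f (t, z) = f (t, z') := by
      rw [← coe_toDisk (hf (t, z)), ← coe_toDisk (hf (t, z'))]
      exact congrArg Subtype.val hz
    have e : ∀ z : Disk, (s.chart k z : ℂ) = _ := fun z => coe_pnt h.1 (h.chart_lt k z).le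
    have hre := congrArg Complex.re h1
    have him := congrArg Complex.im h1
    simp only [f, ContinuousMap.coe_mk, e, plane, latX, latY, Complex.add_re, Complex.add_im,
      Complex.re_ofReal_mul, Complex.im_ofReal_mul] at hre him
    have ht0 : (0 : ℝ) ≤ t := t.2.1
    have ht1 : (0 : ℝ) ≤ 1 - t := sub_nonneg.2 t.2.2
    have hpos : ∀ a : ℝ, 0 < a → 0 < (1 - t) + t * a := by
      intro a ha
      rcases eq_or_lt_of_le ht0 with h2 | h2
      · rw [← h2]
        norm_num
      · have := mul_pos h2 ha
        linarith
    have h2 : (((1 - t) + t * (latH w.bd.length * (s.radius k / latH (deg w k) / s.size))) *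
        ((z : ℂ).im - (z' : ℂ).im) : ℝ) = 0 := by
      linear_combination him
    have h3 := sub_eq_zero.1 ((mul_eq_zero.1 h2).resolve_left (hpos _ (by positivity)).ne')
    rw [h3] at hre
    have h4 : (((1 - t) + t * (s.radius k / s.size)) * ((z : ℂ).re - (z' : ℂ).re) : ℝ) = 0 := by
      linear_combination hre
    have h5 := sub_eq_zero.1 ((mul_eq_zero.1 h4).resolve_left (hpos _ (by positivity)).ne')
    exact Subtype.ext (Complex.ext h5 h3)

theorem ValidBoxes.chart_disjoint (h : s.ValidBoxes) {k l : Fin w.n} {z z' : Disk}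
    (he : s.chart k z = s.chart l z') : k = l := by
  obtain ⟨h1, h2⟩ := h.of_chart_eq (h.chart_lt k z).le he
  by_contra hkl
  obtain ⟨hx, hy⟩ := abs_lat_lt (deg w k) (mem_closedBall_zero_iff.1 z.2)
  obtain ⟨hx', hy'⟩ := abs_lat_lt (deg w l) (mem_closedBall_zero_iff.1 z'.2)
  have hr : (0 : ℝ) < s.radius k := by exact_mod_cast (h.2.2.1 k).2.1
  have hr' : (0 : ℝ) < s.radius l := by exact_mod_cast (h.2.2.1 l).2.1
  have key : ∀ c c' x x' : ℝ, |x| < 2 → |x'| < 2 → c + s.radius k * x = c' + s.radius l * x' →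
      |c - c'| ≤ 2 * (s.radius k + s.radius l) := by
    intro c c' x x' hx hx' hc
    rw [abs_lt] at hx hx'
    rw [abs_le]
    constructor <;> nlinarith
  rcases h.2.2.2 k l hkl with h3 | h3
  · have h4 := key _ _ _ _ hx hx' h1
    have h5 : (2 * (s.radius k + s.radius l) : ℝ) <
      |((s.center k).1 : ℝ) - (s.center l).1| := by exact_mod_cast h3
    linarith
  · have h4 := key _ _ _ _ hy hy' h2
    have h5 : (2 * (s.radius k + s.radius l) : ℝ) <
      |((s.center k).2 : ℝ) - (s.center l).2| := by exact_mod_cast h3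
    linarith

/-- The interior of a segment does not meet the ellipses, being strictly beyond a tangent line. -/
theorem path_ne_chart (h : s.ValidBoxes) (h' : s.ValidSegs) (j : Fin s.segs.length) {t : I}
    (h0 : t ≠ 0) (h1 : t ≠ 1) (k : Fin w.n) (z : Disk) : s.path j t ≠ s.chart k z := by
  intro he
  obtain ⟨e1, e2⟩ := h.of_chart_eq (h'.path_lt j h0 h1).le he
  have ht0 : (0 : ℝ) < t := lt_of_le_of_ne t.2.1 fun h => h0 (Subtype.ext h.symm)
  have ht1 : (0 : ℝ) < 1 - t := sub_pos.2 (lt_of_le_of_ne t.2.2 fun h => h1 (Subtype.ext h))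
  have hr : (0 : ℝ) < s.radius k := by exact_mod_cast (h.2.2.1 k).2.1
  obtain ⟨u, hu, hle, b, hlt⟩ := h'.2.1 j k
  have h2 := mul_le_mul_of_nonneg_left (tangent_le (qR_lat_le (deg w k) z) hu) hr.le
  have h3 : ∀ b, (latB (deg w k) (s.tip j b - s.center k) u : ℝ) =
      2 * ((s.tip j b).1 - (s.center k).1) * u.1 + latK (deg w k) *
        (((s.tip j b).1 - (s.center k).1) * u.2 + ((s.tip j b).2 - (s.center k).2) * u.1) +
        2 * ((s.tip j b).2 - (s.center k).2) * u.2 := by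
    intro b
    simp [latB]
  have h4 : ∀ b, (2 * s.radius k : ℝ) ≤ latB (deg w k) (s.tip j b - s.center k) u := fun b => by
    exact_mod_cast hle b
  have h5 : (2 * s.radius k : ℝ) < latB (deg w k) (s.tip j b - s.center k) u := by
    exact_mod_cast hlt
  have h6 : (1 - t) * (latB (deg w k) (s.tip j false - s.center k) u : ℝ) +
      t * (latB (deg w k) (s.tip j true - s.center k) u : ℝ) ≤ s.radius k * 2 := by
    refine le_trans (le_of_eq ?_) h2
    rw [h3, h3]
    linear_combination (2 * (u.1 : ℝ) + latK (deg w k) * u.2) * e1 +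
      (2 * (u.2 : ℝ) + latK (deg w k) * u.1) * e2
  have h7 := h4 false
  have h8 := h4 true
  cases b
  · nlinarith
  · nlinarith

/-- Segments do not meet except in endpoints: there is a functional for which the values on one
segment do not exceed those on the other one, and are smaller than the value in at least one of its
ends. -/
theorem path_injective (h : s.ValidBoxes) (h' : s.ValidSegs) {j i : Fin s.segs.length} {t r : I}
    (h0 : t ≠ 0) (h1 : t ≠ 1) (he : s.path j t = s.path i r) : j = i ∧ t = r := by
  have hr : qR w.bd.length ((1 - r) * (s.tip i false).1 + r * (s.tip i true).1)
      ((1 - r) * (s.tip i false).2 + r * (s.tip i true).2) ≤ s.size * s.size := by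
    by_cases hr0 : r = 0
    · simpa [hr0] using h'.tip_le i false
    by_cases hr1 : r = 1
    · simpa [hr1] using h'.tip_le i true
    exact (h'.path_lt i hr0 hr1).le
  obtain ⟨e1, e2⟩ := pnt_injective h.1 (h'.path_lt j h0 h1).le hr he
  have ht0 : (0 : ℝ) < t := lt_of_le_of_ne t.2.1 fun h => h0 (Subtype.ext h.symm)
  have ht1 : (0 : ℝ) < 1 - t := sub_pos.2 (lt_of_le_of_ne t.2.2 fun h => h1 (Subtype.ext h))
  have hr0 : (0 : ℝ) ≤ r := r.2.1
  have hr1 : (0 : ℝ) ≤ 1 - r := sub_nonneg.2 r.2.2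
  by_cases hij : j = i
  · subst hij
    refine ⟨rfl, Subtype.ext ?_⟩
    by_contra hne
    refine (h'.1 j).1 (Prod.ext ?_ ?_)
    · have : ((t : ℝ) - r) * ((s.tip j true).1 - (s.tip j false).1) = 0 := by
        linear_combination e1
      exact_mod_cast (sub_eq_zero.1 ((mul_eq_zero.1 this).resolve_left (sub_ne_zero.2 hne))).symm
    · have : ((t : ℝ) - r) * ((s.tip j true).2 - (s.tip j false).2) = 0 := by
        linear_combination e2
      exact_mod_cast (sub_eq_zero.1 ((mul_eq_zero.1 this).resolve_left (sub_ne_zero.2 hne))).symm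
  · exfalso
    obtain ⟨f, -, hle, c, hlt⟩ := h'.2.2 j i hij
    have g : ∀ j b, (eval f (s.tip j b) : ℝ) = f.1 * (s.tip j b).1 + f.2 * (s.tip j b).2 := by
      intro j b
      simp [eval]
    have hle' : ∀ b c, (eval f (s.tip i b) : ℝ) ≤ eval f (s.tip j c) := fun b c => by
      exact_mod_cast hle b c
    have hlt' : ∀ b, (eval f (s.tip i b) : ℝ) < eval f (s.tip j c) := fun b => by
      exact_mod_cast hlt b
    have key : (1 - t) * (eval f (s.tip j false) : ℝ) + t * eval f (s.tip j true) =
        (1 - r) * (eval f (s.tip i false) : ℝ) + r * eval f (s.tip i true) := by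
      rw [g, g, g, g]
      linear_combination (f.1 : ℝ) * e1 + f.2 * e2
    obtain ⟨b, hb⟩ : ∃ b, (1 - r) * (eval f (s.tip i false) : ℝ) + r * eval f (s.tip i true) ≤
        eval f (s.tip i b) := by
      rcases le_total (eval f (s.tip i false) : ℝ) (eval f (s.tip i true)) with h2 | h2
      · exact ⟨true, by nlinarith⟩
      · exact ⟨false, by nlinarith⟩
    have h2 := hle' b false
    have h3 := hle' b true
    have h4 := hlt' b
    cases c <;> nlinarith

theorem ValidBoxes.chart_port (h : s.ValidBoxes) (k : Fin w.n) {i : ℕ} (hi : i < deg w k) :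
    s.chart k (port (deg w k) i) = s.pnt (s.boxPort k i).1 (s.boxPort k i).2 := by
  have h1 := port_eq_plane (h.2.2.1 k).1 hi
  rw [← plane_lat (deg w k) (port _ _ : ℂ)] at h1
  obtain ⟨h2, h3⟩ := plane_injective _ h1
  change s.pnt _ _ = _
  rw [h2, h3]
  simp [boxPort]

theorem ValidBoxes.boxPort_lt (h : s.ValidBoxes) (k : Fin w.n) {i : ℕ} (hi : i < deg w k) :
    qR w.bd.length (s.boxPort k i).1 (s.boxPort k i).2 < s.size * s.size := by
  have h1 := port_eq_plane (h.2.2.1 k).1 hi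
  rw [← plane_lat (deg w k) (port _ _ : ℂ)] at h1
  obtain ⟨h2, h3⟩ := plane_injective _ h1
  have h4 := h.chart_lt k (port (deg w k) i)
  rw [h2, h3] at h4
  simpa [boxPort] using h4

theorem ValidBoxes.port_eq (h : s.ValidBoxes) {i : ℕ} (hi : i < w.bd.length) :
    port w.bd.length i = s.pnt (s.node (.bd i)).1 (s.node (.bd i)).2 ∧
      qR w.bd.length (s.node (.bd i)).1 (s.node (.bd i)).2 ≤ s.size * s.size := by
  have h1 := port_eq_plane h.2.1 hi
  have hN := size_pos h.1
  have h2 : qR w.bd.length (latPort w.bd.length i).1 (latPort w.bd.length i).2 = 1 := by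
    rw [← norm_plane_eq, ← h1]
    exact norm_port _ _
  have h3 : qR w.bd.length (s.node (.bd i)).1 (s.node (.bd i)).2 ≤ s.size * s.size := by
    refine le_of_eq ?_
    rw [← mul_one ((s.size : ℝ) * s.size), ← h2]
    simp only [node, qR, Prod.smul_fst, Prod.smul_snd, smul_eq_mul]
    push_cast
    ring
  refine ⟨Subtype.ext ?_, h3⟩
  rw [coe_pnt h.1 h3, h1]
  simp only [node, Prod.smul_fst, Prod.smul_snd, smul_eq_mul]
  push_cast
  congr 1 <;> field_simp

theorem tip_eq (h : s.ValidBoxes) (h' : s.ValidSegs) {j : Fin s.segs.length} {b : Bool}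
    {p : ℤ × ℤ} (hp : qR w.bd.length p.1 p.2 ≤ s.size * s.size) :
    endpt s.path (j, b) = s.pnt p.1 p.2 ↔ s.tip j b = p := by
  rw [endpt_path]
  constructor
  · intro he
    obtain ⟨h1, h2⟩ := pnt_injective h.1 (h'.tip_le j b) hp he
    exact Prod.ext (by exact_mod_cast h1) (by exact_mod_cast h2)
  · rintro rfl
    rfl

theorem tip_eq_tip (h : s.ValidBoxes) (h' : s.ValidSegs) {j i : Fin s.segs.length} {b c : Bool} :
    endpt s.path (j, b) = endpt s.path (i, c) ↔ s.tip j b = s.tip i c := by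
  rw [endpt_path (j := i), tip_eq h h' (h'.tip_le i c)]

theorem norm_tip (h : s.ValidBoxes) (h' : s.ValidSegs) (j : Fin s.segs.length) (b : Bool) :
    ‖((endpt s.path (j, b) : Disk) : ℂ)‖ = 1 ↔
      ¬ latQ w.bd.length (s.tip j b) < s.size * s.size := by
  rw [endpt_path, norm_pnt h.1 (h'.tip_le j b), not_lt]
  have := h'.tip_le j b
  rw [qR_int] at this ⊢
  constructor
  · intro h1
    exact_mod_cast h1.ge
  · intro h1
    exact le_antisymm this (by exact_mod_cast h1)

/-- The diagram drawn by a valid sketch. -/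
def diagram (s : Sketch w) (hs : s.Valid) : Diagram diskSurf where
  V := Fin w.n
  E := Fin s.segs.length
  finV := inferInstance
  finE := inferInstance
  label := w.vertex
  chart := s.chart
  path := s.path
  chart_inj := hs.1.chart_injective
  chart_pos := hs.1.chart_pos
  chart_inner k z hz := by
    have h1 := hs.1.chart_lt k z
    exact absurd ((norm_pnt hs.1.1 h1.le).1 hz) h1.ne
  chart_disjoint _ _ _ _ := hs.1.chart_disjoint
  path_inner j t h0 h1 hz := by
    have h2 := hs.2.1.path_lt j h0 h1
    exact absurd ((norm_pnt hs.1.1 h2.le).1 hz) h2.ne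
  path_chart j t h0 h1 := path_ne_chart hs.1 hs.2.1 j h0 h1
  path_inj j t h0 h1 i r := path_injective hs.1 hs.2.1 h0 h1
  end_bdry := by
    rintro ⟨j, b⟩ ⟨i, c⟩ hp hpq
    rcases hs.2.2.1.1 j b with h1 | h1
    · exact (h1 i c ((tip_eq_tip hs.1 hs.2.1).1 hpq.symm)).symm
    · exact absurd h1 ((norm_tip hs.1 hs.2.1 j b).1 hp)
  end_chart := by
    rintro ⟨j, b⟩ k z he
    rcases hs.2.2.1.2.2.2.1 j b k with h1 | ⟨i, hi⟩
    · exfalso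
      rw [endpt_path] at he
      obtain ⟨e1, e2⟩ := hs.1.of_chart_eq (hs.2.1.tip_le j b) he
      have hr : (0 : ℝ) < s.radius k := by exact_mod_cast (hs.1.2.2.1 k).2.1
      have h2 : (s.radius k * s.radius k : ℝ) < latQ (deg w k) (s.tip j b - s.center k) := by
        exact_mod_cast h1
      have h3 := qR_lat_le (deg w k) z
      rw [← qR_int] at h2
      have h4 : qR (deg w k) ((s.tip j b - s.center k).1 : ℤ) ((s.tip j b - s.center k).2 : ℤ) =
          s.radius k * s.radius k * qR (deg w k) (latX (deg w k) z) (latY (deg w k) z) := by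
        simp only [Prod.fst_sub, Prod.snd_sub, Int.cast_sub, e1, e2]
        unfold qR
        ring
      have h5 : (0 : ℝ) < s.radius k * s.radius k := by positivity
      rw [h4] at h2
      nlinarith
    · refine ⟨i, i.2, hs.1.chart_injective k ?_⟩
      rw [← he, hs.1.chart_port k i.2, tip_eq hs.1 hs.2.1 (hs.1.boxPort_lt k i.2).le, hi]
  end_port := by
    intro k i hi
    obtain ⟨j, b, h1, h2⟩ := hs.2.2.1.2.2.2.2.1 k ⟨i, hi⟩
    have e : ∀ j b, endpt s.path (j, b) = s.chart k (port (deg w k) i) ↔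
        s.tip j b = s.boxPort k i := by
      intro j b
      rw [hs.1.chart_port k hi, tip_eq hs.1 hs.2.1 (hs.1.boxPort_lt k hi).le]
    exact ⟨(j, b), (e j b).2 h1, fun ⟨j', b'⟩ h3 => h2 j' b' ((e j' b').1 h3)⟩
  end_joint := by
    rintro ⟨j, b⟩ hb hc
    rcases hs.2.2.1.2.2.2.2.2 j b with ⟨i, hi⟩ | ⟨k, i, hi⟩ | ⟨i, c, hne, h1, h2⟩
    · refine absurd ?_ hb
      have h3 := hs.1.port_eq i.2
      change ‖((endpt s.path (j, b) : Disk) : ℂ)‖ = 1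
      rw [(tip_eq hs.1 hs.2.1 h3.2).2 hi, ← h3.1]
      exact norm_port _ _
    · refine absurd ?_ (hc k (port (deg w k) i))
      rw [hs.1.chart_port k i.2, tip_eq hs.1 hs.2.1 (hs.1.boxPort_lt k i.2).le, hi]
    · refine ⟨(i, c), ⟨hne, (tip_eq_tip hs.1 hs.2.1).2 h1⟩, ?_⟩
      rintro ⟨i', c'⟩ ⟨h3, h4⟩
      exact (h2 i' c' ((tip_eq_tip hs.1 hs.2.1).1 h4)).resolve_left h3

/-- A valid sketch gives a picture, after the union of the segments of every polygonal path. -/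
theorem exists_picture {s : Sketch w} (hs : s.Valid) : Nonempty (Picture w) := by
  have hends := hs.2.2.1
  refine (exists_picture_of_chainCheck (S := diskSurf) (o := .oriented) (A := ℤ) (M' := ∅)
    (w := w) (s.diagram hs) ?_ (Equiv.refl _) (fun _ => rfl) (fun j => s.segs.get j)
    (fun p => s.pnt p.1 p.2) (fun j => ?_) (fun j => ?_) s.segs (fun j => List.get_mem _ j)
    (fun l hl => List.get_of_mem hl) s.node ?_ hs.2.2.2.2).elim fun Q _ => ⟨Q⟩
  · intro z hz
    constructor
    · rintro ⟨⟨j, b⟩, rfl⟩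
      rcases hends.2.1 j b with h1 | ⟨i, hi⟩
      · exact absurd h1 ((norm_tip hs.1 hs.2.1 j b).1 hz)
      · have h3 := hs.1.port_eq i.2
        exact ⟨i, i.2, ((tip_eq hs.1 hs.2.1 h3.2).2 hi).trans h3.1.symm⟩
    · rintro ⟨i, hi, rfl⟩
      obtain ⟨j, b, hj⟩ := hends.2.2.1 ⟨i, hi⟩
      have h3 := hs.1.port_eq hi
      exact ⟨(j, b), ((tip_eq hs.1 hs.2.1 h3.2).2 hj).trans h3.1.symm⟩
  · refine Eq.trans ?_ (endpt_path s j false)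
    simp [endpt, diagram]
  · refine Eq.trans ?_ (endpt_path s j true)
    simp [endpt, diagram]
  · intro j b
    have h1 := hs.2.2.2.1 j b
    generalize w.place j b = x at h1
    cases x with
    | bd i => exact (hs.1.port_eq h1).1.symm
    | vx k i => exact (hs.1.chart_port k h1).symm

end Sketch

/-! ### Operations on local skein modules -/

section
variable {w : Wiring}

/-- The number of marked points of a vertex. -/
abbrev Wiring.deg (w : Wiring) (k : Fin w.n) : ℕ := (w.vertex k).signs.length

/-- The vertices of a picture for which the given diagrams are tangles that fit. -/
def Wiring.fits (w : Wiring) (f : Fin w.n → Option (Diagram diskSurf)) : Set (Fin w.n) :=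
  {k | ∃ T, f k = some T ∧ HasPorts (w.deg k) T}

theorem Picture.fits_hasPorts (Q : Picture w) (f : Fin w.n → Option (Diagram diskSurf)) :
    ∀ k ∈ w.fits f, HasPorts (w.deg k) ((f k).getD Q.T) := by
  rintro k ⟨T, hT, h⟩
  rw [hT]
  exact h

/-- The tangle obtained from a picture by insertion of the given diagrams at its vertices; the
vertices with the value `none` remain unchanged. (The vertices where a diagram does not fit also
remain unchanged.) -/
def Picture.tg (Q : Picture w) (f : Fin w.n → Option (Diagram diskSurf)) : Tg w.bd.length :=
  Q.fillTg (w.fits f) (fun k => (f k).getD Q.T) (Q.fits_hasPorts f)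

variable {F : Type} [TopologicalSpace F] {S : Surf F} {o : Mode} {A : Type*} [CommRing A]
  {M' : KnotTheory o A}

theorem Picture.cls_tg_unique (hw : w.Connected) (Q Q' : Picture w)
    (f : Fin w.n → Option (Diagram diskSurf)) : cls S M' (Q.tg f) = cls S M' (Q'.tg f) := by
  refine Q.skSame hw Q' _ _ _ _ _ _ (fun v => ?_) (fun v hv => ?_) _ _ _
  · simp
  · obtain ⟨T, hT, -⟩ := hv
    simp [hT]

/-- Composition of pictures. -/
theorem exists_comp_tg {h : Wiring} {u : Fin h.n → Wiring} {P : Fin h.n → Bool} {w : Wiring}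
    {s : Fin w.n → List ℕ} (hs : compCheck h u P w s = true) (H : Picture h)
    (U : ∀ i, Picture (u i)) :
    ∃ Q : Picture w, ∀ (g : Fin h.n → Option (Diagram diskSurf))
      (gU : ∀ i, Fin (u i).n → Option (Diagram diskSurf)) (f : Fin w.n → Option (Diagram diskSurf)),
      (∀ i, P i = true → g i = some ((U i).tg (gU i)).1) →
      (∀ k i, s k = [i.1] → f k = g i) →
      (∀ k i (a : Fin (u i).n), s k = [i.1, a.1] → f k = gU i a) →
      ∀ m hm hm', cls S M' (⟨(H.tg g).1, hm⟩ : Tg m) = cls S M' ⟨(Q.tg f).1, hm'⟩ := by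
  classical
  obtain ⟨Q, hQ⟩ := exists_comp (S := S) (M' := M') hs H U
  simp only [compCheck, Bool.and_eq_true, List.all_eq_true, List.mem_finRange, true_imp_iff,
    Bool.or_eq_true, decide_eq_true_eq, List.any_eq_true, true_and, Bool.not_eq_true',
    decide_not, decide_eq_false_iff_not, ← imp_iff_not_or, ne_eq] at hs
  obtain ⟨⟨⟨⟨⟨⟨hbd, hlen⟩, hmem⟩, hinj⟩, hsurj⟩, hlab⟩, hch⟩ := hs
  refine ⟨Q, fun g gU f h1 h2 h3 m hm hm' => ?_⟩
  refine hQ _ _ (Q.fits_hasPorts f) _ _ (H.fits_hasPorts g) _ (fun i k => (gU i k).getD (U i).T)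
    (fun i => (U i).fits_hasPorts (gU i)) ?_ ?_ ?_ m hm hm'
  · intro i hi
    refine ⟨⟨_, h1 i hi, ?_⟩, ?_⟩
    · rcases hlen i with h4 | h4
      · rw [hi] at h4
        cases h4
      · have h5 : ∀ n, (u i).bd.length = n → HasPorts n ((U i).tg (gU i)).1 := by
          rintro _ rfl
          exact ((U i).tg (gU i)).2
        exact h5 _ h4
    · rw [h1 i hi]
      rfl
  · intro k i hk
    have h4 := h2 k i hk
    have h5 : w.deg k = h.deg i := by rw [Wiring.deg, Wiring.deg, (hlab k i).1 hk]
    refine ⟨?_, ?_⟩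
    · simp only [Wiring.fits, Set.mem_ofPred_eq]
      rw [h4, h5]
    · rintro ⟨T, hT, -⟩
      rw [← h4, hT]
      rfl
  · intro k i a hk
    have h4 := h3 k i a hk
    have h5 : w.deg k = (u i).deg a := by rw [Wiring.deg, Wiring.deg, (hlab k i).2 a hk]
    refine ⟨?_, ?_⟩
    · simp only [Wiring.fits, Set.mem_ofPred_eq]
      rw [h4, h5]
    · rintro ⟨T, hT, -⟩
      rw [← h4, hT]
      rfl

/-- Insertion at a vertex of a picture, as an operation on local skein modules; at the other
vertices fixed tangles are inserted. -/
def Picture.opAt (M' : KnotTheory o A) (Q : Picture w) (f : Fin w.n → Option (Diagram diskSurf))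
    (k : Fin w.n) (hk : f k = none) : Sk S M' (w.deg k) →ₗ[A] Sk S M' w.bd.length :=
  plugOp M' (Q.tg f).1 (Q.tg f).2 (Sum.inl ⟨Q.v k, by
    rintro ⟨T, hT, -⟩
    rw [Equiv.symm_apply_apply, hk] at hT
    cases hT⟩) (congrArg _ (congrArg _ (Q.label_eq k)))

theorem Picture.opAt_cls (Q : Picture w) (f : Fin w.n → Option (Diagram diskSurf))
    (k : Fin w.n) (hk : f k = none) (T : Tg (w.deg k)) :
    Q.opAt M' f k hk (cls S M' T) = cls S M' (Q.tg (Function.update f k (some T.1))) := by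
  classical
  have hl : HasPorts (Q.T.label (Q.v k)).signs.length T.1 := by
    rw [Q.label_eq]
    exact T.2
  have hkn : Q.v k ∉ Q.v.symm ⁻¹' w.fits f := by
    rintro ⟨T, hT, -⟩
    rw [Equiv.symm_apply_apply, hk] at hT
    cases hT
  have hset : Q.v.symm ⁻¹' w.fits (Function.update f k (some T.1)) =
      insert (Q.v k) (Q.v.symm ⁻¹' w.fits f) := by
    ext v
    obtain ⟨l, rfl⟩ := Q.v.surjective v
    by_cases hkl : l = k
    · subst hkl
      refine iff_of_true ⟨T.1, ?_, ?_⟩ (Set.mem_insert _ _)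
      · simp
      · simpa using T.2
    · simp [Wiring.fits, hkl]
  have e := Q.T.fillInsert (Q.v.symm ⁻¹' w.fits f) (fun x => (f (Q.v.symm x)).getD Q.T)
    (Q.isTangle_fill (Q.fits_hasPorts f)) (Q.v k) hkn T.1 hl _ hset
    (fun x => (Function.update f k (some T.1) (Q.v.symm x)).getD Q.T)
    (Q.isTangle_fill (Q.fits_hasPorts _)) (by
      rintro v ⟨U, hU, -⟩
      have : Q.v.symm v ≠ k := by
        rintro rfl
        rw [hk] at hU
        cases hU
      simp [this]) (by simp)
  have h1 := plugOp_cls (M' := M') (S := S) (Q.tg f).1 (Q.tg f).2 (Sum.inl ⟨Q.v k, hkn⟩)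
    (congrArg _ (congrArg _ (Q.label_eq k))) T hl
  have h2 := cls_eq_of_relabel (S := S) (M' := M')
    (T := ⟨_, hasPorts_plug (D := (Q.tg f).1) (v := Sum.inl ⟨Q.v k, hkn⟩) (hT := hl) |>.2
      (Q.tg f).2⟩)
    (T' := Q.tg (Function.update f k (some T.1))) e
  exact h1.trans h2

/-- Insertion at two vertices of a picture, as a bilinear operation. -/
def Picture.op₂ (M' : KnotTheory o A) (Q : Picture w) (f : Fin w.n → Option (Diagram diskSurf))
    (k l : Fin w.n) (hkl : l ≠ k) (hk : f k = none) (hl : f l = none) :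
    Sk S M' (w.deg k) →ₗ[A] Sk S M' (w.deg l) →ₗ[A] Sk S M' w.bd.length :=
  Submodule.liftQ _ (Finsupp.linearCombination A fun T : Tg (w.deg k) =>
    Q.opAt M' (Function.update f k (some T.1)) l (by rw [Function.update_of_ne hkl, hl])) (by
    have h : ∀ (x : Tg (w.deg k) →₀ A) (U : Tg (w.deg l)), Finsupp.linearCombination A
        (fun T : Tg (w.deg k) => Q.opAt M' (Function.update f k (some T.1)) l
          (by rw [Function.update_of_ne hkl, hl])) x (cls S M' U) =
        Q.opAt M' (Function.update f l (some U.1)) k (by rw [Function.update_of_ne hkl.symm, hk])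
          ((Null S M' (w.deg k)).mkQ x) := by
      intro x U
      induction x using Finsupp.induction_linear with
      | zero => simp
      | add x y hx hy => rw [map_add, map_add, map_add, LinearMap.add_apply, hx, hy]
      | single T a =>
        rw [Finsupp.linearCombination_single, LinearMap.smul_apply, opAt_cls,
          ← mul_one a, ← smul_eq_mul, ← Finsupp.smul_single, map_smul, map_smul, smul_eq_mul,
          mul_one]
        congr 1
        refine Eq.trans ?_ (Q.opAt_cls _ _ _ _).symm
        rw [Function.update_comm hkl]
    intro x hx
    rw [LinearMap.mem_ker]
    refine Sk.hom_ext fun U => ?_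
    rw [h, Submodule.mkQ_apply, (Submodule.Quotient.mk_eq_zero _).2 hx, map_zero,
      LinearMap.zero_apply])

theorem Picture.op₂_cls (Q : Picture w) (f : Fin w.n → Option (Diagram diskSurf))
    (k l : Fin w.n) (hkl : l ≠ k) (hk : f k = none) (hl : f l = none) (T : Tg (w.deg k))
    (U : Tg (w.deg l)) : Q.op₂ M' f k l hkl hk hl (cls S M' T) (cls S M' U) =
      cls S M' (Q.tg (Function.update (Function.update f k (some T.1)) l (some U.1))) := by
  rw [← opAt_cls _ _ _ (by rw [Function.update_of_ne hkl, hl])]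
  simp [Picture.op₂, cls]

end

/-! ### Wirings for products, closures and bigons, and drawings of basic pictures -/

/-- A place for a 2-tangle. -/
abbrev box₄ : Label := .box crossSigns

/-- Three strands directed upwards. -/
abbrev tripleSigns : List Bool := [true, true, true, false, false, false]

/-- A place for a 3-tangle. -/
abbrev box₆ : Label := .box tripleSigns

/-- A place for a 1-tangle. -/
abbrev box₂ : Label := .box [true, false]

/-- A single crossing. -/
abbrev crossing (l : Label) : Wiring where
  bd := crossSigns
  n := 1
  vertex := ![l]
  edges := [(.bd 0, .vx 0 0), (.bd 1, .vx 0 1), (.vx 0 2, .bd 2), (.vx 0 3, .bd 3)]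

/-- Two 3-tangles, stacked along the strands. -/
abbrev stack : Wiring where
  bd := tripleSigns
  n := 2
  vertex := ![box₆, box₆]
  edges := [(.bd 0, .vx 0 0), (.bd 1, .vx 0 1), (.bd 2, .vx 0 2), (.vx 0 5, .vx 1 0),
    (.vx 0 4, .vx 1 1), (.vx 0 3, .vx 1 2), (.vx 1 5, .bd 5), (.vx 1 4, .bd 4), (.vx 1 3, .bd 3)]

/-- A 2-tangle on the strands `1, 2` of three parallel strands. -/
abbrev besideLeft : Wiring where
  bd := tripleSigns
  n := 1
  vertex := ![box₄]
  edges := [(.bd 0, .vx 0 0), (.bd 1, .vx 0 1), (.vx 0 3, .bd 5), (.vx 0 2, .bd 4), (.bd 2, .bd 3)]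

/-- A 2-tangle on the strands `2, 3` of three parallel strands. -/
abbrev besideRight : Wiring where
  bd := tripleSigns
  n := 1
  vertex := ![box₄]
  edges := [(.bd 0, .bd 5), (.bd 1, .vx 0 0), (.bd 2, .vx 0 1), (.vx 0 3, .bd 4), (.vx 0 2, .bd 3)]

/-- The closure of the left strand of a 3-tangle. -/
abbrev closeLeft : Wiring where
  bd := crossSigns
  n := 1
  vertex := ![box₆]
  edges := [(.vx 0 5, .vx 0 0), (.bd 0, .vx 0 1), (.bd 1, .vx 0 2), (.vx 0 4, .bd 3),
    (.vx 0 3, .bd 2)]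

/-- The closure of the right strand of a 3-tangle. -/
abbrev closeRight : Wiring where
  bd := crossSigns
  n := 1
  vertex := ![box₆]
  edges := [(.vx 0 3, .vx 0 2), (.bd 0, .vx 0 0), (.bd 1, .vx 0 1), (.vx 0 5, .bd 3),
    (.vx 0 4, .bd 2)]

/-- Two 2-tangles stacked along the strands, with a 1-tangle on the left strand between them. -/
abbrev bridgeLeft : Wiring where
  bd := crossSigns
  n := 3
  vertex := ![box₄, box₂, box₄]
  edges := [(.bd 0, .vx 0 0), (.bd 1, .vx 0 1), (.vx 0 3, .vx 1 0), (.vx 1 1, .vx 2 0),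
    (.vx 0 2, .vx 2 1), (.vx 2 3, .bd 3), (.vx 2 2, .bd 2)]

/-- Two 2-tangles stacked along the strands, with a 1-tangle on the right strand between them. -/
abbrev bridgeRight : Wiring where
  bd := crossSigns
  n := 3
  vertex := ![box₄, box₂, box₄]
  edges := [(.bd 0, .vx 0 0), (.bd 1, .vx 0 1), (.vx 0 3, .vx 2 0), (.vx 0 2, .vx 1 0),
    (.vx 1 1, .vx 2 1), (.vx 2 3, .bd 3), (.vx 2 2, .bd 2)]

/-- The clockwise bigon, with the boundary points renumbered by a rotation. -/
abbrev antiLink : Wiring where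
  bd := [true, false, true, false]
  n := 2
  vertex := ![box₄, box₄]
  edges := [(.vx 1 3, .bd 1), (.bd 2, .vx 1 0), (.vx 0 3, .bd 3), (.bd 0, .vx 0 0),
    (.vx 0 2, .vx 1 1), (.vx 1 2, .vx 0 1)]

/-- The counterclockwise bigon, with the boundary points renumbered by a rotation. -/
abbrev antiLink' : Wiring where
  bd := [false, true, false, true]
  n := 2
  vertex := ![box₄, box₄]
  edges := [(.vx 0 3, .vx 1 0), (.vx 1 3, .vx 0 0), (.bd 1, .vx 1 1), (.vx 1 2, .bd 2),
    (.bd 3, .vx 0 1), (.vx 0 2, .bd 0)]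

/-- The counterclockwise bigon, with a place for a tangle between its antiparallel strands. -/
abbrev bigonHost : Wiring where
  bd := [true, false, true, false]
  n := 3
  vertex := ![box₄, box₄, .box [false, true, false, true]]
  edges := [(.bd 0, .vx 0 1), (.vx 1 2, .bd 3), (.vx 1 3, .vx 0 0), (.vx 0 3, .vx 1 0),
    (.vx 2 0, .bd 1), (.bd 2, .vx 2 1), (.vx 2 2, .vx 1 1), (.vx 0 2, .vx 2 3)]

/-- The clockwise bigon, with a place for a tangle between its antiparallel strands. -/
abbrev bigonHost' : Wiring where
  bd := [false, true, false, true]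
  n := 3
  vertex := ![box₄, box₄, .box [true, false, true, false]]
  edges := [(.bd 1, .vx 2 0), (.vx 2 1, .bd 2), (.vx 0 3, .vx 2 2), (.vx 2 3, .vx 1 0),
    (.bd 3, .vx 0 0), (.vx 0 2, .vx 1 1), (.vx 1 2, .vx 0 1), (.vx 1 3, .bd 0)]

instance : Nonempty (Picture (parallelBigon box₄ box₄)) :=
  Sketch.exists_picture (s :=
    { size := 9
      center := ![(2, 2), (0, -3)]
      radius := ![1, 1]
      segs := [
      ((9, 0), (4, 0)), ((4, 0), (4, 2)), ((4, 2), (3, 2)), ((0, 9), (0, 4)), ((0, 4), (2, 4)),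
      ((2, 4), (2, 3)), ((2, 1), (2, -3)), ((2, -3), (1, -3)), ((1, 2), (0, 2)),
      ((0, 2), (0, -2)), ((0, -4), (0, -9)), ((-1, -3), (-8, -3)), ((-8, -3), (-8, 0)),
      ((-8, 0), (-9, 0))] }) (by decide +kernel)

instance : Nonempty (Picture stack) :=
  Sketch.exists_picture (s :=
    { size := 12
      center := ![(0, 0), (0, -5)]
      radius := ![1, 1]
      segs := [
      ((12, 0), (1, 0)), ((0, 12), (0, 1)), ((-12, 12), (-1, 12)), ((-1, 12), (-1, 1)),
      ((1, -1), (2, -1)), ((2, -1), (2, -5)), ((2, -5), (1, -5)), ((0, -1), (0, -4)),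
      ((-1, 0), (-2, 0)), ((-2, 0), (-2, -4)), ((-2, -4), (-1, -4)), ((1, -6), (12, -6)),
      ((12, -6), (12, -12)), ((0, -6), (0, -12)), ((-1, -5), (-8, -5)), ((-8, -5), (-8, 0)),
      ((-8, 0), (-12, 0))] }) (by decide +kernel)

instance : Nonempty (Picture besideLeft) :=
  Sketch.exists_picture (s :=
    { size := 8
      center := ![(3, 0)]
      radius := ![1]
      segs := [
      ((8, 0), (4, 0)), ((0, 8), (0, 2)), ((0, 2), (3, 2)), ((3, 2), (3, 1)), ((3, -1), (3, -8)),
      ((3, -8), (8, -8)), ((2, 0), (0, 0)), ((0, 0), (0, -8)), ((-8, 8), (-7, 8)),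
      ((-7, 8), (-7, 0)), ((-7, 0), (-8, 0))] }) (by decide +kernel)

instance : Nonempty (Picture besideRight) :=
  Sketch.exists_picture (s :=
    { size := 8
      center := ![(-2, 0)]
      radius := ![1]
      segs := [
      ((8, 0), (7, 0)), ((7, 0), (7, -8)), ((7, -8), (8, -8)), ((0, 8), (0, 0)),
      ((0, 0), (-1, 0)), ((-8, 8), (-2, 8)), ((-2, 8), (-2, 1)), ((-2, -1), (-2, -6)),
      ((-2, -6), (0, -6)), ((0, -6), (0, -8)), ((-3, 0), (-8, 0))] }) (by decide +kernel)

instance : Nonempty (Picture closeLeft) :=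
  Sketch.exists_picture (s :=
    { size := 8
      center := ![(0, -3)]
      radius := ![1]
      segs := [
      ((1, -4), (2, -4)), ((2, -4), (2, -3)), ((2, -3), (1, -3)), ((8, 0), (0, 0)),
      ((0, 0), (0, -2)), ((0, 8), (0, 1)), ((0, 1), (-1, 1)), ((-1, 1), (-1, -2)),
      ((0, -4), (0, -8)), ((-1, -3), (-7, -3)), ((-7, -3), (-7, 0)), ((-7, 0), (-8, 0))] })
    (by decide +kernel)

instance : Nonempty (Picture closeRight) :=
  Sketch.exists_picture (s :=
    { size := 8
      center := ![(0, 3)]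
      radius := ![1]
      segs := [
      ((-1, 3), (-2, 3)), ((-2, 3), (-2, 4)), ((-2, 4), (-1, 4)), ((8, 0), (2, 0)),
      ((2, 0), (2, 3)), ((2, 3), (1, 3)), ((0, 8), (0, 4)), ((1, 2), (1, -7)), ((1, -7), (0, -7)),
      ((0, -7), (0, -8)), ((0, 2), (0, 0)), ((0, 0), (-8, 0))] }) (by decide +kernel)

instance : Nonempty (Picture parallelStrands) :=
  Sketch.exists_picture (s :=
    { size := 4
      center := Fin.elim0
      radius := Fin.elim0
      segs := [
      ((4, 0), (1, 0)), ((1, 0), (1, -3)), ((1, -3), (0, -3)), ((0, -3), (0, -4)),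
      ((0, 4), (0, 0)), ((0, 0), (-4, 0))] }) (by decide +kernel)

instance : Nonempty (Picture strand) :=
  Sketch.exists_picture (s :=
    { size := 3
      center := Fin.elim0
      radius := Fin.elim0
      segs := [
      ((3, 0), (-3, 0))] }) (by decide +kernel)

instance : Nonempty (Picture antiStrands) :=
  Sketch.exists_picture (s :=
    { size := 4
      center := Fin.elim0
      radius := Fin.elim0
      segs := [
      ((4, 0), (1, 0)), ((1, 0), (1, -3)), ((1, -3), (0, -3)), ((0, -3), (0, -4)),
      ((-4, 0), (0, 0)), ((0, 0), (0, 4))] }) (by decide +kernel)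

instance : Nonempty (Picture antiStrands') :=
  Sketch.exists_picture (s :=
    { size := 4
      center := Fin.elim0
      radius := Fin.elim0
      segs := [
      ((0, -4), (0, -1)), ((0, -1), (3, -1)), ((3, -1), (3, 0)), ((3, 0), (4, 0)),
      ((0, 4), (0, 0)), ((0, 0), (-4, 0))] }) (by decide +kernel)

instance : Nonempty (Picture (loopRight box₄)) :=
  Sketch.exists_picture (s :=
    { size := 6
      center := ![(0, 0)]
      radius := ![1]
      segs := [
      ((6, 0), (1, 0)), ((-1, 0), (-2, 0)), ((-2, 0), (-2, 2)), ((-2, 2), (0, 2)),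
      ((0, 2), (0, 1)), ((0, -1), (0, -2)), ((0, -2), (-5, -2)), ((-5, -2), (-5, 0)),
      ((-5, 0), (-6, 0))] }) (by decide +kernel)

instance : Nonempty (Picture (loopLeft box₄)) :=
  Sketch.exists_picture (s :=
    { size := 6
      center := ![(0, 0)]
      radius := ![1]
      segs := [
      ((6, 0), (3, 0)), ((3, 0), (3, 2)), ((3, 2), (0, 2)), ((0, 2), (0, 1)), ((0, -1), (0, -2)),
      ((0, -2), (2, -2)), ((2, -2), (2, 0)), ((2, 0), (1, 0)), ((-1, 0), (-6, 0))] })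
    (by decide +kernel)

instance : Nonempty (Picture bridgeLeft) :=
  Sketch.exists_picture (s :=
    { size := 12
      center := ![(0, 2), (2, -5), (-7, 0)]
      radius := ![1, 1, 1]
      segs := [
      ((12, 0), (2, 0)), ((2, 0), (2, 2)), ((2, 2), (1, 2)), ((0, 12), (0, 3)), ((0, 1), (0, -3)),
      ((0, -3), (4, -3)), ((4, -3), (4, -5)), ((4, -5), (3, -5)), ((1, -5), (-5, -5)),
      ((-5, -5), (-5, 0)), ((-5, 0), (-6, 0)), ((-1, 2), (-7, 2)), ((-7, 2), (-7, 1)),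
      ((-7, -1), (-7, -9)), ((-7, -9), (0, -9)), ((0, -9), (0, -12)), ((-8, 0), (-12, 0))] })
    (by decide +kernel)

instance : Nonempty (Picture bridgeRight) :=
  Sketch.exists_picture (s :=
    { size := 12
      center := ![(5, 2), (0, 2), (-7, 0)]
      radius := ![1, 1, 1]
      segs := [
      ((12, 0), (7, 0)), ((7, 0), (7, 2)), ((7, 2), (6, 2)), ((0, 12), (0, 4)), ((0, 4), (5, 4)),
      ((5, 4), (5, 3)), ((5, 1), (5, 0)), ((5, 0), (-6, 0)), ((4, 2), (1, 2)), ((-1, 2), (-7, 2)),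
      ((-7, 2), (-7, 1)), ((-7, -1), (-7, -9)), ((-7, -9), (0, -9)), ((0, -9), (0, -12)),
      ((-8, 0), (-12, 0))] }) (by decide +kernel)

instance : Nonempty (Picture antiLink) :=
  Sketch.exists_picture (s :=
    { size := 9
      center := ![(0, -3), (2, 2)]
      radius := ![1, 1]
      segs := [
      ((2, 1), (2, 0)), ((2, 0), (5, 0)), ((5, 0), (5, 7)), ((5, 7), (0, 7)), ((0, 7), (0, 9)),
      ((-9, 0), (-3, 0)), ((-3, 0), (-3, 5)), ((-3, 5), (4, 5)), ((4, 5), (4, 2)),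
      ((4, 2), (3, 2)), ((0, -4), (0, -9)), ((9, 0), (6, 0)), ((6, 0), (6, -3)),
      ((6, -3), (1, -3)), ((-1, -3), (-2, -3)), ((-2, -3), (-2, 4)), ((-2, 4), (2, 4)),
      ((2, 4), (2, 3)), ((1, 2), (0, 2)), ((0, 2), (0, -2))] }) (by decide +kernel)

instance : Nonempty (Picture antiLink') :=
  Sketch.exists_picture (s :=
    { size := 9
      center := ![(-3, -1), (0, 4)]
      radius := ![1, 1]
      segs := [
      ((-3, -2), (-3, -3)), ((-3, -3), (2, -3)), ((2, -3), (2, 4)), ((2, 4), (1, 4)),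
      ((0, 3), (0, -1)), ((0, -1), (-2, -1)), ((0, 9), (0, 5)), ((-1, 4), (-8, 4)),
      ((-8, 4), (-8, 0)), ((-8, 0), (-9, 0)), ((0, -9), (0, -5)), ((0, -5), (-6, -5)),
      ((-6, -5), (-6, 1)), ((-6, 1), (-3, 1)), ((-3, 1), (-3, 0)), ((-4, -1), (-5, -1)),
      ((-5, -1), (-5, -4)), ((-5, -4), (8, -4)), ((8, -4), (8, 0)), ((8, 0), (9, 0))] })
    (by decide +kernel)

instance : Nonempty (Picture bigonHost) :=
  Sketch.exists_picture (s :=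
    { size := 12
      center := ![(6, 1), (2, -5), (-2, 3)]
      radius := ![1, 1, 1]
      segs := [
      ((12, 0), (9, 0)), ((9, 0), (9, 3)), ((9, 3), (6, 3)), ((6, 3), (6, 2)), ((1, -5), (0, -5)),
      ((0, -5), (0, -12)), ((2, -6), (2, -7)), ((2, -7), (8, -7)), ((8, -7), (8, 1)),
      ((8, 1), (7, 1)), ((6, 0), (6, -5)), ((6, -5), (3, -5)), ((-1, 3), (0, 3)),
      ((0, 3), (0, 12)), ((-12, 0), (-5, 0)), ((-5, 0), (-5, 5)), ((-5, 5), (-2, 5)),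
      ((-2, 5), (-2, 4)), ((-3, 3), (-4, 3)), ((-4, 3), (-4, -3)), ((-4, -3), (2, -3)),
      ((2, -3), (2, -4)), ((5, 1), (-2, 1)), ((-2, 1), (-2, 2))] }) (by decide +kernel)

instance : Nonempty (Picture bigonHost') :=
  Sketch.exists_picture (s :=
    { size := 12
      center := ![(-2, -5), (3, -3), (-3, 4)]
      radius := ![1, 1, 1]
      segs := [
      ((0, 12), (0, 4)), ((0, 4), (-2, 4)), ((-3, 5), (-3, 6)), ((-3, 6), (-10, 6)),
      ((-10, 6), (-10, 0)), ((-10, 0), (-12, 0)), ((-2, -6), (-2, -7)), ((-2, -7), (-5, -7)),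
      ((-5, -7), (-5, 4)), ((-5, 4), (-4, 4)), ((-3, 3), (-3, 0)), ((-3, 0), (5, 0)),
      ((5, 0), (5, -3)), ((5, -3), (4, -3)), ((0, -12), (0, -5)), ((0, -5), (-1, -5)),
      ((-3, -5), (-4, -5)), ((-4, -5), (-4, -1)), ((-4, -1), (3, -1)), ((3, -1), (3, -2)),
      ((2, -3), (-2, -3)), ((-2, -3), (-2, -4)), ((3, -4), (3, -5)), ((3, -5), (10, -5)),
      ((10, -5), (10, 0)), ((10, 0), (12, 0))] }) (by decide +kernel)

instance : Nonempty (Picture (crossing .pos)) :=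
  Sketch.exists_picture (s :=
    { size := 5
      center := ![(0, 0)]
      radius := ![1]
      segs := [
      ((5, 0), (1, 0)), ((0, 5), (0, 1)), ((-1, 0), (-5, 0)), ((0, -1), (0, -5))] })
    (by decide +kernel)

instance : Nonempty (Picture (crossing .neg)) :=
  Sketch.exists_picture (s :=
    { size := 5
      center := ![(0, 0)]
      radius := ![1]
      segs := [
      ((5, 0), (1, 0)), ((0, 5), (0, 1)), ((-1, 0), (-5, 0)), ((0, -1), (0, -5))] })
    (by decide +kernel)

/-! ### Tangles drawn from pictures -/

section
variable {F : Type} [TopologicalSpace F] {S : Surf F} {o : Mode} {A : Type*} [CommRing A]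
  {M' : KnotTheory o A}

/-- A tangle obtained by insertion of the given diagrams in some drawing of a picture. -/
def draw (w : Wiring) [Nonempty (Picture w)] (f : Fin w.n → Option (Diagram diskSurf)) :
    Tg w.bd.length :=
  (Classical.arbitrary (Picture w)).tg f

/-- The diagram inserted at the vertex with the given code. -/
def lookup {h : Wiring} {u : Fin h.n → Wiring} (g : Fin h.n → Option (Diagram diskSurf))
    (gU : ∀ i, Fin (u i).n → Option (Diagram diskSurf)) : List ℕ → Option (Diagram diskSurf)
  | [i] => if hi : i < h.n then g ⟨i, hi⟩ else none
  | [i, a] => if hi : i < h.n then if ha : a < (u ⟨i, hi⟩).n then gU ⟨i, hi⟩ ⟨a, ha⟩ else none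
      else none
  | _ => none

/-- A wiring composed of wirings that have pictures has a picture. -/
theorem nonempty_picture_of_comp (h : Wiring) [hh : Nonempty (Picture h)] (u : Fin h.n → Wiring)
    (P : Fin h.n → Bool) {w : Wiring} (s : Fin w.n → List ℕ)
    (hs : compCheck h u P w s = true := by decide +kernel)
    (hu : ∀ i, Nonempty (Picture (u i)) := by
      intro i; fin_cases i <;> (dsimp; infer_instance)) : Nonempty (Picture w) := by
  obtain ⟨Q, -⟩ := exists_comp_tg (S := diskSurf) (o := .oriented) (A := ℤ) (M' := ∅) hs
    hh.some fun i => (hu i).some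
  exact ⟨Q⟩

/-- A wiring that has a picture, together with diagrams to be inserted at its vertices. -/
structure Piece where
  w : Wiring
  [nonempty : Nonempty (Picture w)]
  f : Fin w.n → Option (Diagram diskSurf)

attribute [instance] Piece.nonempty

/-- The composition law for the tangles obtained from pictures: `u` are the wirings of the inserted
pieces, and the remaining data are as in `compCheck`. A picture is inserted only at the vertices `i`
with `P i = true`; at the other ones the value of `u` is immaterial, and `strand` is used below. -/
theorem cls_draw_comp {h : Wiring} [Nonempty (Picture h)] (U : Fin h.n → Piece)
    (u : Fin h.n → Wiring) (P : Fin h.n → Bool) {w : Wiring} [Nonempty (Picture w)]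
    (s : Fin w.n → List ℕ) {g : Fin h.n → Option (Diagram diskSurf)}
    {f : Fin w.n → Option (Diagram diskSurf)}
    {m : ℕ} {hm : HasPorts m (draw h g).1} {hm' : HasPorts m (draw w f).1}
    (hu : ∀ i, (U i).w = u i := by intro i; fin_cases i <;> rfl)
    (hs : compCheck h u P w s = true := by decide +kernel)
    (hw : w.Connected := by decide +kernel)
    (hg : ∀ i, P i = true → g i = some (draw (U i).w (U i).f).1 := by
      intro i; fin_cases i <;> first | exact fun _ => rfl | exact nofun)
    (hf : ∀ k, f k = lookup g (fun i => (U i).f) (s k) := by intro i; fin_cases i <;> rfl) :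
    cls S M' (⟨(draw h g).1, hm⟩ : Tg m) = cls S M' ⟨(draw w f).1, hm'⟩ := by
  obtain rfl : (fun i => (U i).w) = u := funext hu
  obtain ⟨Q, hQ⟩ := exists_comp_tg (S := S) (M' := M') hs (Classical.arbitrary (Picture h))
    fun i => Classical.arbitrary (Picture (U i).w)
  have h1 : m = w.bd.length := HasPorts.unique hm' (draw w f).2
  subst h1
  refine (hQ g (fun i => (U i).f) f hg ?_ ?_ _ hm (Q.tg f).2).trans (Q.cls_tg_unique hw _ f)
  · intro k i hk
    rw [hf, hk]
    exact dif_pos i.2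
  · intro k i a hk
    rw [hf, hk]
    exact (dif_pos i.2).trans (dif_pos a.2)

theorem Picture.cls_tg_eq_draw {w : Wiring} (hw : w.Connected) [Nonempty (Picture w)]
    (Q : Picture w) (f : Fin w.n → Option (Diagram diskSurf)) :
    cls S M' (Q.tg f) = cls S M' (draw w f) :=
  Q.cls_tg_unique hw _ f

end

/-! ### Relations between composed pictures -/

section
variable {F : Type} [TopologicalSpace F] {S : Surf F} {o : Mode} {A : Type*} [CommRing A]
  {M' : KnotTheory o A}

/-- Three 2-tangles stacked along the strands. -/
abbrev triple (l₀ l₁ l₂ : Label) : Wiring where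
  bd := crossSigns
  n := 3
  vertex := ![l₀, l₁, l₂]
  edges := [(.bd 0, .vx 0 0), (.bd 1, .vx 0 1), (.vx 0 3, .vx 1 0), (.vx 0 2, .vx 1 1),
    (.vx 1 3, .vx 2 0), (.vx 1 2, .vx 2 1), (.vx 2 3, .bd 3), (.vx 2 2, .bd 2)]

instance : Nonempty (Picture (triple box₄ box₄ box₄)) :=
  nonempty_picture_of_comp (parallelBigon box₄ box₄) ![parallelBigon box₄ box₄, strand]
    ![true, false] ![[0, 0], [0, 1], [1]]

theorem cls_parallelBigon_left (a b c : Tg 4) :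
    cls S M' (draw (parallelBigon box₄ box₄) ![some (draw (parallelBigon box₄ box₄) ![some a.1,
        some b.1]).1, some c.1]) =
      cls S M' (draw (triple box₄ box₄ box₄) ![some a.1, some b.1, some c.1]) :=
  cls_draw_comp ![.mk (parallelBigon box₄ box₄) ![some a.1, some b.1], .mk strand Fin.elim0]
    ![parallelBigon box₄ box₄, strand] ![true, false] ![[0, 0], [0, 1], [1]]

theorem cls_parallelBigon_right (a b c : Tg 4) :
    cls S M' (draw (parallelBigon box₄ box₄) ![some a.1, some (draw (parallelBigon box₄ box₄)
        ![some b.1, some c.1]).1]) =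
      cls S M' (draw (triple box₄ box₄ box₄) ![some a.1, some b.1, some c.1]) :=
  cls_draw_comp ![.mk strand Fin.elim0, .mk (parallelBigon box₄ box₄) ![some b.1, some c.1]]
    ![strand, parallelBigon box₄ box₄] ![false, true] ![[0], [1, 0], [1, 1]]

theorem cls_parallelStrands_parallelBigon (a b : Tg 4) :
    cls S M' (draw (parallelBigon box₄ box₄) ![some (draw parallelStrands Fin.elim0).1,
        some (draw (parallelBigon box₄ box₄) ![some a.1, some b.1]).1]) =
      cls S M' (draw (parallelBigon box₄ box₄) ![some a.1, some b.1]) :=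
  cls_draw_comp ![.mk parallelStrands Fin.elim0, .mk (parallelBigon box₄ box₄) ![some a.1,
      some b.1]]
    ![parallelStrands, parallelBigon box₄ box₄] ![true, true] ![[1, 0], [1, 1]]

theorem cls_parallelBigon_parallelStrands (a b : Tg 4) :
    cls S M' (draw (parallelBigon box₄ box₄) ![some (draw (parallelBigon box₄ box₄) ![some a.1,
        some b.1]).1, some (draw parallelStrands Fin.elim0).1]) =
      cls S M' (draw (parallelBigon box₄ box₄) ![some a.1, some b.1]) :=
  cls_draw_comp ![.mk (parallelBigon box₄ box₄) ![some a.1, some b.1],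
      .mk parallelStrands Fin.elim0]
    ![parallelBigon box₄ box₄, parallelStrands] ![true, true] ![[0, 0], [0, 1]]

/-- Three 3-tangles stacked along the strands. -/
abbrev stackThree : Wiring where
  bd := tripleSigns
  n := 3
  vertex := ![box₆, box₆, box₆]
  edges := [(.bd 0, .vx 0 0), (.bd 1, .vx 0 1), (.bd 2, .vx 0 2), (.vx 0 5, .vx 1 0),
    (.vx 0 4, .vx 1 1), (.vx 0 3, .vx 1 2), (.vx 1 5, .vx 2 0), (.vx 1 4, .vx 2 1),
    (.vx 1 3, .vx 2 2), (.vx 2 5, .bd 5), (.vx 2 4, .bd 4), (.vx 2 3, .bd 3)]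

/-- Three parallel strands. -/
abbrev threeStrands : Wiring where
  bd := tripleSigns
  n := 0
  vertex := Fin.elim0
  edges := [(.bd 0, .bd 5), (.bd 1, .bd 4), (.bd 2, .bd 3)]

instance : Nonempty (Picture stackThree) :=
  nonempty_picture_of_comp stack ![stack, strand]
    ![true, false] ![[0, 0], [0, 1], [1]]

theorem cls_stack_left (a b c : Tg 6) :
    cls S M' (draw stack ![some (draw stack ![some a.1, some b.1]).1, some c.1]) =
      cls S M' (draw stackThree ![some a.1, some b.1, some c.1]) :=
  cls_draw_comp ![.mk stack ![some a.1, some b.1], .mk strand Fin.elim0]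
    ![stack, strand] ![true, false] ![[0, 0], [0, 1], [1]]

theorem cls_stack_right (a b c : Tg 6) :
    cls S M' (draw stack ![some a.1, some (draw stack ![some b.1, some c.1]).1]) =
      cls S M' (draw stackThree ![some a.1, some b.1, some c.1]) :=
  cls_draw_comp ![.mk strand Fin.elim0, .mk stack ![some b.1, some c.1]]
    ![strand, stack] ![false, true] ![[0], [1, 0], [1, 1]]

instance : Nonempty (Picture threeStrands) :=
  nonempty_picture_of_comp besideLeft ![parallelStrands]
    ![true] Fin.elim0

theorem cls_besideLeft_parallelStrands :
    cls S M' (draw besideLeft ![some (draw parallelStrands Fin.elim0).1]) =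
      cls S M' (draw threeStrands Fin.elim0) :=
  cls_draw_comp ![.mk parallelStrands Fin.elim0]
    ![parallelStrands] ![true] Fin.elim0

theorem cls_besideRight_parallelStrands :
    cls S M' (draw besideRight ![some (draw parallelStrands Fin.elim0).1]) =
      cls S M' (draw threeStrands Fin.elim0) :=
  cls_draw_comp ![.mk parallelStrands Fin.elim0]
    ![parallelStrands] ![true] Fin.elim0

theorem cls_threeStrands_stack (a b : Tg 6) :
    cls S M' (draw stack ![some (draw threeStrands Fin.elim0).1, some (draw stack ![some a.1,
        some b.1]).1]) =
      cls S M' (draw stack ![some a.1, some b.1]) :=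
  cls_draw_comp ![.mk threeStrands Fin.elim0, .mk stack ![some a.1, some b.1]]
    ![threeStrands, stack] ![true, true] ![[1, 0], [1, 1]]

theorem cls_stack_threeStrands (a b : Tg 6) :
    cls S M' (draw stack ![some (draw stack ![some a.1, some b.1]).1,
        some (draw threeStrands Fin.elim0).1]) =
      cls S M' (draw stack ![some a.1, some b.1]) :=
  cls_draw_comp ![.mk stack ![some a.1, some b.1], .mk threeStrands Fin.elim0]
    ![stack, threeStrands] ![true, true] ![[0, 0], [0, 1]]

/-- Two 2-tangles stacked on the strands `1, 2` of three parallel strands. -/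
abbrev besideLeftTwo : Wiring where
  bd := tripleSigns
  n := 2
  vertex := ![box₄, box₄]
  edges := [(.bd 0, .vx 0 0), (.bd 1, .vx 0 1), (.vx 0 3, .vx 1 0), (.vx 0 2, .vx 1 1),
    (.vx 1 3, .bd 5), (.vx 1 2, .bd 4), (.bd 2, .bd 3)]

/-- Two 2-tangles stacked on the strands `2, 3` of three parallel strands. -/
abbrev besideRightTwo : Wiring where
  bd := tripleSigns
  n := 2
  vertex := ![box₄, box₄]
  edges := [(.bd 0, .bd 5), (.bd 1, .vx 0 0), (.bd 2, .vx 0 1), (.vx 0 3, .vx 1 0),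
    (.vx 0 2, .vx 1 1), (.vx 1 3, .bd 4), (.vx 1 2, .bd 3)]

instance : Nonempty (Picture besideLeftTwo) :=
  nonempty_picture_of_comp besideLeft ![parallelBigon box₄ box₄]
    ![true] ![[0, 0], [0, 1]]

theorem cls_besideLeft_parallelBigon (a b : Tg 4) :
    cls S M' (draw besideLeft ![some (draw (parallelBigon box₄ box₄) ![some a.1, some b.1]).1]) =
      cls S M' (draw besideLeftTwo ![some a.1, some b.1]) :=
  cls_draw_comp ![.mk (parallelBigon box₄ box₄) ![some a.1, some b.1]]
    ![parallelBigon box₄ box₄] ![true] ![[0, 0], [0, 1]]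

theorem cls_stack_besideLeft (a b : Tg 4) :
    cls S M' (draw stack ![some (draw besideLeft ![some a.1]).1, some (draw besideLeft
        ![some b.1]).1]) =
      cls S M' (draw besideLeftTwo ![some a.1, some b.1]) :=
  cls_draw_comp ![.mk besideLeft ![some a.1], .mk besideLeft ![some b.1]]
    ![besideLeft, besideLeft] ![true, true] ![[0, 0], [1, 0]]

instance : Nonempty (Picture besideRightTwo) :=
  nonempty_picture_of_comp besideRight ![parallelBigon box₄ box₄]
    ![true] ![[0, 0], [0, 1]]

theorem cls_besideRight_parallelBigon (a b : Tg 4) :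
    cls S M' (draw besideRight ![some (draw (parallelBigon box₄ box₄) ![some a.1, some b.1]).1]) =
      cls S M' (draw besideRightTwo ![some a.1, some b.1]) :=
  cls_draw_comp ![.mk (parallelBigon box₄ box₄) ![some a.1, some b.1]]
    ![parallelBigon box₄ box₄] ![true] ![[0, 0], [0, 1]]

theorem cls_stack_besideRight (a b : Tg 4) :
    cls S M' (draw stack ![some (draw besideRight ![some a.1]).1, some (draw besideRight
        ![some b.1]).1]) =
      cls S M' (draw besideRightTwo ![some a.1, some b.1]) :=
  cls_draw_comp ![.mk besideRight ![some a.1], .mk besideRight ![some b.1]]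
    ![besideRight, besideRight] ![true, true] ![[0, 0], [1, 0]]

instance : Nonempty (Picture (triangleLeft box₄ box₄ box₄)) :=
  nonempty_picture_of_comp stackThree ![besideLeft, besideRight, besideLeft]
    ![true, true, true] ![[0, 0], [1, 0], [2, 0]]

theorem cls_stackThree_triangleLeft (a b c : Tg 4) :
    cls S M' (draw stackThree ![some (draw besideLeft ![some a.1]).1, some (draw besideRight
        ![some b.1]).1, some (draw besideLeft ![some c.1]).1]) =
      cls S M' (draw (triangleLeft box₄ box₄ box₄) ![some a.1, some b.1, some c.1]) :=
  cls_draw_comp ![.mk besideLeft ![some a.1], .mk besideRight ![some b.1], .mk besideLeft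
      ![some c.1]]
    ![besideLeft, besideRight, besideLeft] ![true, true, true] ![[0, 0], [1, 0], [2, 0]]

instance : Nonempty (Picture (triangleRight box₄ box₄ box₄)) :=
  nonempty_picture_of_comp stackThree ![besideRight, besideLeft, besideRight]
    ![true, true, true] ![[2, 0], [1, 0], [0, 0]]

theorem cls_stackThree_triangleRight (a b c : Tg 4) :
    cls S M' (draw stackThree ![some (draw besideRight ![some a.1]).1, some (draw besideLeft
        ![some b.1]).1, some (draw besideRight ![some c.1]).1]) =
      cls S M' (draw (triangleRight box₄ box₄ box₄) ![some c.1, some b.1, some a.1]) :=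
  cls_draw_comp ![.mk besideRight ![some a.1], .mk besideLeft ![some b.1], .mk besideRight
      ![some c.1]]
    ![besideRight, besideLeft, besideRight] ![true, true, true] ![[2, 0], [1, 0], [0, 0]]

/-! ### Closures of three strands -/

/-- The left closure of `triangleRight`. -/
abbrev closedLeftTriangleRight : Wiring where
  bd := crossSigns
  n := 3
  vertex := ![box₄, box₄, box₄]
  edges := [(.bd 0, .vx 2 0), (.bd 1, .vx 2 1), (.vx 1 3, .vx 1 0), (.vx 2 3, .vx 1 1),
    (.vx 1 2, .vx 0 0), (.vx 2 2, .vx 0 1), (.vx 0 3, .bd 3), (.vx 0 2, .bd 2)]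

/-- The right closure of `triangleLeft`. -/
abbrev closedRightTriangleLeft : Wiring where
  bd := crossSigns
  n := 3
  vertex := ![box₄, box₄, box₄]
  edges := [(.bd 0, .vx 0 0), (.bd 1, .vx 0 1), (.vx 0 3, .vx 2 0), (.vx 0 2, .vx 1 0),
    (.vx 1 2, .vx 1 1), (.vx 1 3, .vx 2 1), (.vx 2 2, .bd 2), (.vx 2 3, .bd 3)]

instance : Nonempty (Picture closedLeftTriangleRight) :=
  nonempty_picture_of_comp closeLeft ![triangleRight box₄ box₄ box₄]
    ![true] ![[0, 0], [0, 1], [0, 2]]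

theorem cls_closeLeft_triangleRight (a b c : Tg 4) :
    cls S M' (draw closeLeft ![some (draw (triangleRight box₄ box₄ box₄) ![some a.1, some b.1,
        some c.1]).1]) =
      cls S M' (draw closedLeftTriangleRight ![some a.1, some b.1, some c.1]) :=
  cls_draw_comp ![.mk (triangleRight box₄ box₄ box₄) ![some a.1, some b.1, some c.1]]
    ![triangleRight box₄ box₄ box₄] ![true] ![[0, 0], [0, 1], [0, 2]]

theorem cls_bridgeLeft_loopLeft (a b c : Tg 4) :
    cls S M' (draw bridgeLeft ![some c.1, some (draw (loopLeft box₄) ![some b.1]).1, some a.1]) =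
      cls S M' (draw closedLeftTriangleRight ![some a.1, some b.1, some c.1]) :=
  cls_draw_comp ![.mk strand Fin.elim0, .mk (loopLeft box₄) ![some b.1], .mk strand Fin.elim0]
    ![strand, loopLeft box₄, strand] ![false, true, false] ![[2], [1, 0], [0]]

theorem cls_bridgeLeft_strand (a b : Tg 4) :
    cls S M' (draw bridgeLeft ![some a.1, some (draw strand Fin.elim0).1, some b.1]) =
      cls S M' (draw (parallelBigon box₄ box₄) ![some a.1, some b.1]) :=
  cls_draw_comp ![.mk strand Fin.elim0, .mk strand Fin.elim0, .mk strand Fin.elim0]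
    ![strand, strand, strand] ![false, true, false] ![[0], [2]]

instance : Nonempty (Picture closedRightTriangleLeft) :=
  nonempty_picture_of_comp closeRight ![triangleLeft box₄ box₄ box₄]
    ![true] ![[0, 0], [0, 1], [0, 2]]

theorem cls_closeRight_triangleLeft (a b c : Tg 4) :
    cls S M' (draw closeRight ![some (draw (triangleLeft box₄ box₄ box₄) ![some a.1, some b.1,
        some c.1]).1]) =
      cls S M' (draw closedRightTriangleLeft ![some a.1, some b.1, some c.1]) :=
  cls_draw_comp ![.mk (triangleLeft box₄ box₄ box₄) ![some a.1, some b.1, some c.1]]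
    ![triangleLeft box₄ box₄ box₄] ![true] ![[0, 0], [0, 1], [0, 2]]

theorem cls_bridgeRight_loopRight (a b c : Tg 4) :
    cls S M' (draw bridgeRight ![some a.1, some (draw (loopRight box₄) ![some b.1]).1, some c.1]) =
      cls S M' (draw closedRightTriangleLeft ![some a.1, some b.1, some c.1]) :=
  cls_draw_comp ![.mk strand Fin.elim0, .mk (loopRight box₄) ![some b.1], .mk strand Fin.elim0]
    ![strand, loopRight box₄, strand] ![false, true, false] ![[0], [1, 0], [2]]

theorem cls_bridgeRight_strand (a b : Tg 4) :
    cls S M' (draw bridgeRight ![some a.1, some (draw strand Fin.elim0).1, some b.1]) =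
      cls S M' (draw (parallelBigon box₄ box₄) ![some a.1, some b.1]) :=
  cls_draw_comp ![.mk strand Fin.elim0, .mk strand Fin.elim0, .mk strand Fin.elim0]
    ![strand, strand, strand] ![false, true, false] ![[0], [2]]

/-! ### Antiparallel bigons -/

/-- The left closure of `triangleLeft`. -/
abbrev closedLeftTriangleLeft : Wiring where
  bd := crossSigns
  n := 3
  vertex := ![box₄, box₄, box₄]
  edges := [(.vx 2 3, .vx 0 0), (.bd 0, .vx 0 1), (.vx 0 3, .vx 2 0), (.vx 0 2, .vx 1 0),
    (.bd 1, .vx 1 1), (.vx 1 3, .vx 2 1), (.vx 1 2, .bd 2), (.vx 2 2, .bd 3)]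

/-- The right closure of `triangleRight`. -/
abbrev closedRightTriangleRight : Wiring where
  bd := crossSigns
  n := 3
  vertex := ![box₄, box₄, box₄]
  edges := [(.bd 0, .vx 1 0), (.bd 1, .vx 2 0), (.vx 2 3, .vx 1 1), (.vx 2 2, .vx 0 1),
    (.vx 1 2, .vx 0 0), (.vx 0 2, .vx 2 1), (.vx 1 3, .bd 3), (.vx 0 3, .bd 2)]

/-- The picture `bigonHost` with a clockwise bigon inserted. -/
abbrev doubleBigon : Wiring where
  bd := [true, false, true, false]
  n := 4
  vertex := ![box₄, box₄, box₄, box₄]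
  edges := [(.bd 0, .vx 0 1), (.vx 0 2, .vx 1 0), (.vx 1 2, .vx 3 1), (.vx 2 2, .bd 3),
    (.vx 2 3, .vx 0 0), (.vx 0 3, .vx 2 0), (.vx 1 3, .vx 2 1), (.vx 3 3, .bd 1),
    (.bd 2, .vx 3 0), (.vx 3 2, .vx 1 1)]

/-- The picture `bigonHost'` with a counterclockwise bigon inserted. -/
abbrev doubleBigon' : Wiring where
  bd := [false, true, false, true]
  n := 4
  vertex := ![box₄, box₄, box₄, box₄]
  edges := [(.vx 3 3, .vx 1 0), (.bd 3, .vx 2 0), (.vx 2 3, .vx 1 1), (.vx 2 2, .vx 0 1),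
    (.vx 1 2, .vx 0 0), (.vx 0 2, .vx 2 1), (.vx 1 3, .vx 3 0), (.vx 0 3, .bd 0),
    (.bd 1, .vx 3 1), (.vx 3 2, .bd 2)]

instance : Nonempty (Picture closedLeftTriangleLeft) :=
  nonempty_picture_of_comp closeLeft ![triangleLeft box₄ box₄ box₄]
    ![true] ![[0, 0], [0, 1], [0, 2]]

theorem cls_closeLeft_triangleLeft (a b c : Tg 4) :
    cls S M' (draw closeLeft ![some (draw (triangleLeft box₄ box₄ box₄) ![some a.1, some b.1,
        some c.1]).1]) =
      cls S M' (draw closedLeftTriangleLeft ![some a.1, some b.1, some c.1]) :=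
  cls_draw_comp ![.mk (triangleLeft box₄ box₄ box₄) ![some a.1, some b.1, some c.1]]
    ![triangleLeft box₄ box₄ box₄] ![true] ![[0, 0], [0, 1], [0, 2]]

instance : Nonempty (Picture doubleBigon) :=
  nonempty_picture_of_comp antiLink ![closedLeftTriangleLeft, strand]
    ![true, false] ![[0, 0], [0, 1], [0, 2], [1]]

theorem cls_antiLink_closedLeft (a b c d : Tg 4) :
    cls S M' (draw antiLink ![some (draw closedLeftTriangleLeft ![some a.1, some b.1, some c.1]).1,
        some d.1]) =
      cls S M' (draw doubleBigon ![some a.1, some b.1, some c.1, some d.1]) :=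
  cls_draw_comp ![.mk closedLeftTriangleLeft ![some a.1, some b.1, some c.1], .mk strand Fin.elim0]
    ![closedLeftTriangleLeft, strand] ![true, false] ![[0, 0], [0, 1], [0, 2], [1]]

instance : Nonempty (Picture (ccwBigon box₄ box₄)) :=
  nonempty_picture_of_comp bigonHost ![strand, strand, antiStrands']
    ![false, false, true] ![[1], [0]]

theorem cls_bigonHost_antiStrands (a b : Tg 4) :
    cls S M' (draw bigonHost ![some a.1, some b.1, some (draw antiStrands' Fin.elim0).1]) =
      cls S M' (draw (ccwBigon box₄ box₄) ![some b.1, some a.1]) :=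
  cls_draw_comp ![.mk strand Fin.elim0, .mk strand Fin.elim0, .mk antiStrands' Fin.elim0]
    ![strand, strand, antiStrands'] ![false, false, true] ![[1], [0]]

instance : Nonempty (Picture closedRightTriangleRight) :=
  nonempty_picture_of_comp closeRight ![triangleRight box₄ box₄ box₄]
    ![true] ![[0, 0], [0, 1], [0, 2]]

theorem cls_closeRight_triangleRight (a b c : Tg 4) :
    cls S M' (draw closeRight ![some (draw (triangleRight box₄ box₄ box₄) ![some a.1, some b.1,
        some c.1]).1]) =
      cls S M' (draw closedRightTriangleRight ![some a.1, some b.1, some c.1]) :=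
  cls_draw_comp ![.mk (triangleRight box₄ box₄ box₄) ![some a.1, some b.1, some c.1]]
    ![triangleRight box₄ box₄ box₄] ![true] ![[0, 0], [0, 1], [0, 2]]

instance : Nonempty (Picture doubleBigon') :=
  nonempty_picture_of_comp antiLink' ![closedRightTriangleRight, strand]
    ![true, false] ![[0, 0], [0, 1], [0, 2], [1]]

theorem cls_antiLink'_closedRight (a b c d : Tg 4) :
    cls S M' (draw antiLink' ![some (draw closedRightTriangleRight ![some a.1, some b.1,
        some c.1]).1, some d.1]) =
      cls S M' (draw doubleBigon' ![some a.1, some b.1, some c.1, some d.1]) :=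
  cls_draw_comp ![.mk closedRightTriangleRight ![some a.1, some b.1, some c.1],
      .mk strand Fin.elim0]
    ![closedRightTriangleRight, strand] ![true, false] ![[0, 0], [0, 1], [0, 2], [1]]

instance : Nonempty (Picture (cwBigon box₄ box₄)) :=
  nonempty_picture_of_comp bigonHost' ![strand, strand, antiStrands]
    ![false, false, true] ![[0], [1]]

theorem cls_bigonHost'_antiStrands (a b : Tg 4) :
    cls S M' (draw bigonHost' ![some a.1, some b.1, some (draw antiStrands Fin.elim0).1]) =
      cls S M' (draw (cwBigon box₄ box₄) ![some a.1, some b.1]) :=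
  cls_draw_comp ![.mk strand Fin.elim0, .mk strand Fin.elim0, .mk antiStrands Fin.elim0]
    ![strand, strand, antiStrands] ![false, false, true] ![[0], [1]]

theorem cls_bigonHost_cwBigon (a b c d : Tg 4) :
    cls S M' (draw bigonHost ![some a.1, some c.1, some (draw (cwBigon box₄ box₄) ![some b.1,
        some d.1]).1]) =
      cls S M' (draw doubleBigon ![some a.1, some b.1, some c.1, some d.1]) :=
  cls_draw_comp ![.mk strand Fin.elim0, .mk strand Fin.elim0, .mk (cwBigon box₄ box₄) ![some b.1,
      some d.1]]
    ![strand, strand, cwBigon box₄ box₄] ![false, false, true] ![[0], [2, 0], [1], [2, 1]]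

theorem cls_bigonHost'_ccwBigon (a b c d : Tg 4) :
    cls S M' (draw bigonHost' ![some c.1, some a.1, some (draw (ccwBigon box₄ box₄) ![some b.1,
        some d.1]).1]) =
      cls S M' (draw doubleBigon' ![some a.1, some b.1, some c.1, some d.1]) :=
  cls_draw_comp ![.mk strand Fin.elim0, .mk strand Fin.elim0, .mk (ccwBigon box₄ box₄) ![some b.1,
      some d.1]]
    ![strand, strand, ccwBigon box₄ box₄] ![false, false, true] ![[1], [2, 0], [0], [2, 1]]

/-! ### Pictures with crossings -/

/-- The tangle that consists of a single crossing. -/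
abbrev crossingTg (l : Label) [Nonempty (Picture (crossing l))] : Tg 4 :=
  draw (crossing l) fun _ => none

instance : Nonempty (Picture (parallelBigon .pos .neg)) :=
  nonempty_picture_of_comp (parallelBigon box₄ box₄) ![crossing .pos, crossing .neg]
    ![true, true] ![[0, 0], [1, 0]]

theorem cls_parallelBigon_pos_neg :
    cls S M' (draw (parallelBigon box₄ box₄) ![some (crossingTg .pos).1,
        some (crossingTg .neg).1]) =
      cls S M' (draw (parallelBigon .pos .neg) fun _ => none) :=
  cls_draw_comp ![.mk (crossing .pos) fun _ => none, .mk (crossing .neg) fun _ => none]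
    ![crossing .pos, crossing .neg] ![true, true] ![[0, 0], [1, 0]]

instance : Nonempty (Picture (parallelBigon box₄ .neg)) :=
  nonempty_picture_of_comp (parallelBigon box₄ box₄) ![strand, crossing .neg]
    ![false, true] ![[0], [1, 0]]

theorem cls_parallelBigon_box_neg (a : Tg 4) :
    cls S M' (draw (parallelBigon box₄ box₄) ![some a.1, some (crossingTg .neg).1]) =
      cls S M' (draw (parallelBigon box₄ .neg) ![some a.1, none]) :=
  cls_draw_comp ![.mk strand Fin.elim0, .mk (crossing .neg) fun _ => none]
    ![strand, crossing .neg] ![false, true] ![[0], [1, 0]]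

instance : Nonempty (Picture (parallelBigon .pos box₄)) :=
  nonempty_picture_of_comp (parallelBigon box₄ box₄) ![crossing .pos, strand]
    ![true, false] ![[0, 0], [1]]

theorem cls_parallelBigon_pos_box (a : Tg 4) :
    cls S M' (draw (parallelBigon box₄ box₄) ![some (crossingTg .pos).1, some a.1]) =
      cls S M' (draw (parallelBigon .pos box₄) ![none, some a.1]) :=
  cls_draw_comp ![.mk (crossing .pos) fun _ => none, .mk strand Fin.elim0]
    ![crossing .pos, strand] ![true, false] ![[0, 0], [1]]

instance : Nonempty (Picture (parallelBigon .neg .pos)) :=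
  nonempty_picture_of_comp (parallelBigon box₄ box₄) ![crossing .neg, crossing .pos]
    ![true, true] ![[0, 0], [1, 0]]

theorem cls_parallelBigon_neg_pos :
    cls S M' (draw (parallelBigon box₄ box₄) ![some (crossingTg .neg).1,
        some (crossingTg .pos).1]) =
      cls S M' (draw (parallelBigon .neg .pos) fun _ => none) :=
  cls_draw_comp ![.mk (crossing .neg) fun _ => none, .mk (crossing .pos) fun _ => none]
    ![crossing .neg, crossing .pos] ![true, true] ![[0, 0], [1, 0]]

instance : Nonempty (Picture (parallelBigon box₄ .pos)) :=
  nonempty_picture_of_comp (parallelBigon box₄ box₄) ![strand, crossing .pos]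
    ![false, true] ![[0], [1, 0]]

theorem cls_parallelBigon_box_pos (a : Tg 4) :
    cls S M' (draw (parallelBigon box₄ box₄) ![some a.1, some (crossingTg .pos).1]) =
      cls S M' (draw (parallelBigon box₄ .pos) ![some a.1, none]) :=
  cls_draw_comp ![.mk strand Fin.elim0, .mk (crossing .pos) fun _ => none]
    ![strand, crossing .pos] ![false, true] ![[0], [1, 0]]

instance : Nonempty (Picture (parallelBigon .neg box₄)) :=
  nonempty_picture_of_comp (parallelBigon box₄ box₄) ![crossing .neg, strand]
    ![true, false] ![[0, 0], [1]]

theorem cls_parallelBigon_neg_box (a : Tg 4) :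
    cls S M' (draw (parallelBigon box₄ box₄) ![some (crossingTg .neg).1, some a.1]) =
      cls S M' (draw (parallelBigon .neg box₄) ![none, some a.1]) :=
  cls_draw_comp ![.mk (crossing .neg) fun _ => none, .mk strand Fin.elim0]
    ![crossing .neg, strand] ![true, false] ![[0, 0], [1]]

instance : Nonempty (Picture (ccwBigon .pos .neg)) :=
  nonempty_picture_of_comp (ccwBigon box₄ box₄) ![crossing .pos, crossing .neg]
    ![true, true] ![[0, 0], [1, 0]]

theorem cls_ccwBigon_pos_neg :
    cls S M' (draw (ccwBigon box₄ box₄) ![some (crossingTg .pos).1, some (crossingTg .neg).1]) =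
      cls S M' (draw (ccwBigon .pos .neg) fun _ => none) :=
  cls_draw_comp ![.mk (crossing .pos) fun _ => none, .mk (crossing .neg) fun _ => none]
    ![crossing .pos, crossing .neg] ![true, true] ![[0, 0], [1, 0]]

instance : Nonempty (Picture (ccwBigon box₄ .neg)) :=
  nonempty_picture_of_comp (ccwBigon box₄ box₄) ![strand, crossing .neg]
    ![false, true] ![[0], [1, 0]]

theorem cls_ccwBigon_box_neg (a : Tg 4) :
    cls S M' (draw (ccwBigon box₄ box₄) ![some a.1, some (crossingTg .neg).1]) =
      cls S M' (draw (ccwBigon box₄ .neg) ![some a.1, none]) :=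
  cls_draw_comp ![.mk strand Fin.elim0, .mk (crossing .neg) fun _ => none]
    ![strand, crossing .neg] ![false, true] ![[0], [1, 0]]

instance : Nonempty (Picture (ccwBigon .pos box₄)) :=
  nonempty_picture_of_comp (ccwBigon box₄ box₄) ![crossing .pos, strand]
    ![true, false] ![[0, 0], [1]]

theorem cls_ccwBigon_pos_box (a : Tg 4) :
    cls S M' (draw (ccwBigon box₄ box₄) ![some (crossingTg .pos).1, some a.1]) =
      cls S M' (draw (ccwBigon .pos box₄) ![none, some a.1]) :=
  cls_draw_comp ![.mk (crossing .pos) fun _ => none, .mk strand Fin.elim0]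
    ![crossing .pos, strand] ![true, false] ![[0, 0], [1]]

instance : Nonempty (Picture (cwBigon .pos .neg)) :=
  nonempty_picture_of_comp (cwBigon box₄ box₄) ![crossing .pos, crossing .neg]
    ![true, true] ![[0, 0], [1, 0]]

theorem cls_cwBigon_pos_neg :
    cls S M' (draw (cwBigon box₄ box₄) ![some (crossingTg .pos).1, some (crossingTg .neg).1]) =
      cls S M' (draw (cwBigon .pos .neg) fun _ => none) :=
  cls_draw_comp ![.mk (crossing .pos) fun _ => none, .mk (crossing .neg) fun _ => none]
    ![crossing .pos, crossing .neg] ![true, true] ![[0, 0], [1, 0]]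

instance : Nonempty (Picture (cwBigon box₄ .neg)) :=
  nonempty_picture_of_comp (cwBigon box₄ box₄) ![strand, crossing .neg]
    ![false, true] ![[0], [1, 0]]

theorem cls_cwBigon_box_neg (a : Tg 4) :
    cls S M' (draw (cwBigon box₄ box₄) ![some a.1, some (crossingTg .neg).1]) =
      cls S M' (draw (cwBigon box₄ .neg) ![some a.1, none]) :=
  cls_draw_comp ![.mk strand Fin.elim0, .mk (crossing .neg) fun _ => none]
    ![strand, crossing .neg] ![false, true] ![[0], [1, 0]]

instance : Nonempty (Picture (cwBigon .pos box₄)) :=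
  nonempty_picture_of_comp (cwBigon box₄ box₄) ![crossing .pos, strand]
    ![true, false] ![[0, 0], [1]]

theorem cls_cwBigon_pos_box (a : Tg 4) :
    cls S M' (draw (cwBigon box₄ box₄) ![some (crossingTg .pos).1, some a.1]) =
      cls S M' (draw (cwBigon .pos box₄) ![none, some a.1]) :=
  cls_draw_comp ![.mk (crossing .pos) fun _ => none, .mk strand Fin.elim0]
    ![crossing .pos, strand] ![true, false] ![[0, 0], [1]]

instance : Nonempty (Picture (triangleLeft .pos .pos .pos)) :=
  nonempty_picture_of_comp (triangleLeft box₄ box₄ box₄) ![crossing .pos, crossing .pos,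
      (crossing .pos)]
    ![true, true, true] ![[0, 0], [1, 0], [2, 0]]

theorem cls_triangleLeft_pos_pos_pos :
    cls S M' (draw (triangleLeft box₄ box₄ box₄) ![some (crossingTg .pos).1,
        some (crossingTg .pos).1, some (crossingTg .pos).1]) =
      cls S M' (draw (triangleLeft .pos .pos .pos) fun _ => none) :=
  cls_draw_comp ![.mk (crossing .pos) fun _ => none, .mk (crossing .pos) fun _ => none,
      .mk (crossing .pos) fun _ => none]
    ![crossing .pos, crossing .pos, crossing .pos] ![true, true, true] ![[0, 0], [1, 0], [2,
     0]]

instance : Nonempty (Picture (triangleLeft box₄ .pos .pos)) :=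
  nonempty_picture_of_comp (triangleLeft box₄ box₄ box₄) ![strand, crossing .pos, crossing .pos]
    ![false, true, true] ![[0], [1, 0], [2, 0]]

theorem cls_triangleLeft_box_pos_pos (a : Tg 4) :
    cls S M' (draw (triangleLeft box₄ box₄ box₄) ![some a.1, some (crossingTg .pos).1,
        some (crossingTg .pos).1]) =
      cls S M' (draw (triangleLeft box₄ .pos .pos) ![some a.1, none, none]) :=
  cls_draw_comp ![.mk strand Fin.elim0, .mk (crossing .pos) fun _ => none,
      .mk (crossing .pos) fun _ => none]
    ![strand, crossing .pos, crossing .pos] ![false, true, true] ![[0], [1, 0], [2, 0]]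

instance : Nonempty (Picture (triangleLeft .pos box₄ .pos)) :=
  nonempty_picture_of_comp (triangleLeft box₄ box₄ box₄) ![crossing .pos, strand, crossing .pos]
    ![true, false, true] ![[0, 0], [1], [2, 0]]

theorem cls_triangleLeft_pos_box_pos (a : Tg 4) :
    cls S M' (draw (triangleLeft box₄ box₄ box₄) ![some (crossingTg .pos).1, some a.1,
        some (crossingTg .pos).1]) =
      cls S M' (draw (triangleLeft .pos box₄ .pos) ![none, some a.1, none]) :=
  cls_draw_comp ![.mk (crossing .pos) fun _ => none, .mk strand Fin.elim0,
      .mk (crossing .pos) fun _ => none]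
    ![crossing .pos, strand, crossing .pos] ![true, false, true] ![[0, 0], [1], [2, 0]]

instance : Nonempty (Picture (triangleRight .pos .pos .pos)) :=
  nonempty_picture_of_comp (triangleRight box₄ box₄ box₄) ![crossing .pos, crossing .pos,
      (crossing .pos)]
    ![true, true, true] ![[0, 0], [1, 0], [2, 0]]

theorem cls_triangleRight_pos_pos_pos :
    cls S M' (draw (triangleRight box₄ box₄ box₄) ![some (crossingTg .pos).1,
        some (crossingTg .pos).1, some (crossingTg .pos).1]) =
      cls S M' (draw (triangleRight .pos .pos .pos) fun _ => none) :=
  cls_draw_comp ![.mk (crossing .pos) fun _ => none, .mk (crossing .pos) fun _ => none,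
      .mk (crossing .pos) fun _ => none]
    ![crossing .pos, crossing .pos, crossing .pos] ![true, true, true] ![[0, 0], [1, 0], [2,
     0]]

instance : Nonempty (Picture (triangleRight box₄ .pos .pos)) :=
  nonempty_picture_of_comp (triangleRight box₄ box₄ box₄) ![strand, crossing .pos,
      (crossing .pos)]
    ![false, true, true] ![[0], [1, 0], [2, 0]]

theorem cls_triangleRight_box_pos_pos (a : Tg 4) :
    cls S M' (draw (triangleRight box₄ box₄ box₄) ![some a.1, some (crossingTg .pos).1,
        some (crossingTg .pos).1]) =
      cls S M' (draw (triangleRight box₄ .pos .pos) ![some a.1, none, none]) :=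
  cls_draw_comp ![.mk strand Fin.elim0, .mk (crossing .pos) fun _ => none,
      .mk (crossing .pos) fun _ => none]
    ![strand, crossing .pos, crossing .pos] ![false, true, true] ![[0], [1, 0], [2, 0]]

instance : Nonempty (Picture (triangleRight .pos box₄ .pos)) :=
  nonempty_picture_of_comp (triangleRight box₄ box₄ box₄) ![crossing .pos, strand,
      (crossing .pos)]
    ![true, false, true] ![[0, 0], [1], [2, 0]]

theorem cls_triangleRight_pos_box_pos (a : Tg 4) :
    cls S M' (draw (triangleRight box₄ box₄ box₄) ![some (crossingTg .pos).1, some a.1,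
        some (crossingTg .pos).1]) =
      cls S M' (draw (triangleRight .pos box₄ .pos) ![none, some a.1, none]) :=
  cls_draw_comp ![.mk (crossing .pos) fun _ => none, .mk strand Fin.elim0,
      .mk (crossing .pos) fun _ => none]
    ![crossing .pos, strand, crossing .pos] ![true, false, true] ![[0, 0], [1], [2, 0]]

instance : Nonempty (Picture (triple .pos box₄ .pos)) :=
  nonempty_picture_of_comp (triple box₄ box₄ box₄) ![crossing .pos, strand, crossing .pos]
    ![true, false, true] ![[0, 0], [1], [2, 0]]

theorem cls_triple_pos_box_pos (a : Tg 4) :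
    cls S M' (draw (triple box₄ box₄ box₄) ![some (crossingTg .pos).1, some a.1,
        some (crossingTg .pos).1]) =
      cls S M' (draw (triple .pos box₄ .pos) ![none, some a.1, none]) :=
  cls_draw_comp ![.mk (crossing .pos) fun _ => none, .mk strand Fin.elim0,
      .mk (crossing .pos) fun _ => none]
    ![crossing .pos, strand, crossing .pos] ![true, false, true] ![[0, 0], [1], [2, 0]]

instance : Nonempty (Picture (triple .neg box₄ .neg)) :=
  nonempty_picture_of_comp (triple box₄ box₄ box₄) ![crossing .neg, strand, crossing .neg]
    ![true, false, true] ![[0, 0], [1], [2, 0]]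

theorem cls_triple_neg_box_neg (a : Tg 4) :
    cls S M' (draw (triple box₄ box₄ box₄) ![some (crossingTg .neg).1, some a.1,
        some (crossingTg .neg).1]) =
      cls S M' (draw (triple .neg box₄ .neg) ![none, some a.1, none]) :=
  cls_draw_comp ![.mk (crossing .neg) fun _ => none, .mk strand Fin.elim0,
      .mk (crossing .neg) fun _ => none]
    ![crossing .neg, strand, crossing .neg] ![true, false, true] ![[0, 0], [1], [2, 0]]

instance : Nonempty (Picture (loopRight .pos)) :=
  nonempty_picture_of_comp (loopRight box₄) ![crossing .pos]
    ![true] ![[0, 0]]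

theorem cls_loopRight_pos :
    cls S M' (draw (loopRight box₄) ![some (crossingTg .pos).1]) =
      cls S M' (draw (loopRight .pos) fun _ => none) :=
  cls_draw_comp ![.mk (crossing .pos) fun _ => none]
    ![crossing .pos] ![true] ![[0, 0]]

instance : Nonempty (Picture (loopLeft .pos)) :=
  nonempty_picture_of_comp (loopLeft box₄) ![crossing .pos]
    ![true] ![[0, 0]]

theorem cls_loopLeft_pos :
    cls S M' (draw (loopLeft box₄) ![some (crossingTg .pos).1]) =
      cls S M' (draw (loopLeft .pos) fun _ => none) :=
  cls_draw_comp ![.mk (crossing .pos) fun _ => none]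
    ![crossing .pos] ![true] ![[0, 0]]

end

/-! ### Insertion at crossings of pictures -/

section
variable {F : Type} [TopologicalSpace F] {S : Surf F} {o : Mode} {A : Type*} [CommRing A]
  {M' : KnotTheory o A}

open Classical in
variable (M') in
/-- Insertion at a vertex of a picture; by convention zero unless the vertex is a classical
crossing. -/
def Picture.ins {w : Wiring} (Q : Picture w) (k : Fin w.n) :
    Sk S M' crossSigns.length →ₗ[A] Sk S M' w.bd.length :=
  if h : (w.vertex k).IsClassical then
    plugOp M' Q.T Q.isTangle (Q.v k) (by rw [Q.label_eq, h.signs_eq]) else 0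

theorem Picture.ins_clsLin {w : Wiring} (Q : Picture w) {k : Fin w.n}
    (h : (w.vertex k).IsClassical) (hk : (w.vertex k).signs = crossSigns)
    (x : Tangle o crossSigns →₀ A) :
    Q.ins M' k (clsLin S M' crossSigns.length (toDiagrams x)) =
      clsLin S M' w.bd.length (Q.put k hk x) := by
  rw [Picture.ins, dif_pos h, Picture.put, clsLin_putLin Q.T Q.isTangle]

theorem Picture.ins_of_not_isClassical {w : Wiring} (Q : Picture w) {k : Fin w.n}
    (h : ¬ (w.vertex k).IsClassical) (x : Sk S M' crossSigns.length) : Q.ins M' k x = 0 := by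
  rw [Picture.ins, dif_neg h, LinearMap.zero_apply]

theorem Picture.cls_eq_draw {w : Wiring} [Nonempty (Picture w)] (hw : w.Connected)
    (Q : Picture w) {m : ℕ} (hm : HasPorts m Q.T)
    (hm' : HasPorts m (draw w fun _ => none).1) :
    cls S M' ⟨Q.T, hm⟩ = cls S M' ⟨(draw w fun _ => none).1, hm'⟩ := by
  obtain rfl := HasPorts.unique hm Q.isTangle
  refine (cls_eq_of_relabel ?_).symm.trans (Q.cls_tg_eq_draw hw _)
  refine Q.T.fillEmpty (fun v => ?_) (Q.isTangle_fill (Q.fits_hasPorts _))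
  rintro ⟨T, hT, -⟩
  cases hT

/-- A tangle can be inserted in any picture of a wiring, with the same result. -/
theorem Picture.cls_plug_eq_draw {w : Wiring} [Nonempty (Picture w)] (hw : w.Connected)
    (Q : Picture w) (k : Fin w.n) {T : Diagram diskSurf}
    (hT : IsTangle (Q.T.label (Q.v k)).signs T) {f : Fin w.n → Option (Diagram diskSurf)}
    (hf : f = Function.update (fun _ => none) k (some T)) :
    cls S M' ⟨Q.T.plug (Q.v k) T hT, hasPorts_plug.2 Q.isTangle⟩ = cls S M' (draw w f) := by
  have hfk : f k = some T := by rw [hf, Function.update_self]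
  refine Q.skSame hw (Classical.arbitrary _) _ _ _ _ _ (Picture.isTangle_fill _
    (Picture.fits_hasPorts _ f)) (fun v => ?_) (fun v hv => ?_) _ _ _
  · obtain ⟨j, rfl⟩ := Q.v.surjective v
    rw [Set.mem_preimage, Equiv.trans_apply, Equiv.symm_apply_apply, Equiv.symm_apply_apply]
    by_cases hj : j = k
    · subst hj
      refine iff_of_true rfl ⟨T, hfk, ?_⟩
      rw [Wiring.deg, ← Q.label_eq]
      exact hT
    · refine iff_of_false (fun h => hj (Q.v.injective h)) ?_
      rintro ⟨U, hU, -⟩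
      rw [hf, Function.update_of_ne hj] at hU
      cases hU
  · obtain rfl : v = Q.v k := hv
    rw [Equiv.trans_apply, Equiv.symm_apply_apply, Equiv.symm_apply_apply, hfk]
    rfl

/-- A picture with the labels of vertices changed. -/
def Picture.relabel {w : Wiring} (Q : Picture w) (l : Fin w.n → Label)
    (hl : ∀ j, (l j).signs.length = (w.vertex j).signs.length) :
    Picture { w with vertex := l } :=
  let T : Diagram diskSurf :=
    { Q.T with
      label := fun v => l (Q.v.symm v)
      end_chart := by
        intro p v z hz
        rw [hl, ← Q.label_eq, Equiv.apply_symm_apply]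
        exact Q.T.end_chart p v z hz
      end_port := by
        intro v i hi
        rw [hl, ← Q.label_eq, Equiv.apply_symm_apply] at hi ⊢
        exact Q.T.end_port v i hi }
  have hT (x : Place w.n) : x.point w.bd.length Q.T Q.v = x.point w.bd.length T Q.v := by
    cases x with
    | bd i => rfl
    | vx k i =>
      change Q.T.chart (Q.v k) (port (Q.T.label (Q.v k)).signs.length i) =
        Q.T.chart (Q.v k) (port (l (Q.v.symm (Q.v k))).signs.length i)
      rw [Equiv.symm_apply_apply, hl, Q.label_eq]
  { T := T
    isTangle := Q.isTangle
    v := Q.v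
    e := Q.e
    label_eq := fun k => congrArg l (Q.v.symm_apply_apply k)
    tail := fun j => (Q.tail j).trans (hT _)
    head := fun j => (Q.head j).trans (hT _) }

/-- Insertion at a crossing of a picture is insertion in the picture with a box instead. -/
theorem Picture.ins_cls {w : Wiring} (Q : Picture w) {k : Fin w.n} (hk : (w.vertex k).IsClassical)
    (l : Fin w.n → Label) [Nonempty (Picture { w with vertex := l })] (T : Tg 4)
    (f : Fin w.n → Option (Diagram diskSurf)) (h0 : l k = box₄ := by rfl)
    (h1 : ∀ j, j ≠ k → l j = w.vertex j := by decide)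
    (hw : Wiring.Connected { w with vertex := l } := by decide +kernel)
    (hf : f = Function.update (fun _ => none) k (some T.1) := by
      funext i; fin_cases i <;> rfl) :
    Q.ins M' k (cls S M' T) = cls S M' (draw { w with vertex := l } f) := by
  have hl : ∀ j, (l j).signs.length = (w.vertex j).signs.length := by
    intro j
    by_cases hj : j = k
    · rw [hj, h0, hk.signs_eq]
      rfl
    · rw [h1 j hj]
  have hT : IsTangle (Q.T.label (Q.v k)).signs T.1 := by
    rw [Q.label_eq, hk.signs_eq]
    exact T.2
  have hT' : IsTangle ((Q.relabel l hl).T.label (Q.v k)).signs T.1 := by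
    have h2 := (Q.relabel l hl).label_eq k
    change (Q.relabel l hl).T.label (Q.v k) = l k at h2
    rw [h2, h0]
    exact T.2
  rw [Picture.ins, dif_pos hk]
  refine (plugOp_cls Q.T Q.isTangle (Q.v k) _ T hT).trans ?_
  have ρ : Relabel (Q.T.plug (Q.v k) T.1 hT) ((Q.relabel l hl).T.plug (Q.v k) T.1 hT') :=
    { eV := fun x => x
      eE := fun x => x
      surjV := fun x => ⟨x, rfl⟩
      surjE := fun x => ⟨x, rfl⟩
      label := by
        rintro (⟨v, hv⟩ | x)
        · have h2 : Q.v.symm v ≠ k := fun h => hv (by rw [← h, Equiv.apply_symm_apply]; rfl)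
          have h3 : l (Q.v.symm v) = Q.T.label v := by
            rw [h1 _ h2, ← Q.label_eq, Equiv.apply_symm_apply]
          exact h3
        · rfl
      chart := by rintro (v | x) <;> rfl
      path := by rintro (e | x) <;> rfl }
  refine (cls_eq_of_relabel (T' := ⟨(Q.relabel l hl).T.plug (Q.v k) T.1 hT',
    hasPorts_plug.2 (Q.relabel l hl).isTangle⟩) ρ).trans ?_
  exact (Q.relabel l hl).cls_plug_eq_draw hw k hT' (hf := hf)

end

/-! ### Algebra of local skein modules -/

section
variable {F : Type} [TopologicalSpace F] {S : Surf F} {o : Mode} {A : Type*} [CommRing A]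
  {M' : KnotTheory o A}

/-- A local skein module is generated by the classes of tangles. -/
@[elab_as_elim]
theorem Sk.induction {m : ℕ} {p : Sk S M' m → Prop} (x : Sk S M' m) (zero : p 0)
    (add : ∀ x y, p x → p y → p (x + y)) (smul : ∀ (a : A) x, p x → p (a • x))
    (cls : ∀ T, p (cls S M' T)) : p x := by
  obtain ⟨y, rfl⟩ := (Null S M' m).mkQ_surjective x
  induction y using Finsupp.induction_linear with
  | zero => rwa [map_zero]
  | add f g hf hg => rw [map_add]; exact add _ _ hf hg
  | single T a =>
    rw [← mul_one a, ← smul_eq_mul, ← Finsupp.smul_single, map_smul]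
    exact smul _ _ (cls T)

variable (M') in
/-- Insertion at a vertex of some drawing of a picture. -/
def op (w : Wiring) [Nonempty (Picture w)] (f : Fin w.n → Option (Diagram diskSurf)) (k : Fin w.n)
    (hk : f k = none := by rfl) : Sk S M' (w.deg k) →ₗ[A] Sk S M' w.bd.length :=
  (Classical.arbitrary (Picture w)).opAt M' f k hk

theorem op_cls (w : Wiring) [Nonempty (Picture w)] (f : Fin w.n → Option (Diagram diskSurf))
    (k : Fin w.n) (hk : f k = none) (T : Tg (w.deg k)) (f' : Fin w.n → Option (Diagram diskSurf))
    (hf : f' = Function.update f k (some T.1) := by funext i; fin_cases i <;> rfl) :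
    op M' w f k hk (cls S M' T) = cls S M' (draw w f') := by
  rw [hf]
  exact Picture.opAt_cls _ _ _ _ _

variable (M') in
/-- Insertion at two vertices of some drawing of a picture. -/
def op₂ (w : Wiring) [Nonempty (Picture w)] (k l : Fin w.n) (hkl : l ≠ k := by decide) :
    Sk S M' (w.deg k) →ₗ[A] Sk S M' (w.deg l) →ₗ[A] Sk S M' w.bd.length :=
  (Classical.arbitrary (Picture w)).op₂ M' (fun _ => none) k l hkl rfl rfl

theorem op₂_cls (w : Wiring) [Nonempty (Picture w)] (k l : Fin w.n) (hkl : l ≠ k)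
    (T : Tg (w.deg k)) (U : Tg (w.deg l)) (f : Fin w.n → Option (Diagram diskSurf))
    (hf : f = Function.update (Function.update (fun _ => none) k (some T.1)) l (some U.1) := by
      funext i; fin_cases i <;> rfl) :
    op₂ M' w k l hkl (cls S M' T) (cls S M' U) = cls S M' (draw w f) := by
  rw [hf]
  exact Picture.op₂_cls _ _ _ _ _ _ _ _ _

theorem cls_draw_congr (w : Wiring) [Nonempty (Picture w)]
    (f : Fin w.n → Option (Diagram diskSurf)) (k : Fin w.n) (T U : Tg (w.deg k))
    (h : cls S M' T = cls S M' U) (f₁ f₂ : Fin w.n → Option (Diagram diskSurf))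
    (hk : f k = none := by rfl)
    (hf₁ : f₁ = Function.update f k (some T.1) := by funext i; fin_cases i <;> rfl)
    (hf₂ : f₂ = Function.update f k (some U.1) := by funext i; fin_cases i <;> rfl) :
    cls S M' (draw w f₁) = cls S M' (draw w f₂) := by
  rw [← op_cls w f k hk T f₁ hf₁, h, op_cls w f k hk U f₂ hf₂]

/-- The product of 2-tangles, stacked along the strands. -/
def mul₄ : Sk S M' 4 →ₗ[A] Sk S M' 4 →ₗ[A] Sk S M' 4 := op₂ M' (parallelBigon box₄ box₄) 0 1

theorem mul₄_cls (a b : Tg 4) : mul₄ (cls S M' a) (cls S M' b) =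
    cls S M' (draw (parallelBigon box₄ box₄) ![some a.1, some b.1]) :=
  op₂_cls (parallelBigon box₄ box₄) 0 1 _ a b _

/-- The product of 3-tangles, stacked along the strands. -/
def mul₆ : Sk S M' 6 →ₗ[A] Sk S M' 6 →ₗ[A] Sk S M' 6 := op₂ M' stack 0 1

theorem mul₆_cls (a b : Tg 6) : mul₆ (cls S M' a) (cls S M' b) =
    cls S M' (draw stack ![some a.1, some b.1]) :=
  op₂_cls stack 0 1 _ a b _

/-- Addition of a third strand on the right. -/
def incl₁₂ : Sk S M' 4 →ₗ[A] Sk S M' 6 := op M' besideLeft (fun _ => none) 0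

theorem incl₁₂_cls (a : Tg 4) : incl₁₂ (cls S M' a) = cls S M' (draw besideLeft ![some a.1]) :=
  op_cls besideLeft _ 0 _ a _

/-- Addition of a third strand on the left. -/
def incl₂₃ : Sk S M' 4 →ₗ[A] Sk S M' 6 := op M' besideRight (fun _ => none) 0

theorem incl₂₃_cls (a : Tg 4) : incl₂₃ (cls S M' a) = cls S M' (draw besideRight ![some a.1]) :=
  op_cls besideRight _ 0 _ a _

theorem mul₄_assoc (x y z : Sk S M' 4) : mul₄ (mul₄ x y) z = mul₄ x (mul₄ y z) := by
  induction x using Sk.induction with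
  | zero => simp only [map_zero, LinearMap.zero_apply]
  | add x y hx hy => simp only [map_add, LinearMap.add_apply, hx, hy]
  | smul a x hx => simp only [map_smul, LinearMap.smul_apply, hx]
  | cls a =>
  induction y using Sk.induction with
  | zero => simp only [map_zero, LinearMap.zero_apply]
  | add x y hx hy => simp only [map_add, LinearMap.add_apply, hx, hy]
  | smul a x hx => simp only [map_smul, LinearMap.smul_apply, hx]
  | cls b =>
  induction z using Sk.induction with
  | zero => simp only [map_zero]
  | add x y hx hy => simp only [map_add, hx, hy]
  | smul a x hx => simp only [map_smul, hx]
  | cls c =>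
  rw [mul₄_cls, mul₄_cls b]
  exact (mul₄_cls _ c).trans ((cls_parallelBigon_left a b c).trans
    ((cls_parallelBigon_right a b c).symm.trans (mul₄_cls a _).symm))

theorem mul₆_assoc (x y z : Sk S M' 6) : mul₆ (mul₆ x y) z = mul₆ x (mul₆ y z) := by
  induction x using Sk.induction with
  | zero => simp only [map_zero, LinearMap.zero_apply]
  | add x y hx hy => simp only [map_add, LinearMap.add_apply, hx, hy]
  | smul a x hx => simp only [map_smul, LinearMap.smul_apply, hx]
  | cls a =>
  induction y using Sk.induction with
  | zero => simp only [map_zero, LinearMap.zero_apply]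
  | add x y hx hy => simp only [map_add, LinearMap.add_apply, hx, hy]
  | smul a x hx => simp only [map_smul, LinearMap.smul_apply, hx]
  | cls b =>
  induction z using Sk.induction with
  | zero => simp only [map_zero]
  | add x y hx hy => simp only [map_add, hx, hy]
  | smul a x hx => simp only [map_smul, hx]
  | cls c =>
  rw [mul₆_cls, mul₆_cls b]
  exact (mul₆_cls _ c).trans ((cls_stack_left a b c).trans
    ((cls_stack_right a b c).symm.trans (mul₆_cls a _).symm))

/-- A bilinear map is determined by its values on classes of tangles. -/
theorem bilin_ext {m n k : ℕ} {f g : Sk S M' m →ₗ[A] Sk S M' n →ₗ[A] Sk S M' k}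
    (h : ∀ a b, f (cls S M' a) (cls S M' b) = g (cls S M' a) (cls S M' b)) : f = g :=
  Sk.hom_ext fun a => Sk.hom_ext fun b => h a b

/-- The class of the trivial 2-tangle. It is used as a unit only for products. -/
def one₄ : Sk S M' 4 := cls S M' (draw parallelStrands Fin.elim0)

/-- The class of the trivial 3-tangle. It is used as a unit only for products. -/
def one₆ : Sk S M' 6 := cls S M' (draw threeStrands Fin.elim0)

theorem one₄_mul₄ (x y : Sk S M' 4) : mul₄ one₄ (mul₄ x y) = mul₄ x y := by
  refine LinearMap.congr_fun₂ (f := mul₄.compr₂ (mul₄ one₄)) (bilin_ext fun a b => ?_) x y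
  rw [LinearMap.compr₂_apply, mul₄_cls, one₄]
  exact (mul₄_cls _ _).trans (cls_parallelStrands_parallelBigon a b)

theorem mul₄_one₄ (x y : Sk S M' 4) : mul₄ (mul₄ x y) one₄ = mul₄ x y := by
  refine LinearMap.congr_fun₂ (f := mul₄.compr₂ (mul₄.flip one₄)) (bilin_ext fun a b => ?_) x y
  rw [LinearMap.compr₂_apply, mul₄_cls, one₄]
  exact (mul₄_cls _ _).trans (cls_parallelBigon_parallelStrands a b)

theorem one₆_mul₆ (x y : Sk S M' 6) : mul₆ one₆ (mul₆ x y) = mul₆ x y := by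
  refine LinearMap.congr_fun₂ (f := mul₆.compr₂ (mul₆ one₆)) (bilin_ext fun a b => ?_) x y
  rw [LinearMap.compr₂_apply, mul₆_cls, one₆]
  exact (mul₆_cls _ _).trans (cls_threeStrands_stack a b)

theorem mul₆_one₆ (x y : Sk S M' 6) : mul₆ (mul₆ x y) one₆ = mul₆ x y := by
  refine LinearMap.congr_fun₂ (f := mul₆.compr₂ (mul₆.flip one₆)) (bilin_ext fun a b => ?_) x y
  rw [LinearMap.compr₂_apply, mul₆_cls, one₆]
  exact (mul₆_cls _ _).trans (cls_stack_threeStrands a b)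

theorem incl₁₂_mul₄ (x y : Sk S M' 4) :
    incl₁₂ (mul₄ x y) = mul₆ (incl₁₂ x) (incl₁₂ y) := by
  refine LinearMap.congr_fun₂ (f := mul₄.compr₂ incl₁₂) (g := mul₆.compl₁₂ incl₁₂ incl₁₂)
    (bilin_ext fun a b => ?_) x y
  rw [LinearMap.compr₂_apply, LinearMap.compl₁₂_apply, mul₄_cls, incl₁₂_cls a, incl₁₂_cls b]
  exact (incl₁₂_cls _).trans ((cls_besideLeft_parallelBigon a b).trans
    ((cls_stack_besideLeft a b).symm.trans (mul₆_cls _ _).symm))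

theorem incl₂₃_mul₄ (x y : Sk S M' 4) :
    incl₂₃ (mul₄ x y) = mul₆ (incl₂₃ x) (incl₂₃ y) := by
  refine LinearMap.congr_fun₂ (f := mul₄.compr₂ incl₂₃) (g := mul₆.compl₁₂ incl₂₃ incl₂₃)
    (bilin_ext fun a b => ?_) x y
  rw [LinearMap.compr₂_apply, LinearMap.compl₁₂_apply, mul₄_cls, incl₂₃_cls a, incl₂₃_cls b]
  exact (incl₂₃_cls _).trans ((cls_besideRight_parallelBigon a b).trans
    ((cls_stack_besideRight a b).symm.trans (mul₆_cls _ _).symm))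

theorem incl₁₂_one₄ : incl₁₂ (one₄ : Sk S M' 4) = one₆ :=
  (incl₁₂_cls _).trans cls_besideLeft_parallelStrands

theorem incl₂₃_one₄ : incl₂₃ (one₄ : Sk S M' 4) = one₆ :=
  (incl₂₃_cls _).trans cls_besideRight_parallelStrands

theorem cls_triangleLeft (a b c : Tg 4) : cls S M' (draw (triangleLeft box₄ box₄ box₄)
      ![some a.1, some b.1, some c.1]) =
    mul₆ (incl₁₂ (cls S M' a)) (mul₆ (incl₂₃ (cls S M' b)) (incl₁₂ (cls S M' c))) := by
  rw [incl₁₂_cls, incl₁₂_cls, incl₂₃_cls]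
  refine Eq.trans ?_ (congrArg _ (mul₆_cls _ _)).symm
  refine Eq.trans ?_ (mul₆_cls _ _).symm
  exact (cls_stackThree_triangleLeft a b c).symm.trans (cls_stack_right _ _ _).symm

theorem cls_triangleRight (a b c : Tg 4) : cls S M' (draw (triangleRight box₄ box₄ box₄)
      ![some a.1, some b.1, some c.1]) =
    mul₆ (incl₂₃ (cls S M' c)) (mul₆ (incl₁₂ (cls S M' b)) (incl₂₃ (cls S M' a))) := by
  rw [incl₁₂_cls, incl₂₃_cls, incl₂₃_cls]
  refine Eq.trans ?_ (congrArg _ (mul₆_cls _ _)).symm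
  refine Eq.trans ?_ (mul₆_cls _ _).symm
  exact (cls_stackThree_triangleRight c b a).symm.trans (cls_stack_right _ _ _).symm

end

/-! ### Braid relations in a semigroup -/

section
variable {R : Type*} [Semigroup R] {e s s' t t' : R}

/-- Conjugation of a relation of the form `s y s = t x t`. The element `e` is a unit for products
only. -/
theorem braid_conj (h₁ : ∀ x y : R, e * (x * y) = x * y) (h₂ : ∀ x y : R, x * y * e = x * y)
    (hs : s' * s = e) (ht : t * t' = e) {x y : R} (h : s * (y * s) = t * (x * t)) :
    s' * (t * x) = y * (s * t') :=
  calc s' * (t * x) = s' * (t * x) * e := (h₂ _ _).symm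
    _ = s' * (t * (x * t)) * t' := by simp only [← ht, mul_assoc]
    _ = s' * s * (y * (s * t')) := by simp only [← h, mul_assoc]
    _ = y * (s * t') := by rw [hs, h₁]

/-- A relation of the form `x t s = t s y` remains valid after multiplication of `x` by `s'`, and of
`y` by `t'`, from both sides. -/
theorem braid_slide (h₁ : ∀ x y : R, e * (x * y) = x * y) (h₂ : ∀ x y : R, x * y * e = x * y)
    (hs : s' * s = e) (ht : t * t' = e) (hst : s * (t * s) = t * (s * t)) {x y : R}
    (h : x * (t * s) = t * (s * y)) :
    s' * (x * s') * (t * s) = t * (s * (t' * (y * t'))) := by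
  have h' : s' * (t * s) = t * (s * t') := braid_conj h₁ h₂ hs ht hst
  calc s' * (x * s') * (t * s) = s' * (x * (s' * (t * s))) := by simp only [mul_assoc]
    _ = s' * (x * (t * s)) * t' := by simp only [h', mul_assoc]
    _ = s' * (t * s) * (y * t') := by simp only [h, mul_assoc]
    _ = t * (s * (t' * (y * t'))) := by simp only [h', mul_assoc]

end

/-! ### Products of tangles and crossings -/

section
variable {F : Type} [TopologicalSpace F] {S : Surf F} {o : Mode} {A : Type*} [CommRing A]
  {M' : KnotTheory o A}

theorem Sk.eq_of_cls {m : ℕ} {N : Type*} [AddCommGroup N] [Module A N] (f g : Sk S M' m →ₗ[A] N)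
    (h : ∀ T, f (cls S M' T) = g (cls S M' T)) (x : Sk S M' m) : f x = g x :=
  LinearMap.congr_fun (Sk.hom_ext h) x

/-- The class of a crossing. -/
def cr (l : Label) [Nonempty (Picture (crossing l))] : Sk S M' 4 := cls S M' (crossingTg l)

theorem ins_triangleLeft_zero (Q : Picture (triangleLeft .pos .pos .pos)) (x : Sk S M' 4) :
    Q.ins M' 0 x = mul₆ (incl₁₂ x) (mul₆ (incl₂₃ (cr .pos)) (incl₁₂ (cr .pos))) := by
  refine Sk.eq_of_cls (Q.ins M' 0) (mul₆.flip _ ∘ₗ incl₁₂) (fun a => ?_) x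
  refine (Q.ins_cls (Or.inl rfl) ![box₄, .pos, .pos] a ![some a.1, none, none]).trans ?_
  exact (cls_triangleLeft_box_pos_pos a).symm.trans (cls_triangleLeft a _ _)

theorem ins_triangleLeft_one (Q : Picture (triangleLeft .pos .pos .pos)) (x : Sk S M' 4) :
    Q.ins M' 1 x = mul₆ (incl₁₂ (cr .pos)) (mul₆ (incl₂₃ x) (incl₁₂ (cr .pos))) := by
  refine Sk.eq_of_cls (Q.ins M' 1) (mul₆ (incl₁₂ (cr .pos)) ∘ₗ
    mul₆.flip (incl₁₂ (cr .pos)) ∘ₗ incl₂₃) (fun a => ?_) x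
  refine (Q.ins_cls (Or.inl rfl) ![.pos, box₄, .pos] a ![none, some a.1, none]).trans ?_
  exact (cls_triangleLeft_pos_box_pos a).symm.trans (cls_triangleLeft _ a _)

theorem ins_triangleRight_zero (Q : Picture (triangleRight .pos .pos .pos)) (x : Sk S M' 4) :
    Q.ins M' 0 x = mul₆ (incl₂₃ (cr .pos)) (mul₆ (incl₁₂ (cr .pos)) (incl₂₃ x)) := by
  refine Sk.eq_of_cls (Q.ins M' 0) (mul₆ (incl₂₃ (cr .pos)) ∘ₗ
    mul₆ (incl₁₂ (cr .pos)) ∘ₗ incl₂₃) (fun a => ?_) x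
  refine (Q.ins_cls (Or.inl rfl) ![box₄, .pos, .pos] a ![some a.1, none, none]).trans ?_
  exact (cls_triangleRight_box_pos_pos a).symm.trans (cls_triangleRight a _ _)

theorem ins_triangleRight_one (Q : Picture (triangleRight .pos .pos .pos)) (x : Sk S M' 4) :
    Q.ins M' 1 x = mul₆ (incl₂₃ (cr .pos)) (mul₆ (incl₁₂ x) (incl₂₃ (cr .pos))) := by
  refine Sk.eq_of_cls (Q.ins M' 1) (mul₆ (incl₂₃ (cr .pos)) ∘ₗ
    mul₆.flip (incl₂₃ (cr .pos)) ∘ₗ incl₁₂) (fun a => ?_) x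
  refine (Q.ins_cls (Or.inl rfl) ![.pos, box₄, .pos] a ![none, some a.1, none]).trans ?_
  exact (cls_triangleRight_pos_box_pos a).symm.trans (cls_triangleRight _ a _)

theorem ins_parallelBigon_pos_neg_zero (Q : Picture (parallelBigon .pos .neg)) (x : Sk S M' 4) :
    Q.ins M' 0 x = mul₄ x (cr .neg) := by
  refine Sk.eq_of_cls (Q.ins M' 0) (mul₄.flip (cr .neg)) (fun a => ?_) x
  refine (Q.ins_cls (by simp [Label.IsClassical]) ![box₄, .neg] a ![some a.1, none]).trans ?_
  exact (cls_parallelBigon_box_neg a).symm.trans (mul₄_cls a _).symm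

theorem ins_parallelBigon_pos_neg_one (Q : Picture (parallelBigon .pos .neg)) (x : Sk S M' 4) :
    Q.ins M' 1 x = mul₄ (cr .pos) x := by
  refine Sk.eq_of_cls (Q.ins M' 1) (mul₄ (cr .pos)) (fun a => ?_) x
  refine (Q.ins_cls (by simp [Label.IsClassical]) ![.pos, box₄] a ![none, some a.1]).trans ?_
  exact (cls_parallelBigon_pos_box a).symm.trans (mul₄_cls _ a).symm

theorem ins_parallelBigon_neg_pos_zero (Q : Picture (parallelBigon .neg .pos)) (x : Sk S M' 4) :
    Q.ins M' 0 x = mul₄ x (cr .pos) := by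
  refine Sk.eq_of_cls (Q.ins M' 0) (mul₄.flip (cr .pos)) (fun a => ?_) x
  refine (Q.ins_cls (by simp [Label.IsClassical]) ![box₄, .pos] a ![some a.1, none]).trans ?_
  exact (cls_parallelBigon_box_pos a).symm.trans (mul₄_cls a _).symm

theorem ins_parallelBigon_neg_pos_one (Q : Picture (parallelBigon .neg .pos)) (x : Sk S M' 4) :
    Q.ins M' 1 x = mul₄ (cr .neg) x := by
  refine Sk.eq_of_cls (Q.ins M' 1) (mul₄ (cr .neg)) (fun a => ?_) x
  refine (Q.ins_cls (by simp [Label.IsClassical]) ![.neg, box₄] a ![none, some a.1]).trans ?_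
  exact (cls_parallelBigon_neg_box a).symm.trans (mul₄_cls _ a).symm

theorem put_sandwich_pos (Q : Picture (sandwich .pos)) (x : Tangle o crossSigns →₀ A) :
    clsLin S M' 4 (Q.put 1 rfl x) = mul₄ (cr .pos)
      (mul₄ (clsLin S M' crossSigns.length (toDiagrams x)) (cr .pos)) := by
  refine (clsLin_putLin Q.T Q.isTangle _ _ _).trans ?_
  refine Sk.eq_of_cls (plugOp M' Q.T Q.isTangle _ _) (mul₄ (cr .pos) ∘ₗ mul₄.flip (cr .pos))
    (fun a => ?_) _
  have ha : IsTangle (Q.T.label (Q.v 1)).signs a.1 := by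
    rw [Q.label_eq]
    exact a.2
  refine (plugOp_cls Q.T Q.isTangle _ _ a ha).trans ?_
  refine (Q.cls_plug_eq_draw (by decide +kernel) 1 ha (f := ![none, some a.1, none])
    (by funext i; fin_cases i <;> rfl)).trans ?_
  refine (cls_triple_pos_box_pos a).symm.trans ?_
  refine (cls_parallelBigon_right _ a _).symm.trans ((mul₄_cls _ _).symm.trans ?_)
  exact congrArg (mul₄ (cr .pos)) (mul₄_cls a _).symm

theorem put_sandwich_neg (Q : Picture (sandwich .neg)) (x : Tangle o crossSigns →₀ A) :
    clsLin S M' 4 (Q.put 1 rfl x) = mul₄ (cr .neg)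
      (mul₄ (clsLin S M' crossSigns.length (toDiagrams x)) (cr .neg)) := by
  refine (clsLin_putLin Q.T Q.isTangle _ _ _).trans ?_
  refine Sk.eq_of_cls (plugOp M' Q.T Q.isTangle _ _) (mul₄ (cr .neg) ∘ₗ mul₄.flip (cr .neg))
    (fun a => ?_) _
  have ha : IsTangle (Q.T.label (Q.v 1)).signs a.1 := by
    rw [Q.label_eq]
    exact a.2
  refine (plugOp_cls Q.T Q.isTangle _ _ a ha).trans ?_
  refine (Q.cls_plug_eq_draw (by decide +kernel) 1 ha (f := ![none, some a.1, none])
    (by funext i; fin_cases i <;> rfl)).trans ?_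
  refine (cls_triple_neg_box_neg a).symm.trans ?_
  refine (cls_parallelBigon_right _ a _).symm.trans ((mul₄_cls _ _).symm.trans ?_)
  exact congrArg (mul₄ (cr .neg)) (mul₄_cls a _).symm

end

/-! ### Closures and antiparallel bigons -/

section
variable {F : Type} [TopologicalSpace F] {S : Surf F} {o : Mode} {A : Type*} [CommRing A]
  {M' : KnotTheory o A}

/-- The closure of the left strand of a 3-tangle. -/
def closureLeft : Sk S M' 6 →ₗ[A] Sk S M' 4 := op M' closeLeft (fun _ => none) 0

theorem closureLeft_cls (a : Tg 6) :
    closureLeft (cls S M' a) = cls S M' (draw closeLeft ![some a.1]) :=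
  op_cls closeLeft _ 0 _ a _

/-- The closure of the right strand of a 3-tangle. -/
def closureRight : Sk S M' 6 →ₗ[A] Sk S M' 4 := op M' closeRight (fun _ => none) 0

theorem closureRight_cls (a : Tg 6) :
    closureRight (cls S M' a) = cls S M' (draw closeRight ![some a.1]) :=
  op_cls closeRight _ 0 _ a _

/-- The counterclockwise bigon of two 2-tangles. -/
def ccw : Sk S M' 4 →ₗ[A] Sk S M' 4 →ₗ[A] Sk S M' 4 := op₂ M' (ccwBigon box₄ box₄) 0 1

theorem ccw_cls (a b : Tg 4) : ccw (cls S M' a) (cls S M' b) =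
    cls S M' (draw (ccwBigon box₄ box₄) ![some a.1, some b.1]) :=
  op₂_cls (ccwBigon box₄ box₄) 0 1 _ a b _

/-- The clockwise bigon of two 2-tangles. -/
def cw : Sk S M' 4 →ₗ[A] Sk S M' 4 →ₗ[A] Sk S M' 4 := op₂ M' (cwBigon box₄ box₄) 0 1

theorem cw_cls (a b : Tg 4) : cw (cls S M' a) (cls S M' b) =
    cls S M' (draw (cwBigon box₄ box₄) ![some a.1, some b.1]) :=
  op₂_cls (cwBigon box₄ box₄) 0 1 _ a b _

/-- The clockwise bigon of a 2-tangle and a negative crossing, with the boundary points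
renumbered. -/
def link : Sk S M' 4 →ₗ[A] Sk S M' 4 := op M' antiLink ![none, some (crossingTg .neg).1] 0

theorem link_cls (a : Tg 4) :
    link (cls S M' a) = cls S M' (draw antiLink ![some a.1, some (crossingTg .neg).1]) :=
  op_cls antiLink _ 0 _ a _

/-- The counterclockwise bigon of a 2-tangle and a negative crossing, with the boundary points
renumbered. -/
def link' : Sk S M' 4 →ₗ[A] Sk S M' 4 := op M' antiLink' ![none, some (crossingTg .neg).1] 0

theorem link'_cls (a : Tg 4) :
    link' (cls S M' a) = cls S M' (draw antiLink' ![some a.1, some (crossingTg .neg).1]) :=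
  op_cls antiLink' _ 0 _ a _

/-- The closed strand has a loop at the middle crossing, which can be removed by a first
Reidemeister move. -/
theorem closureLeft_mul (h : cls S M' (draw (loopLeft box₄) ![some (crossingTg .pos).1]) =
      cls S M' (draw strand Fin.elim0)) (x y : Sk S M' 4) :
    closureLeft (mul₆ (incl₂₃ x) (mul₆ (incl₁₂ (cr .pos)) (incl₂₃ y))) = mul₄ x y := by
  refine LinearMap.congr_fun₂ (f := (mul₆.compl₁₂ incl₂₃ (mul₆ (incl₁₂ (cr .pos)) ∘ₗ
    incl₂₃)).compr₂ closureLeft) (bilin_ext fun a b => ?_) x y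
  refine (congrArg closureLeft (cls_triangleRight b (crossingTg .pos) a).symm).trans ?_
  refine (closureLeft_cls _).trans ((cls_closeLeft_triangleRight b _ a).trans ?_)
  refine (cls_bridgeLeft_loopLeft b _ a).symm.trans (Eq.trans ?_
    ((cls_bridgeLeft_strand a b).trans (mul₄_cls a b).symm))
  exact cls_draw_congr bridgeLeft ![some a.1, none, some b.1] 1 _ _ h _ _

/-- The mirror image of `closureLeft_mul`. -/
theorem closureRight_mul (h : cls S M' (draw (loopRight box₄) ![some (crossingTg .pos).1]) =
      cls S M' (draw strand Fin.elim0)) (x y : Sk S M' 4) :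
    closureRight (mul₆ (incl₁₂ x) (mul₆ (incl₂₃ (cr .pos)) (incl₁₂ y))) = mul₄ x y := by
  refine LinearMap.congr_fun₂ (f := (mul₆.compl₁₂ incl₁₂ (mul₆ (incl₂₃ (cr .pos)) ∘ₗ
    incl₁₂)).compr₂ closureRight) (bilin_ext fun a b => ?_) x y
  refine (congrArg closureRight (cls_triangleLeft a (crossingTg .pos) b).symm).trans ?_
  refine (closureRight_cls _).trans ((cls_closeRight_triangleLeft a _ b).trans ?_)
  refine (cls_bridgeRight_loopRight a _ b).symm.trans (Eq.trans ?_
    ((cls_bridgeRight_strand a b).trans (mul₄_cls a b).symm))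
  exact cls_draw_congr bridgeRight ![some a.1, none, some b.1] 1 _ _ h _ _

/-- A clockwise bigon of two crossings of opposite signs is inserted between the antiparallel
strands of the counterclockwise bigon. One of its crossings is the crossing in the middle of the
product, and the other one belongs to `link`. -/
theorem ccw_eq (h : cls S M' (draw (cwBigon box₄ box₄)
      ![some (crossingTg .pos).1, some (crossingTg .neg).1]) =
      cls S M' (draw antiStrands' Fin.elim0)) (x y : Sk S M' 4) :
    ccw y x = link (closureLeft (mul₆ (incl₁₂ x) (mul₆ (incl₂₃ (cr .pos)) (incl₁₂ y)))) := by
  refine LinearMap.congr_fun₂ (f := ccw.flip) (g := (mul₆.compl₁₂ incl₁₂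
    (mul₆ (incl₂₃ (cr .pos)) ∘ₗ incl₁₂)).compr₂ (link ∘ₗ closureLeft))
    (bilin_ext fun a b => Eq.symm ?_) x y
  refine (congrArg (fun z => link (closureLeft z))
    (cls_triangleLeft a (crossingTg .pos) b).symm).trans ?_
  refine (congrArg link ((closureLeft_cls _).trans (cls_closeLeft_triangleLeft a _ b))).trans ?_
  refine (link_cls _).trans ((cls_antiLink_closedLeft a _ b _).trans ?_)
  refine (cls_bigonHost_cwBigon a _ b _).symm.trans (Eq.trans ?_
    ((cls_bigonHost_antiStrands a b).trans (ccw_cls b a).symm))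
  exact cls_draw_congr bigonHost ![some a.1, some b.1, none] 2 _ _ h _ _

/-- The mirror image of `ccw_eq`. -/
theorem cw_eq (h : cls S M' (draw (ccwBigon box₄ box₄)
      ![some (crossingTg .pos).1, some (crossingTg .neg).1]) =
      cls S M' (draw antiStrands Fin.elim0)) (x y : Sk S M' 4) :
    cw x y = link' (closureRight (mul₆ (incl₂₃ x) (mul₆ (incl₁₂ (cr .pos)) (incl₂₃ y)))) := by
  refine LinearMap.congr_fun₂ (f := cw) (g := (mul₆.compl₁₂ incl₂₃
    (mul₆ (incl₁₂ (cr .pos)) ∘ₗ incl₂₃)).compr₂ (link' ∘ₗ closureRight))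
    (bilin_ext fun a b => Eq.symm ?_) x y
  refine (congrArg (fun z => link' (closureRight z))
    (cls_triangleRight b (crossingTg .pos) a).symm).trans ?_
  refine (congrArg link' ((closureRight_cls _).trans (cls_closeRight_triangleRight b _ a))).trans ?_
  refine (link'_cls _).trans ((cls_antiLink'_closedRight b _ a _).trans ?_)
  refine (cls_bigonHost'_ccwBigon b _ a _).symm.trans (Eq.trans ?_
    ((cls_bigonHost'_antiStrands a b).trans (cw_cls a b).symm))
  exact cls_draw_congr bigonHost' ![some a.1, some b.1, none] 2 _ _ h _ _

theorem ins_ccwBigon_zero (Q : Picture (ccwBigon .pos .neg)) (x : Sk S M' 4) :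
    Q.ins M' 0 x = ccw x (cr .neg) := by
  refine Sk.eq_of_cls (Q.ins M' 0) (ccw.flip (cr .neg)) (fun a => ?_) x
  refine (Q.ins_cls (by simp [Label.IsClassical]) ![box₄, .neg] a ![some a.1, none]).trans ?_
  exact (cls_ccwBigon_box_neg a).symm.trans (ccw_cls a _).symm

theorem ins_ccwBigon_one (Q : Picture (ccwBigon .pos .neg)) (x : Sk S M' 4) :
    Q.ins M' 1 x = ccw (cr .pos) x := by
  refine Sk.eq_of_cls (Q.ins M' 1) (ccw (cr .pos)) (fun a => ?_) x
  refine (Q.ins_cls (by simp [Label.IsClassical]) ![.pos, box₄] a ![none, some a.1]).trans ?_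
  exact (cls_ccwBigon_pos_box a).symm.trans (ccw_cls _ a).symm

theorem ins_cwBigon_zero (Q : Picture (cwBigon .pos .neg)) (x : Sk S M' 4) :
    Q.ins M' 0 x = cw x (cr .neg) := by
  refine Sk.eq_of_cls (Q.ins M' 0) (cw.flip (cr .neg)) (fun a => ?_) x
  refine (Q.ins_cls (by simp [Label.IsClassical]) ![box₄, .neg] a ![some a.1, none]).trans ?_
  exact (cls_cwBigon_box_neg a).symm.trans (cw_cls a _).symm

theorem ins_cwBigon_one (Q : Picture (cwBigon .pos .neg)) (x : Sk S M' 4) :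
    Q.ins M' 1 x = cw (cr .pos) x := by
  refine Sk.eq_of_cls (Q.ins M' 1) (cw (cr .pos)) (fun a => ?_) x
  refine (Q.ins_cls (by simp [Label.IsClassical]) ![.pos, box₄] a ![none, some a.1]).trans ?_
  exact (cls_cwBigon_pos_box a).symm.trans (cw_cls _ a).symm

end

/-! ### Second Reidemeister moves -/

section
variable {F : Type} [TopologicalSpace F] [T2Space F] [ChartedSpace (EuclideanHalfSpace 2) F]
  {ω : SurfaceOrientation F} {o : Mode} {A : Type*} [CommRing A] {M' : KnotTheory o A}
  {𝔱 : Theory}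

/-- A move of the source theory is an equality in the local skein module of the target theory. -/
theorem Includes.cls_draw (hM' : Includes 𝔱 M') {w w' : Wiring} (h : IsMove 𝔱 w w')
    [Nonempty (Picture w)] [Nonempty (Picture w')] (f' : Fin w'.n → Option (Diagram diskSurf))
    (hf' : f' = fun _ => none := by first | rfl | exact Subsingleton.elim _ _)
    (hw : w.Connected := by decide +kernel) (hw' : w'.Connected := by decide +kernel)
    (hbd : w'.bd.length = w.bd.length := by rfl) :
    cls ω.surf M' (draw w fun _ => none) =
      cls ω.surf M' ⟨(draw w' f').1, hbd ▸ (draw w' f').2⟩ := by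
  subst hf'
  obtain ⟨Q⟩ := ‹Nonempty (Picture w)›
  obtain ⟨Q'⟩ := ‹Nonempty (Picture w')›
  have hQ : HasPorts w.bd.length Q.T := Q.isTangle
  have hQ' : HasPorts w.bd.length Q'.T := hbd ▸ Q'.isTangle
  have h1 := (hM' w w' h Q Q').clsLin_eq (ω := ω)
  rw [clsLin_single hQ, clsLin_single hQ', one_smul, one_smul] at h1
  exact (Q.cls_eq_draw hw hQ _).symm.trans (h1.trans (Q'.cls_eq_draw hw' hQ' _))

theorem mul₄_pos_neg (hM' : Includes 𝔱 M') :
    mul₄ (cr .pos) (cr .neg) = (one₄ : Sk ω.surf M' 4) :=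
  (mul₄_cls _ _).trans (cls_parallelBigon_pos_neg.trans
    (hM'.cls_draw (.omega2 _ _ _ .a) Fin.elim0))

theorem mul₄_neg_pos (hM' : Includes 𝔱 M') :
    mul₄ (cr .neg) (cr .pos) = (one₄ : Sk ω.surf M' 4) :=
  (mul₄_cls _ _).trans (cls_parallelBigon_neg_pos.trans
    (hM'.cls_draw (.omega2 _ _ _ .b) Fin.elim0))

theorem braid_relation (hM' : Includes 𝔱 M') :
    mul₆ (incl₁₂ (cr .pos)) (mul₆ (incl₂₃ (cr .pos)) (incl₁₂ (cr .pos))) =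
      mul₆ (incl₂₃ (cr .pos)) (mul₆ (incl₁₂ (cr .pos)) (incl₂₃ (cr .pos : Sk ω.surf M' 4))) :=
  (cls_triangleLeft _ _ _).symm.trans (cls_triangleLeft_pos_pos_pos.trans
    ((hM'.cls_draw (.omega3 _) _).trans (cls_triangleRight_pos_pos_pos.symm.trans
      (cls_triangleRight _ _ _))))

/-- Compatibility with the third Reidemeister move, in terms of products of 3-tangles. -/
theorem Omega3Compatible.mul₆_eq {x : Tangle o crossSigns →₀ A} (h : Omega3Compatible M' x)
    {X : Sk ω.surf M' 4} (hX : X = clsLin ω.surf M' crossSigns.length (toDiagrams x)) :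
    mul₆ (incl₁₂ X) (mul₆ (incl₂₃ (cr .pos)) (incl₁₂ (cr .pos))) =
        mul₆ (incl₂₃ (cr .pos)) (mul₆ (incl₁₂ (cr .pos)) (incl₂₃ X)) ∧
      mul₆ (incl₁₂ (cr .pos)) (mul₆ (incl₂₃ X) (incl₁₂ (cr .pos))) =
        mul₆ (incl₂₃ (cr .pos)) (mul₆ (incl₁₂ X) (incl₂₃ (cr .pos))) := by
  obtain ⟨Q⟩ : Nonempty (Picture (triangleLeft .pos .pos .pos)) := inferInstance
  obtain ⟨Q'⟩ : Nonempty (Picture (triangleRight .pos .pos .pos)) := inferInstance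
  obtain ⟨h0, h1, -⟩ := h Q Q'
  rw [← ins_triangleLeft_zero Q, ← ins_triangleRight_zero Q', ← ins_triangleLeft_one Q,
    ← ins_triangleRight_one Q', hX]
  exact ⟨(Q.ins_clsLin (Or.inl rfl) rfl x).trans (h0.clsLin_eq.trans
      (Q'.ins_clsLin (Or.inl rfl) rfl x).symm),
    (Q.ins_clsLin (Or.inl rfl) rfl x).trans (h1.clsLin_eq.trans
      (Q'.ins_clsLin (Or.inl rfl) rfl x).symm)⟩

/-- The identities that allow a 2-tangle to be moved along a bigon. -/
theorem Omega3Compatible.slide (hM' : Includes 𝔱 M') {x : Tangle o crossSigns →₀ A}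
    (h : Omega3Compatible M' x) {X : Sk ω.surf M' 4}
    (hX : X = clsLin ω.surf M' crossSigns.length (toDiagrams x)) :
    mul₆ (incl₁₂ (cr .neg)) (mul₆ (incl₂₃ (cr .pos)) (incl₁₂ X)) =
        mul₆ (incl₂₃ X) (mul₆ (incl₁₂ (cr .pos)) (incl₂₃ (cr .neg))) ∧
      mul₆ (incl₁₂ (mul₄ (cr .neg) (mul₄ X (cr .neg))))
          (mul₆ (incl₂₃ (cr .pos)) (incl₁₂ (cr .pos))) =
        mul₆ (incl₂₃ (cr .pos)) (mul₆ (incl₁₂ (cr .pos))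
          (incl₂₃ (mul₄ (cr .neg) (mul₄ X (cr .neg))))) := by
  obtain ⟨h0, h1⟩ := h.mul₆_eq hX
  let inst : Semigroup (Sk ω.surf M' 6) :=
    { mul := fun a b => mul₆ a b
      mul_assoc := mul₆_assoc }
  have hs : mul₆ (incl₁₂ (cr .neg)) (incl₁₂ (cr .pos)) = (one₆ : Sk ω.surf M' 6) := by
    rw [← incl₁₂_mul₄, mul₄_neg_pos hM', incl₁₂_one₄]
  have ht : mul₆ (incl₂₃ (cr .pos)) (incl₂₃ (cr .neg)) = (one₆ : Sk ω.surf M' 6) := by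
    rw [← incl₂₃_mul₄, mul₄_pos_neg hM', incl₂₃_one₄]
  refine ⟨braid_conj one₆_mul₆ mul₆_one₆ hs ht h1, ?_⟩
  rw [incl₁₂_mul₄, incl₁₂_mul₄, incl₂₃_mul₄, incl₂₃_mul₄]
  exact braid_slide one₆_mul₆ mul₆_one₆ hs ht (braid_relation hM') h0

theorem mul₄_conj_left (hM' : Includes 𝔱 M') (X : Sk ω.surf M' 4) :
    mul₄ (cr .pos) (mul₄ (cr .neg) (mul₄ X (cr .neg))) = mul₄ X (cr .neg) := by
  rw [← mul₄_assoc, mul₄_pos_neg hM', one₄_mul₄]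

theorem mul₄_conj_right (hM' : Includes 𝔱 M') (X : Sk ω.surf M' 4) :
    mul₄ (mul₄ (cr .neg) (mul₄ X (cr .neg))) (cr .pos) = mul₄ (cr .neg) X := by
  rw [← mul₄_assoc, mul₄_assoc, mul₄_neg_pos hM', mul₄_one₄]

theorem mul₄_conj_left' (hM' : Includes 𝔱 M') (X : Sk ω.surf M' 4) :
    mul₄ (cr .neg) (mul₄ (cr .pos) (mul₄ X (cr .pos))) = mul₄ X (cr .pos) := by
  rw [← mul₄_assoc, mul₄_neg_pos hM', one₄_mul₄]

/-- A 2-tangle at the positive crossing of a counterclockwise bigon can be moved to the negative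
one: both sides equal the value of `link` on a product of parallel 2-tangles. -/
theorem ccw_neg (hM' : Includes 𝔱 M') {x : Tangle o crossSigns →₀ A}
    (h : Omega3Compatible M' x) {X : Sk ω.surf M' 4}
    (hX : X = clsLin ω.surf M' crossSigns.length (toDiagrams x)) :
    ccw X (cr .neg) = ccw (cr .pos) (mul₄ (cr .neg) (mul₄ X (cr .neg))) := by
  obtain ⟨h1, h2⟩ := h.slide hM' hX
  have hc := cls_cwBigon_pos_neg.trans (hM'.cls_draw (ω := ω) (.omega2 _ _ _ .d) Fin.elim0)
  have hl := cls_loopLeft_pos.trans (hM'.cls_draw (ω := ω) (.omega1l _) Fin.elim0)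
  rw [ccw_eq hc, ccw_eq hc, h1, h2, closureLeft_mul hl, closureLeft_mul hl, mul₄_conj_left hM']

/-- The mirror image of `ccw_neg`. -/
theorem cw_neg (hM' : Includes 𝔱 M') {x : Tangle o crossSigns →₀ A}
    (h : Omega3Compatible M' x) {X : Sk ω.surf M' 4}
    (hX : X = clsLin ω.surf M' crossSigns.length (toDiagrams x)) :
    cw X (cr .neg) = cw (cr .pos) (mul₄ (cr .neg) (mul₄ X (cr .neg))) := by
  obtain ⟨h1, h2⟩ := h.slide hM' hX
  have hc := cls_ccwBigon_pos_neg.trans (hM'.cls_draw (ω := ω) (.omega2 _ _ _ .c) Fin.elim0)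
  have hl := cls_loopRight_pos.trans (hM'.cls_draw (ω := ω) (.omega1r _) Fin.elim0)
  rw [cw_eq hc, cw_eq hc, ← h1, ← h2, closureRight_mul hl, closureRight_mul hl,
    mul₄_conj_right hM']

/-- The contributions of the two crossings of a second Reidemeister move cancel each other. -/
theorem omega2_cancel (hM' : Includes 𝔱 M') {w w' : Wiring} (h : IsOmega2 w w') (Q : Picture w)
    {k₁ k₂ : Fin w.n} (hk : k₁ < k₂) {x y : Tangle o crossSigns →₀ A}
    (hx : w.vertex k₁ = .pos → Omega3Compatible M' x) (hxy : IsDual M' (w.vertex k₁) x y) :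
    Q.ins M' k₁ (clsLin ω.surf M' crossSigns.length (toDiagrams x)) +
      Q.ins M' k₂ (clsLin ω.surf M' crossSigns.length (toDiagrams y)) = 0 := by
  have h01 : ∀ i j : Fin 2, i < j → i = 0 ∧ j = 1 := by decide
  obtain ⟨X, hX⟩ : ∃ X : Sk ω.surf M' 4,
    X = clsLin ω.surf M' crossSigns.length (toDiagrams x) := ⟨_, rfl⟩
  have hneg : IsDual M' .pos x y → clsLin ω.surf M' crossSigns.length (toDiagrams y) =
      -mul₄ (cr .neg) (mul₄ X (cr .neg)) := by
    intro h
    -- the wiring `sandwich` is a product of three 2-tangles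
    obtain ⟨Q'⟩ : Nonempty (Picture (sandwich .neg)) :=
      inferInstanceAs (Nonempty (Picture (triple .neg box₄ .neg)))
    rw [hX, ← put_sandwich_neg Q', ← map_neg]
    exact (h Q').clsLin_eq.symm
  have hpos : IsDual M' .neg x y → clsLin ω.surf M' crossSigns.length (toDiagrams y) =
      -mul₄ (cr .pos) (mul₄ X (cr .pos)) := by
    intro h
    obtain ⟨Q'⟩ : Nonempty (Picture (sandwich .pos)) :=
      inferInstanceAs (Nonempty (Picture (triple .pos box₄ .pos)))
    rw [hX, ← put_sandwich_pos Q', ← map_neg]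
    exact (h Q').clsLin_eq.symm
  rw [← hX]
  cases h with
  | a =>
    obtain ⟨rfl, rfl⟩ := h01 k₁ k₂ hk
    rw [hneg hxy]
    refine (congrArg₂ _ (ins_parallelBigon_pos_neg_zero Q X)
      (ins_parallelBigon_pos_neg_one Q _)).trans ?_
    rw [map_neg, mul₄_conj_left hM']
    exact add_neg_cancel _
  | b =>
    obtain ⟨rfl, rfl⟩ := h01 k₁ k₂ hk
    rw [hpos hxy]
    refine (congrArg₂ _ (ins_parallelBigon_neg_pos_zero Q X)
      (ins_parallelBigon_neg_pos_one Q _)).trans ?_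
    rw [map_neg, mul₄_conj_left' hM']
    exact add_neg_cancel _
  | c =>
    obtain ⟨rfl, rfl⟩ := h01 k₁ k₂ hk
    rw [hneg hxy]
    refine (congrArg₂ _ (ins_ccwBigon_zero Q X) (ins_ccwBigon_one Q _)).trans ?_
    rw [map_neg, ccw_neg hM' (hx rfl) hX, add_neg_cancel]
  | d =>
    obtain ⟨rfl, rfl⟩ := h01 k₁ k₂ hk
    rw [hneg hxy]
    refine (congrArg₂ _ (ins_cwBigon_zero Q X) (ins_cwBigon_one Q _)).trans ?_
    rw [map_neg, cw_neg hM' (hx rfl) hX, add_neg_cancel]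

end

/-! ### Invariance of the derivation -/

section
variable {F : Type} [TopologicalSpace F] {S : Surf F} {o : Mode} {A : Type*} [CommRing A]
  (M' : KnotTheory o A)

open Classical in
/-- The contribution of a vertex to the derivation of a diagram, in the skein module of all the
diagrams. -/
def derivationTerm (τ : Rule S o A) (D : Diagram S) (c : D.V) :
    (Diagram S →₀ A) ⧸ relAll S M' :=
  if h : (D.label c).IsClassical then
    plugSk M' D c (congrArg _ h.signs_eq) (clsLin S M' crossSigns.length (toDiagrams (τ D c)))
  else 0

/-- The derivation is the sum of the contributions of all vertices; only classical crossings
contribute. -/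
theorem mkQ_derivation (τ : Rule S o A) (D : Diagram S) :
    (relAll S M').mkQ (derivation τ D) = ∑ᶠ c, derivationTerm M' τ D c := by
  classical
  have h : derivation τ D = ∑ᶠ c : D.Crossings, applyAt τ D c := rfl
  rw [h, ← LinearMap.toAddMonoidHom_coe, AddMonoidHom.map_finsum _ (Set.toFinite _)]
  have h1 : ∀ c : D.Crossings, (relAll S M').mkQ.toAddMonoidHom (applyAt τ D c) =
      derivationTerm M' τ D c := by
    intro c
    rw [derivationTerm, dif_pos c.2, LinearMap.toAddMonoidHom_coe, applyAt, mkQ_putLin]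
  rw [finsum_congr h1, finsum_subtype_eq_finsum_cond]
  refine finsum_congr fun c => ?_
  by_cases hc : (D.label c).IsClassical
  · simp [hc]
  · simp [hc, derivationTerm]

variable {M'}

/-- The derivations of two diagrams are equal if their crossings correspond to each other, the
values of the rule at corresponding crossings are equal, and insertion of any tangle at them gives
equal results. -/
theorem finsum_derivationTerm_eq {τ : Rule S o A} {D D' : Diagram S} {r : D.V → D'.V → Prop}
    (hτ : ∀ c c', (D.label c).IsClassical → (D'.label c').IsClassical → r c c' →
      clsLin S M' crossSigns.length (toDiagrams (τ D c)) =
        clsLin S M' crossSigns.length (toDiagrams (τ D' c')))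
    (e : D'.V ≃ D.V) (hr : ∀ c, r (e c) c) (hl : ∀ c, D.label (e c) = D'.label c)
    (hp : ∀ c U (hU : IsTangle (D.label (e c)).signs U) (hU' : IsTangle (D'.label c).signs U),
      (relAll S M').mkQ (Finsupp.single (D.plug (e c) U hU) 1) =
        (relAll S M').mkQ (Finsupp.single (D'.plug c U hU') 1)) :
    ∑ᶠ c, derivationTerm M' τ D c = ∑ᶠ c, derivationTerm M' τ D' c := by
  rw [← finsum_comp_equiv e]
  refine finsum_congr fun c => ?_
  by_cases hc : (D'.label c).IsClassical
  · have hc' : (D.label (e c)).IsClassical := by rwa [hl]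
    rw [derivationTerm, derivationTerm, dif_pos hc, dif_pos hc', hτ _ _ hc' hc (hr c)]
    refine LinearMap.congr_fun (Sk.hom_ext fun U => ?_) _
    have hU : IsTangle (D.label (e c)).signs U.1 := by
      rw [hc'.signs_eq]
      exact U.2
    have hU' : IsTangle (D'.label c).signs U.1 := by
      rw [hc.signs_eq]
      exact U.2
    rw [plugSk_cls (hT := hU), plugSk_cls (hT := hU')]
    exact hp c U.1 hU hU'
  · have hc' : ¬ (D.label (e c)).IsClassical := by rwa [hl]
    rw [derivationTerm, derivationTerm, dif_neg hc, dif_neg hc']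

theorem MapsTo.of_oriented {D D' : Diagram S} {g : C(F, F)} {eV : D.V ≃ D'.V}
    (h : MapsTo .oriented D D' g eV) : MapsTo o D D' g eV where
  vertex v := by
    rcases h.vertex v with h1 | h1
    · exact Or.inl h1
    · exact nomatch h1.1
  curve := h.curve
  direction _ := h.direction rfl

theorem mkQ_plug_relabel (W : Diagram S) (v : W.V) {T T' : Diagram diskSurf} (ρ : Relabel T T')
    (hT : IsTangle (W.label v).signs T) (hT' : IsTangle (W.label v).signs T') :
    (relAll S M').mkQ (Finsupp.single (W.plug v T hT) 1) =
      (relAll S M').mkQ (Finsupp.single (W.plug v T' hT') 1) := by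
  rw [← plugSk_cls W v rfl ⟨T, hT⟩, ← plugSk_cls W v rfl ⟨T', hT'⟩]
  exact congrArg _ (cls_eq_of_relabel ρ)

/-- The derivation is invariant under isotopies: an isotopy of diagrams gives an isotopy of the
diagrams with any tangle inserted at corresponding vertices. -/
theorem finsum_derivationTerm_isotopy {τ : Rule S o A} {D D' : Diagram S}
    {r : D.V → D'.V → Prop} (h : Isotopy .oriented D D' r)
    (hτ : ∀ c c', (D.label c).IsClassical → (D'.label c').IsClassical → r c c' →
      clsLin S M' crossSigns.length (toDiagrams (τ D c)) =
        clsLin S M' crossSigns.length (toDiagrams (τ D' c'))) :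
    ∑ᶠ c, derivationTerm M' τ D c = ∑ᶠ c, derivationTerm M' τ D' c := by
  classical
  cases h with
  | ambient _ _ g eV hg h =>
    have hv : ∀ v, D'.label (eV v) = D.label v ∧ D'.chart (eV v) = g.comp (D.chart v) := by
      intro v
      rcases h.vertex v with h1 | h1
      · exact h1
      · exact nomatch h1.1
    refine finsum_derivationTerm_eq hτ eV.symm (fun c => eV.apply_symm_apply c) ?_ ?_
    · intro c
      rw [← (hv _).1, Equiv.apply_symm_apply]
    · intro c U hU hU'
      obtain ⟨c, rfl⟩ := eV.surjective c
      generalize hc : eV.symm (eV c) = c₁ at hU ⊢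
      rw [Equiv.symm_apply_apply] at hc
      subst hc
      refine mkQ_single_eq (isotopy_mem M' (Isotopy.ambient _ _ g _ hg (MapsTo.of_oriented
        (MapsTo.fill hg.bijective.1 eV (P := {c}) (P' := {eV c}) ?_ (fun v _ => h.vertex v)
          h.curve h.direction (T := fun _ => U) (T' := fun _ => U)
          (fun _ => ContinuousMap.id Disk) (fun _ => Equiv.refl _)
          (fun _ => ?_) (fun v => (hv v).2) _ _))))
      · intro v
        exact eV.injective.eq_iff.symm
      · convert (Relabel.refl U).mapsTo .oriented
        ext x
        rfl
  | planar W v T T' eV eE h hc P R hR hP hP' =>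
    let f : (W.plug v (T'.fill (eV.symm ⁻¹' P) (fun x' => R (eV.symm x'))
        (h.isTangle_symm hR)) hP').V ≃ (W.plug v (T.fill P R hR) hP).V :=
      Diagram.fillEquiv (Equiv.refl W.V) (P := {v}) (P' := {v}) (fun _ => Iff.rfl)
        (T := fun _ => T'.fill (eV.symm ⁻¹' P) (fun x' => R (eV.symm x')) (h.isTangle_symm hR))
        (T' := fun _ => T.fill P R hR) fun _ =>
          Diagram.fillEquiv (D := T') (D' := T) eV.symm (P := eV.symm ⁻¹' P) (P' := P)
            (fun _ => Iff.rfl) (T := fun x' => R (eV.symm x')) (T' := R) fun _ => Equiv.refl _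
    refine finsum_derivationTerm_eq hτ f ?_ ?_ ?_
    · rintro (w | ⟨w, x | ⟨y, z⟩⟩)
      · exact Sum.LiftRel.inl rfl
      · exact Sum.LiftRel.inr (Sum.LiftRel.inl (eV.apply_symm_apply _))
      · exact Sum.LiftRel.inr (Sum.LiftRel.inr rfl)
    · rintro (w | ⟨w, x | ⟨y, z⟩⟩)
      · rfl
      · change T.label (eV.symm x.1) = T'.label x.1
        rw [← h.label, Equiv.apply_symm_apply]
      · rfl
    · rintro (⟨w, hw⟩ | ⟨⟨w, hw⟩, ⟨x, hx⟩ | ⟨⟨y, hy⟩, z⟩⟩) U hU hU'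
      -- a vertex of `W`
      · refine (mkQ_single_eq (relabel_mem M' (W.plugComm hw _ U hP hU))).trans (Eq.trans ?_
          (mkQ_single_eq (relabel_mem M' (W.plugComm hw _ U hP' hU'))).symm)
        exact mkQ_single_eq (isotopy_mem M' (Isotopy.planar (W.plug w U hU)
          (Sum.inl ⟨v, Ne.symm hw⟩) T T' eV eE h hc P R hR hP hP'))
      -- a vertex of the plane graph `T'`, at which a further tangle is inserted
      · cases hw
        have hUx : IsTangle (T.label (eV.symm x)).signs U := hU
        have hUx' : IsTangle (T'.label x).signs U := hU'
        have hx' : eV.symm x ∉ P := hx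
        obtain ⟨R₂, hRx, hRo⟩ : ∃ R₂ : T.V → Diagram diskSurf, R₂ (eV.symm x) = U ∧
            ∀ y ∈ P, R₂ y = R y :=
          ⟨Function.update R (eV.symm x) U, Function.update_self _ _ _, fun y hy =>
            Function.update_of_ne (fun h => hx' (by rw [← h]; exact hy)) _ _⟩
        have hR₂ : ∀ y ∈ insert (eV.symm x) P, IsTangle (T.label y).signs (R₂ y) := by
          rintro y (rfl | hy)
          · rwa [hRx]
          · rw [hRo y hy]
            exact hR y hy
        have hm : IsTangle (W.label v).signs (T.fill _ R₂ hR₂) :=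
          hasPorts_fill.2 (hasPorts_fill.1 hP)
        have hm' : IsTangle (W.label v).signs (T'.fill (eV.symm ⁻¹' insert (eV.symm x) P)
          (fun x' => R₂ (eV.symm x')) (h.isTangle_symm hR₂)) :=
          hasPorts_fill.2 (hasPorts_fill.1 hP')
        have e1 := mkQ_single_eq (relabel_mem M' (W.plugPlug v _ hP (Sum.inl ⟨_, hx'⟩) U hU
          (hasPorts_plug.2 hP)))
        have e2 := mkQ_single_eq (relabel_mem M' (W.plugPlug v _ hP' (Sum.inl ⟨x, hx⟩) U hU'
          (hasPorts_plug.2 hP')))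
        have e3 := mkQ_plug_relabel (M' := M') W v (T.fillInsert P R hR _ hx' U hU _ rfl R₂ hR₂
          hRo hRx) (hasPorts_plug.2 hP) hm
        have e4 := mkQ_plug_relabel (M' := M') W v (T'.fillInsert (eV.symm ⁻¹' P) _
          (h.isTangle_symm hR) _ hx U hU' (eV.symm ⁻¹' insert (eV.symm x) P)
          (by ext y; simp [Set.mem_insert_iff]) _ (h.isTangle_symm hR₂)
          (fun y hy => hRo _ hy) hRx) (hasPorts_plug.2 hP') hm'
        exact e1.trans (e3.trans ((mkQ_single_eq (isotopy_mem M' (Isotopy.planar W v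
          T T' eV eE h hc _ R₂ hR₂ hm hm'))).trans (e4.symm.trans e2.symm)))
      -- a vertex of one of the tangles inserted in `T'`
      · cases hw
        have hy' : eV.symm y ∈ P := hy
        obtain ⟨R₂, hRx, hRo⟩ : ∃ R₂ : T.V → Diagram diskSurf,
            R₂ (eV.symm y) = (R (eV.symm y)).plug z U hU ∧ ∀ y₁ ≠ eV.symm y, R₂ y₁ = R y₁ :=
          ⟨Function.update R (eV.symm y) _, Function.update_self _ _ _, fun y₁ hy₁ =>
            Function.update_of_ne hy₁ _ _⟩
        have hR₂ : ∀ y ∈ P, IsTangle (T.label y).signs (R₂ y) := by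
          intro y₁ hy₁
          by_cases hyy : y₁ = eV.symm y
          · subst hyy
            rw [hRx]
            exact hasPorts_plug.2 (hR _ hy₁)
          · rw [hRo _ hyy]
            exact hR _ hy₁
        have hm : IsTangle (W.label v).signs (T.fill _ R₂ hR₂) :=
          hasPorts_fill.2 (hasPorts_fill.1 hP)
        have hm' : IsTangle (W.label v).signs (T'.fill (eV.symm ⁻¹' P)
          (fun x' => R₂ (eV.symm x')) (h.isTangle_symm hR₂)) :=
          hasPorts_fill.2 (hasPorts_fill.1 hP')
        have e1 := mkQ_single_eq (relabel_mem M' (W.plugPlug v _ hP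
          (Sum.inr ⟨⟨_, hy'⟩, z⟩) U hU (hasPorts_plug.2 hP)))
        have e2 := mkQ_single_eq (relabel_mem M' (W.plugPlug v _ hP'
          (Sum.inr ⟨⟨y, hy⟩, z⟩) U hU' (hasPorts_plug.2 hP')))
        have e3 := mkQ_plug_relabel (M' := M') W v (T.fillInner P R hR ⟨_, hy'⟩ z U hU R₂ hR₂
          (fun y _ hy => hRo y hy) hRx) (hasPorts_plug.2 hP) hm
        have e4 := mkQ_plug_relabel (M' := M') W v (T'.fillInner (eV.symm ⁻¹' P) _
          (h.isTangle_symm hR) ⟨y, hy⟩ z U hU' _ (h.isTangle_symm hR₂)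
          (fun y _ hy => hRo _ fun h => hy (eV.symm.injective h)) hRx) (hasPorts_plug.2 hP') hm'
        exact e1.trans (e3.trans ((mkQ_single_eq (isotopy_mem M' (Isotopy.planar W v
          T T' eV eE h hc _ R₂ hR₂ hm hm'))).trans (e4.symm.trans e2.symm)))

/-- Vertices of a diagram with an inserted tangle are vertices outside of it and vertices of the
tangle. -/
theorem finsum_plug {N : Type*} [AddCommMonoid N] (W : Diagram S) (v : W.V) (T : Diagram diskSurf)
    (hT : IsTangle (W.label v).signs T) (f : (W.plug v T hT).V → N) :
    ∑ᶠ c, f c = ∑ᶠ w : {w // w ∉ ({v} : Set W.V)}, f (Sum.inl w) +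
      ∑ᶠ x, f (W.plugIn v T hT x) := by
  classical
  let e : {w // w ∉ ({v} : Set W.V)} ⊕ T.V ≃ (W.plug v T hT).V :=
    Equiv.sumCongr (Equiv.refl _) (Equiv.uniqueSigma (fun _ : ({v} : Set W.V) => T.V)).symm
  have : Fintype {w // w ∉ ({v} : Set W.V)} := Fintype.ofFinite _
  have : Fintype T.V := Fintype.ofFinite _
  rw [← finsum_comp_equiv e, finsum_eq_sum_of_fintype, finsum_eq_sum_of_fintype,
    finsum_eq_sum_of_fintype, Fintype.sum_sum_type]
  rfl

/-- The contributions of the vertices of an inserted picture can be computed in the local skein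
module. -/
theorem finsum_derivationTerm_plug {τ : Rule S o A} {w : Wiring} (Q : Picture w) (W : Diagram S)
    (v : W.V) (hv : IsTangle (W.label v).signs Q.T) :
    ∑ᶠ c, derivationTerm M' τ (W.plug v Q.T hv) c =
      ∑ᶠ c : {c // c ∉ ({v} : Set W.V)}, derivationTerm M' τ (W.plug v Q.T hv) (Sum.inl c) +
      plugSk M' W v (HasPorts.unique (T := Q.T) hv Q.isTangle) (∑ k, Q.ins M' k
        (clsLin S M' crossSigns.length
          (toDiagrams (τ (W.plug v Q.T hv) (W.plugIn v Q.T hv (Q.v k)))))) := by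
  rw [finsum_plug, ← finsum_comp_equiv Q.v, map_sum]
  congr 1
  rw [finsum_eq_sum_of_fintype]
  refine Finset.sum_congr rfl fun k _ => ?_
  have hl : (W.plug v Q.T hv).label (W.plugIn v Q.T hv (Q.v k)) = w.vertex k := Q.label_eq k
  by_cases h : (w.vertex k).IsClassical
  · rw [derivationTerm, dif_pos (by rwa [hl]), Picture.ins, dif_pos h]
    exact plugSk_plugIn W v _ Q.T Q.isTangle hv (Q.v k) _ _
  · rw [derivationTerm, dif_neg (by rwa [hl]), Picture.ins, dif_neg h, LinearMap.zero_apply,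
      map_zero]

end

section
variable {F : Type} [TopologicalSpace F] [T2Space F] [ChartedSpace (EuclideanHalfSpace 2) F]
  {ω : SurfaceOrientation F} {o : Mode} {A : Type*} [CommRing A] {M' : KnotTheory o A}
  {𝔱 : Theory}

/-- A move preserves the derivation if the sums over the crossings of the move are equal: insertion
at a crossing outside of the support of the move commutes with the move, which holds in the target
theory. -/
theorem finsum_derivationTerm_move (hM' : Includes 𝔱 M') {τ : Rule ω.surf o A} {w w' : Wiring}
    (hw : IsMove 𝔱 w w') (Q : Picture w) (Q' : Picture w') (W : Diagram ω.surf) (v : W.V)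
    (hv : IsTangle (W.label v).signs Q.T) (hv' : IsTangle (W.label v).signs Q'.T)
    (hτ : ∀ c : {c // c ∉ ({v} : Set W.V)}, (W.label c).IsClassical →
      clsLin ω.surf M' crossSigns.length (toDiagrams (τ (W.plug v Q.T hv) (Sum.inl c))) =
      clsLin ω.surf M' crossSigns.length (toDiagrams (τ (W.plug v Q'.T hv') (Sum.inl c))))
    (hin : ∑ k, plugSk M' W v (HasPorts.unique (T := Q.T) hv Q.isTangle) (Q.ins M' k
        (clsLin ω.surf M' crossSigns.length
          (toDiagrams (τ (W.plug v Q.T hv) (W.plugIn v Q.T hv (Q.v k)))))) =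
      ∑ k, plugSk M' W v (HasPorts.unique (T := Q'.T) hv' Q'.isTangle) (Q'.ins M' k
        (clsLin ω.surf M' crossSigns.length
          (toDiagrams (τ (W.plug v Q'.T hv') (W.plugIn v Q'.T hv' (Q'.v k))))))) :
    ∑ᶠ c, derivationTerm M' τ (W.plug v Q.T hv) c =
      ∑ᶠ c, derivationTerm M' τ (W.plug v Q'.T hv') c := by
  rw [finsum_derivationTerm_plug, finsum_derivationTerm_plug, map_sum, map_sum, hin]
  congr 1
  refine finsum_congr fun ⟨c, hc⟩ => ?_
  by_cases h : (W.label c).IsClassical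
  · refine (dif_pos h).trans (Eq.trans ?_ (dif_pos h).symm)
    rw [hτ ⟨c, hc⟩ h]
    refine LinearMap.congr_fun (Sk.hom_ext fun U => ?_) _
    have hU : IsTangle (W.label c).signs U.1 := by
      rw [h.signs_eq]
      exact U.2
    refine (plugSk_cls (W.plug v Q.T hv) (Sum.inl ⟨c, hc⟩) _ U hU).trans (Eq.trans ?_
      (plugSk_cls (W.plug v Q'.T hv') (Sum.inl ⟨c, hc⟩) _ U hU).symm)
    refine (mkQ_single_eq (relabel_mem M' (W.plugComm hc _ _ hv hU))).trans (Eq.trans ?_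
      (mkQ_single_eq (relabel_mem M' (W.plugComm hc _ _ hv' hU))).symm)
    have hl : (W.label v).signs.length = w.bd.length := HasPorts.unique (T := Q.T) hv Q.isTangle
    have hQ' : HasPorts w.bd.length Q'.T := by rwa [← hl]
    have h1 := (hM' w w' hw Q Q').clsLin_eq (ω := ω)
    rw [clsLin_single (show HasPorts w.bd.length Q.T from Q.isTangle), clsLin_single hQ', one_smul,
      one_smul] at h1
    have h2 : ((W.plug c U.1 hU).label (Sum.inl ⟨v, Ne.symm hc⟩)).signs.length = w.bd.length := hl
    exact (plugSk_cls _ _ h2 ⟨Q.T, Q.isTangle⟩ hv).symm.trans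
      ((congrArg _ h1).trans (plugSk_cls _ _ h2 ⟨Q'.T, hQ'⟩ hv'))
  · have h0 : ∀ T (hT : IsTangle (W.label v).signs T),
        derivationTerm M' τ (W.plug v T hT) (Sum.inl ⟨c, hc⟩) = 0 := fun T hT => dif_neg h
    rw [h0, h0]

end

theorem Label.not_isClassical_virt : ¬ Label.virt.IsClassical := by
  rintro (h | h) <;> cases h

section
variable {F : Type} [TopologicalSpace F] [T2Space F] [ChartedSpace (EuclideanHalfSpace 2) F]
  {ω : SurfaceOrientation F} {o : Mode} {A : Type*} [CommRing A] {M' : KnotTheory o A}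
  {𝔱 : Theory}

/-- The derivation is invariant under isotopies and moves of the source theory. -/
theorem finsum_derivationTerm_step {𝒟 : Set (Diagram ω.surf)} (hM' : Includes 𝔱 M')
    (τ : Rule ω.surf o A) (hτ : IsTrait 𝔱 𝒟 τ)
    (h1 : ∀ D ∈ 𝒟, ∀ c, D.label c = .pos → Omega3Compatible M' (τ D c))
    (h1v : 𝔱 = .virtual → ∀ D ∈ 𝒟, ∀ c, D.label c = .pos → SemivirtualCompatible M' (τ D c))
    (h2 : ∀ w w', IsOmega2 w w' → ∀ (Q : Picture w) (W : Diagram ω.surf) (v : W.V)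
      (hv : IsTangle (W.label v).signs Q.T), W.plug v Q.T hv ∈ 𝒟 →
      ∀ k₁ k₂ : Fin w.n, k₁ ≠ k₂ →
        IsDual M' (w.vertex k₁)
          (τ (W.plug v Q.T hv) (W.plugIn v Q.T hv (Q.v k₁)))
          (τ (W.plug v Q.T hv) (W.plugIn v Q.T hv (Q.v k₂))))
    (h3r : ∀ (Q : Picture (loopRight .pos)) (W : Diagram ω.surf) (v : W.V)
      (hv : IsTangle (W.label v).signs Q.T), W.plug v Q.T hv ∈ 𝒟 →
        AnnRight M' (τ (W.plug v Q.T hv) (W.plugIn v Q.T hv (Q.v 0))))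
    (h3l : ∀ (Q : Picture (loopLeft .pos)) (W : Diagram ω.surf) (v : W.V)
      (hv : IsTangle (W.label v).signs Q.T), W.plug v Q.T hv ∈ 𝒟 →
        AnnLeft M' (τ (W.plug v Q.T hv) (W.plugIn v Q.T hv (Q.v 0))))
    {D D' : Diagram ω.surf} (hD : D ∈ 𝒟) (hD' : D' ∈ 𝒟) {r : D.V → D'.V → Prop}
    (h : Step 𝔱 D D' r) :
    ∑ᶠ c, derivationTerm M' τ D c = ∑ᶠ c, derivationTerm M' τ D' c := by
  have hval : ∀ c c', (D.label c).IsClassical → (D'.label c').IsClassical → r c c' →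
      clsLin ω.surf M' crossSigns.length (toDiagrams (τ D c)) =
        clsLin ω.surf M' crossSigns.length (toDiagrams (τ D' c')) := fun c c' hc hc' hcc =>
    (hτ D hD D' hD' r h c c' hc hc' hcc).clsLin_eq_of_empty
  cases h with
  | isotopy _ _ _ h => exact finsum_derivationTerm_isotopy h hval
  | move w w' hw Q Q' W v hv hv' =>
    have hQl : ∀ k, (W.plug v Q.T hv).label (W.plugIn v Q.T hv (Q.v k)) = w.vertex k := Q.label_eq
    have hin : ∀ (k : Fin w.n) (k' : Fin w'.n), (k : ℕ) = k' → w'.vertex k' = w.vertex k →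
        (w.vertex k).IsClassical → clsLin ω.surf M' crossSigns.length
          (toDiagrams (τ (W.plug v Q.T hv) (W.plugIn v Q.T hv (Q.v k)))) =
        clsLin ω.surf M' crossSigns.length
          (toDiagrams (τ (W.plug v Q'.T hv') (W.plugIn v Q'.T hv' (Q'.v k')))) := by
      intro k k' hk hl hc
      refine hval _ _ ?_ ?_ (Sum.LiftRel.inr ⟨k, k', hk, rfl, rfl⟩)
      · rwa [hQl]
      · change (Q'.T.label _).IsClassical
        rwa [Q'.label_eq, hl]
    refine finsum_derivationTerm_move hM' hw Q Q' W v hv hv' ?_ ?_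
    · exact fun c hc => hval _ _ hc hc (Sum.LiftRel.inl rfl)
    cases hw with
    | omega1r =>
      rw [Fin.sum_univ_one, Finset.univ_eq_empty, Finset.sum_empty,
        Q.ins_clsLin (k := 0) (Or.inl rfl) rfl, (h3r Q W v hv hD Q).clsLin_eq, map_zero, map_zero]
    | omega1l =>
      rw [Fin.sum_univ_one, Finset.univ_eq_empty, Finset.sum_empty,
        Q.ins_clsLin (k := 0) (Or.inl rfl) rfl, (h3l Q W v hv hD Q).clsLin_eq, map_zero, map_zero]
    | omega2 _ _ _ h =>
      have key := fun (k₁ k₂ : Fin w.n) (hk : k₁ < k₂) =>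
        omega2_cancel (ω := ω) hM' h Q hk (fun hl => h1 _ hD _ ((hQl k₁).trans hl))
          (h2 w w' h Q W v hv hD k₁ k₂ hk.ne)
      rw [← map_sum]
      cases h <;>
      · rw [Fin.sum_univ_two, key 0 1 (by decide), map_zero, Finset.univ_eq_empty,
          Finset.sum_empty]
    | omega3 =>
      refine Finset.sum_congr rfl fun k _ => congrArg _ ?_
      have hc : ((triangleLeft .pos .pos .pos).vertex k).IsClassical := by
        fin_cases k <;> exact Or.inl rfl
      have hl : (triangleLeft .pos .pos .pos).vertex k = .pos := by fin_cases k <;> rfl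
      rw [← hin k k rfl rfl hc]
      obtain ⟨e0, e1, e2⟩ := h1 _ hD _ ((hQl k).trans hl) Q Q'
      fin_cases k
      · exact (Q.ins_clsLin hc rfl _).trans (e0.clsLin_eq.trans (Q'.ins_clsLin hc rfl _).symm)
      · exact (Q.ins_clsLin hc rfl _).trans (e1.clsLin_eq.trans (Q'.ins_clsLin hc rfl _).symm)
      · exact (Q.ins_clsLin hc rfl _).trans (e2.clsLin_eq.trans (Q'.ins_clsLin hc rfl _).symm)
    | semivirtual3 =>
      refine Finset.sum_congr rfl fun k _ => congrArg _ ?_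
      by_cases hk : k = 0
      · subst hk
        have e0 := h1v rfl _ hD _ (hQl 0) Q Q'
        rw [← hin 0 0 rfl rfl (Or.inl rfl)]
        exact (Q.ins_clsLin (Or.inl rfl) rfl _).trans
          (e0.clsLin_eq.trans (Q'.ins_clsLin (Or.inl rfl) rfl _).symm)
      · have hl : ¬ ((triangleLeft .pos .virt .virt).vertex k).IsClassical := by
          fin_cases k
          exacts [absurd rfl hk, Label.not_isClassical_virt, Label.not_isClassical_virt]
        exact (Q.ins_of_not_isClassical hl _).trans (Q'.ins_of_not_isClassical hl _).symm
    -- the virtual moves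
    | _ =>
      trans (0 : (Diagram ω.surf →₀ A) ⧸ relAll ω.surf M')
      · refine Finset.sum_eq_zero fun k _ => ?_
        rw [Q.ins_of_not_isClassical, map_zero]
        fin_cases k <;> exact Label.not_isClassical_virt
      · refine (Finset.sum_eq_zero fun k _ => ?_).symm
        rw [Q'.ins_of_not_isClassical, map_zero]
        fin_cases k <;> exact Label.not_isClassical_virt

end

end Skein

end

open Skein in
theorem mainTheorem8 {F : Type} [TopologicalSpace F] [T2Space F] [CompactSpace F]
    [ConnectedSpace F] [ChartedSpace (EuclideanHalfSpace 2) F] (ω : SurfaceOrientation F)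
    {A : Type*} [CommRing A] (𝔱 : Theory)
    (𝒟 : Set (Diagram ω.surf)) (h𝒟 : 𝒟 ⊆ sourceDiagrams ω.surf 𝔱)
    (o : Mode) (M' : KnotTheory o A) (hM' : Includes 𝔱 M')
    (𝒟' : Set (Diagram ω.surf)) (h𝒟' : 𝒟' ⊆ diagrams ω.surf o) (hclosed : ClosedUnder M' 𝒟')
    (τ : Rule ω.surf o A) (hτ : IsTrait 𝔱 𝒟 τ)
    (hd : ∀ D ∈ 𝒟, derivation τ D ∈ Finsupp.supported A A 𝒟')
    (h1 : ∀ D ∈ 𝒟, ∀ c, D.label c = .pos → Omega3Compatible M' (τ D c))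
    (h1v : 𝔱 = .virtual → ∀ D ∈ 𝒟, ∀ c, D.label c = .pos → SemivirtualCompatible M' (τ D c))
    (h2 : ∀ w w', IsOmega2 w w' → ∀ (Q : Picture w) (W : Diagram ω.surf) (v : W.V)
      (hv : IsTangle (W.label v).signs Q.T), W.plug v Q.T hv ∈ 𝒟 →
      ∀ k₁ k₂ : Fin w.n, k₁ ≠ k₂ →
        IsDual M' (w.vertex k₁)
          (τ (W.plug v Q.T hv) (W.plugIn v Q.T hv (Q.v k₁)))
          (τ (W.plug v Q.T hv) (W.plugIn v Q.T hv (Q.v k₂))))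
    (h3r : ∀ (Q : Picture (loopRight .pos)) (W : Diagram ω.surf) (v : W.V)
      (hv : IsTangle (W.label v).signs Q.T), W.plug v Q.T hv ∈ 𝒟 →
        AnnRight M' (τ (W.plug v Q.T hv) (W.plugIn v Q.T hv (Q.v 0))))
    (h3l : ∀ (Q : Picture (loopLeft .pos)) (W : Diagram ω.surf) (v : W.V)
      (hv : IsTangle (W.label v).signs Q.T), W.plug v Q.T hv ∈ 𝒟 →
        AnnLeft M' (τ (W.plug v Q.T hv) (W.plugIn v Q.T hv (Q.v 0)))) :
    ∀ (D₁ D₂ : Diagram ω.surf) (hD₁ : D₁ ∈ 𝒟) (hD₂ : D₂ ∈ 𝒟), Equivalent 𝔱 𝒟 D₁ D₂ →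
      skeinClass M' 𝒟' (derivation τ D₁) (hd D₁ hD₁) =
        skeinClass M' 𝒟' (derivation τ D₂) (hd D₂ hD₂) := by
  intro D₁ D₂ hD₁ hD₂ h
  have key : derivation τ D₁ - derivation τ D₂ ∈ relAll ω.surf M' := by
    rw [← Submodule.Quotient.mk_eq_zero, ← Submodule.mkQ_apply, map_sub, sub_eq_zero]
    clear hD₁ hD₂
    induction h with
    | rel D D' h =>
      obtain ⟨hD, hD', r, hr⟩ := h
      rw [mkQ_derivation, mkQ_derivation]
      exact finsum_derivationTerm_step hM' τ hτ h1 h1v h2 h3r h3l hD hD' hr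
    | refl => rfl
    | symm _ _ _ ih => exact ih.symm
    | trans _ _ _ _ _ ih ih' => exact ih.trans ih'
  exact (Submodule.Quotient.eq _).2
    (skeinEq_of_mem_relAll hclosed (hd D₁ hD₁) (hd D₂ hD₂) key)
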